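/- \textbf{Setting.} Let $M$ be a compact manifold with boundary, $k\ge 0$, and $\mathbf a=(a_0,\dots,a_k)$ positive integers with $a_0=1$. A tower of fibrations on $M$ is a sequence of smooth fibre bundles $\tilde B_k\xrightarrow{\Phi_k}\tilde B_{k-1}\to\dots\to\tilde B_0\xrightarrow{\Phi_0}[0,\varepsilon)$ of manifolds with boundary, with fibres without boundary, where $\tilde B_k$ is an open neighbourhood of $\partial M$ in $M$; put $\Phi_{k,i}=\Phi_i\circ\dots\circ\Phi_k:\tilde B_k\to\tilde B_{i-1}$, $\tilde B_{-1}=[0,\varepsilon)$, $x=\Phi_{k,0}$, and let $\phi_k$ be the restriction of $\Phi_k$ to $\partial M$ (for $k=0$: the map to a point). The tower represents, to order $\mathbf a$, the space $\mathcal V$ of smooth vector fields $V$ on $M$ such that $Vu\in x^{a_i+\dots+a_k}C^\infty(\tilde B_k)$ for all $u\in\Phi_{k,i}^*C^\infty(\tilde B_{i-1})$ and $i=0,\dots,k$. Let ${}^{\mathbf a}\mathcal V(M)$ be a space of vector fields represented to order $\mathbf a$ by a tower $\mathbf\Phi$ for which the fibres of $\phi_k$ are connected. ${}^{\mathbf a}TM$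 is the vector bundle with space of sections ${}^{\mathbf a}\mathcal V(M)$, and ${}^{\mathbf a}N\partial M$ is the kernel of the natural map ${}^{\mathbf a}TM\to TM$ over $\partial M$. The double space $\beta_{\mathbf a}:M^2_{\mathbf a}\to M^2$ is obtained by blowing up the corner $\partial M\times\partial M$ and then successively, for $i=1,\dots,k$, blowing up quasihomogeneously to order $a_i$ the boundary of the lift (closure of the preimage) of the interior fibre diagonal $\{(q,q'):\Phi_{k,i}(q)=\Phi_{k,i}(q')\}$. Here the quasihomogeneous blow-up to order $a$ of $\{x'=0,\,y'=0\}$ with interior extension $\{y'=0\}$ gives weight $1$ to the boundary variables $x'$ and weight $a$ to the interior variables $y'$. Let $\mathrm{ff}_{\mathbf a}$ be the front face of the last blow-up. A one step refinement of ${}^{\mathbf a}\mathcal V(M)$ is a space $\mathcal R$ represented to order $\mathbf a+1:=(a_0,\dots,a_{k-1},a_k+1)$ by a tower that represents ${}^{\mathbf a}\mathcal V(M)$ to order $\mathbf a$. It realises ${}^{\mathbf a}N^*\partial M$ as a subbundle of ${}^{\mathbf a}T^*_{\partial M}M$, with sections $(x\alpha)_{|\partial M}$, $\alpha$ a smooth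 section of the dual of the bundle with section space $\mathcal R$. \textbf{Proposition.} One step refinements exist, and to every one step refinement $\mathcal R$ there is associated a diffeomorphism $$E_{\mathcal R}:\ \mathrm{int}(\mathrm{ff}_{\mathbf a})\ \longrightarrow\ {}^{\mathbf a}N\partial M\times_{\phi_k}\partial M,$$ as bundles over $\partial M\times_{\phi_k}\partial M$ (it covers the identity with respect to $\beta_{\mathbf a}$). It is determined by $\mathcal R$: for every tower $\mathbf\Phi'$ that represents $\mathcal R$ to order $\mathbf a+1$ and ${}^{\mathbf a}\mathcal V(M)$ to order $\mathbf a$, with boundary defining function $x$, if $E_{\mathcal R}(\xi)=(v,p')$, $v\in{}^{\mathbf a}N_p\partial M$, is represented by $V\in{}^{\mathbf a}\mathcal V(M)$, then as interior points $(q,q')$ tend to $\xi$, $$\frac{\log (x(q)/x(q'))}{x(q)^{a_1+\dots+a_k}}\to \Big(\frac{Vx}{x^{a_0+\dots+a_k}}\Big)(p),\qquad \frac{y(q)-y(q')}{x(q)^{a_i+\dots+a_k}}\to\Big(\frac{Vy}{x^{a_i+\dots+a_k}}\Big)(p)$$ for all $y\in(\Phi'_{k,i})^*C^\infty(\tilde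 B'_{i-1})$, $i=1,\dots,k$. And it determines $\mathcal R$: if $E_{\mathcal R}=E_{\mathcal R'}$ then $\mathcal R=\mathcal R'$. Fix a one step refinement, hence the identification $E_{\mathcal R}$. If $g\in C^\infty(\mathrm{int}\,M)$ is such that $dg$ extends to a smooth section of ${}^{\mathbf a}T^*M$ whose values over $\partial M$ lie in ${}^{\mathbf a}N^*\partial M$, then $\beta_{\mathbf a}^*(\pi_l^*g-\pi_r^*g)$ extends smoothly to $\mathrm{int}(\mathrm{ff}_{\mathbf a})$ and equals $dg$ there, regarded as a function on ${}^{\mathbf a}N\partial M\times_{\phi_k}\partial M$ constant in the second factor, where $\pi_l,\pi_r:M^2\to M$ are the projections. Moreover $\beta_{\mathbf a}^*(\pi_l^*g-\pi_r^*g)$ has finite order singularities at the other boundary hypersurfaces of $M^2_{\mathbf a}$: locally, for each $m$, its product with some power of the defining functions of these hypersurfaces extends to a $C^m$ function. -/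

import Mathlib

open Set Filter Topology
open scoped Manifold ContDiff

universe u

noncomputable section

namespace MultiFibred

/-! ### Towers of fibrations of manifolds with boundary -/

/-- A smooth manifold with boundary (Hausdorff, second countable), of dimension `dim + 1`. -/
structure BdryManifold where
  carrier : Type u
  dim : ℕ
  [top : TopologicalSpace carrier]
  [charted : ChartedSpace (EuclideanHalfSpace (dim + 1)) carrier]
  [smooth : IsManifold (𝓡∂ (dim + 1)) ∞ carrier]
  [t2 : T2Space carrier]
  [sc : SecondCountableTopology carrier]

attribute [instance] BdryManifold.top BdryManifold.charted BdryManifold.smooth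
  BdryManifold.t2 BdryManifold.sc

/-- The model with corners of a manifold with boundary. -/
abbrev BdryManifold.model (B : BdryManifold.{u}) :
    ModelWithCorners ℝ (EuclideanSpace ℝ (Fin (B.dim + 1))) (EuclideanHalfSpace (B.dim + 1)) :=
  𝓡∂ (B.dim + 1)

/-- `f : X → S ⊆ Y` is a smooth fibre bundle: `f` is smooth with image `S`, and over a neighbourhood
`V` of every point of `S` there is a fibre `F` (a smooth manifold without boundary) and a
diffeomorphism `(f, ψ) : f⁻¹ V → (V ∩ S) × F` with inverse `χ`. -/
def IsFibration {EX HX EY HY : Type*} {X : Type u} {Y : Type*}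
    [NormedAddCommGroup EX] [NormedSpace ℝ EX] [TopologicalSpace HX]
    [NormedAddCommGroup EY] [NormedSpace ℝ EY] [TopologicalSpace HY]
    [TopologicalSpace X] [ChartedSpace HX X] [TopologicalSpace Y] [ChartedSpace HY Y]
    (I : ModelWithCorners ℝ EX HX) (J : ModelWithCorners ℝ EY HY) (f : X → Y) (S : Set Y) : Prop :=
  ContMDiff I J ∞ f ∧ range f = S ∧
    ∀ y ∈ S, ∃ V : Set Y, IsOpen V ∧ y ∈ V ∧
      ∃ (d : ℕ) (F : Type u) (_ : TopologicalSpace F)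
        (_ : ChartedSpace (EuclideanSpace ℝ (Fin d)) F) (_ : IsManifold (𝓡 d) ∞ F)
        (ψ : X → F) (χ : Y × F → X),
        ContMDiffOn I (𝓡 d) ∞ ψ (f ⁻¹' V) ∧
        ContMDiffOn (J.prod (𝓡 d)) I ∞ χ ((V ∩ S) ×ˢ univ) ∧
        (∀ x ∈ f ⁻¹' V, χ (f x, ψ x) = x) ∧
        (∀ y' ∈ V ∩ S, ∀ z : F, f (χ (y', z)) = y' ∧ ψ (χ (y', z)) = z)

/-- A tower of fibrations `B k → B (k-1) → ⋯ → B 0 → [0, ε)` of manifolds with boundary, whose top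
space `B k` is identified by the diffeomorphism `emb` with an open neighbourhood `emb.source` of
the boundary of `M`. -/
structure Tower (n : ℕ) [NeZero n] (M : Type u) [TopologicalSpace M]
    [ChartedSpace (EuclideanHalfSpace n) M] (k : ℕ) where
  B : Fin (k + 1) → BdryManifold.{u}
  Φ : ∀ i : Fin k, (B i.succ).carrier → (B i.castSucc).carrier
  fibration : ∀ i : Fin k,
    IsFibration (B i.succ).model (B i.castSucc).model (Φ i) univ
  ε : ℝ
  ε_pos : 0 < ε
  Φ₀ : (B 0).carrier → ℝ
  fibration₀ : IsFibration (B 0).model 𝓘(ℝ, ℝ) Φ₀ (Ico 0 ε)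
  emb : OpenPartialHomeomorph M (B (Fin.last k)).carrier
  boundary_subset : (𝓡∂ n).boundary M ⊆ emb.source
  target_eq : emb.target = univ
  smooth_emb : ContMDiffOn (𝓡∂ n) (B (Fin.last k)).model ∞ emb emb.source
  smooth_symm : ContMDiff (B (Fin.last k)).model (𝓡∂ n) ∞ emb.symm

/-! ### Vector fields -/

section Fields

variable (n : ℕ) [NeZero n] (M : Type u) [TopologicalSpace M]
  [ChartedSpace (EuclideanHalfSpace n) M]

/-- Not necessarily smooth vector fields on `M`. -/
abbrev VField : Type u := ∀ p : M, TangentSpace (𝓡∂ n) p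

variable {n M}

/-- Smoothness (up to the boundary) of a vector field. -/
def SmoothField [IsManifold (𝓡∂ n) ∞ M] (V : VField n M) : Prop :=
  ContMDiff (𝓡∂ n) (𝓡∂ n).tangent ∞ (fun p => (⟨p, V p⟩ : TangentBundle (𝓡∂ n) M))

/-- The derivative `V u = du(V)` at `p`. -/
def dirDeriv (V : VField n M) (u : M → ℝ) (p : M) : ℝ :=
  mfderiv (𝓡∂ n) 𝓘(ℝ, ℝ) u p (V p)

/-- `w` is a smooth function on `U` with `f = x ^ A * w` there. -/
def IsQuotientOn (U : Set M) (x f : M → ℝ) (A : ℕ) (w : M → ℝ) : Prop :=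
  ContMDiffOn (𝓡∂ n) 𝓘(ℝ, ℝ) ∞ w U ∧ ∀ p ∈ U, f p = x p ^ A * w p

/-- `f = O(x ^ A)` on `U`. -/
def BigO (U : Set M) (x f : M → ℝ) (A : ℕ) : Prop :=
  ∃ w : M → ℝ, IsQuotientOn (n := n) U x f A w

theorem dirDeriv_add (V W : VField n M) (u : M → ℝ) (p : M) :
    dirDeriv (V + W) u p = dirDeriv V u p + dirDeriv W u p := by
  simp only [dirDeriv, Pi.add_apply]
  exact map_add _ _ _

theorem dirDeriv_smul (c : ℝ) (V : VField n M) (u : M → ℝ) (p : M) :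
    dirDeriv (c • V) u p = c * dirDeriv V u p := by
  simp only [dirDeriv, Pi.smul_apply]
  exact map_smul _ _ _

theorem BigO.add {U : Set M} {x : M → ℝ} {A : ℕ} {u : M → ℝ} {V W : VField n M}
    (hV : BigO (n := n) U x (dirDeriv V u) A) (hW : BigO (n := n) U x (dirDeriv W u) A) :
    BigO (n := n) U x (dirDeriv (V + W) u) A := by
  obtain ⟨v, hv, hv'⟩ := hV
  obtain ⟨w, hw, hw'⟩ := hW
  refine ⟨fun p => v p + w p, hv.add hw, fun p hp => ?_⟩
  rw [dirDeriv_add, hv' p hp, hw' p hp]; ring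

theorem BigO.smul {U : Set M} {x : M → ℝ} {A : ℕ} {u : M → ℝ} {V : VField n M} (c : ℝ)
    (hV : BigO (n := n) U x (dirDeriv V u) A) : BigO (n := n) U x (dirDeriv (c • V) u) A := by
  obtain ⟨v, hv, hv'⟩ := hV
  refine ⟨fun p => c * v p, contMDiffOn_const.mul hv, fun p hp => ?_⟩
  rw [dirDeriv_smul, hv' p hp]; ring

end Fields

/-- `a_i + ⋯ + a_k`. -/
def tailSum {k : ℕ} (a : Fin (k + 1) → ℕ) (i : ℕ) : ℕ :=
  ∑ j ∈ Finset.univ.filter (fun j : Fin (k + 1) => i ≤ (j : ℕ)), a j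

/-- The orders `(a_0, …, a_{k-1}, a_k + 1)`. -/
def refineOrder {k : ℕ} (a : Fin (k + 1) → ℕ) : Fin (k + 1) → ℕ :=
  Function.update a (Fin.last k) (a (Fin.last k) + 1)

namespace Tower

variable {n : ℕ} [NeZero n] {M : Type u} [TopologicalSpace M]
  [ChartedSpace (EuclideanHalfSpace n) M] {k : ℕ} (T : Tower n M k)

/-- The composition `B k → ⋯ → B i` of the fibrations. -/
def fromTop (i : Fin (k + 1)) : (T.B (Fin.last k)).carrier → (T.B i).carrier :=
  Fin.reverseInduction (motive := fun i => (T.B (Fin.last k)).carrier → (T.B i).carrier)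
    id (fun i f => T.Φ i ∘ f) i

/-- The projection from `emb.source ⊆ M` to `B i` (only meaningful on `emb.source`). -/
def proj (i : Fin (k + 1)) (p : M) : (T.B i).carrier := T.fromTop i (T.emb p)

/-- The boundary defining function of the tower (only meaningful on `emb.source`). -/
def x (p : M) : ℝ := T.Φ₀ (T.proj 0 p)

/-- The vector fields tangent to the tower to order `a`: `V u = O(x ^ (a_i + ⋯ + a_k))` for all
`u` pulled back from `B (i-1)`, `i = 0, …, k`, where `B (-1) = [0, ε)`. -/
def fields [IsManifold (𝓡∂ n) ∞ M] (a : Fin (k + 1) → ℕ) : Submodule ℝ (VField n M) where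
  carrier := {V | SmoothField V ∧
    (∀ u : ℝ → ℝ, ContDiff ℝ ∞ u →
      BigO (n := n) T.emb.source T.x (dirDeriv V (fun p => u (T.x p))) (tailSum a 0)) ∧
    (∀ (i : Fin k) (u : (T.B i.castSucc).carrier → ℝ),
      ContMDiff (T.B i.castSucc).model 𝓘(ℝ, ℝ) ∞ u →
      BigO (n := n) T.emb.source T.x (dirDeriv V (fun p => u (T.proj i.castSucc p)))
        (tailSum a (i + 1)))}
  add_mem' := fun hV hW =>
    ⟨hV.1.add_section hW.1, fun u hu => (hV.2.1 u hu).add (hW.2.1 u hu),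
      fun i u hu => (hV.2.2 i u hu).add (hW.2.2 i u hu)⟩
  zero_mem' :=
    ⟨Bundle.contMDiff_zeroSection (IB := 𝓡∂ n) (n := ∞) ℝ (TangentSpace (𝓡∂ n) : M → Type _),
      fun _ _ => ⟨fun _ => 0, contMDiffOn_const,
        fun p _ => by simp only [dirDeriv, mul_zero]; exact map_zero _⟩,
      fun _ _ _ => ⟨fun _ => 0, contMDiffOn_const,
        fun p _ => by simp only [dirDeriv, mul_zero]; exact map_zero _⟩⟩
  smul_mem' := fun c _ hV =>
    ⟨hV.1.const_smul_section, fun u hu => (hV.2.1 u hu).smul c,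
      fun i u hu => (hV.2.2 i u hu).smul c⟩

/-- `q` and `q'` have the same image in `B (i-1)`, that is, they lie in the same fibre of the
composition of the fibrations number `k, …, i` (for `i = 0`: `x q = x q'`). -/
def SameFibre (i : Fin (k + 1)) (q q' : M) : Prop :=
  T.x q = T.x q' ∧
    ∀ j : Fin k, j.succ ≤ i → T.proj j.castSucc q = T.proj j.castSucc q'

/-- The interior fibre diagonal of the fibration of a neighbourhood of the boundary over
`B (i-1)`. -/
def fibreDiagonal (i : Fin (k + 1)) : Set (M × M) :=
  {q | q.1 ∈ T.emb.source ∧ q.2 ∈ T.emb.source ∧ T.SameFibre i q.1 q.2}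

end Tower

/-! ### The `a`-tangent bundle, the `a`-normal bundle and their duals -/

section Bundles

variable {n : ℕ} [NeZero n] {M : Type u} [TopologicalSpace M]
  [ChartedSpace (EuclideanHalfSpace n) M] (𝒱 ℛ : Submodule ℝ (VField n M))

/-- The subspace of `𝒱` generated by the products `f V` with `V ∈ 𝒱` and `f` smooth, `f p = 0`. -/
def vanishing (p : M) : Submodule ℝ 𝒱 :=
  Submodule.span ℝ {W | ∃ f : M → ℝ, ContMDiff (𝓡∂ n) 𝓘(ℝ, ℝ) ∞ f ∧ f p = 0 ∧
    ∃ V : 𝒱, ∀ q, W.1 q = f q • V.1 q}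

/-- The fibre at `p` of the vector bundle whose space of sections is `𝒱`. -/
abbrev AT (p : M) : Type u := 𝒱 ⧸ vanishing 𝒱 p

variable {𝒱} in
/-- The value at `p` of `V`, regarded as a section of this bundle. -/
def atVal (p : M) (V : 𝒱) : AT 𝒱 p := Submodule.Quotient.mk V

/-- Evaluation of vector fields at `p` as usual tangent vectors. -/
def evalAt (p : M) : 𝒱 →ₗ[ℝ] TangentSpace (𝓡∂ n) p :=
  (LinearMap.proj p : VField n M →ₗ[ℝ] TangentSpace (𝓡∂ n) p) ∘ₗ 𝒱.subtype

theorem vanishing_le (p : M) : vanishing 𝒱 p ≤ LinearMap.ker (evalAt 𝒱 p) := by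
  refine Submodule.span_le.2 ?_
  rintro W ⟨f, -, hf, V, hV⟩
  have h : W.1 p = 0 := by rw [hV p, hf, zero_smul]
  exact h

/-- The natural bundle map to the usual tangent bundle. -/
def anchor (p : M) : AT 𝒱 p →ₗ[ℝ] TangentSpace (𝓡∂ n) p :=
  (vanishing 𝒱 p).liftQ (evalAt 𝒱 p) (vanishing_le 𝒱 p)

/-- The fibre at `p` of the normal bundle (used for boundary points `p`). -/
def ANormal (p : M) : Submodule ℝ (AT 𝒱 p) := LinearMap.ker (anchor 𝒱 p)

/-- Families of covectors on the bundle with section space `𝒱`. -/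
abbrev ACoField : Type u := ∀ p : M, AT 𝒱 p →ₗ[ℝ] ℝ

variable {𝒱} in
/-- Smooth sections (up to the boundary) of the dual bundle. -/
def SmoothCoField (θ : ACoField 𝒱) : Prop :=
  ∀ V : 𝒱, ContMDiff (𝓡∂ n) 𝓘(ℝ, ℝ) ∞ (fun p => θ p (atVal p V))

variable {𝒱} in
/-- The differential of `g`, a function on the interior, extends to `θ`. -/
def ExtendsDifferential (g : M → ℝ) (θ : ACoField 𝒱) : Prop :=
  ∀ p ∈ (𝓡∂ n).interior M, ∀ V : 𝒱, θ p (atVal p V) = dirDeriv V.1 g p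

variable (n) in
/-- Boundary defining functions. -/
def IsBdf (ρ : M → ℝ) : Prop :=
  ContMDiff (𝓡∂ n) 𝓘(ℝ, ℝ) ∞ ρ ∧ (∀ p, 0 ≤ ρ p) ∧
    (∀ p, ρ p = 0 ↔ p ∈ (𝓡∂ n).boundary M) ∧
    ∀ p ∈ (𝓡∂ n).boundary M, mfderiv (𝓡∂ n) 𝓘(ℝ, ℝ) ρ p ≠ 0

/-- The conormal space at the boundary point `p`, realised through the refinement `ℛ` as a subspace
of the dual of `AT 𝒱 p`: the values `(ρ α)(p)`, for `α` a section of the dual of the bundle of the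
refinement and `ρ` a boundary defining function, where `(ρ α)(V) = α(ρ V)`. -/
def conormal (p : M) : Set (AT 𝒱 p →ₗ[ℝ] ℝ) :=
  {ξ | ∃ (ρ : M → ℝ) (α : ACoField ℛ), IsBdf n ρ ∧ SmoothCoField α ∧
    ∀ (V : 𝒱) (W : ℛ), (∀ q, W.1 q = ρ q • V.1 q) → ξ (atVal p V) = α p (atVal p W)}

end Bundles

/-! ### Manifolds with corners glued from coordinate patches, and quasihomogeneous blow-ups -/

/-- A coordinate patch with corners: a map to `W`, considered on the relatively open subset
`dom = O ∩ {u | u_j ≥ 0 for j ∈ corners}`. -/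
structure Patch (ι W : Type*) where
  toFun : (ι → ℝ) → W
  corners : Finset ι
  O : Set (ι → ℝ)
  isOpen : IsOpen O

namespace Patch

variable {ι W : Type*}

/-- The domain of a patch. -/
def dom (P : Patch ι W) : Set (ι → ℝ) := {u | u ∈ P.O ∧ ∀ j ∈ P.corners, 0 ≤ u j}

/-- The interior of the domain. -/
def int (P : Patch ι W) : Set (ι → ℝ) := {u | u ∈ P.O ∧ ∀ j ∈ P.corners, 0 < u j}

/-- `P` is a diffeomorphism onto an open subset of the manifold (with corners) `W`. -/
def IsLocalParam [Fintype ι] {E H : Type*} [NormedAddCommGroup E] [NormedSpace ℝ E]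
    [TopologicalSpace H] [TopologicalSpace W] [ChartedSpace H W] (J : ModelWithCorners ℝ E H)
    (P : Patch ι W) : Prop :=
  ContMDiffOn 𝓘(ℝ, ι → ℝ) J ∞ P.toFun P.dom ∧ IsOpen (P.toFun '' P.dom) ∧
    ∃ Q : W → (ι → ℝ), ContMDiffOn J 𝓘(ℝ, ι → ℝ) ∞ Q (P.toFun '' P.dom) ∧
      ∀ u ∈ P.dom, Q (P.toFun u) = u

/-- The patches obtained from those in `𝒜` by restriction to open subsets and change of
coordinates. -/
def saturate [Fintype ι] (𝒜 : Set (Patch ι W)) : Set (Patch ι W) :=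
  {P | ∃ P' ∈ 𝒜, ∃ (h h' : (ι → ℝ) → (ι → ℝ)) (O' : Set (ι → ℝ)), IsOpen O' ∧
    h '' P.dom = P'.dom ∩ O' ∧ ContDiffOn ℝ ∞ h P.dom ∧ ContDiffOn ℝ ∞ h' (P'.dom ∩ O') ∧
    (∀ u ∈ P.dom, h' (h u) = u) ∧ ∀ u ∈ P.dom, P.toFun u = P'.toFun (h u)}

/-- `(P, u)` and `(P', u')` represent the same point: `P = P' ∘ h` near `u` for a local
diffeomorphism `h` of the domains with `h u = u'`. -/
def SamePoint [Fintype ι] (z z' : Patch ι W × (ι → ℝ)) : Prop :=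
  ∃ (h h' : (ι → ℝ) → (ι → ℝ)) (O O' : Set (ι → ℝ)), IsOpen O ∧ IsOpen O' ∧
    z.2 ∈ O ∧ z'.2 ∈ O' ∧ h z.2 = z'.2 ∧
    ContDiffOn ℝ ∞ h (z.1.dom ∩ O) ∧ ContDiffOn ℝ ∞ h' (z'.1.dom ∩ O') ∧
    MapsTo h (z.1.dom ∩ O) (z'.1.dom ∩ O') ∧ MapsTo h' (z'.1.dom ∩ O') (z.1.dom ∩ O) ∧
    (∀ u ∈ z.1.dom ∩ O, h' (h u) = u) ∧ (∀ u ∈ z'.1.dom ∩ O', h (h' u) = u) ∧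
    ∀ u ∈ z.1.dom ∩ O, z.1.toFun u = z'.1.toFun (h u)

/-- The coordinates of `P` are adapted to the centre `Z` with interior extension `Zt`:
`Z = {x' = 0, y' = 0}` and `Zt = {y' = 0}`, where `x'` are the boundary coordinates with index in
`R` and `y'` the interior coordinates with index in `S`. -/
def Adapted (P : Patch ι W) (Zt Z : Set (ι → ℝ)) (R S : Finset ι) : Prop :=
  R ⊆ P.corners ∧ Disjoint S P.corners ∧
    P.dom ∩ Zt = {u | u ∈ P.dom ∧ ∀ j ∈ S, u j = 0} ∧
    P.dom ∩ Z = {u | u ∈ P.dom ∧ (∀ j ∈ R, u j = 0) ∧ ∀ j ∈ S, u j = 0}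

variable [DecidableEq ι]

/-- The blow-down map in projective coordinates `x_i, W_j = x_j / x_i, y' / x_i ^ a, y''`. -/
def blowX (a : ℕ) (R S : Finset ι) (i : ι) (u : ι → ℝ) : ι → ℝ := fun j =>
  if j = i then u i else if j ∈ S then u i ^ a * u j else if j ∈ R then u i * u j else u j

/-- The blow-down map in projective coordinates `r = |y_p| ^ (1/a), x' / r, y_q / r ^ a, y''`, valid
where `y_p` has the sign `ε`. -/
def blowY (a : ℕ) (R S : Finset ι) (p : ι) (ε : ℝ) (u : ι → ℝ) : ι → ℝ := fun j =>
  if j = p then ε * u p ^ a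
  else if j ∈ S then u p ^ a * u j else if j ∈ R then u p * u j else u j

theorem continuous_blowX (a : ℕ) (R S : Finset ι) (i : ι) : Continuous (blowX a R S i) := by
  refine continuous_pi fun j => ?_
  unfold blowX
  split_ifs <;> fun_prop

theorem continuous_blowY (a : ℕ) (R S : Finset ι) (p : ι) (ε : ℝ) :
    Continuous (blowY a R S p ε) := by
  refine continuous_pi fun j => ?_
  unfold blowY
  split_ifs <;> fun_prop

/-- The patch with coordinates `x_i, W, y' / x_i ^ a, y''`. -/
def pullX (P : Patch ι W) (a : ℕ) (R S : Finset ι) (i : ι) : Patch ι W where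
  toFun := P.toFun ∘ blowX a R S i
  corners := P.corners
  O := blowX a R S i ⁻¹' P.O
  isOpen := P.isOpen.preimage (continuous_blowX a R S i)

/-- The patch with coordinates `r, x' / r, y_q / r ^ a, y''`. -/
def pullY (P : Patch ι W) (a : ℕ) (R S : Finset ι) (p : ι) (ε : ℝ) : Patch ι W where
  toFun := P.toFun ∘ blowY a R S p ε
  corners := insert p P.corners
  O := blowY a R S p ε ⁻¹' P.O
  isOpen := P.isOpen.preimage (continuous_blowY a R S p ε)

/-- The patches, with values in `W`, of the quasihomogeneous blow-up to order `a` of the manifold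
with corners with patches `𝒜`; the centre and its interior extension are given in each patch as
`Z P` and `Zt P`. A patch comes with `some i` if the front face is `{u_i = 0}` in it, and with
`none` if it lies off the front face. -/
inductive BlowUp (𝒜 : Set (Patch ι W)) (Zt Z : Patch ι W → Set (ι → ℝ)) (a : ℕ) :
    Option ι → Patch ι W → Prop
  | off (P : Patch ι W) (hP : P ∈ 𝒜) (h : Disjoint P.dom (Z P)) : BlowUp 𝒜 Zt Z a none P
  | projX (P : Patch ι W) (hP : P ∈ 𝒜) (R S : Finset ι) (h : P.Adapted (Zt P) (Z P) R S)
      (i : ι) (hi : i ∈ R) : BlowUp 𝒜 Zt Z a (some i) (P.pullX a R S i)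
  | projY (P : Patch ι W) (hP : P ∈ 𝒜) (R S : Finset ι) (h : P.Adapted (Zt P) (Z P) R S)
      (p : ι) (hp : p ∈ S) (ε : ℝ) (hε : ε = 1 ∨ ε = -1) :
      BlowUp 𝒜 Zt Z a (some p) (P.pullY a R S p ε)

/-- `G`, a function on the interior of `W`, has finite order singularities, in the patch `P`, at the
boundary hypersurfaces `{u_j = 0}`, `j ∈ J`: locally and for each `m`, its product with some power
of the boundary defining functions of these faces extends to a `C ^ m` function. -/
def FiniteOrder [Fintype ι] (P : Patch ι W) (J : Finset ι) (G : W → ℝ) : Prop :=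
  ∀ u₀ ∈ P.dom, ∀ m : ℕ, ∃ (N : ℕ) (O : Set (ι → ℝ)) (F : (ι → ℝ) → ℝ), IsOpen O ∧ u₀ ∈ O ∧
    ContDiffOn ℝ m F (P.dom ∩ O) ∧
    ∀ u ∈ P.int ∩ O, F u = (∏ j ∈ J, u j) ^ N * G (P.toFun u)

end Patch

/-! ### The double space and its top front face -/

namespace Tower

variable {n : ℕ} [NeZero n] {M : Type u} [TopologicalSpace M]
  [ChartedSpace (EuclideanHalfSpace n) M] {k : ℕ} (T : Tower n M k) (a : Fin (k + 1) → ℕ)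

/-- Index set of the coordinates on `M × M`. -/
abbrev Idx (n : ℕ) : Type := Fin n ⊕ Fin n

/-- The lift of the `i`-th interior fibre diagonal, in a patch: the closure of its preimage. -/
def liftDiagonal (i : Fin (k + 1)) (P : Patch (Idx n) (M × M)) : Set (Idx n → ℝ) :=
  closure {v | v ∈ P.int ∧ P.toFun v ∈ T.fibreDiagonal i}

/-- The boundary of the lift of the `i`-th interior fibre diagonal, in a patch. -/
def liftBoundary (i : Fin (k + 1)) (P : Patch (Idx n) (M × M)) : Set (Idx n → ℝ) :=
  {u | u ∈ T.liftDiagonal i P ∧ ∃ j ∈ P.corners, u j = 0}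

/-- The patches of the iterated blow-up: first the blow-up of the corner `∂M × ∂M` of `M × M`, then,
for `i = 1, …, k`, the blow-up to order `a_i` of the boundary of the lifted `i`-th interior
fibre diagonal. -/
def atlas (i : Fin (k + 1)) : Option (Idx n) → Patch (Idx n) (M × M) → Prop :=
  Fin.induction (motive := fun _ => Option (Idx n) → Patch (Idx n) (M × M) → Prop)
    (Patch.BlowUp {P | P.IsLocalParam ((𝓡∂ n).prod (𝓡∂ n))} (fun _ => univ)
      (fun P => P.toFun ⁻¹' ((𝓡∂ n).boundary M ×ˢ (𝓡∂ n).boundary M)) 1)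
    (fun i 𝒜 => Patch.BlowUp (Patch.saturate {P | ∃ o, 𝒜 o P})
      (T.liftDiagonal i.succ) (T.liftBoundary i.succ) (a i.succ)) i

/-- A coordinate patch of the double space, with the coordinates of a point in its domain. -/
def PatchPoint : Type u :=
  {z : Patch (Idx n) (M × M) × (Idx n → ℝ) // (∃ o, T.atlas a (Fin.last k) o z.1) ∧ z.2 ∈ z.1.dom}

/-- The double space: the domains of all the coordinate patches, glued. -/
def DoubleSpace : Type u :=
  Quot (fun z z' : T.PatchPoint a => Patch.SamePoint z.1 z'.1)

/-- The blow-down map of the double space. -/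
def blowDown : T.DoubleSpace a → M × M :=
  Quot.lift (fun z => z.1.1.toFun z.1.2) (by
    rintro ⟨z, hz⟩ ⟨z', hz'⟩ ⟨h, h', O, O', -, -, hO, -, hh, -, -, -, -, -, -, hP⟩
    have := hP z.2 ⟨hz.2, hO⟩
    rw [hh] at this
    exact this)

/-- The patch `P` has coordinates `u` at the point `ξ` of the double space. -/
def HasCoords (ξ : T.DoubleSpace a) (P : Patch (Idx n) (M × M)) (u : Idx n → ℝ) : Prop :=
  ∃ h, ξ = Quot.mk _ ⟨(P, u), h⟩

/-- In the patch `P` with front face `{u_i = 0}`: the point with coordinates `u` is not on any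
other boundary hypersurface. -/
def OffOtherFaces (i : Idx n) (P : Patch (Idx n) (M × M)) (u : Idx n → ℝ) : Prop :=
  ∀ j ∈ P.corners, j ≠ i → 0 < u j

/-- The interior of the front face of the last blow-up. -/
def frontInterior : Set (T.DoubleSpace a) :=
  {ξ | ∃ i P u, T.atlas a (Fin.last k) (some i) P ∧ T.HasCoords a ξ P u ∧ u i = 0 ∧
    OffOtherFaces i P u}

/-- The `a`-normal bundle `×` the boundary, fibred over the base of the smallest fibres:
triples of boundary points `p`, `p'` in the same fibre and a normal vector at `p`. -/
structure NormalProduct (𝒱 : Submodule ℝ (VField n M)) where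
  p : M
  p' : M
  hp : p ∈ (𝓡∂ n).boundary M
  hp' : p' ∈ (𝓡∂ n).boundary M
  same : T.SameFibre (Fin.last k) p p'
  v : ANormal 𝒱 p

/-- Smooth maps from an open subset of `ℝ ^ d` to the interior of the front face. -/
def SmoothToFront {d : ℕ} (c : (Fin d → ℝ) → T.frontInterior a) (Ω : Set (Fin d → ℝ)) : Prop :=
  ∀ t ∈ Ω, ∃ (P : Patch (Idx n) (M × M)) (γ : (Fin d → ℝ) → (Idx n → ℝ)) (O : Set (Fin d → ℝ)),
    IsOpen O ∧ t ∈ O ∧ ContDiffOn ℝ ∞ γ (Ω ∩ O) ∧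
    ∀ s ∈ Ω ∩ O, T.HasCoords a (c s).1 P (γ s)

variable {T} in
/-- Smooth maps from an open subset of `ℝ ^ d` to the normal product: both base points depend
smoothly on the parameter, and the vector is locally a combination of sections `V_j` with smooth
coefficients. -/
def SmoothToNormal {𝒱 : Submodule ℝ (VField n M)} {d : ℕ}
    (c : (Fin d → ℝ) → T.NormalProduct 𝒱) (Ω : Set (Fin d → ℝ)) : Prop :=
  ContMDiffOn 𝓘(ℝ, Fin d → ℝ) (𝓡∂ n) ∞ (fun s => (c s).p) Ω ∧
  ContMDiffOn 𝓘(ℝ, Fin d → ℝ) (𝓡∂ n) ∞ (fun s => (c s).p') Ω ∧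
  ∀ t ∈ Ω, ∃ (O : Set (Fin d → ℝ)) (l : ℕ) (V : Fin l → 𝒱) (f : Fin l → (Fin d → ℝ) → ℝ),
    IsOpen O ∧ t ∈ O ∧ (∀ j, ContDiffOn ℝ ∞ (f j) (Ω ∩ O)) ∧
    ∀ s ∈ Ω ∩ O, ((c s).v : AT 𝒱 (c s).p) = ∑ j, f j s • atVal (c s).p (V j)

variable {a} {T} in
/-- A bijection is a diffeomorphism if it and its inverse map smooth maps from open subsets of
the spaces `ℝ ^ d` to smooth maps. -/
def IsDiffeo {𝒱 : Submodule ℝ (VField n M)} (e : T.frontInterior a ≃ T.NormalProduct 𝒱) : Prop :=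
  ∀ (d : ℕ) (Ω : Set (Fin d → ℝ)), IsOpen Ω → ∀ c : (Fin d → ℝ) → T.frontInterior a,
    T.SmoothToFront a c Ω ↔ SmoothToNormal (fun s => e (c s)) Ω

variable {a} {T} in
/-- The bijection covers the identity of the fibre product of the boundary with itself. -/
def CoversIdentity {𝒱 : Submodule ℝ (VField n M)} (e : T.frontInterior a ≃ T.NormalProduct 𝒱) :
    Prop :=
  ∀ ξ, T.blowDown a ξ.1 = ((e ξ).p, (e ξ).p')

variable {a} {T} in
/-- The bijection is given by the coordinates of the tower `T'`: if `V` represents the normal vector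
corresponding to `ξ`, then, as `(q, q')` tends to `ξ` from the interior,
`log (x q / x q') / x q ^ (a_1 + ⋯ + a_k)` tends to the value of `x ^ (-(a_0 + ⋯ + a_k)) V x`, and
`(y q - y q') / x q ^ (a_i + ⋯ + a_k)` to that of `x ^ (-(a_i + ⋯ + a_k)) V y`, for `y` pulled back
from the base number `i - 1`. (For `k ≥ 1` and `a_0 = 1`, the first quotient may be replaced by
`(x q - x q') / x q ^ (a_0 + ⋯ + a_k)`.) -/
def IsGivenByCoordinates {𝒱 : Submodule ℝ (VField n M)}
    (e : T.frontInterior a ≃ T.NormalProduct 𝒱) (T' : Tower n M k) : Prop :=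
  ∀ ξ P u, T.HasCoords a ξ.1 P u → ∀ V : 𝒱, ((e ξ).v : AT 𝒱 (e ξ).p) = atVal (e ξ).p V →
    (∀ w : M → ℝ,
      IsQuotientOn (n := n) T'.emb.source T'.x (dirDeriv V.1 T'.x) (tailSum a 0) w →
      Tendsto (fun s => Real.log (T'.x (P.toFun s).1 / T'.x (P.toFun s).2) /
        T'.x (P.toFun s).1 ^ tailSum a 1) (𝓝[P.int] u) (𝓝 (w (e ξ).p))) ∧
    (∀ (i : Fin k) (y : (T'.B i.castSucc).carrier → ℝ) (w : M → ℝ),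
      ContMDiff (T'.B i.castSucc).model 𝓘(ℝ, ℝ) ∞ y →
      IsQuotientOn (n := n) T'.emb.source T'.x
        (dirDeriv V.1 (fun q => y (T'.proj i.castSucc q))) (tailSum a (i + 1)) w →
      Tendsto (fun s => (y (T'.proj i.castSucc (P.toFun s).1) -
          y (T'.proj i.castSucc (P.toFun s).2)) / T'.x (P.toFun s).1 ^ tailSum a (i + 1))
        (𝓝[P.int] u) (𝓝 (w (e ξ).p)))

open Classical in
variable {a} {T} in
/-- The pull-back of `g(q) - g(q')` to the double space extends smoothly to the interior of the
front face, and the extension is there the function that the covector field `θ` defines by means of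
`e` (pairing with the normal vector, constant in the second factor). -/
def ExtendsToFront {𝒱 : Submodule ℝ (VField n M)} (e : T.frontInterior a ≃ T.NormalProduct 𝒱)
    (g : M → ℝ) (θ : ACoField 𝒱) : Prop :=
  ∀ i P, T.atlas a (Fin.last k) (some i) P →
    ∃ G : (Idx n → ℝ) → ℝ,
      ContDiffOn ℝ ∞ G {u | u ∈ P.dom ∧ OffOtherFaces i P u} ∧
      (∀ u ∈ P.int, G u = g (P.toFun u).1 - g (P.toFun u).2) ∧
      ∀ u, u i = 0 → OffOtherFaces i P u → ∀ ξ : T.frontInterior a, T.HasCoords a ξ.1 P u →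
        G u = θ (e ξ).p (e ξ).v

/-- The pull-back of `g(q) - g(q')` to the double space has finite order singularities at all faces
other than the front face of the last blow-up. -/
def FiniteOrderAtOtherFaces (g : M → ℝ) : Prop :=
  ∀ o P, T.atlas a (Fin.last k) o P →
    P.FiniteOrder (P.corners.filter (fun j => o ≠ some j)) (fun q => g q.1 - g q.2)

end Tower

/-- `ℛ` is a one step refinement of the structure `𝒱` of order `a`: a structure of order
`(a_0, …, a_k + 1)` whose representing tower represents `𝒱` to order `a`. -/
def IsRefinement {n : ℕ} [NeZero n] {M : Type u} [TopologicalSpace M]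
    [ChartedSpace (EuclideanHalfSpace n) M] [IsManifold (𝓡∂ n) ∞ M] {k : ℕ}
    (a : Fin (k + 1) → ℕ) (𝒱 ℛ : Submodule ℝ (VField n M)) : Prop :=
  ∃ T : Tower n M k, T.fields (refineOrder a) = ℛ ∧ T.fields a = 𝒱

end MultiFibred

end

set_option linter.unusedSectionVars false

noncomputable section

namespace MultiFibred

open Tower (Idx)
open Finset (sum_congr mul_sum mem_insert_self mem_filter mem_erase sum_eq_zero single_le_sum
  sum_neg_distrib mem_singleton_self)
open Metric (ball mem_ball_self isOpen_ball ball_subset_ball ball_mem_nhds mem_ball)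
open Sum (inl inr elim)
local notation:max "ℝ^" ι:max => ι → ℝ
local notation "C∞" => ContDiffOn ℝ ∞

/-! ### Parameter dependent integrals -/

section ParamIntegral

variable {E : Type} [NormedAddCommGroup E] [NormedSpace ℝ E]

lemma intervalIntegrable_of_continuousOn_prod {G : Type} [NormedAddCommGroup G] {K : Set E}
    {F : E → ℝ → G}
    (hF : ContinuousOn (Function.uncurry F) (K ×ˢ Icc (0 : ℝ) 1)) {q : E} (hq : q ∈ K) :
    IntervalIntegrable (F q) MeasureTheory.volume 0 1 := by
  refine ContinuousOn.intervalIntegrable ?_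
  rw [uIcc_of_le zero_le_one]
  exact hF.comp (f := fun t => (q, t)) (by fun_prop) fun t ht => ⟨hq, ht⟩

lemma continuousOn_integral {G : Type} [NormedAddCommGroup G] [NormedSpace ℝ G] {K : Set E}
    {F : E → ℝ → G}
    (hF : ContinuousOn (Function.uncurry F) (K ×ˢ Icc (0 : ℝ) 1)) :
    ContinuousOn (fun v => ∫ t in (0 : ℝ)..1, F v t) K := by
  intro q hq
  refine Metric.continuousWithinAt_iff'.2 fun ε hε => ?_
  obtain ⟨v, hv, hvF⟩ := isCompact_Icc.mem_uniformity_of_prod hF hq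
    (Metric.dist_mem_uniformity (half_pos hε))
  filter_upwards [hv, self_mem_nhdsWithin] with p hp hpK
  rw [dist_eq_norm, ← intervalIntegral.integral_sub
    (intervalIntegrable_of_continuousOn_prod hF hpK)
    (intervalIntegrable_of_continuousOn_prod hF hq)]
  have : ‖∫ t in 0..1, (F p t - F q t)‖ ≤ ε / 2 * |1 - 0| := by
    refine intervalIntegral.norm_integral_le_of_norm_le_const fun t ht => ?_
    rw [uIoc_of_le zero_le_one] at ht
    have := hvF p hp t ⟨ht.1.le, ht.2⟩
    simp [dist_eq_norm] at this
    exact this.le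
  linarith

lemma hasFDerivWithinAt_integral {G : Type} [NormedAddCommGroup G] [NormedSpace ℝ G]
    [CompleteSpace G] {K : Set E} (hK : Convex ℝ K) {F : E → ℝ → G} {D : E → ℝ → E →L[ℝ] G}
    (hF : ContinuousOn (Function.uncurry F) (K ×ˢ Icc (0 : ℝ) 1))
    (hD : ContinuousOn (Function.uncurry D) (K ×ˢ Icc (0 : ℝ) 1))
    (hFD : ∀ v ∈ K, ∀ t ∈ Icc (0 : ℝ) 1, HasFDerivWithinAt (fun w => F w t) (D v t) K v)
    {q : E} (hq : q ∈ K) :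
    HasFDerivWithinAt (fun v => ∫ t in (0 : ℝ)..1, F v t) (∫ t in (0 : ℝ)..1, D q t) K q := by
  rw [hasFDerivWithinAt_iff_isLittleO, Asymptotics.isLittleO_iff]
  intro ε hε
  obtain ⟨v, hv, hvF⟩ := isCompact_Icc.mem_uniformity_of_prod hD hq
    (Metric.dist_mem_uniformity hε)
  obtain ⟨δ, hδ, hδv⟩ := Metric.mem_nhdsWithin_iff.1 hv
  filter_upwards [mem_nhdsWithin_of_mem_nhds (ball_mem_nhds q hδ), self_mem_nhdsWithin]
    with p hp hpK
  have i1 := intervalIntegrable_of_continuousOn_prod hF hpK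
  have i2 := intervalIntegrable_of_continuousOn_prod hF hq
  have i3 := intervalIntegrable_of_continuousOn_prod hD hq
  have i4 : IntervalIntegrable (fun t => D q t _) _ 0 1 :=
    ⟨(ContinuousLinearMap.apply ℝ G (p - q)).integrable_comp i3.1,
      (ContinuousLinearMap.apply ℝ G (p - q)).integrable_comp i3.2⟩
  have e : (∫ t in 0..1, D q t) (p - q) = ∫ t in 0..1, D q t _ :=
    ContinuousLinearMap.intervalIntegral_apply i3 _
  rw [e, ← intervalIntegral.integral_sub i1 i2, ← intervalIntegral.integral_sub (i1.sub i2) i4]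
  have : ‖∫ t in 0..1, (F p t - F q t - D q t (p - q))‖ ≤ ε * ‖p - q‖ * |1 - 0| := by
    refine intervalIntegral.norm_integral_le_of_norm_le_const fun t ht => ?_
    rw [uIoc_of_le zero_le_one] at ht
    have ht' : t ∈ Icc _ 1 := ⟨ht.1.le, ht.2⟩
    have hc := (convex_ball q δ).inter hK
    refine hc.norm_image_sub_le_of_norm_hasFDerivWithin_le'
      (fun x hx => (hFD x hx.2 t ht').mono inter_subset_right) (fun x hx => ?_)
      ⟨mem_ball_self hδ, hq⟩ ⟨hp, hpK⟩
    have := hvF x (hδv hx) t ht'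
    simp [dist_eq_norm] at this
    exact this.le
  simpa using this

lemma contDiffOn_integral_nat (n : ℕ) : ∀ {G : Type} [NormedAddCommGroup G] [NormedSpace ℝ G]
    [CompleteSpace G] {K : Set E} (_ : Convex ℝ K) (_ : UniqueDiffOn ℝ K) {F : E → ℝ → G}
    (_ : C∞ (Function.uncurry F) (K ×ˢ Icc (0 : ℝ) 1)),
    ContDiffOn ℝ n (fun v => ∫ t in (0 : ℝ)..1, F v t) K := by
  induction n with
  | zero =>
    intro G _ _ _ K _ _ F hF
    simpa using continuousOn_integral hF.continuousOn
  | succ n ih =>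
    intro G _ _ _ K hK hU F hF
    have hU' := hU.prod (uniqueDiffOn_Icc zero_lt_one)
    have h1 := (contDiffOn_infty_iff_fderivWithin hU').1 hF
    set D : E → ℝ → E →L[ℝ] G := fun v t =>
      (fderivWithin ℝ _ _ (v, t)).comp
        (ContinuousLinearMap.inl ℝ E ℝ) with hDdef
    have hD : C∞ (Function.uncurry D) (K ×ˢ Icc 0 1) := by
      have : Function.uncurry D = fun z => (fderivWithin ℝ (Function.uncurry F)
          (K ×ˢ Icc 0 1) z).comp (ContinuousLinearMap.inl ℝ E ℝ) := by
        ext z; rfl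
      rw [this]
      exact h1.2.clm_comp contDiffOn_const
    rw [Nat.cast_succ]
    rw [contDiffOn_succ_iff_hasFDerivWithinAt_of_uniqueDiffOn hU]
    refine ⟨by simp, fun v => ∫ t in 0..1, D v t, ih hK hU hD, fun q hq => ?_⟩
    refine hasFDerivWithinAt_integral hK hF.continuousOn hD.continuousOn (fun v hv t ht => ?_) hq
    have h2 := (h1.1 (v, t) ⟨hv, ht⟩).hasFDerivWithinAt
    have h3 : HasFDerivWithinAt (fun w : E => (w, t)) (ContinuousLinearMap.inl ℝ E ℝ) K v :=
      (hasFDerivAt_prodMk_left v t).hasFDerivWithinAt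
    have h4 : MapsTo (fun w : E => (w, t)) K _ := fun w hw => mk_mem_prod hw ht
    exact h2.comp v h3 h4

lemma contDiffOn_integral {G : Type} [NormedAddCommGroup G] [NormedSpace ℝ G]
    [CompleteSpace G] {K : Set E} (hK : Convex ℝ K) (hU : UniqueDiffOn ℝ K) {F : E → ℝ → G}
    (hF : C∞ (Function.uncurry F) (K ×ˢ Icc (0 : ℝ) 1)) :
    C∞ (fun v => ∫ t in (0 : ℝ)..1, F v t) K :=
  contDiffOn_infty.2 fun n => contDiffOn_integral_nat n hK hU hF

end ParamIntegral

/-! ### Orthants -/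

section Orthant

variable {ι : Type} [Fintype ι]

/-- The points whose coordinates with index in `C` are nonnegative. -/
def orth (C : Finset ι) : Set ℝ^ι := {v | ∀ j ∈ C, 0 ≤ v j}

/-- The points whose coordinates with index in `C` are positive. -/
def orthInt (C : Finset ι) : Set ℝ^ι := {v | ∀ j ∈ C, 0 < v j}

lemma orthInt_subset (C : Finset ι) : orthInt C ⊆ orth C := fun _ hv j hj => (hv j hj).le

lemma convex_orth (C : Finset ι) : Convex ℝ (orth C) := by
  intro v hv w hw a b ha hb _ j hj
  exact add_nonneg (mul_nonneg ha (hv j hj)) (mul_nonneg hb (hw j hj))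

lemma convex_orthInt (C : Finset ι) : Convex ℝ (orthInt C) := fun _ hv _ hw _ _ ha hb h j hj =>
  convex_Ioi (𝕜 := ℝ) (0 : ℝ) (hv j hj) (hw j hj) ha hb h

lemma isOpen_orthInt (C : Finset ι) : IsOpen (orthInt C) := by
  have : orthInt C = ⋂ j ∈ C, {v : ℝ^ι | 0 < v j} := by ext; simp [orthInt]
  rw [this]
  exact isOpen_biInter_finset fun j _ => isOpen_lt continuous_const (continuous_apply j)

lemma uniqueDiffOn_orth (C : Finset ι) : UniqueDiffOn ℝ (orth C) := by
  refine uniqueDiffOn_convex (convex_orth C) ⟨fun _ => 1, ?_⟩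
  exact interior_mono (orthInt_subset C) ((isOpen_orthInt C).interior_eq.symm ▸
    fun j _ => zero_lt_one)

lemma uniqueDiffOn_orth_inter (C : Finset ι) {O : Set ℝ^ι} (hO : IsOpen O) :
    UniqueDiffOn ℝ (orth C ∩ O) := (uniqueDiffOn_orth C).inter hO

lemma tendsto_push (v : ℝ^ι) (w : ℝ^ι) :
    Tendsto (fun t : ℝ => v + t • w) (𝓝[>] 0) (𝓝 v) := by
  have : Tendsto (fun t : ℝ => v + t • w) _ _ :=
    Continuous.tendsto (by fun_prop) 0
  rw [zero_smul, add_zero] at this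
  exact this.mono_left nhdsWithin_le_nhds

lemma eventually_push {C : Finset ι} {O : Set ℝ^ι} (hO : IsOpen O) {v : ℝ^ι}
    (hv : v ∈ orth C ∩ O) {s : ℝ^ι} (hs : 0 ≤ s) : ∀ᶠ t : ℝ in 𝓝[>] 0, 0 < t ∧
      v + t • s ∈ orth C ∩ O ∧ ∀ j ∈ C, 0 < s j → 0 < v j + t * s j := by
  filter_upwards [(tendsto_push v s).eventually (hO.mem_nhds hv.2), self_mem_nhdsWithin] with t ht h0
  exact ⟨h0, ⟨fun j hj => add_nonneg (hv.1 j hj) (mul_nonneg (le_of_lt h0) (hs j)), ht⟩,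
    fun j hj h => add_pos_of_nonneg_of_pos (hv.1 j hj) (mul_pos h0 h)⟩

lemma mem_closure_orthInt_inter {C : Finset ι} {O : Set ℝ^ι} (hO : IsOpen O) {v : ℝ^ι}
    (hv : v ∈ orth C ∩ O) : v ∈ closure (orthInt C ∩ O) :=
  mem_closure_of_tendsto (tendsto_push v 1) ((eventually_push hO hv zero_le_one).mono
    fun _ h => ⟨fun j hj => h.2.2 j hj one_pos, h.2.1.2⟩)

lemma eqOn_of_eqOn_orthInt {Y : Type*} [TopologicalSpace Y] [T2Space Y] {C : Finset ι}
    {O : Set ℝ^ι} (hO : IsOpen O) {f g : ℝ^ι → Y} (hf : ContinuousOn f (orth C ∩ O))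
    (hg : ContinuousOn g (orth C ∩ O)) (h : EqOn f g (orthInt C ∩ O)) :
    EqOn f g (orth C ∩ O) :=
  h.of_subset_closure hf hg (inter_subset_inter_left _ (orthInt_subset C))
    fun _ hv => mem_closure_orthInt_inter hO hv

lemma contDiffOn_integral_orth {G : Type} [NormedAddCommGroup G] [NormedSpace ℝ G]
    [CompleteSpace G] {C : Finset ι} {O : Set ℝ^ι} (hO : IsOpen O) {F : ℝ^ι → ℝ → G}
    (hF : C∞ (Function.uncurry F) ((orth C ∩ O) ×ˢ Icc (0 : ℝ) 1)) :
    C∞ (fun v => ∫ t in (0 : ℝ)..1, F v t) (orth C ∩ O) := by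
  intro v hv
  obtain ⟨r, hr, hrO⟩ := Metric.isOpen_iff.1 hO v hv.2
  have h := contDiffOn_integral
    ((convex_orth C).inter (convex_ball v r)) (uniqueDiffOn_orth_inter C isOpen_ball)
    (hF.mono (prod_mono (inter_subset_inter_right _ hrO) le_rfl))
  refine (h v ⟨hv.1, mem_ball_self hr⟩).mono_of_mem_nhdsWithin ?_
  exact inter_mem (mem_of_superset self_mem_nhdsWithin inter_subset_left)
    (mem_nhdsWithin_of_mem_nhds (ball_mem_nhds v hr))

end Orthant

/-! ### Integration along paths and Hadamard's lemma -/

lemma sub_eq_integral_path {E : Type*} [NormedAddCommGroup E] [NormedSpace ℝ E] {K : Set E}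
    {f : E → ℝ} (hf : DifferentiableOn ℝ f K) (hf' : ContinuousOn (fderivWithin ℝ f K) K)
    {γ γ' : ℝ → E} (hγ : ∀ t ∈ Icc (0 : ℝ) 1, γ t ∈ K)
    (hd : ∀ t ∈ Icc (0 : ℝ) 1, HasDerivAt γ (γ' t) t) (hγ' : ContinuousOn γ' (Icc 0 1)) :
    f (γ 1) - f (γ 0) = ∫ t in (0 : ℝ)..1, fderivWithin ℝ f K (γ t) (γ' t) := by
  have hγc : ContinuousOn γ _ := fun t ht => (hd t ht).continuousAt.continuousWithinAt
  symm
  refine intervalIntegral.integral_eq_sub_of_hasDerivAt_of_le zero_le_one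
    (hf.continuousOn.comp hγc hγ) (fun t ht => ?_) ?_
  · have ht' := Ioo_subset_Icc_self ht
    have h1 := (hf _ (hγ t ht')).hasFDerivWithinAt
    have h2 := h1.comp_hasDerivWithinAt t ((hd t ht').hasDerivWithinAt) hγ
    exact h2.hasDerivAt (Icc_mem_nhds ht.1 ht.2)
  · refine ContinuousOn.intervalIntegrable ?_
    rw [uIcc_of_le zero_le_one]
    exact (hf'.comp hγc hγ).clm_apply hγ'

section Coordinates

variable {ι ι' : Type} [Fintype ι] [DecidableEq ι] [Fintype ι'] [DecidableEq ι']

/-- The partial derivative, within `K`, with respect to the coordinate number `j`. -/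
def pd (K : Set ℝ^ι) (f : ℝ^ι → ℝ) (j : ι) (v : ℝ^ι) : ℝ :=
  fderivWithin ℝ f K v (Pi.single j 1)

lemma clm_apply_eq_sum (L : ℝ^ι →L[ℝ] ℝ) (w : ℝ^ι) :
    L w = ∑ j, w j * L (Pi.single j 1) := by
  conv_lhs => rw [← Finset.univ_sum_single w]
  rw [map_sum]
  refine sum_congr rfl fun j _ => ?_
  rw [← smul_eq_mul, ← map_smul, ← Pi.single_smul, smul_eq_mul, mul_one]

lemma fderivWithin_eq_sum_pd (K : Set ℝ^ι) (f : ℝ^ι → ℝ) (v w : ℝ^ι) :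
    fderivWithin ℝ f K v w = ∑ j, w j * pd K f j v := clm_apply_eq_sum _ w

lemma contDiffOn_pd {K : Set ℝ^ι} (hK : UniqueDiffOn ℝ K) {f : ℝ^ι → ℝ}
    (hf : C∞ f K) (j : ι) : C∞ (pd K f j) K :=
  ((contDiffOn_infty_iff_fderivWithin hK).1 hf).2.clm_apply contDiffOn_const

/-- Multiply the coordinates with index in `S` by `t`. -/
def scaleCoords (S : Finset ι) (t : ℝ) (w : ℝ^ι) : ℝ^ι := fun j => if j ∈ S then t * w j else w j

lemma scaleCoords_mem {C S : Finset ι} {v₀ : ℝ^ι} {r : ℝ} (h0 : ∀ j ∈ S, v₀ j = 0)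
    {w : ℝ^ι} (hw : w ∈ orth C ∩ ball v₀ r) {t : ℝ} (ht : t ∈ Icc (0 : ℝ) 1) :
    scaleCoords S t w ∈ orth C ∩ ball v₀ r := by
  refine ⟨fun j hj => ?_, ?_⟩
  · unfold scaleCoords
    split_ifs
    · exact mul_nonneg ht.1 (hw.1 j hj)
    · exact hw.1 j hj
  · have hw2 := hw.2
    rw [mem_ball] at hw2 ⊢
    refine lt_of_le_of_lt ?_ hw2
    rw [dist_pi_le_iff dist_nonneg]
    intro j
    refine le_trans ?_ (dist_le_pi_dist w v₀ j)
    unfold scaleCoords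
    split_ifs with h
    · rw [h0 j h, Real.dist_eq, Real.dist_eq, sub_zero, sub_zero, abs_mul, abs_of_nonneg ht.1]
      exact mul_le_of_le_one_left (abs_nonneg _) ht.2
    · rfl

lemma hadamard {C S : Finset ι} {v₀ : ℝ^ι} {r : ℝ} (h0 : ∀ j ∈ S, v₀ j = 0)
    {f : ℝ^ι → ℝ} (hf : C∞ f (orth C ∩ ball v₀ r))
    (hz : ∀ w ∈ orth C ∩ ball v₀ r, (∀ j ∈ S, w j = 0) → f w = 0) :
    ∃ g : ι → ℝ^ι → ℝ, (∀ s, C∞ (g s) (orth C ∩ ball v₀ r)) ∧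
      ∀ w ∈ orth C ∩ ball v₀ r, f w = ∑ s ∈ S, w s * g s w := by
  set K := orth C ∩ ball v₀ r with hKdef
  have hU : UniqueDiffOn ℝ K := uniqueDiffOn_orth_inter C isOpen_ball
  have hsm : ContDiff ℝ ∞ (fun z : ℝ^ι × ℝ => scaleCoords S z.2 z.1) := by
    rw [contDiff_pi]
    intro j
    unfold scaleCoords
    split_ifs <;> fun_prop
  have hpd : ∀ s, C∞ (Function.uncurry fun w t => pd K f s (scaleCoords S t w))
      (K ×ˢ Icc _ 1) := fun s =>
    (contDiffOn_pd hU hf s).comp hsm.contDiffOn fun z hz => scaleCoords_mem h0 hz.1 hz.2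
  refine ⟨fun s w => ∫ t in 0..1, pd K f s _, fun s =>
    contDiffOn_integral_orth isOpen_ball (hpd s), fun w hw => ?_⟩
  have h1 := sub_eq_integral_path
    (γ' := fun _ j => if j ∈ S then w j else 0)
    (hf.differentiableOn (by simp)) ((contDiffOn_infty_iff_fderivWithin hU).1 hf).2.continuousOn
    (fun t ht => scaleCoords_mem h0 hw ht) (fun t _ => by
      rw [hasDerivAt_pi]
      intro j
      unfold scaleCoords
      split_ifs
      · simpa using (hasDerivAt_id t).mul_const (w j)
      · exact hasDerivAt_const _ _) continuousOn_const
  have h2 : f (scaleCoords S 0 w) = 0 := by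
    refine hz _ (scaleCoords_mem h0 hw ⟨le_rfl, zero_le_one⟩) fun j hj => ?_
    simp [scaleCoords, hj]
  have h3 : scaleCoords S 1 w = w := by ext j; simp [scaleCoords]
  simp [h2, h3, sub_zero] at h1
  rw [h1]
  have h4 := fun s =>
    intervalIntegrable_of_continuousOn_prod (hpd s).continuousOn hw
  simp_rw [fderivWithin_eq_sum_pd, ite_mul, zero_mul, Finset.sum_ite_mem, Finset.univ_inter]
  rw [intervalIntegral.integral_finsetSum fun s _ => (h4 s).const_mul _]
  simp_rw [intervalIntegral.integral_const_mul]

lemma hadamard_single {C : Finset ι} {v₀ : ℝ^ι} {r : ℝ} {l : ι} (h0 : v₀ l = 0)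
    {f : ℝ^ι → ℝ} (hf : C∞ f (orth C ∩ ball v₀ r))
    (hz : ∀ w ∈ orth C ∩ ball v₀ r, w l = 0 → f w = 0) :
    ∃ g : ℝ^ι → ℝ, C∞ g (orth C ∩ ball v₀ r) ∧
      ∀ w ∈ orth C ∩ ball v₀ r, f w = w l * g w := by
  obtain ⟨g, hg, hfg⟩ := hadamard (S := {l}) (by simpa using h0) hf
    (fun w hw h => hz w hw (by simpa using h))
  exact ⟨g l, hg l, fun w hw => by simpa using hfg w hw⟩

/-! ### Local diffeomorphisms between parts of orthants -/

/-- `h` and `h'` are mutually inverse diffeomorphisms between relatively open parts of orthants. -/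
structure LocDiffeo (C : Finset ι) (C' : Finset ι') (O : Set ℝ^ι) (O' : Set ℝ^ι')
    (h : ℝ^ι → ℝ^ι') (h' : ℝ^ι' → ℝ^ι) : Prop where
  isOpen : IsOpen O
  isOpen' : IsOpen O'
  smooth : C∞ h (orth C ∩ O)
  smooth' : C∞ h' (orth C' ∩ O')
  maps : MapsTo h (orth C ∩ O) (orth C' ∩ O')
  maps' : MapsTo h' (orth C' ∩ O') (orth C ∩ O)
  left : ∀ v ∈ orth C ∩ O, h' (h v) = v
  right : ∀ v ∈ orth C' ∩ O', h (h' v) = v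

namespace LocDiffeo

variable {C : Finset ι} {C' : Finset ι'} {O : Set ℝ^ι} {O' : Set ℝ^ι'}
  {h : ℝ^ι → ℝ^ι'} {h' : ℝ^ι' → ℝ^ι}

lemma symm (H : LocDiffeo C C' O O' h h') : LocDiffeo C' C O' O h' h :=
  ⟨H.isOpen', H.isOpen, H.smooth', H.smooth, H.maps', H.maps, H.right, H.left⟩

lemma fderiv_surj (H : LocDiffeo C C' O O' h h') {v : ℝ^ι} (hv : v ∈ orth C ∩ O)
    (y : ℝ^ι') : ∃ x, fderivWithin ℝ h (orth C ∩ O) v x = y := by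
  have h1 := ((H.smooth.differentiableOn (by simp)) v hv).hasFDerivWithinAt
  have h2 := ((H.smooth'.differentiableOn (by simp)) (h v) (H.maps hv)).hasFDerivWithinAt
  have h1' : HasFDerivWithinAt h (fderivWithin ℝ h (orth C ∩ O) v) (orth C ∩ O) (h' (h v)) := by
    rwa [H.left v hv]
  have h3 := h1'.comp (h v) h2 H.maps'
  have h4 : HasFDerivWithinAt _ (ContinuousLinearMap.id ℝ _) _ (h v) :=
    (hasFDerivWithinAt_id _ _).congr (fun z hz => H.right z hz) (H.right _ (H.maps hv))
  have h5 := (uniqueDiffOn_orth_inter C' H.isOpen' (h v) (H.maps hv)).eq h3 h4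
  exact ⟨_, by
    simpa using congrArg (fun L => L y) h5⟩

lemma fderiv_eq_zero (H : LocDiffeo C C' O O' h h') {v : ℝ^ι} (hv : v ∈ orth C ∩ O)
    {j : ι'} (hj : j ∈ C') (hvj : h v j = 0) {x : ℝ^ι} (hx : ∀ l ∈ C, v l = 0 → x l = 0) :
    fderivWithin ℝ h (orth C ∩ O) v x j = 0 := by
  have h1 := ((H.smooth.differentiableOn (by simp)) v hv).hasFDerivWithinAt
  have hline : HasDerivAt (fun t : ℝ => v + t • x) x 0 := by
    simpa using ((hasDerivAt_id (0 : ℝ)).smul_const x).const_add v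
  have hct : Tendsto (fun t : ℝ => v + t • x) (𝓝 0) (𝓝 v) :=
    Continuous.tendsto' (by fun_prop) 0 _ (by simp)
  have hmem : ∀ᶠ t : ℝ in 𝓝 0, v + t • x ∈ orth C ∩ O := by
    have hO := hct.eventually (H.isOpen.mem_nhds hv.2)
    have hC : ∀ᶠ t : ℝ in 𝓝 0, ∀ l ∈ C, 0 ≤ (v + t • x) l := by
      rw [Finset.eventually_all]
      intro l hl
      rcases (hv.1 l hl).eq_or_lt with h0 | h0
      · refine Eventually.of_forall fun t => ?_
        simp [← h0, hx l hl _]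
      · have :=
          ((continuous_apply l).tendsto v).comp hct
        exact (this.eventually (lt_mem_nhds h0)).mono fun t ht => ht.le
    filter_upwards [hO, hC] with t h1 h2 using ⟨h2, h1⟩
  have h1' : HasFDerivWithinAt h (fderivWithin ℝ h (orth C ∩ O) v) (orth C ∩ O)
      (v + (0 : ℝ) • x) := by simpa using h1
  have h2 :=
    h1'.comp_hasDerivWithinAt 0 hline.hasDerivWithinAt (fun t ht => ht)
  have h3 := h2.hasDerivAt hmem
  have h4 := (hasDerivAt_pi.1 h3) j
  refine IsLocalMin.hasDerivAt_eq_zero ?_ h4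
  filter_upwards [hmem] with t ht
  simpa [hvj] using (H.maps ht).1 j hj

lemma mem_orthInt (H : LocDiffeo C C' O O' h h') {v : ℝ^ι} (hv : v ∈ orth C ∩ O)
    (hvi : v ∈ orthInt C) : h v ∈ orthInt C' := by
  intro j hj
  refine lt_of_le_of_ne ((H.maps hv).1 j hj) fun h0 => ?_
  obtain ⟨x, hx⟩ := H.fderiv_surj hv (fun _ => 1)
  have := H.fderiv_eq_zero hv hj h0.symm (x := x) fun l hl hl0 => absurd hl0 (hvi l hl).ne'
  rw [hx] at this
  exact one_ne_zero this

lemma mem_orthInt_iff (H : LocDiffeo C C' O O' h h') {v : ℝ^ι} (hv : v ∈ orth C ∩ O) :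
    h v ∈ orthInt C' ↔ v ∈ orthInt C :=
  ⟨fun h1 => by simpa [H.left v hv] using H.symm.mem_orthInt (H.maps hv) h1, H.mem_orthInt hv⟩

lemma eq_of_fderiv_eq_zero (H : LocDiffeo C C' O O' h h') {v : ℝ^ι} (hv : v ∈ orth C ∩ O)
    {l : ι} {j j' : ι'} (h1 : ∀ x : ℝ^ι, x l = 0 → fderivWithin ℝ h (orth C ∩ O) v x j = 0)
    (h2 : ∀ x : ℝ^ι, x l = 0 → fderivWithin ℝ h (orth C ∩ O) v x j' = 0) : j = j' := by
  by_contra hne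
  obtain ⟨x, hx⟩ := H.fderiv_surj hv (Pi.single j 1)
  obtain ⟨x', hx'⟩ := H.fderiv_surj hv (Pi.single j' 1)
  have a2 := h1 (x' l • x - x l • x') (by simp [mul_comm])
  rw [map_sub, map_smul, map_smul, hx, hx'] at a2
  simp [Pi.single_eq_of_ne hne] at a2
  simpa [hx'] using h2 x' a2

lemma facet_unique (H : LocDiffeo C C' O O' h h') {v : ℝ^ι} (hv : v ∈ orth C ∩ O)
    {l : ι} (hl : ∀ m ∈ C, m ≠ l → 0 < v m) {j j' : ι'} (hj : j ∈ C') (hj' : j' ∈ C')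
    (h1 : h v j = 0) (h2 : h v j' = 0) : j = j' := by
  have key : ∀ y : ℝ^ι, y l = 0 → ∀ m ∈ C, v m = 0 → y m = 0 := fun y hy m hm hm0 => by
    by_cases hml : m = l
    · rw [hml, hy]
    · exact absurd hm0 (hl m hm hml).ne'
  exact H.eq_of_fderiv_eq_zero hv (fun y hy => H.fderiv_eq_zero hv hj h1 (key y hy))
    fun y hy => H.fderiv_eq_zero hv hj' h2 (key y hy)

lemma exists_vanish (H : LocDiffeo C C' O O' h h') {v : ℝ^ι} (hv : v ∈ orth C ∩ O)
    {l : ι} (hl : l ∈ C) (hvl : v l = 0) :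
    ∃ j ∈ C', ∃ r > 0, ball v r ⊆ O ∧
      ∀ w ∈ orth C ∩ ball v r, w l = 0 → h w j = 0 := by
  set s : ℝ^ι := fun m => if m = l then 0 else 1 with hs
  set F : Set ℝ^ι := {w | w ∈ orth C ∩ O ∧ w l = 0 ∧ ∀ m ∈ C, m ≠ l → 0 < w m}
  have hpush : ∀ U, IsOpen U → U ⊆ O → ∀ w ∈ orth C ∩ U, w l = 0 →
      ∀ᶠ t : ℝ in 𝓝[>] 0, w + t • s ∈ F ∩ U := fun U hU hUO w hw hwl =>
    (eventually_push hU hw fun m => by simp only [hs]; split_ifs <;> simp).mono fun t ht =>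
      ⟨⟨⟨ht.2.1.1, hUO ht.2.1.2⟩, by simp [hs, hwl],
        fun m hm hml => ht.2.2 m hm (by simp [hs, hml])⟩, ht.2.1.2⟩
  have hex : ∀ w ∈ F, ∃ j ∈ C', h w j = 0 := fun w hw => by
    by_contra! hcon
    exact ((H.mem_orthInt_iff hw.1).1 (fun j hj =>
      lt_of_le_of_ne ((H.maps hw.1).1 j hj) (hcon j hj).symm) l hl).ne' hw.2.1
  have hd := H.smooth.continuousOn_fderivWithin (uniqueDiffOn_orth_inter C H.isOpen) (by simp) v hv
  have key : ∀ i ∈ C', (∃ᶠ w in 𝓝[F] v, h w i = 0) → ∀ x : ℝ^ι, x l = 0 →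
      fderivWithin ℝ h (orth C ∩ O) v x i = 0 := fun i hi hf x hx => by
    by_contra hne
    obtain ⟨w, h0, hwF, hw⟩ := (hf.and_eventually (eventually_mem_nhdsWithin.and
      ((((continuous_apply i).tendsto _).comp ((hd.mono fun w hw => hw.1).clm_apply
        continuousWithinAt_const)).eventually_ne hne))).exists
    refine hw (H.fderiv_eq_zero hwF.1 hi h0 fun m hm hm0 => ?_)
    by_cases hml : m = l
    · rw [hml, hx]
    · exact absurd hm0 (hwF.2.2 m hm hml).ne'
  have := mem_closure_iff_nhdsWithin_neBot.1 (mem_closure_of_tendsto (tendsto_push v s)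
    ((hpush O H.isOpen subset_rfl v hv hvl).mono fun t ht => ht.1))
  obtain ⟨j, hj, hfr⟩ : ∃ j ∈ C', ∃ᶠ w in 𝓝[F] v, h w j = 0 := by
    by_contra! hcon
    obtain ⟨w, hw, hwF⟩ := (((Finset.eventually_all _).2 hcon).and
      eventually_mem_nhdsWithin).exists
    obtain ⟨j, hj, h0⟩ := hex w hwF
    exact hw j hj h0
  have hall : ∀ᶠ w in 𝓝[F] v, h w j = 0 := by
    have : ∀ᶠ w in 𝓝[F] v, ∀ i ∈ C', h w i = 0 → i = j := (Finset.eventually_all _).2 fun i hi => by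
      by_cases hij : i = j
      · exact .of_forall fun _ _ => hij
      · exact (not_frequently.1 fun hf => hij (H.eq_of_fderiv_eq_zero hv (key i hi hf)
          (key j hj hfr))).mono fun w hw h0 => absurd h0 hw
    filter_upwards [this, self_mem_nhdsWithin] with w hw hwF
    obtain ⟨i, hi, h0⟩ := hex w hwF
    exact hw i hi h0 ▸ h0
  obtain ⟨r, hr, hrO⟩ := Metric.eventually_nhds_iff_ball.1
    ((H.isOpen.eventually_mem hv.2).and (eventually_nhdsWithin_iff.1 hall))
  refine ⟨j, hj, r, hr, fun w hw => (hrO w hw).1, fun w hw hwl => ?_⟩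
  have e := hpush _ isOpen_ball (fun w hw => (hrO w hw).1) w hw hwl
  refine tendsto_nhds_unique (((continuous_apply j).tendsto (h w)).comp
    ((H.smooth.continuousOn w ⟨hw.1, (hrO w hw.2).1⟩).tendsto.comp (tendsto_nhdsWithin_iff.2
      ⟨tendsto_push w s, e.mono fun t ht => ht.1.1⟩))) (tendsto_const_nhds.congr' ?_)
  exact e.mono fun t ht => ((hrO _ ht.2).2 ht.1).symm

lemma corner (H : LocDiffeo C C' O O' h h') {v : ℝ^ι} (hv : v ∈ orth C ∩ O)
    {l : ι} (hl : l ∈ C) (hvl : v l = 0) :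
    ∃ j ∈ C', h v j = 0 ∧ ∃ r > 0, ∃ c : ℝ^ι → ℝ, ball v r ⊆ O ∧
      C∞ c (orth C ∩ ball v r) ∧
      ∀ w ∈ orth C ∩ ball v r, 0 < c w ∧ h w j = w l * c w := by
  obtain ⟨j, hj, r, hr, hrO, hvan⟩ := H.exists_vanish hv hl hvl
  have hsub := inter_subset_inter_right (orth C) hrO
  obtain ⟨c, hc, hcf⟩ := hadamard_single hvl ((contDiffOn_pi.1 H.smooth j).mono hsub) hvan
  have hvB : v ∈ orth C ∩ ball v r := ⟨hv.1, mem_ball_self hr⟩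
  have e := eventually_push isOpen_ball hvB zero_le_one
  have h0 : 0 ≤ c v := ge_of_tendsto ((hc.continuousOn v hvB).tendsto.comp
    (tendsto_nhdsWithin_iff.2 ⟨tendsto_push v 1, e.mono fun t ht => ht.2.1⟩)) (e.mono fun t ht => by
      have := (H.maps (hsub ht.2.1)).1 j hj
      rw [hcf _ ht.2.1] at this
      exact nonneg_of_mul_nonneg_right this (by simpa [hvl] using ht.1))
  have h1 : c v ≠ 0 := fun h1 => by
    have d1 := (hasFDerivWithinAt_pi'.1
      (H.smooth.differentiableOn (by simp) v hv).hasFDerivWithinAt j).mono hsub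
    have d2 := ((hasFDerivWithinAt_apply l v _).mul
      (hc.differentiableOn (by simp) v hvB).hasFDerivWithinAt).congr hcf (hcf v hvB)
    obtain ⟨x, hx⟩ := H.fderiv_surj hv (fun _ => 1)
    simpa [h1, hvl, hx] using congrArg (fun L => L x)
      ((uniqueDiffOn_orth_inter C isOpen_ball v hvB).eq d1 d2)
  obtain ⟨ρ, hρ, hs⟩ := Metric.mem_nhdsWithin_iff.1
    ((hc.continuousOn v hvB).eventually (lt_mem_nhds (h0.lt_of_ne' h1)))
  have hb := ball_subset_ball (x := v) (min_le_left r ρ)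
  exact ⟨j, hj, hvan v hvB hvl, _, lt_min hr hρ, c, hb.trans hrO,
    hc.mono (inter_subset_inter_right _ hb), fun w hw => ⟨hs ⟨ball_subset_ball
      (min_le_right _ _) hw.2, hw.1, hb hw.2⟩, hcf w ⟨hw.1, hb hw.2⟩⟩⟩

end LocDiffeo

end Coordinates

namespace LocDiffeo

variable {ι ι' ι'' : Type} [Fintype ι] [DecidableEq ι] [Fintype ι'] [DecidableEq ι'] [Fintype ι'']
  [DecidableEq ι'']
  {C : Finset ι} {C' : Finset ι'} {C'' : Finset ι''} {O : Set ℝ^ι} {O' : Set ℝ^ι'}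
  {h : ℝ^ι → ℝ^ι'} {h' : ℝ^ι' → ℝ^ι}

lemma exists_pos_ne (C : Finset ι) {v : ℝ^ι} (hv : v ∈ orth C) (l : ι) {N : Set ℝ^ι}
    (hN : N ∈ 𝓝 v) : ∃ w ∈ orth C ∩ N, w l = v l ∧ ∀ m, m ≠ l → v m < w m := by
  obtain ⟨t, ht, h0, hw, -⟩ := (((tendsto_push v _).eventually hN).and (eventually_push isOpen_univ
    ⟨hv, mem_univ _⟩ (s := fun m => if m = l then 0 else 1)
      fun m => by dsimp only; split_ifs <;> simp)).exists
  exact ⟨_, ⟨hw.1, ht⟩, by simp, fun m hm => by simp [hm, h0]⟩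

lemma corner_unique {v : ℝ^ι} (hv : v ∈ orth C) {l l' : ι} (hl' : l' ∈ C)
    {r r' : ℝ} (hr : 0 < r) (hr' : 0 < r') {f c c' : ℝ^ι → ℝ} (hvl : v l = 0)
    (h1 : ∀ w ∈ orth C ∩ ball v r, 0 < c w ∧ f w = w l * c w)
    (h2 : ∀ w ∈ orth C ∩ ball v r', 0 < c' w ∧ f w = w l' * c' w) : l' = l := by
  by_contra hne
  obtain ⟨w, ⟨hw, hwb, hwb'⟩, hwl, hwm⟩ := exists_pos_ne C hv l
    (inter_mem (ball_mem_nhds v hr) (ball_mem_nhds v hr'))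
  have e1 := (h1 w ⟨hw, hwb⟩).2
  have e2 := (h2 w ⟨hw, hwb'⟩)
  rw [hwl, hvl, zero_mul] at e1
  have := hwm l' hne
  have h0 := hv l' hl'
  rw [e1] at e2
  exact (mul_pos (lt_of_le_of_lt h0 this) e2.1).ne e2.2

lemma corner_inv (H : LocDiffeo C C' O O' h h') {v : ℝ^ι} (hv : v ∈ orth C ∩ O)
    {j : ι'} (hj : j ∈ C') (hvj : h v j = 0) :
    ∃ l ∈ C, v l = 0 ∧ ∃ r > 0, ∃ c : ℝ^ι → ℝ, ball v r ⊆ O ∧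
      C∞ c (orth C ∩ ball v r) ∧
      ∀ w ∈ orth C ∩ ball v r, 0 < c w ∧ h w j = w l * c w := by
  obtain ⟨l, hl, hvl, r, hr, c, hrO, hc, hcf⟩ := H.symm.corner (H.maps hv) hj hvj
  rw [H.left v hv] at hvl
  obtain ⟨ρ, hρ, hs⟩ := Metric.eventually_nhds_iff_ball.1 ((H.isOpen.eventually_mem hv.2).and
    (eventually_nhdsWithin_iff.1 ((H.smooth.continuousOn v hv).eventually
      (ball_mem_nhds _ hr))))
  have hm : ∀ w ∈ orth C ∩ ball v ρ, w ∈ orth C ∩ O ∧ h w ∈ orth C' ∩ ball (h v) r :=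
    fun w hw =>
      have hO : w ∈ orth C ∩ O := ⟨hw.1, (hs w hw.2).1⟩
      ⟨hO, (H.maps hO).1, (hs w hw.2).2 hO⟩
  have hp := fun w hw => (hcf _ (hm w hw).2).1
  refine ⟨l, hl, hvl, ρ, hρ, fun w => (c (h w))⁻¹, fun w hw => (hs w hw).1,
    (hc.comp (H.smooth.mono fun w hw => (hm w hw).1) fun w hw => (hm w hw).2).inv
      fun w hw => (hp w hw).ne', fun w hw => ⟨inv_pos.2 (hp w hw), ?_⟩⟩
  have := (hcf _ (hm w hw).2).2
  rw [H.left _ (hm w hw).1] at this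
  rw [this, mul_inv_cancel_right₀ (hp w hw).ne']

lemma exists_restrict (H : LocDiffeo C C' O O' h h') {V : Set ℝ^ι'} (hV : IsOpen V) :
    ∃ A ⊆ O, (∀ v ∈ orth C, v ∈ A ↔ v ∈ O ∧ h v ∈ V) ∧ LocDiffeo C C' A (O' ∩ V) h h' := by
  obtain ⟨U, hU, hUe⟩ := continuousOn_iff'.1 H.smooth.continuousOn V hV
  have key : ∀ v ∈ orth C, v ∈ O ∩ U ↔ v ∈ O ∧ h v ∈ V := by
    intro v hv
    have := Set.ext_iff.1 hUe v
    constructor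
    · rintro ⟨h1, h2⟩
      exact ⟨h1, (this.2 ⟨h2, hv, h1⟩).1⟩
    · rintro ⟨h1, h2⟩
      exact ⟨h1, (this.1 ⟨h2, hv, h1⟩).1⟩
  refine ⟨O ∩ U, inter_subset_left, key, ⟨H.isOpen.inter hU, H.isOpen'.inter hV,
    H.smooth.mono (inter_subset_inter_right _ inter_subset_left),
    H.smooth'.mono (inter_subset_inter_right _ inter_subset_left), ?_, ?_, ?_, ?_⟩⟩
  · rintro v ⟨hv, hvA⟩
    have := (key v hv).1 hvA
    have h2 := H.maps ⟨hv, this.1⟩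
    exact ⟨h2.1, h2.2, this.2⟩
  · rintro w ⟨hw, hwO, hwV⟩
    have h2 := H.maps' ⟨hw, hwO⟩
    exact ⟨h2.1, (key _ h2.1).2 ⟨h2.2, by rwa [H.right w ⟨hw, hwO⟩]⟩⟩
  · rintro v ⟨hv, hvA⟩
    exact H.left v ⟨hv, hvA.1⟩
  · rintro w ⟨hw, hwO, hwV⟩
    exact H.right w ⟨hw, hwO⟩

lemma trans (H : LocDiffeo C C' O O' h h') {O₁ : Set ℝ^ι'} {O₂ : Set ℝ^ι''}
    {g : ℝ^ι' → ℝ^ι''} {g' : ℝ^ι'' → ℝ^ι'} (G : LocDiffeo C' C'' O₁ O₂ g g') :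
    ∃ A ⊆ O, ∃ B ⊆ O₂, (∀ v ∈ orth C, v ∈ A ↔ v ∈ O ∧ h v ∈ O₁) ∧
      (∀ w ∈ orth C'', w ∈ B ↔ w ∈ O₂ ∧ g' w ∈ O') ∧
      LocDiffeo C C'' A B (g ∘ h) (h' ∘ g') := by
  obtain ⟨A, hAO, hA, HA⟩ := H.exists_restrict G.isOpen
  obtain ⟨B, hBO, hB, HB⟩ := G.symm.exists_restrict H.isOpen'
  refine ⟨A, hAO, B, hBO, hA, hB, ⟨HA.isOpen, HB.isOpen, ?_, ?_, ?_, ?_, ?_, ?_⟩⟩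
  · exact G.smooth.comp HA.smooth fun v hv => ⟨(HA.maps hv).1, (HA.maps hv).2.2⟩
  · exact H.smooth'.comp HB.smooth fun v hv => ⟨(HB.maps hv).1, (HB.maps hv).2.2⟩
  · exact fun v hv => HB.maps' ⟨(HA.maps hv).1, (HA.maps hv).2.2, (HA.maps hv).2.1⟩
  · exact fun v hv => HA.maps' ⟨(HB.maps hv).1, (HB.maps hv).2.2, (HB.maps hv).2.1⟩
  · intro v hv
    simp
    rw [G.left _ ⟨(HA.maps hv).1, (HA.maps hv).2.2⟩, HA.left v hv]
  · intro v hv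
    simp
    rw [H.right _ ⟨(HB.maps hv).1, (HB.maps hv).2.2⟩, HB.left v hv]

end LocDiffeo

namespace Patch

variable {ι : Type} [Fintype ι] [DecidableEq ι] {W : Type*}

lemma dom_eq (P : Patch ι W) : P.dom = orth P.corners ∩ P.O := by
  ext; exact and_comm

lemma dom_inter (P : Patch ι W) (O : Set ℝ^ι) :
    P.dom ∩ O = orth P.corners ∩ (P.O ∩ O) := by
  rw [dom_eq, inter_assoc]

lemma int_eq (P : Patch ι W) : P.int = orthInt P.corners ∩ P.O := by
  ext; exact and_comm

lemma int_subset_dom (P : Patch ι W) : P.int ⊆ P.dom := fun _ h => ⟨h.1, fun j hj => (h.2 j hj).le⟩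

lemma uniqueDiffOn_dom (P : Patch ι W) {O : Set ℝ^ι} (hO : IsOpen O) :
    UniqueDiffOn ℝ (P.dom ∩ O) := by
  rw [dom_inter]; exact uniqueDiffOn_orth_inter _ (P.isOpen.inter hO)

lemma mem_int_iff {P : Patch ι W} {v : ℝ^ι} (hv : v ∈ P.dom) :
    v ∈ P.int ↔ ∀ j ∈ P.corners, v j ≠ 0 :=
  ⟨fun h j hj => (h.2 j hj).ne', fun h => ⟨hv.1, fun j hj => lt_of_le_of_ne (hv.2 j hj) (h j hj).symm⟩⟩

lemma SamePoint.exists_locDiffeo {P P' : Patch ι W} {v v' : ℝ^ι}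
    (hz : SamePoint (P, v) (P', v')) (hv : v ∈ P.dom) :
    ∃ O ⊆ P.O, ∃ O' ⊆ P'.O, ∃ h h', LocDiffeo P.corners P'.corners O O' h h' ∧ v ∈ O ∧ v' ∈ O' ∧
      v' ∈ P'.dom ∧ h v = v' ∧ ∀ w ∈ orth P.corners ∩ O, P.toFun w = P'.toFun (h w) := by
  obtain ⟨h, h', O, O', hO, hO', hvO, hvO', hvv, sm, sm', mp, mp', lf, rt, he⟩ := hz
  have hd := mp ⟨hv, hvO⟩
  rw [hvv] at hd
  rw [dom_inter, dom_inter] at mp mp'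
  rw [dom_inter] at sm sm' lf rt he
  exact ⟨_, inter_subset_left, _, inter_subset_left, h, h',
    ⟨P.isOpen.inter hO, P'.isOpen.inter hO', sm, sm', mp, mp', lf, rt⟩, ⟨hv.1, hvO⟩,
    ⟨hd.1.1, hvO'⟩, hd.1, hvv, he⟩

lemma samePoint_of_locDiffeo {P P' : Patch ι W} {v v' : ℝ^ι} {O O' : Set ℝ^ι}
    {h h' : ℝ^ι → ℝ^ι} (H : LocDiffeo P.corners P'.corners O O' h h')
    (hO : O ⊆ P.O) (hO' : O' ⊆ P'.O) (hv : v ∈ O) (hv' : v' ∈ O') (hvv : h v = v')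
    (he : ∀ w ∈ orth P.corners ∩ O, P.toFun w = P'.toFun (h w)) :
    SamePoint (P, v) (P', v') := by
  have e1 : P.dom ∩ O = orth P.corners ∩ O := by
    rw [dom_inter, inter_eq_self_of_subset_right hO]
  have e2 : P'.dom ∩ O' = orth P'.corners ∩ O' := by
    rw [dom_inter, inter_eq_self_of_subset_right hO']
  refine ⟨h, h', O, O', H.isOpen, H.isOpen', hv, hv', hvv, ?_, ?_, ?_, ?_, ?_, ?_, ?_⟩ <;>
    simp only [e1, e2]
  exacts [H.smooth, H.smooth', H.maps, H.maps', H.left, H.right, he]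

lemma SamePoint.refl (z : Patch ι W × ℝ^ι) : SamePoint z z :=
  ⟨id, id, univ, univ, isOpen_univ, isOpen_univ, mem_univ _, mem_univ _, rfl, contDiffOn_id,
    contDiffOn_id, mapsTo_id _, mapsTo_id _, fun _ _ => rfl, fun _ _ => rfl, fun _ _ => rfl⟩

lemma SamePoint.symm {P P' : Patch ι W} {v v' : ℝ^ι} (hv : v ∈ P.dom)
    (hz : SamePoint (P, v) (P', v')) : SamePoint (P', v') (P, v) := by
  obtain ⟨O, hO, O', hO', h, h', H, hvO, hvO', hd, hvv, he⟩ := hz.exists_locDiffeo hv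
  refine samePoint_of_locDiffeo H.symm hO' hO hvO' hvO ?_ fun w hw => ?_
  · rw [← hvv, H.left v ⟨(dom_eq P ▸ hv).1, hvO⟩]
  · rw [he _ (H.maps' hw), H.right w hw]

lemma SamePoint.mem_dom {P P' : Patch ι W} {v v' : ℝ^ι} (hv : v ∈ P.dom)
    (hz : SamePoint (P, v) (P', v')) : v' ∈ P'.dom := by
  obtain ⟨O, hO, O', hO', h, h', H, hvO, hvO', hd, hvv, he⟩ := hz.exists_locDiffeo hv
  exact hd

lemma SamePoint.apply_eq {P P' : Patch ι W} {v v' : ℝ^ι} (hv : v ∈ P.dom)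
    (hz : SamePoint (P, v) (P', v')) : P.toFun v = P'.toFun v' := by
  obtain ⟨O, hO, O', hO', h, h', H, hvO, hvO', hd, hvv, he⟩ := hz.exists_locDiffeo hv
  rw [← hvv]
  exact he v ⟨(dom_eq P ▸ hv).1, hvO⟩

lemma SamePoint.trans {P P' P'' : Patch ι W} {v v' v'' : ℝ^ι} (hv : v ∈ P.dom)
    (hz : SamePoint (P, v) (P', v')) (hz' : SamePoint (P', v') (P'', v'')) :
    SamePoint (P, v) (P'', v'') := by
  obtain ⟨O, hO, O', hO', h, h', H, hvO, hvO', hd, hvv, he⟩ := hz.exists_locDiffeo hv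
  obtain ⟨U, hU, U', hU', g, g', G, hvU, hvU', hd', hvv', he'⟩ := hz'.exists_locDiffeo hd
  obtain ⟨A, hA, B, hB, hA', hB', K⟩ := H.trans G
  have hv0 := (dom_eq P ▸ hv).1
  have hAv := (hA' v hv0).2 ⟨hvO, hvv ▸ hvU⟩
  refine samePoint_of_locDiffeo K (hA.trans hO) (hB.trans hU') hAv ?_ ?_ ?_
  · refine (hB' v'' (dom_eq P'' ▸ hd').1).2 ⟨hvU', ?_⟩
    rw [← hvv', G.left _ ⟨(dom_eq P' ▸ hd).1, hvU⟩]
    exact hvO'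
  · simp [hvv, hvv']
  · intro w hw
    have h1 := (hA' w hw.1).1 hw.2
    rw [he w ⟨hw.1, h1.1⟩, he' (h w) ⟨(H.maps ⟨hw.1, h1.1⟩).1, h1.2⟩]
    rfl

/-! ### Patches that are injective in the interior -/

/-- `P` is injective in its interior, and maps precisely its interior points to `Wi`. -/
structure IsGood (Wi : Set W) (P : Patch ι W) : Prop where
  injOn : InjOn P.toFun P.int
  int_iff : ∀ v ∈ P.dom, P.toFun v ∈ Wi ↔ v ∈ P.int

lemma samePoint_of_maps {Wi : Set W} {P P' : Patch ι W} (hP : P.IsGood Wi) (hP' : P'.IsGood Wi)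
    {v : ℝ^ι} (hv : v ∈ P.dom) {O O' : Set ℝ^ι} {η η' : ℝ^ι → ℝ^ι}
    (hO : IsOpen O) (hO' : IsOpen O') (hvO : v ∈ O) (hvO' : η v ∈ O')
    (sm : C∞ η (P.dom ∩ O)) (sm' : C∞ η' (P'.dom ∩ O'))
    (mp : MapsTo η (P.dom ∩ O) P'.dom) (mp' : MapsTo η' (P'.dom ∩ O') P.dom)
    (he : ∀ w ∈ P.dom ∩ O, P'.toFun (η w) = P.toFun w)
    (he' : ∀ w ∈ P'.dom ∩ O', P.toFun (η' w) = P'.toFun w) :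
    SamePoint (P, v) (P', η v) := by
  have key : ∀ {P P' : Patch ι W} (_ : P.IsGood Wi) (_ : P'.IsGood Wi) {O O' : Set _}
      {η η' : ℝ^ι → ℝ^ι} (_ : IsOpen O) (_ : IsOpen O')
      (_ : C∞ η (P.dom ∩ O)) (_ : C∞ η' (P'.dom ∩ O'))
      (_ : MapsTo η (P.dom ∩ O) P'.dom) (_ : MapsTo η' (P'.dom ∩ O') P.dom)
      (_ : ∀ w ∈ P.dom ∩ O, P'.toFun (η w) = P.toFun w)
      (_ : ∀ w ∈ P'.dom ∩ O', P.toFun (η' w) = P'.toFun w),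
      ∃ O₁ ⊆ O, IsOpen O₁ ∧ (∀ w ∈ P.dom, w ∈ O₁ ↔ w ∈ O ∧ η w ∈ O') ∧
        ∀ w ∈ P.dom ∩ O₁, η' (η w) = w := by
    clear * -
    intro P P' hP hP' O O' η η' hO hO' sm sm' mp mp' he he'
    obtain ⟨U, hU, hUe⟩ := continuousOn_iff'.1 sm.continuousOn O' hO'
    have h1 : ∀ w ∈ P.dom, w ∈ O ∩ U ↔ w ∈ O ∧ η w ∈ O' := by
      intro w hw
      have := Set.ext_iff.1 hUe w
      exact ⟨fun h => ⟨h.1, (this.2 ⟨h.2, hw, h.1⟩).1⟩, fun h => ⟨h.1, (this.1 ⟨h.2, hw, h.1⟩).1⟩⟩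
    refine ⟨O ∩ U, inter_subset_left, hO.inter hU, h1, ?_⟩
    rw [dom_inter]
    refine eqOn_of_eqOn_orthInt (P.isOpen.inter (hO.inter hU))
      ?_ continuousOn_id ?_
    · rw [← dom_inter]
      exact sm'.continuousOn.comp (sm.continuousOn.mono fun w hw => ⟨hw.1, hw.2.1⟩)
        fun w hw => ⟨mp ⟨hw.1, hw.2.1⟩, ((h1 w hw.1).1 hw.2).2⟩
    · rintro w ⟨hwi, hwO, hwU⟩
      have hwi' : w ∈ P.int := ⟨hwO, hwi⟩
      have hwd := int_subset_dom P hwi'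
      have hw2 := (h1 w hwd).1 hwU
      have e1 := he w ⟨hwd, hw2.1⟩
      have d1 := mp ⟨hwd, hw2.1⟩
      have e2 := he' _ ⟨d1, hw2.2⟩
      refine hP.injOn ?_ hwi' (e2.trans e1)
      rw [← hP.int_iff _ (mp' ⟨d1, hw2.2⟩), e2, e1, hP.int_iff _ hwd]
      exact hwi'
  obtain ⟨O₁, hO₁, hO₁o, h1, l1⟩ := key hP hP' hO hO' sm sm' mp mp' he he'
  obtain ⟨O₂, hO₂, hO₂o, h2, l2⟩ := key hP' hP hO' hO sm' sm mp' mp he' he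
  have hv1 := (h1 v hv).2 ⟨hvO, hvO'⟩
  have m1 : ∀ w ∈ P.dom ∩ O₁, η w ∈ P'.dom ∩ O₂ := fun w hw => by
    have a := mp ⟨hw.1, hO₁ hw.2⟩
    refine ⟨a, (h2 _ a).2 ⟨((h1 w hw.1).1 hw.2).2, ?_⟩⟩
    rw [l1 w hw]; exact hO₁ hw.2
  have m2 : ∀ w ∈ P'.dom ∩ O₂, η' w ∈ P.dom ∩ O₁ := fun w hw => by
    have a := mp' ⟨hw.1, hO₂ hw.2⟩
    refine ⟨a, (h1 _ a).2 ⟨((h2 w hw.1).1 hw.2).2, ?_⟩⟩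
    rw [l2 w hw]; exact hO₂ hw.2
  exact ⟨η, η', O₁, O₂, hO₁o, hO₂o, hv1, (m1 v ⟨hv, hv1⟩).2, rfl,
    sm.mono (inter_subset_inter_right _ hO₁), sm'.mono (inter_subset_inter_right _ hO₂), m1, m2,
    l1, l2, fun w hw => (he w ⟨hw.1, hO₁ hw.2⟩).symm⟩

lemma subset_saturate (𝒜 : Set (Patch ι W)) : 𝒜 ⊆ saturate 𝒜 := fun P hP =>
  ⟨P, hP, id, id, univ, isOpen_univ, by simp, contDiffOn_id, contDiffOn_id, fun _ _ => rfl,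
    fun _ _ => rfl⟩

lemma exists_of_mem_saturate {𝒜 : Set (Patch ι W)} {P : Patch ι W} (hP : P ∈ saturate 𝒜) :
    ∃ P' ∈ 𝒜, ∃ h h' O', O' ⊆ P'.O ∧ LocDiffeo P.corners P'.corners P.O O' h h' ∧
      ∀ v ∈ P.dom, P.toFun v = P'.toFun (h v) := by
  obtain ⟨P', hP', h, h', O', hO', him, sm, sm', lf, he⟩ := hP
  rw [dom_inter] at him sm'
  have mp : MapsTo h P.dom _ := fun v hv => him ▸ mem_image_of_mem h hv
  have mp' : ∀ w ∈ orth _ ∩ (P'.O ∩ O'), h' w ∈ P.dom ∧ h (h' w) = w := fun w hw => by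
    rw [← him] at hw
    obtain ⟨v, hv, rfl⟩ := hw
    rw [lf v hv]
    exact ⟨hv, rfl⟩
  refine ⟨P', hP', h, h', _, inter_subset_left, ⟨P.isOpen, P'.isOpen.inter hO', ?_, sm',
    ?_, ?_, ?_, fun w hw => (mp' w hw).2⟩, he⟩
  · rwa [← dom_eq]
  · rwa [← dom_eq]
  · rw [← dom_eq]; exact fun w hw => (mp' w hw).1
  · rwa [← dom_eq]

lemma mem_saturate_of_locDiffeo {𝒜 : Set (Patch ι W)} {P P' : Patch ι W} (hP' : P' ∈ 𝒜)
    {h h' O'} (hO' : O' ⊆ P'.O) (H : LocDiffeo P.corners P'.corners P.O O' h h')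
    (he : ∀ v ∈ P.dom, P.toFun v = P'.toFun (h v)) : P ∈ saturate 𝒜 := by
  have e2 : P'.dom ∩ O' = orth P'.corners ∩ O' := by
    rw [dom_inter, inter_eq_self_of_subset_right hO']
  refine ⟨P', hP', h, h', O', H.isOpen', ?_, ?_, ?_, ?_, he⟩
  · rw [e2, dom_eq]
    refine Subset.antisymm (image_subset_iff.2 H.maps) fun w hw => ⟨h' w, H.maps' hw, H.right w hw⟩
  · rw [dom_eq]; exact H.smooth
  · rw [e2]; exact H.smooth'
  · rw [dom_eq]; exact H.left

lemma mem_saturate_of_mem_saturate {𝒜 : Set (Patch ι W)} {P P' : Patch ι W}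
    (hP' : P' ∈ saturate 𝒜) {h h' O'} (hO' : O' ⊆ P'.O)
    (H : LocDiffeo P.corners P'.corners P.O O' h h')
    (he : ∀ v ∈ P.dom, P.toFun v = P'.toFun (h v)) : P ∈ saturate 𝒜 := by
  obtain ⟨P'', hP'', g, g', O'', hO'', G, he'⟩ := exists_of_mem_saturate hP'
  obtain ⟨A, hA, B, hB, hA', hB', K⟩ := H.trans G
  have mA : ∀ v ∈ orth _, v ∈ A ↔ v ∈ P.O := fun v hv => by
    rw [hA' v hv]
    exact ⟨fun h => h.1, fun h => ⟨h, hO' (H.maps ⟨hv, h⟩).2⟩⟩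
  have eA : orth P.corners ∩ A = orth P.corners ∩ P.O := by
    ext v
    exact ⟨fun h => ⟨h.1, (mA v h.1).1 h.2⟩, fun h => ⟨h.1, (mA v h.1).2 h.2⟩⟩
  refine mem_saturate_of_locDiffeo hP'' (hB.trans hO'') (h := g ∘ h) (h' := h' ∘ g') ?_ ?_
  · obtain ⟨a1, a2, a3, a4, a5, a6, a7, a8⟩ := K
    rw [eA] at a3 a5 a6 a7
    exact ⟨P.isOpen, a2, a3, a4, a5, a6, a7, a8⟩
  · intro v hv
    have hv' := dom_eq P ▸ hv
    have := H.maps hv'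
    rw [he v hv, he' (h v) (by rw [dom_eq]; exact ⟨this.1, hO' this.2⟩)]
    rfl

lemma isGood_of_mem_saturate {Wi : Set W} {𝒜 : Set (Patch ι W)} (h𝒜 : ∀ P ∈ 𝒜, P.IsGood Wi)
    {P : Patch ι W} (hP : P ∈ saturate 𝒜) : P.IsGood Wi := by
  obtain ⟨P', hP', h, h', O', hO', H, he⟩ := exists_of_mem_saturate hP
  have hG := h𝒜 P' hP'
  have int_iff : ∀ v ∈ P.dom, h v ∈ P'.int ↔ v ∈ P.int := fun v hv => by
    rw [int_eq, int_eq]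
    have hv' := dom_eq P ▸ hv
    have := H.mem_orthInt_iff hv'
    exact ⟨fun a => ⟨this.1 a.1, hv'.2⟩, fun a => ⟨this.2 a.1, hO' (H.maps hv').2⟩⟩
  have hd : ∀ v ∈ P.dom, h v ∈ P'.dom := fun v hv => by
    rw [dom_eq] at hv ⊢
    exact ⟨(H.maps hv).1, hO' (H.maps hv).2⟩
  refine ⟨fun v hv w hw hvw => ?_, fun v hv => ?_⟩
  · have dv := int_subset_dom _ hv
    have dw := int_subset_dom _ hw
    rw [he v dv, he w dw] at hvw
    have := hG.injOn ((int_iff v dv).2 hv) ((int_iff w dw).2 hw) hvw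
    rw [← H.left v (dom_eq P ▸ dv), ← H.left w (dom_eq P ▸ dw), this]
  · rw [he v hv, hG.int_iff _ (hd v hv), int_iff v hv]

lemma exists_samePoint_of_mem_saturate {𝒜 : Set (Patch ι W)} {P : Patch ι W}
    (hP : P ∈ saturate 𝒜) {v : ℝ^ι} (hv : v ∈ P.dom) :
    ∃ P' ∈ 𝒜, ∃ v', SamePoint (P, v) (P', v') := by
  obtain ⟨P', hP', h, h', O', hO', H, he⟩ := exists_of_mem_saturate hP
  have hv' := dom_eq P ▸ hv
  exact ⟨P', hP', h v, samePoint_of_locDiffeo H le_rfl hO' hv.1 (H.maps hv').2 rfl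
    fun w hw => he w (by rwa [dom_eq])⟩

end Patch

namespace Patch

variable {ι : Type} [Fintype ι] [DecidableEq ι] {W : Type*}

/-! ### Blow-ups of patches -/

section Blow

variable {P : Patch ι W} {R S : Finset ι} {i p : ι} {a : ℕ} {ε : ℝ}

lemma contDiff_blowX (a : ℕ) (R S : Finset ι) (i : ι) : ContDiff ℝ ∞ (blowX a R S i) := by
  rw [contDiff_pi]
  intro j
  unfold blowX
  split_ifs <;> fun_prop

lemma contDiff_blowY (a : ℕ) (R S : Finset ι) (p : ι) (ε : ℝ) :
    ContDiff ℝ ∞ (blowY a R S p ε) := by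
  rw [contDiff_pi]
  intro j
  unfold blowY
  split_ifs <;> fun_prop

@[simp] theorem blowX_self (v : ℝ^ι) : blowX a R S i v i = v i := by simp [blowX]

lemma blowX_of_mem_S (v : ℝ^ι) {j : ι} (hj : j ∈ S) (hji : j ≠ i) :
    blowX a R S i v j = v i ^ a * v j := by simp [blowX, hj, hji]

lemma blowX_of_mem_R (v : ℝ^ι) {j : ι} (hj : j ∈ R) (hjS : j ∉ S) (hji : j ≠ i) :
    blowX a R S i v j = v i * v j := by simp [blowX, hj, hji, hjS]

lemma blowX_of_notMem (v : ℝ^ι) {j : ι} (hj : j ∉ R) (hjS : j ∉ S) (hji : j ≠ i) :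
    blowX a R S i v j = v j := by simp [blowX, hj, hji, hjS]

lemma blowX_mem_orth {C : Finset ι} (hi : i ∈ C) (hS : Disjoint S C) {v : ℝ^ι}
    (hv : v ∈ orth C) : blowX a R S i v ∈ orth C := fun j hj => by
  simp only [blowX, if_neg fun h => Finset.disjoint_left.1 hS h hj]
  split_ifs
  exacts [hv i hi, mul_nonneg (hv i hi) (hv j hj), hv j hj]

lemma blowX_mem_orthInt_iff {C : Finset ι} (hi : i ∈ C) (hS : Disjoint S C) {v : ℝ^ι}
    (hv : v ∈ orth C) : blowX a R S i v ∈ orthInt C ↔ v ∈ orthInt C := by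
  have h : ∀ j ∈ C, j ∉ S := fun j hj h => Finset.disjoint_left.1 hS h hj
  refine ⟨fun H j hj => lt_of_le_of_ne (hv j hj) fun h0 => (H j hj).ne' ?_, fun H j hj => ?_⟩ <;>
    simp only [blowX, if_neg (h j hj)] <;> split_ifs with h1
  exacts [h1 ▸ h0.symm, by rw [← h0, mul_zero], h0.symm, H i hi, mul_pos (H i hi) (H j hj), H j hj]

lemma blowX_injective {v w : ℝ^ι} (hv : 0 < v i) (h : blowX a R S i v = blowX a R S i w) :
    v = w := by
  have hi : v i = w i := by simpa using congrFun h i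
  ext j
  have hj := congrFun h j
  simp only [blowX, ← hi] at hj
  split_ifs at hj with h1
  exacts [h1 ▸ hi, mul_left_cancel₀ (pow_pos hv a).ne' hj, mul_left_cancel₀ hv.ne' hj, hj]

lemma mem_dom_pullX (hi : i ∈ P.corners) (hS : Disjoint S P.corners) {v : ℝ^ι}
    (hv : v ∈ (P.pullX a R S i).dom) : blowX a R S i v ∈ P.dom :=
  ⟨hv.1, blowX_mem_orth hi hS hv.2⟩

lemma mem_int_pullX_iff (hi : i ∈ P.corners) (hS : Disjoint S P.corners) {v : ℝ^ι}
    (hv : v ∈ (P.pullX a R S i).dom) :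
    blowX a R S i v ∈ P.int ↔ v ∈ (P.pullX a R S i).int := by
  have := blowX_mem_orthInt_iff (a := a) (R := R) hi hS hv.2
  exact ⟨fun h => ⟨h.1, this.1 h.2⟩, fun h => ⟨h.1, this.2 h.2⟩⟩

lemma isGood_pullX {Wi : Set W} (hP : P.IsGood Wi) (hi : i ∈ P.corners)
    (hS : Disjoint S P.corners) : (P.pullX a R S i).IsGood Wi := by
  refine ⟨fun v hv w hw hvw => ?_, fun v hv => ?_⟩
  · have := hP.injOn ((mem_int_pullX_iff hi hS (int_subset_dom _ hv)).2 hv)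
      ((mem_int_pullX_iff hi hS (int_subset_dom _ hw)).2 hw) hvw
    exact blowX_injective (hv.2 i hi) this
  · rw [← mem_int_pullX_iff hi hS hv]
    exact hP.int_iff _ (mem_dom_pullX hi hS hv)

@[simp] theorem blowY_self (v : ℝ^ι) : blowY a R S p ε v p = ε * v p ^ a := by simp [blowY]

lemma blowY_of_mem_S (v : ℝ^ι) {j : ι} (hj : j ∈ S) (hji : j ≠ p) :
    blowY a R S p ε v j = v p ^ a * v j := by simp [blowY, hj, hji]

lemma blowY_of_mem_R (v : ℝ^ι) {j : ι} (hj : j ∈ R) (hjS : j ∉ S) (hji : j ≠ p) :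
    blowY a R S p ε v j = v p * v j := by simp [blowY, hj, hji, hjS]

lemma blowY_of_notMem (v : ℝ^ι) {j : ι} (hj : j ∉ R) (hjS : j ∉ S) (hji : j ≠ p) :
    blowY a R S p ε v j = v j := by simp [blowY, hj, hji, hjS]

lemma mem_dom_pullY (hp : p ∈ S) (hS : Disjoint S P.corners) {v : ℝ^ι}
    (hv : v ∈ (P.pullY a R S p ε).dom) : blowY a R S p ε v ∈ P.dom := by
  refine ⟨hv.1, fun j hj => ?_⟩
  have hjS : j ∉ S := fun h => Finset.disjoint_left.1 hS h hj
  have h2 := hv.2 j (Finset.mem_insert_of_mem hj)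
  have hjp : j ≠ p := fun h => hjS (h ▸ hp)
  simp only [blowY, if_neg hjS, if_neg hjp]
  split_ifs
  exacts [mul_nonneg (hv.2 p (mem_insert_self _ _)) h2, h2]

lemma mem_int_pullY_iff (ha : a ≠ 0) (hp : p ∈ S) (hR : R ⊆ P.corners)
    (hS : Disjoint S P.corners)
    (hRS : ∀ w ∈ P.dom, (∀ j ∈ R, w j = 0) → (∀ j ∈ S, w j = 0) → ∃ j ∈ P.corners, w j = 0)
    {v : ℝ^ι} (hv : v ∈ (P.pullY a R S p ε).dom) :
    blowY a R S p ε v ∈ P.int ↔ v ∈ (P.pullY a R S p ε).int := by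
  have h : ∀ j ∈ P.corners, j ∉ S := fun j hj h => Finset.disjoint_left.1 hS h hj
  have hd := mem_dom_pullY hp hS hv
  rw [mem_int_iff hd, mem_int_iff hv]
  refine ⟨fun H j hj hj0 => ?_, fun H j hj => ?_⟩
  · rcases Finset.mem_insert.1 hj with rfl | hj
    · obtain ⟨l, hl, hl0⟩ := hRS _ hd (fun l hl => by simp [blowY, h l (hR hl), hl, hj0]; grind)
        fun l hl => by simp [blowY, hl, hj0, ha]
      exact H l hl hl0
    · refine H j hj ?_
      simp [blowY, h j hj, hj0]
      grind
  · have h1 := H p (mem_insert_self _ _)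
    have h2 := H j (Finset.mem_insert_of_mem hj)
    have hjp : j ≠ p := fun e => h j hj (e ▸ hp)
    simp only [blowY, if_neg (h j hj), if_neg hjp]
    split_ifs
    exacts [mul_ne_zero h1 h2, h2]

lemma blowY_injective (ha : a ≠ 0) (hε : ε ≠ 0) {v w : ℝ^ι} (hv : 0 < v p) (hw : 0 < w p)
    (h : blowY a R S p ε v = blowY a R S p ε w) : v = w := by
  have hi : v p = w p := by
    have := congrFun h p
    simp only [blowY_self] at this
    exact (pow_left_inj₀ hv.le hw.le ha).1 (mul_left_cancel₀ hε this)
  ext j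
  have hj := congrFun h j
  simp only [blowY, ← hi] at hj
  split_ifs at hj with h1
  exacts [h1 ▸ hi, mul_left_cancel₀ (pow_pos hv a).ne' hj, mul_left_cancel₀ hv.ne' hj, hj]

lemma isGood_pullY {Wi : Set W} (hP : P.IsGood Wi) (ha : a ≠ 0) (hε : ε ≠ 0) (hp : p ∈ S)
    (hR : R ⊆ P.corners) (hS : Disjoint S P.corners)
    (hRS : ∀ w ∈ P.dom, (∀ j ∈ R, w j = 0) → (∀ j ∈ S, w j = 0) → ∃ j ∈ P.corners, w j = 0) :
    (P.pullY a R S p ε).IsGood Wi := by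
  refine ⟨fun v hv w hw hvw => ?_, fun v hv => ?_⟩
  · have := hP.injOn ((mem_int_pullY_iff ha hp hR hS hRS (int_subset_dom _ hv)).2 hv)
      ((mem_int_pullY_iff ha hp hR hS hRS (int_subset_dom _ hw)).2 hw) hvw
    exact blowY_injective ha hε (hv.2 p (mem_insert_self _ _))
      (hw.2 p (mem_insert_self _ _)) this
  · rw [← mem_int_pullY_iff ha hp hR hS hRS hv]
    exact hP.int_iff _ (mem_dom_pullY hp hS hv)

end Blow

/-! ### Lifting diffeomorphisms to blow-ups -/

lemma exists_lift {P P' : Patch ι W} {a : ℕ} {R S R' S' : Finset ι} {i i' : ι} (hi : i ∈ R)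
    (hR : R ⊆ P.corners) (hS : Disjoint S P.corners) (hi' : i' ∈ R') (hR' : R' ⊆ P'.corners)
    (hS' : Disjoint S' P'.corners) {v : ℝ^ι}
    {O : Set ℝ^ι} {η : ℝ^ι → ℝ^ι} (hO : IsOpen O) (hvO : blowX a R S i v ∈ O)
    (sm : C∞ η (P.dom ∩ O)) (mp : MapsTo η (P.dom ∩ O) P'.dom)
    (hηR : ∀ j ∈ R', ∃ l ∈ R, (l = i ↔ j = i') ∧ ∃ r > 0, ∃ c : ℝ^ι → ℝ,
      C∞ c (orth P.corners ∩ ball (blowX a R S i v) r) ∧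
      ∀ w ∈ orth P.corners ∩ ball (blowX a R S i v) r, 0 < c w ∧ η w j = w l * c w)
    (hηS : ∀ j ∈ S', ∃ r > 0, ∃ g : ι → ℝ^ι → ℝ,
      (∀ s, C∞ (g s) (orth P.corners ∩ ball (blowX a R S i v) r)) ∧
      ∀ w ∈ orth P.corners ∩ ball (blowX a R S i v) r, η w j = ∑ s ∈ S, w s * g s w) :
    ∃ O₁ : Set ℝ^ι, IsOpen O₁ ∧ v ∈ O₁ ∧ ∃ θ : ℝ^ι → ℝ^ι,
      C∞ θ ((P.pullX a R S i).dom ∩ O₁) ∧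
      MapsTo θ ((P.pullX a R S i).dom ∩ O₁) (P'.pullX a R' S' i').dom ∧
      (∀ w ∈ (P.pullX a R S i).dom ∩ O₁, blowX a R S i w ∈ O) ∧
      (∀ w ∈ (P.pullX a R S i).dom ∩ O₁, blowX a R' S' i' (θ w) = η (blowX a R S i w)) ∧
      ∃ d : ℝ, θ v i' = v i * d := by
  have hRS' : ∀ j ∈ R', j ∉ S' := fun j hj h => Finset.disjoint_left.1 hS' h (hR' hj)
  have hRS : ∀ j ∈ R, j ∉ S := fun j hj h => Finset.disjoint_left.1 hS h (hR hj)
  choose! l hlR hli rR hrR cR hcR hcR' using hηR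
  choose! rS hrS g hg hg' using hηS
  set b := blowX a R S i with hb
  set O₁ := b ⁻¹' (O ∩ ((⋂ j ∈ R', ball (b v) (rR j)) ∩ ⋂ j ∈ S', ball (b v) (rS j)))
  have hb0 : ∀ w ∈ (P.pullX a R S i).dom, b w ∈ orth P.corners := fun w hw =>
    blowX_mem_orth (hR hi) hS hw.2
  have hbO : ∀ w ∈ (P.pullX a R S i).dom ∩ O₁, b w ∈ P.dom ∩ O := fun w hw =>
    ⟨mem_dom_pullX (hR hi) hS hw.1, hw.2.1⟩
  have hbR : ∀ j ∈ R', ∀ w ∈ (P.pullX a R S i).dom ∩ O₁,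
      b w ∈ orth P.corners ∩ ball (b v) (rR j) := fun j hj w hw =>
    ⟨hb0 w hw.1, mem_iInter₂.1 hw.2.2.1 j hj⟩
  have hbS : ∀ j ∈ S', ∀ w ∈ (P.pullX a R S i).dom ∩ O₁,
      b w ∈ orth P.corners ∩ ball (b v) (rS j) := fun j hj w hw =>
    ⟨hb0 w hw.1, mem_iInter₂.1 hw.2.2.2 j hj⟩
  have bsm : C∞ b ((P.pullX a R S i).dom ∩ O₁) := (contDiff_blowX a R S i).contDiffOn
  have cpos : ∀ j ∈ R', ∀ w ∈ (P.pullX a R S i).dom ∩ O₁, 0 < cR j (b w) := fun j hj w hw =>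
    (hcR' j hj _ (hbR j hj w hw)).1
  have csm : ∀ j ∈ R', C∞ (fun w => cR j (b w)) ((P.pullX a R S i).dom ∩ O₁) :=
    fun j hj => (hcR j hj).comp bsm (hbR j hj)
  set θ : ℝ^ι → ℝ^ι := fun w j =>
    if j = i' then w i * cR i' (b w)
    else if j ∈ S' then (∑ s ∈ S, w s * g j s (b w)) / cR i' (b w) ^ a
    else if j ∈ R' then w (l j) * cR j (b w) / cR i' (b w)
    else η (b w) j with hθ
  have hle : l i' = i := (hli i' hi').2 rfl
  have key : ∀ w ∈ (P.pullX a R S i).dom ∩ O₁, blowX a R' S' i' (θ w) = η (b w) := by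
    intro w hw
    have hθi : θ w i' = w i * cR i' (b w) := by simp [hθ]
    have c0 := (cpos i' hi' w hw).ne'
    ext j
    by_cases hj : j = i'
    · subst hj
      rw [blowX_self, hθi, (hcR' j hi' _ (hbR j hi' w hw)).2, hle]
      simp [hb]
    simp only [blowX, hθi, hθ, if_neg hj]
    split_ifs with hjS hjR
    · have : ∑ s ∈ S, b w s * g j s (b w) = w i ^ a * ∑ s ∈ S, w s * g j s (b w) := by
        rw [mul_sum]
        refine sum_congr rfl fun s hs => ?_
        rw [hb, blowX_of_mem_S w hs (fun h => hRS i hi (by rwa [← h]))]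
        ring
      rw [hg' j hjS _ (hbS j hjS w hw), this, mul_pow]
      field_simp
    · rw [(hcR' j hjR _ (hbR j hjR w hw)).2, hb, blowX_of_mem_R w (hlR j hjR) (hRS _ (hlR j hjR))
        fun h => hj ((hli j hjR).1 h)]
      generalize cR i' (b w) = c at c0 ⊢
      field_simp
    · rfl
  refine ⟨O₁, (hO.inter ((isOpen_biInter_finset fun _ _ => isOpen_ball).inter
    (isOpen_biInter_finset fun _ _ => isOpen_ball))).preimage (continuous_blowX a R S i),
    ⟨hvO, mem_iInter₂.2 fun j hj => mem_ball_self (hrR j hj),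
      mem_iInter₂.2 fun j hj => mem_ball_self (hrS j hj)⟩, θ,
    ?_, fun w hw => ⟨?_, fun j hj => ?_⟩, fun w hw => (hbO w hw).2, key, cR i' (b v), by simp [hθ]⟩
  · rw [contDiffOn_pi]
    have hcoord : ∀ j : ι, C∞ (fun w : ℝ^ι => w j) ((P.pullX a R S i).dom ∩ O₁) :=
      fun j => (contDiff_apply ℝ ℝ j).contDiffOn
    intro j
    simp only [hθ]
    split_ifs with h1 h2 h3
    · exact (hcoord i).mul (csm i' hi')
    · refine ContDiffOn.div (ContDiffOn.sum fun s _ => (hcoord s).mul ((hg j h2 s).comp bsm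
        (hbS j h2))) ((csm i' hi').pow a) fun w hw => pow_ne_zero _ (cpos i' hi' w hw).ne'
    · exact ((hcoord _).mul (csm j h3)).div (csm i' hi') fun w hw => (cpos i' hi' w hw).ne'
    · exact (contDiffOn_pi.1 sm j).comp bsm hbO
  · change blowX a R' S' i' (θ w) ∈ P'.O
    rw [key w hw]
    exact (mp (hbO w hw)).1
  · change j ∈ P'.corners at hj
    have hjS : j ∉ S' := fun h => Finset.disjoint_left.1 hS' h hj
    simp only [hθ, if_neg hjS]
    split_ifs with h1 h3
    · exact mul_nonneg (hw.1.2 i (hR hi)) (cpos i' hi' w hw).le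
    · exact div_nonneg (mul_nonneg (hw.1.2 _ (hR (hlR j h3))) (cpos j h3 w hw).le)
        (cpos i' hi' w hw).le
    · exact (mp (hbO w hw)).2 j hj

lemma exists_samePoint_pullY {Wi : Set W} {P : Patch ι W} {a : ℕ} (ha : a ≠ 0)
    {R S : Finset ι} {i p : ι} (hi : i ∈ R) (hp : p ∈ S) (hR : R ⊆ P.corners)
    (hS : Disjoint S P.corners) {ε : ℝ} (hε : ε = 1 ∨ ε = -1)
    (hX : (P.pullX a R S i).IsGood Wi) (hY : (P.pullY a R S p ε).IsGood Wi) {v : ℝ^ι}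
    (hv : v ∈ (P.pullY a R S p ε).dom) (hvi : 0 < v i) :
    ∃ w, SamePoint (P.pullY a R S p ε, v) (P.pullX a R S i, w) ∧ w i = v p * v i := by
  have hiS : i ∉ S := fun h => Finset.disjoint_left.1 hS h (hR hi)
  have hip : i ≠ p := fun h => hiS (h ▸ hp)
  have hε2 : ε * ε = 1 := by rcases hε with rfl | rfl <;> norm_num
  have ha' : (a : ℝ) ≠ 0 := Nat.cast_ne_zero.2 ha
  set η : ℝ^ι → ℝ^ι := fun w j =>
    if j = i then w p * w i else if j = p then ε / w i ^ a else if j ∈ S then w j / w i ^ a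
    else if j ∈ R then w j / w i else w j with hη
  set q : ℝ^ι → ℝ := fun w => (ε * w p) ^ (-(1 / a : ℝ)) with hq
  set η' : ℝ^ι → ℝ^ι := fun w j =>
    if j = i then q w else if j = p then w i / q w else if j ∈ S then w j * q w ^ a
    else if j ∈ R then w j * q w else w j with hη'
  have qpos : ∀ w : ℝ^ι, 0 < ε * w p → 0 < q w := fun w hw => Real.rpow_pos_of_pos hw _
  have qa : ∀ w : ℝ^ι, 0 < ε * w p → q w ^ a = (ε * w p)⁻¹ := fun w hw => by
    rw [hq]
    simp only
    rw [← Real.rpow_natCast, ← Real.rpow_mul hw.le]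
    have : -(1 / a : ℝ) * a = -1 := by field_simp
    rw [this, Real.rpow_neg_one]
  set O : Set ℝ^ι := {w | 0 < w i} with hO
  set O' : Set ℝ^ι := {w | 0 < ε * w p} with hO'
  have key : ∀ w ∈ O, blowX a R S i (η w) = blowY a R S p ε w := by
    intro w hw
    have hw : 0 < w i := hw
    ext j
    simp only [blowX, blowY, hη]
    split_ifs <;> first | grind | (rw [mul_pow]; field_simp)
  have key' : ∀ w ∈ O', blowY a R S p ε (η' w) = blowX a R S i w := by
    intro w hw
    have q0 := qpos w hw
    have q1 := qa w hw
    have hw : ε * w p ≠ 0 := ne_of_gt hw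
    ext j
    simp only [blowX, blowY, hη']
    split_ifs <;> first | grind | (subst_vars; rw [div_pow, q1]; field_simp; grind) | (rw [div_pow, q1]; grind)
  have hcoord : ∀ (j : ι) (s : Set ℝ^ι), C∞ (fun w : ℝ^ι => w j) s :=
    fun j s => (contDiff_apply ℝ ℝ j).contDiffOn
  have qsm : ∀ s ⊆ O', C∞ q s := fun s hs =>
    (contDiffOn_const.mul (hcoord p s)).rpow_const_of_ne fun w hw => (hs hw).ne'
  have hvp : 0 ≤ v p := hv.2 p (mem_insert_self _ _)
  refine ⟨η v, samePoint_of_maps (Wi := Wi) (O := O) (O' := O') (η := η) (η' := η') hY hX hv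
    (isOpen_lt continuous_const (continuous_apply i))
    (isOpen_lt continuous_const (continuous_const.mul (continuous_apply p))) hvi ?_ ?_ ?_ ?_ ?_ ?_
    ?_, by simp [hη]⟩
  · change 0 < ε * η v p
    simp only [hη, if_neg (Ne.symm hip), if_true]
    rw [mul_div_assoc', hε2]
    positivity
  · rw [contDiffOn_pi]
    intro j
    simp only [hη]
    have hne : ∀ w ∈ (P.pullY a R S p ε).dom ∩ O, w i ≠ 0 := fun w hw => (hw.2 : 0 < w i).ne'
    split_ifs
    · exact (hcoord _ _).mul (hcoord _ _)
    · exact contDiffOn_const.div ((hcoord _ _).pow a) fun w hw => pow_ne_zero _ (hne w hw)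
    · exact (hcoord _ _).div ((hcoord _ _).pow a) fun w hw => pow_ne_zero _ (hne w hw)
    · exact (hcoord _ _).div (hcoord _ _) hne
    · exact hcoord _ _
  · rw [contDiffOn_pi]
    intro j
    simp only [hη']
    have qs := qsm ((P.pullX a R S i).dom ∩ O') inter_subset_right
    split_ifs
    · exact qs
    · exact (hcoord _ _).div qs fun w hw => (qpos w hw.2).ne'
    · exact (hcoord _ _).mul (qs.pow a)
    · exact (hcoord _ _).mul qs
    · exact hcoord _ _
  · intro w hw
    have hwi : 0 < w i := hw.2
    refine ⟨?_, fun j hj => ?_⟩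
    · change blowX a R S i (η w) ∈ P.O
      rw [key w hw.2]; exact hw.1.1
    · change j ∈ P.corners at hj
      have hjS : j ∉ S := fun h => Finset.disjoint_left.1 hS h hj
      have hjp : j ≠ p := fun h => hjS (h ▸ hp)
      have h1 := hw.1.2 p (mem_insert_self _ _)
      have h2 := hw.1.2 j (Finset.mem_insert_of_mem hj)
      simp only [hη, if_neg hjp, if_neg hjS]
      split_ifs
      · exact mul_nonneg h1 hwi.le
      · exact div_nonneg h2 hwi.le
      · exact h2
  · intro w hw
    have q0 := qpos w hw.2
    refine ⟨?_, fun j hj => ?_⟩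
    · change blowY a R S p ε (η' w) ∈ P.O
      rw [key' w hw.2]; exact hw.1.1
    · have hwi : 0 ≤ w i := hw.1.2 i (hR hi)
      rcases Finset.mem_insert.1 hj with rfl | hj
      · simp only [hη', if_neg (Ne.symm hip), if_true]
        exact div_nonneg hwi q0.le
      · have hjS : j ∉ S := fun h => Finset.disjoint_left.1 hS h hj
        have hjp : j ≠ p := fun h => hjS (h ▸ hp)
        have h2 : 0 ≤ w j := hw.1.2 j hj
        simp only [hη', if_neg hjp, if_neg hjS]
        split_ifs
        · exact q0.le
        · exact mul_nonneg h2 q0.le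
        · exact h2
  · intro w hw
    change P.toFun (blowX a R S i (η w)) = P.toFun (blowY a R S p ε w)
    rw [key w hw.2]
  · intro w hw
    change P.toFun (blowY a R S p ε (η' w)) = P.toFun (blowX a R S i w)
    rw [key' w hw.2]

end Patch

/-! ### Half-space charts -/

section ChartDef

variable {E H X : Type*} [NormedAddCommGroup E] [NormedSpace ℝ E] [TopologicalSpace H]
  [TopologicalSpace X] [ChartedSpace H X]

/-- A half-space chart of the subset `S` of `X` at `b`: a diffeomorphism `c`, with inverse `inv`,
from `U ∩ S` to the part of a ball where the first coordinate is nonnegative. -/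
structure HalfChart (I : ModelWithCorners ℝ E H) (S : Set X) (N : ℕ) [NeZero N] (b : X) where
  c : X → (Fin N → ℝ)
  inv : (Fin N → ℝ) → X
  U : Set X
  r : ℝ
  isOpen : IsOpen U
  mem : b ∈ U
  r_pos : 0 < r
  smooth : ContMDiffOn I 𝓘(ℝ, Fin N → ℝ) ∞ c U
  smooth_inv : ContMDiffOn 𝓘(ℝ, Fin N → ℝ) I ∞ inv (orth {0} ∩ ball (c b) r)
  maps : ∀ q ∈ U, q ∈ S → c q ∈ orth {0} ∩ ball (c b) r
  inv_mem : ∀ w ∈ orth {0} ∩ ball (c b) r, inv w ∈ U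
  inv_mem' : ∀ w ∈ orth {0} ∩ ball (c b) r, inv w ∈ S
  right : ∀ w ∈ orth {0} ∩ ball (c b) r, c (inv w) = w
  left : ∀ q ∈ U, q ∈ S → inv (c q) = q

namespace HalfChart

variable {I : ModelWithCorners ℝ E H} {S : Set X} {N : ℕ} [NeZero N] {b : X}

/-- The coordinate domain. -/
def D (C : HalfChart I S N b) : Set (Fin N → ℝ) := orth {0} ∩ ball (C.c b) C.r

lemma uniqueDiffOn_D (C : HalfChart I S N b) : UniqueDiffOn ℝ C.D :=
  uniqueDiffOn_orth_inter _ isOpen_ball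

lemma exists_of_local {c c' : X → (Fin N → ℝ)} {inv : (Fin N → ℝ) → X} {U₀ N₀ : Set X}
    {B : Set (Fin N → ℝ)} (hU₀ : IsOpen U₀) (hb : b ∈ U₀) (hbS : b ∈ S) (hB : IsOpen B)
    (hbB : c b ∈ B) (sm : ContMDiffOn I 𝓘(ℝ, Fin N → ℝ) ∞ c U₀)
    (sm' : ContMDiffOn 𝓘(ℝ, Fin N → ℝ) I ∞ inv (orth {0} ∩ B))
    (hinv : ∀ w ∈ orth {0} ∩ B, inv w ∈ U₀ ∧ inv w ∈ S ∧ c (inv w) = w)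
    (hleft : ∀ q ∈ U₀, q ∈ S → c q ∈ orth {0} ∧ (c q ∈ B → inv (c q) = q))
    (hN₀ : N₀ ∈ 𝓝 b) (hcc' : ∀ q ∈ N₀, c' q = c q) :
    ∃ C : HalfChart I S N b, C.c = c' ∧ C.U ⊆ N₀ ∧ C.U ⊆ U₀ ∧ C.inv = inv := by
  obtain ⟨N₁, hN₁, hN₁o, hbN₁⟩ := mem_nhds_iff.1 hN₀
  have hcb : c b ∈ orth {0} ∩ B := ⟨(hleft b hb hbS).1, hbB⟩
  have hib : inv (c b) = b := (hleft b hb hbS).2 hbB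
  have hev : ∀ᶠ w in 𝓝[orth {0} ∩ B] (c b), inv w ∈ N₁ := by
    have := sm'.continuousOn (c b) hcb
    exact this.eventually (hN₁o.mem_nhds (by rwa [hib]))
  obtain ⟨r₁, hr₁, hr₁s⟩ := Metric.mem_nhdsWithin_iff.1 hev
  obtain ⟨r₂, hr₂, hr₂s⟩ := Metric.isOpen_iff.1 hB _ hbB
  set r := min r₁ r₂
  have hsB : ball (c b) r ⊆ B := (ball_subset_ball (min_le_right _ _)).trans hr₂s
  have hsN : ∀ w ∈ orth {0} ∩ ball (c b) r, inv w ∈ N₁ := fun w hw =>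
    hr₁s ⟨ball_subset_ball (min_le_left _ _) hw.2, hw.1, hsB hw.2⟩
  obtain ⟨U, hU, hUe⟩ := continuousOn_iff'.1 sm.continuousOn (ball (c b) r)
    isOpen_ball
  have hmU : ∀ q ∈ U₀, q ∈ U ↔ c q ∈ ball (c b) r := fun q hq => by
    have := Set.ext_iff.1 hUe q
    simp only [mem_inter_iff, mem_preimage, hq, and_true] at this
    exact this.symm
  have hr : 0 < r := lt_min hr₁ hr₂
  have e : c' b = c b := hcc' b (hN₁ hbN₁)
  have hcU : ∀ q ∈ U₀ ∩ U ∩ N₁, c' q = c q := fun q hq => hcc' q (hN₁ hq.2)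
  have hm : ∀ w ∈ orth {0} ∩ ball (c b) r, inv w ∈ U₀ ∩ U ∩ N₁ := fun w hw => by
    have h1 := hinv w ⟨hw.1, hsB hw.2⟩
    exact ⟨⟨h1.1, (hmU _ h1.1).2 (by rw [h1.2.2]; exact hw.2)⟩, hsN w hw⟩
  refine ⟨⟨c', inv, U₀ ∩ U ∩ N₁, r, (hU₀.inter hU).inter hN₁o,
    ⟨⟨hb, (hmU b hb).2 (mem_ball_self hr)⟩, hbN₁⟩, hr,
    (sm.mono fun q hq => hq.1.1).congr hcU, ?_, fun q hq hqS => ?_, ?_, ?_, ?_, fun q hq hqS => ?_⟩,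
    rfl, fun q hq => hN₁ hq.2, fun q hq => hq.1.1, rfl⟩
  · rw [e]; exact sm'.mono (inter_subset_inter_right _ hsB)
  · rw [hcU q hq, e]
    exact ⟨(hleft q hq.1.1 hqS).1, (hmU q hq.1.1).1 hq.1.2⟩
  · rw [e]; exact hm
  · rw [e]; exact fun w hw => (hinv w ⟨hw.1, hsB hw.2⟩).2.1
  · rw [e]; intro w hw
    rw [hcU _ (hm w hw), (hinv w ⟨hw.1, hsB hw.2⟩).2.2]
  · rw [hcU q hq]
    exact (hleft q hq.1.1 hqS).2 (hsB ((hmU q hq.1.1).1 hq.1.2))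

end HalfChart

end ChartDef

section UnivChart

variable {E H X : Type*} [NormedAddCommGroup E] [NormedSpace ℝ E] [TopologicalSpace H]
  [TopologicalSpace X] [ChartedSpace H X]
  {I : ModelWithCorners ℝ E H} {N N' : ℕ} [NeZero N] [NeZero N'] {b b' : X}

lemma HalfChart.exists_locDiffeo (C : HalfChart I (univ : Set X) N b)
    (C' : HalfChart I (univ : Set X) N' b') :
    ∃ O O', LocDiffeo {0} {0} O O' (C'.c ∘ C.inv) (C.c ∘ C'.inv) ∧
      O ⊆ ball (C.c b) C.r ∧ O' ⊆ ball (C'.c b') C'.r ∧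
      (∀ w ∈ C.D, w ∈ O ↔ C.inv w ∈ C'.U) ∧ (∀ w ∈ C'.D, w ∈ O' ↔ C'.inv w ∈ C.U) := by
  have key : ∀ {N N' : ℕ} [NeZero N] [NeZero N'] {b b' : X} (C : HalfChart I (univ : Set X) N b)
      (C' : HalfChart I (univ : Set X) N' b'), ∃ O, IsOpen O ∧ O ⊆ ball (C.c b) C.r ∧
      (∀ w ∈ C.D, w ∈ O ↔ C.inv w ∈ C'.U) ∧ C∞ (C'.c ∘ C.inv) (orth {0} ∩ O) := by
    clear * -
    intro N N' _ _ b b' C C'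
    obtain ⟨U, hU, hUe⟩ := continuousOn_iff'.1 C.smooth_inv.continuousOn C'.U C'.isOpen
    have hw : ∀ w ∈ C.D, w ∈ U ∩ ball (C.c b) C.r ↔ C.inv w ∈ C'.U := fun w hw => by
      have := Set.ext_iff.1 hUe w
      simp only [mem_inter_iff, mem_preimage, hw.1, hw.2, and_true] at this
      rw [this, mem_inter_iff, and_iff_left hw.2]
    refine ⟨U ∩ ball (C.c b) C.r, hU.inter isOpen_ball, inter_subset_right, hw, ?_⟩
    rw [← contMDiffOn_iff_contDiffOn]
    refine C'.smooth.comp (C.smooth_inv.mono fun w hw => ⟨hw.1, hw.2.2⟩) fun w hw' => ?_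
    exact (hw w ⟨hw'.1, hw'.2.2⟩).1 hw'.2
  obtain ⟨O, hO, hOb, hOm, hOs⟩ := key C C'
  obtain ⟨O', hO', hOb', hOm', hOs'⟩ := key C' C
  have hD : ∀ w ∈ orth {0} ∩ O, w ∈ C.D := fun w hw => ⟨hw.1, hOb hw.2⟩
  have hD' : ∀ w ∈ orth {0} ∩ O', w ∈ C'.D := fun w hw => ⟨hw.1, hOb' hw.2⟩
  have m : ∀ w ∈ orth {0} ∩ O, C'.inv (C'.c (C.inv w)) = C.inv w := fun w hw =>
    C'.left _ ((hOm w (hD w hw)).1 hw.2) (mem_univ _)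
  have m' : ∀ w ∈ orth {0} ∩ O', C.inv (C.c (C'.inv w)) = C'.inv w := fun w hw =>
    C.left _ ((hOm' w (hD' w hw)).1 hw.2) (mem_univ _)
  refine ⟨O, O', ⟨hO, hO', hOs, hOs', fun w hw => ?_, fun w hw => ?_, fun w hw => ?_,
    fun w hw => ?_⟩, hOb, hOb', hOm, hOm'⟩
  · have h1 := C'.maps _ ((hOm w (hD w hw)).1 hw.2) (mem_univ _)
    refine ⟨h1.1, (hOm' _ h1).2 ?_⟩
    rw [m w hw]
    exact C.inv_mem w (hD w hw)
  · have h1 := C.maps _ ((hOm' w (hD' w hw)).1 hw.2) (mem_univ _)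
    refine ⟨h1.1, (hOm _ h1).2 ?_⟩
    rw [m' w hw]
    exact C'.inv_mem w (hD' w hw)
  · rw [Function.comp_apply, Function.comp_apply, m w hw, C.right w (hD w hw)]
  · rw [Function.comp_apply, Function.comp_apply, m' w hw, C'.right w (hD' w hw)]

lemma HalfChart.c_mem (C : HalfChart I (univ : Set X) N b) {q : X} (hq : q ∈ C.U) : C.c q ∈ C.D :=
  C.maps q hq (mem_univ _)

lemma HalfChart.inv_c (C : HalfChart I (univ : Set X) N b) {q : X} (hq : q ∈ C.U) :
    C.inv (C.c q) = q := C.left q hq (mem_univ _)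

lemma HalfChart.c_zero_iff (C : HalfChart I (univ : Set X) N b)
    (C' : HalfChart I (univ : Set X) N' b') {q : X} (hq : q ∈ C.U) (hq' : q ∈ C'.U) :
    C.c q 0 = 0 ↔ C'.c q 0 = 0 := by
  obtain ⟨O, O', H, hOb, hOb', hO, hO'⟩ := C.exists_locDiffeo C'
  have hi : C.inv (C.c q) = q := C.inv_c hq
  have h1 : C.c q ∈ orth {0} ∩ O :=
    ⟨(C.c_mem hq).1, (hO _ (C.c_mem hq)).2 (by rwa [hi])⟩
  have := H.mem_orthInt_iff h1
  simp only [Function.comp, hi] at this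
  have a1 := (C.c_mem hq).1 0 (by simp)
  have a2 := (C'.c_mem hq').1 0 (by simp)
  simp only [orthInt, Finset.mem_singleton, forall_eq] at this
  have this' : 0 < C'.c q 0 ↔ 0 < C.c q 0 := this
  rw [lt_iff_le_and_ne, lt_iff_le_and_ne, and_iff_right a1, and_iff_right a2] at this'
  have h2 := not_congr this'
  rw [not_ne_iff, not_ne_iff] at h2
  exact ⟨fun h => (h2.2 h.symm).symm, fun h => (h2.1 h.symm).symm⟩

end UnivChart

section Extend

variable {E H X : Type*} [NormedAddCommGroup E] [NormedSpace ℝ E] [FiniteDimensional ℝ E]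
  [TopologicalSpace H] [TopologicalSpace X] [ChartedSpace H X]
  {I : ModelWithCorners ℝ E H} [IsManifold I ∞ X] [T2Space X] {b : X}

lemma exists_bump (I : ModelWithCorners ℝ E H) [IsManifold I ∞ X] {U : Set X} (hU : U ∈ 𝓝 b) :
    ∃ χ : X → ℝ, ContMDiff I 𝓘(ℝ, ℝ) ∞ χ ∧ tsupport χ ⊆ U ∧ ∃ N : Set X, IsOpen N ∧ b ∈ N ∧
      N ⊆ U ∧ ∀ q ∈ N, χ q = 1 := by
  obtain ⟨f, hf, -⟩ := (SmoothBumpFunction.nhds_basis_support (I := I) hU).mem_iff.1 hU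
  have h1 : {q | f q = 1} ∈ 𝓝 b := f.eventuallyEq_one
  obtain ⟨N, hN, hNo, hbN⟩ := mem_nhds_iff.1 (inter_mem h1 hU)
  exact ⟨f, f.contMDiff, hf, N, hNo, hbN, fun q hq => (hN hq).2, fun q hq => (hN hq).1⟩

lemma exists_global_extension {G : Type*} [NormedAddCommGroup G] [NormedSpace ℝ G] {U : Set X}
    (hU : IsOpen U) (hb : b ∈ U) {f : X → G} (hf : ContMDiffOn I 𝓘(ℝ, G) ∞ f U) :
    ∃ g : X → G, ContMDiff I 𝓘(ℝ, G) ∞ g ∧ ∃ N ∈ 𝓝 b, ∀ q ∈ N, g q = f q := by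
  obtain ⟨χ, hχ, hs, N, hN, hbN, -, h1⟩ := exists_bump I (hU.mem_nhds hb)
  refine ⟨fun q => χ q • f q, contMDiff_of_tsupport fun q hq => ?_, N, hN.mem_nhds hbN,
    fun q hq => by simp [h1 q hq]⟩
  have hqU : q ∈ U := hs (tsupport_smul_subset_left _ _ hq)
  exact hχ.contMDiffAt.smul (hf.contMDiffAt (hU.mem_nhds hqU))

end Extend

/-! ### Charts adapted to fibrations -/

section Fibration

variable {EX HX EY HY : Type*} {X : Type u} {Y : Type*}
    [NormedAddCommGroup EX] [NormedSpace ℝ EX] [FiniteDimensional ℝ EX] [TopologicalSpace HX]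
    [NormedAddCommGroup EY] [NormedSpace ℝ EY] [TopologicalSpace HY]
    [TopologicalSpace X] [ChartedSpace HX X] [TopologicalSpace Y] [ChartedSpace HY Y]
    {I : ModelWithCorners ℝ EX HX} {J : ModelWithCorners ℝ EY HY} [IsManifold I ∞ X] [T2Space X]

lemma HalfChart.finrank_eq {N : ℕ} [NeZero N] {b : X} (C : HalfChart I (univ : Set X) N b) :
    Module.finrank ℝ EX = N := by
  have h1 : MDifferentiableAt I 𝓘(ℝ, Fin N → ℝ) C.c b :=
    ((C.smooth b C.mem).contMDiffAt (C.isOpen.mem_nhds C.mem)).mdifferentiableAt (by simp)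
  have hcb := C.c_mem C.mem
  have h2 : MDifferentiableWithinAt 𝓘(ℝ, Fin N → ℝ) I C.inv C.D (C.c b) :=
    (C.smooth_inv _ hcb).mdifferentiableWithinAt (by simp)
  have hib := C.inv_c C.mem
  have hu : UniqueMDiffWithinAt 𝓘(ℝ, Fin N → ℝ) C.D (C.c b) :=
    (C.uniqueDiffOn_D _ hcb).uniqueMDiffWithinAt
  have f1 := h1.hasMFDerivAt
  have f2 := h2.hasMFDerivWithinAt
  set L := mfderiv I 𝓘(ℝ, Fin N → ℝ) C.c b
  set L' := mfderivWithin 𝓘(ℝ, Fin N → ℝ) I C.inv C.D (C.c b)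
  have f1' : HasMFDerivAt I 𝓘(ℝ, Fin N → ℝ) C.c (C.inv (C.c b)) L := by rw [hib]; exact f1
  have g1 := f1'.comp_hasMFDerivWithinAt (C.c b) f2
  have g1' : HasMFDerivWithinAt 𝓘(ℝ, Fin N → ℝ) 𝓘(ℝ, Fin N → ℝ) (C.c ∘ C.inv) C.D (C.c b)
      (ContinuousLinearMap.id ℝ _) :=
    (hasMFDerivWithinAt_id _ _).congr_of_eventuallyEq
      (eventually_mem_nhdsWithin.mono fun w hw => C.right w hw) (C.right _ hcb)
  have e1 : ∀ y, L (L' y) = y := fun y => by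
    have := hu.eq g1 g1'
    exact congrArg (fun A => A y) this
  have g2 := HasMFDerivWithinAt.comp b f2 (f1.hasMFDerivWithinAt (s := C.U)) (fun q hq => C.c_mem hq)
  have g2' : HasMFDerivAt I I (C.inv ∘ C.c) b (L'.comp L) :=
    g2.hasMFDerivAt (C.isOpen.mem_nhds C.mem)
  have g3 : HasMFDerivAt I I (C.inv ∘ C.c) b (ContinuousLinearMap.id ℝ _) :=
    (hasMFDerivAt_id b).congr_of_eventuallyEq
      (Filter.eventually_of_mem (C.isOpen.mem_nhds C.mem) fun q hq => C.inv_c hq)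
  have e2 : ∀ y, L' (L y) = y := fun y => by
    have := hasMFDerivAt_unique g2' g3
    exact congrArg (fun A => A y) this
  let e : EX ≃ₗ[ℝ] (Fin N → ℝ) :=
    { toFun := L, map_add' := L.map_add, map_smul' := L.map_smul, invFun := L',
      left_inv := e2, right_inv := e1 }
  rw [e.finrank_eq, Module.finrank_fin_fun]

end Fibration

section FibrationStep

variable {EX HX EY HY : Type*} {X : Type u} {Y : Type*}
    [NormedAddCommGroup EX] [NormedSpace ℝ EX] [FiniteDimensional ℝ EX] [TopologicalSpace HX]
    [NormedAddCommGroup EY] [NormedSpace ℝ EY] [TopologicalSpace HY]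
    [TopologicalSpace X] [ChartedSpace HX X] [TopologicalSpace Y] [ChartedSpace HY Y]
    {I : ModelWithCorners ℝ EX HX} {J : ModelWithCorners ℝ EY HY} [IsManifold I ∞ X] [T2Space X]

lemma contMDiffOn_append {N d : ℕ} {U : Set X} {f : X → Fin N → ℝ} {g : X → Fin d → ℝ}
    (hf : ContMDiffOn I 𝓘(ℝ, Fin N → ℝ) ∞ f U) (hg : ContMDiffOn I 𝓘(ℝ, Fin d → ℝ) ∞ g U) :
    ContMDiffOn I 𝓘(ℝ, Fin (N + d) → ℝ) ∞ (fun q => Fin.append (f q) (g q)) U := by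
  rw [contMDiffOn_pi_space] at hf hg ⊢
  intro j
  refine Fin.addCases (fun i => ?_) (fun i => ?_) j
  · simpa only [Fin.append_left] using hf i
  · simpa only [Fin.append_right] using hg i

lemma IsFibration.exists_chart {f : X → Y} {S : Set Y} (hf : IsFibration I J f S) (b : X)
    {N N' : ℕ} [NeZero N] [NeZero N'] (hN' : Module.finrank ℝ EX = N') (C : HalfChart J S N (f b))
    (hC : ContMDiff J 𝓘(ℝ, Fin N → ℝ) ∞ C.c) :
    N ≤ N' ∧ ∃ C' : HalfChart I (univ : Set X) N' b, ContMDiff I 𝓘(ℝ, Fin N' → ℝ) ∞ C'.c ∧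
      C'.U ⊆ f ⁻¹' C.U ∧ ∀ q j (h : j < N) (h' : j < N'), C'.c q ⟨j, h'⟩ = C.c (f q) ⟨j, h⟩ := by
  obtain ⟨hsm, hr, htriv⟩ := hf
  have hfS : ∀ q, f q ∈ S := fun q => hr ▸ mem_range_self q
  obtain ⟨V, hV, hbV, d, F, _, _, _, ψ, χ, hψ, hχ, h1, h2⟩ := htriv (f b) (hfS b)
  set φ := extChartAt (𝓡 d) (ψ b) with hφ
  set A := EuclideanSpace.equiv (Fin d) ℝ with hA
  have hfV : IsOpen (f ⁻¹' V) := hV.preimage hsm.continuous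
  have hsrc : IsOpen φ.source := isOpen_extChartAt_source _
  have hφs : ContMDiffOn (𝓡 d) 𝓘(ℝ, EuclideanSpace ℝ (Fin d)) ∞ φ φ.source := by
    rw [hφ, extChartAt_source]; exact contMDiffOn_extChartAt
  have hφs' : ContMDiffOn 𝓘(ℝ, EuclideanSpace ℝ (Fin d)) (𝓡 d) ∞ φ.symm φ.target :=
    contMDiffOn_extChartAt_symm _
  have htgt : IsOpen φ.target := isOpen_extChartAt_target _
  set U₀ : Set X := (f ⁻¹' V ∩ ψ ⁻¹' φ.source) ∩ f ⁻¹' C.U with hU₀d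
  have hU₀ : IsOpen U₀ :=
    (hψ.continuousOn.isOpen_inter_preimage hfV hsrc).inter (C.isOpen.preimage hsm.continuous)
  have hb : b ∈ U₀ := ⟨⟨hbV, mem_extChartAt_source (I := 𝓡 d) (ψ b)⟩, C.mem⟩
  have hz : ContMDiffOn I 𝓘(ℝ, Fin d → ℝ) ∞ (fun q => A (φ (ψ q))) U₀ := by
    have hA' : ContMDiff 𝓘(ℝ, EuclideanSpace ℝ (Fin d)) 𝓘(ℝ, Fin d → ℝ) ∞ A :=
      A.contDiff.contMDiff
    exact hA'.comp_contMDiffOn (hφs.comp (hψ.mono fun q hq => hq.1.1) fun q hq => hq.1.2)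
  obtain ⟨g, hg, N₀, hN₀, hgN⟩ := exists_global_extension hU₀ hb hz
  obtain ⟨O₁, hO₁, hO₁e⟩ := continuousOn_iff'.1 C.smooth_inv.continuousOn V hV
  have hO₁m : ∀ w ∈ orth {0} ∩ ball (C.c (f b)) C.r, w ∈ O₁ ↔ C.inv w ∈ V := fun w hw => by
    have := Set.ext_iff.1 hO₁e w
    exact ⟨fun h => (this.2 ⟨h, hw⟩).1, fun h => (this.1 ⟨h, hw⟩).1⟩
  have : NeZero (N + d) := ⟨by have := NeZero.ne N; omega⟩
  let l : (Fin (N + d) → ℝ) → (Fin N → ℝ) := fun w i => w (Fin.castAdd d i)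
  let s : (Fin (N + d) → ℝ) → (Fin d → ℝ) := fun w i => w (Fin.natAdd N i)
  have hl : ContDiff ℝ ∞ l := contDiff_pi.2 fun i => contDiff_apply ℝ ℝ (Fin.castAdd d i)
  have hs : ContDiff ℝ ∞ s := contDiff_pi.2 fun i => contDiff_apply ℝ ℝ (Fin.natAdd N i)
  have l0 : ∀ w, l w 0 = w 0 := fun w => by
    change w _ = w _
    congr 1
  set B : Set (Fin (N + d) → ℝ) :=
    l ⁻¹' (O₁ ∩ ball (C.c (f b)) C.r) ∩ (fun w => A.symm (s w)) ⁻¹' φ.target with hBd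
  have hB : IsOpen B := ((hO₁.inter isOpen_ball).preimage hl.continuous).inter
    (htgt.preimage (A.symm.continuous.comp hs.continuous))
  have hla : ∀ (v : Fin N → ℝ) (z : Fin d → ℝ), l (Fin.append v z) = v := fun v z => by
    funext i; exact Fin.append_left _ _ _
  have hsa : ∀ (v : Fin N → ℝ) (z : Fin d → ℝ), s (Fin.append v z) = z := fun v z => by
    funext i; exact Fin.append_right _ _ _
  have hap : ∀ w, Fin.append (l w) (s w) = w := fun w => Fin.append_castAdd_natAdd
  have hlD : ∀ w ∈ orth {0} ∩ B, l w ∈ orth {0} ∩ ball (C.c (f b)) C.r ∧ l w ∈ O₁ :=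
    fun w hw => ⟨⟨fun j hj => by
      rw [Finset.mem_singleton.1 hj, l0]; exact hw.1 0 (by simp), hw.2.1.2⟩, hw.2.1.1⟩
  have hcV : ∀ w ∈ orth {0} ∩ B, C.inv (l w) ∈ V ∩ S := fun w hw =>
    ⟨(hO₁m _ (hlD w hw).1).1 (hlD w hw).2, C.inv_mem' _ (hlD w hw).1⟩
  have hmapU : ∀ q ∈ U₀, C.c (f q) ∈ orth {0} ∩ ball (C.c (f b)) C.r := fun q hq =>
    C.maps _ hq.2 (hfS q)
  obtain ⟨C', hC'c, hC'N, hC'U, -⟩ := HalfChart.exists_of_local (I := I) (S := (univ : Set X))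
    (c := fun q => Fin.append (C.c (f q)) (A (φ (ψ q))))
    (c' := fun q => Fin.append (C.c (f q)) (g q))
    (inv := fun w => χ (C.inv (l w), φ.symm (A.symm (s w)))) (B := B) hU₀ hb (mem_univ _) hB
    (by
      refine ⟨?_, ?_⟩
      · rw [mem_preimage, hla]
        exact ⟨(hO₁m _ (hmapU b hb)).2 (by rw [C.left _ C.mem (hfS b)]; exact hbV),
          (hmapU b hb).2⟩
      · rw [mem_preimage, hsa, A.symm_apply_apply]
        exact mem_extChartAt_target (I := 𝓡 d) (ψ b))
    (contMDiffOn_append (hC.comp_contMDiffOn hsm.contMDiffOn) hz)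
    (by
      refine hχ.comp (t := (V ∩ S) ×ˢ univ) (ContMDiffOn.prodMk ?_ ?_) fun w hw => ⟨hcV w hw, mem_univ _⟩
      · exact C.smooth_inv.comp hl.contMDiff.contMDiffOn fun w hw => (hlD w hw).1
      · exact hφs'.comp (A.symm.contDiff.comp hs).contMDiff.contMDiffOn fun w hw => hw.2.2)
    (fun w hw => by
      obtain ⟨e1, e2⟩ := h2 _ (hcV w hw) (φ.symm (A.symm (s w)))
      refine ⟨⟨⟨?_, ?_⟩, ?_⟩, mem_univ _, ?_⟩
      · rw [mem_preimage, e1]; exact (hcV w hw).1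
      · rw [mem_preimage, e2]; exact φ.map_target hw.2.2
      · rw [mem_preimage, e1]; exact C.inv_mem _ (hlD w hw).1
      · rw [e1, e2, C.right _ (hlD w hw).1, φ.right_inv hw.2.2, A.apply_symm_apply, hap])
    (fun q hq _ => by
      refine ⟨fun j hj => ?_, fun _ => ?_⟩
      · rw [Finset.mem_singleton.1 hj, ← l0 (Fin.append _ _), hla]
        exact (hmapU q hq).1 0 (by simp)
      · rw [hla, hsa, A.symm_apply_apply, φ.left_inv hq.1.2, C.left _ hq.2 (hfS q), h1 q hq.1.1])
    hN₀ (fun q hq => by rw [hgN q hq])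
  obtain rfl : N' = N + d := hN'.symm.trans C'.finrank_eq
  refine ⟨Nat.le_add_right _ _, C', ?_, fun q hq => (hC'U hq).2, fun q j h h' => ?_⟩
  · rw [hC'c, ← contMDiffOn_univ]
    exact contMDiffOn_append (hC.comp hsm).contMDiffOn hg.contMDiffOn
  · rw [hC'c]
    exact Fin.append_left (C.c (f q)) (g q) ⟨j, h⟩

/-- The standard chart of `[0, ε)`. -/
def intervalChart {ε y : ℝ} (hy : y ∈ Ico 0 ε) : HalfChart 𝓘(ℝ, ℝ) (Ico 0 ε) 1 y where
  c := fun t _ => t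
  inv := fun w => w 0
  U := Ioo (y - (ε - y)) ε
  r := ε - y
  isOpen := isOpen_Ioo
  mem := ⟨by linarith [hy.2], hy.2⟩
  r_pos := by linarith [hy.2]
  smooth := (contDiff_pi.2 fun _ => contDiff_id).contMDiff.contMDiffOn
  smooth_inv := (contDiff_apply ℝ ℝ (0 : Fin 1)).contMDiff.contMDiffOn
  maps := fun q hq hqS => by
    refine ⟨fun _ _ => hqS.1, ?_⟩
    rw [mem_ball, dist_pi_lt_iff (by linarith [hy.2])]
    intro _
    rw [Real.dist_eq, abs_lt]
    constructor <;> linarith [hq.1, hq.2]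
  inv_mem := fun w hw => by
    have := (dist_pi_lt_iff (by linarith [hy.2])).1 (mem_ball.1 hw.2) 0
    rw [Real.dist_eq, abs_lt] at this
    constructor <;> linarith [this.1, this.2]
  inv_mem' := fun w hw => by
    have := (dist_pi_lt_iff (by linarith [hy.2])).1 (mem_ball.1 hw.2) 0
    rw [Real.dist_eq, abs_lt] at this
    exact ⟨hw.1 0 (by simp), by linarith [this.1, this.2]⟩
  right := fun w _ => by
    funext i
    rw [Subsingleton.elim i 0]
  left := fun _ _ _ => rfl

end FibrationStep

lemma exists_halfChart {n : ℕ} [NeZero n] {M : Type*} [TopologicalSpace M]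
    [ChartedSpace (EuclideanHalfSpace n) M] [IsManifold (𝓡∂ n) ∞ M] (p : M) :
    ∃ C : HalfChart (𝓡∂ n) (univ : Set M) n p, C.c p 0 = 0 ↔ p ∈ (𝓡∂ n).boundary M := by
  set φ := extChartAt (𝓡∂ n) p with hφ
  set A := EuclideanSpace.equiv (Fin n) ℝ with hA
  have hA0 : ∀ y : EuclideanSpace ℝ (Fin n), A y 0 = y 0 := fun y => rfl
  have hr : range (𝓡∂ n) = {y : EuclideanSpace ℝ (Fin n) | 0 ≤ y 0} :=
    range_modelWithCornersEuclideanHalfSpace n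
  have ht : φ.target = (𝓡∂ n).symm ⁻¹' (chartAt (EuclideanHalfSpace n) p).target ∩ range (𝓡∂ n) :=
    extChartAt_target (I := 𝓡∂ n) p
  have hφs : ContMDiffOn (𝓡∂ n) 𝓘(ℝ, EuclideanSpace ℝ (Fin n)) ∞ φ φ.source := by
    rw [hφ, extChartAt_source]; exact contMDiffOn_extChartAt
  have hφs' : ContMDiffOn 𝓘(ℝ, EuclideanSpace ℝ (Fin n)) (𝓡∂ n) ∞ φ.symm φ.target :=
    contMDiffOn_extChartAt_symm _
  have hps := mem_extChartAt_source (I := 𝓡∂ n) p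
  set B : Set (Fin n → ℝ) := A.symm ⁻¹' ((𝓡∂ n).symm ⁻¹' (chartAt (EuclideanHalfSpace n) p).target)
  have hB : IsOpen B := ((chartAt (EuclideanHalfSpace n) p).open_target.preimage
    (𝓡∂ n).continuous_symm).preimage A.symm.continuous
  have hBt : ∀ w ∈ orth {0} ∩ B, A.symm w ∈ φ.target := fun w hw => by
    rw [ht, hr]
    exact ⟨hw.2, hw.1 0 (by simp)⟩
  have hc : ∀ q ∈ φ.source, A (φ q) ∈ orth {0} ∩ B := fun q hq => by
    have := φ.map_source hq
    rw [ht, hr] at this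
    refine ⟨fun j hj => ?_, ?_⟩
    · rw [Finset.mem_singleton.1 hj, hA0]; exact this.2
    · rw [mem_preimage, A.symm_apply_apply]; exact this.1
  obtain ⟨C, hC, -, -, -⟩ := HalfChart.exists_of_local (I := 𝓡∂ n) (S := (univ : Set M)) (b := p)
    (c := fun q => A (φ q)) (c' := fun q => A (φ q)) (inv := fun w => φ.symm (A.symm w))
    (isOpen_extChartAt_source p) hps (mem_univ _) hB (hc p hps).2
    (A.contDiff.contMDiff.comp_contMDiffOn hφs)
    (hφs'.comp A.symm.contDiff.contMDiff.contMDiffOn fun w hw => hBt w hw)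
    (fun w hw => ⟨φ.map_target (hBt w hw), mem_univ _, by
      rw [φ.right_inv (hBt w hw), A.apply_symm_apply]⟩)
    (fun q hq _ => ⟨(hc q hq).1, fun _ => by rw [A.symm_apply_apply, φ.left_inv hq]⟩)
    univ_mem fun _ _ => rfl
  refine ⟨C, ?_⟩
  rw [hC, ModelWithCorners.boundary, mem_ofPred_eq, ModelWithCorners.isBoundaryPoint_iff,
    frontier_range_modelWithCornersEuclideanHalfSpace]
  exact eq_comm

lemma HalfChart.mem_boundary_iff {n : ℕ} [NeZero n] {M : Type*} [TopologicalSpace M]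
    [ChartedSpace (EuclideanHalfSpace n) M] [IsManifold (𝓡∂ n) ∞ M] {N : ℕ} [NeZero N] {p : M}
    (C : HalfChart (𝓡∂ n) (univ : Set M) N p) {q : M} (hq : q ∈ C.U) :
    q ∈ (𝓡∂ n).boundary M ↔ C.c q 0 = 0 := by
  obtain ⟨C', hC'⟩ := exists_halfChart (n := n) q
  rw [← hC', C.c_zero_iff C' hq C'.mem]

variable {n : ℕ} [NeZero n] {M : Type u} [TopologicalSpace M]
  [ChartedSpace (EuclideanHalfSpace n) M] [IsManifold (𝓡∂ n) ∞ M] [T2Space M] [CompactSpace M]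
  {k : ℕ} {T : Tower n M k} {a : Fin (k + 1) → ℕ} {𝒱 ℛ : Submodule ℝ (VField n M)}
  {p p' p'' q q' : M}

local notation "∂M" => ModelWithCorners.boundary (I := 𝓡∂ n) M
local notation "M°" => ModelWithCorners.interior (I := 𝓡∂ n) M
local notation "CM∞" => ContMDiffOn (𝓡∂ n) 𝓘(ℝ, ℝ) ∞
local notation "ℝⁿ" => Idx n → ℝ

local notation "𝕌" => T.emb.source
local notation "𝔼" => Fin n → ℝ
local notation "𝒫" => Patch (Idx n) (M × M)
local infix:50 " ∼ " => Tower.SameFibre T (Fin.last k)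

variable (n) in
/-- Half-space charts of `M` at `p`. -/
abbrev MChart (p : M) := HalfChart (𝓡∂ n) (univ : Set M) n p

lemma HalfChart.exists_cast {E H X : Type*} [NormedAddCommGroup E] [NormedSpace ℝ E]
    [TopologicalSpace H] [TopologicalSpace X] [ChartedSpace H X] {I : ModelWithCorners ℝ E H}
    {S : Set X} {N N' : ℕ} [NeZero N] [NeZero N'] {b : X} (C : HalfChart I S N b) (hN : N = N') :
    ∃ C' : HalfChart I S N' b, C'.U = C.U ∧
      ∀ q j (h : j < N) (h' : j < N'), C'.c q ⟨j, h'⟩ = C.c q ⟨j, h⟩ := by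
  subst hN
  exact ⟨C, rfl, fun _ _ _ _ => rfl⟩

namespace Tower

variable (T)

lemma fromTop_last : T.fromTop (Fin.last k) = id := by
  simp [fromTop]

lemma fromTop_castSucc (i : Fin k) : T.fromTop i.castSucc = T.Φ i ∘ T.fromTop i.succ := by
  simp [fromTop]

lemma contMDiff_fromTop (i : Fin (k + 1)) :
    ContMDiff (T.B (Fin.last k)).model (T.B i).model ∞ (T.fromTop i) := by
  induction i using Fin.reverseInduction with
  | last => rw [fromTop_last]; exact contMDiff_id
  | cast i ih => rw [fromTop_castSucc]; exact (T.fibration i).1.comp ih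

lemma contMDiffOn_proj (i : Fin (k + 1)) :
    ContMDiffOn (𝓡∂ n) (T.B i).model ∞ (T.proj i) 𝕌 :=
  (T.contMDiff_fromTop i).comp_contMDiffOn T.smooth_emb

lemma contMDiffOn_x : CM∞ T.x 𝕌 :=
  T.fibration₀.1.comp_contMDiffOn (T.contMDiffOn_proj 0)

lemma x_mem (p : M) : T.x p ∈ Ico 0 T.ε := T.fibration₀.2.1 ▸ mem_range_self _

lemma nonempty_B (i : Fin (k + 1)) : Nonempty (T.B i).carrier := by
  induction i using Fin.induction with
  | zero =>
    have h : (0 : ℝ) ∈ range T.Φ₀ := T.fibration₀.2.1 ▸ ⟨le_rfl, T.ε_pos⟩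
    exact ⟨h.choose⟩
  | succ i ih =>
    obtain ⟨b⟩ := ih
    have h : b ∈ range (T.Φ i) := (T.fibration i).2.1 ▸ mem_univ b
    exact ⟨h.choose⟩

lemma exists_baseCharts :
    ∃ Ch : ∀ (i : Fin (k + 1)) (b : (T.B i).carrier),
        HalfChart (T.B i).model (univ : Set (T.B i).carrier) ((T.B i).dim + 1) b,
      (∀ i b, ContMDiff (T.B i).model 𝓘(ℝ, Fin ((T.B i).dim + 1) → ℝ) ∞ (Ch i b).c) ∧
      (∀ b q, (Ch 0 b).c q 0 = T.Φ₀ q) ∧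
      (∀ i : Fin k, (T.B i.castSucc).dim ≤ (T.B i.succ).dim) ∧
      ∀ (i : Fin k) b, (Ch i.succ b).U ⊆ T.Φ i ⁻¹' (Ch i.castSucc (T.Φ i b)).U ∧
        ∀ q j (h : j < (T.B i.castSucc).dim + 1) (h' : j < (T.B i.succ).dim + 1),
          (Ch i.succ b).c q ⟨j, h'⟩ = (Ch i.castSucc (T.Φ i b)).c (T.Φ i q) ⟨j, h⟩ := by
  have h0 : ∀ b : (T.B 0).carrier, ∃ C : HalfChart (T.B 0).model (univ : Set (T.B 0).carrier)
      ((T.B 0).dim + 1) b, ContMDiff (T.B 0).model 𝓘(ℝ, Fin ((T.B 0).dim + 1) → ℝ) ∞ C.c ∧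
      ∀ q, C.c q 0 = T.Φ₀ q := fun b => by
    have hb : T.Φ₀ b ∈ Ico 0 T.ε := T.fibration₀.2.1 ▸ mem_range_self b
    obtain ⟨-, C, hC, -, hC'⟩ := T.fibration₀.exists_chart b (N' := (T.B 0).dim + 1)
      finrank_euclideanSpace_fin (intervalChart hb)
      (contDiff_pi.2 fun _ => contDiff_id).contMDiff
    exact ⟨C, hC, fun q => hC' q 0 one_pos (Nat.succ_pos _)⟩
  have hs := fun (i : Fin k) (b : (T.B i.succ).carrier)
    (C : {C : HalfChart (T.B i.castSucc).model (univ : Set (T.B i.castSucc).carrier)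
      ((T.B i.castSucc).dim + 1) (T.Φ i b) //
      ContMDiff (T.B i.castSucc).model 𝓘(ℝ, Fin ((T.B i.castSucc).dim + 1) → ℝ) ∞ C.c}) =>
    (T.fibration i).exists_chart b (N' := (T.B i.succ).dim + 1) finrank_euclideanSpace_fin C.1 C.2
  choose C₀ hC₀ hC₀' using h0
  choose hd Cs hCs hCU hCc using hs
  let fam : ∀ i : Fin (k + 1), ∀ b : (T.B i).carrier,
      {C : HalfChart (T.B i).model (univ : Set (T.B i).carrier) ((T.B i).dim + 1) b //
        ContMDiff (T.B i).model 𝓘(ℝ, Fin ((T.B i).dim + 1) → ℝ) ∞ C.c} :=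
    Fin.induction (motive := fun i : Fin (k + 1) => ∀ b : (T.B i).carrier,
      {C : HalfChart (T.B i).model (univ : Set (T.B i).carrier) ((T.B i).dim + 1) b //
        ContMDiff (T.B i).model 𝓘(ℝ, Fin ((T.B i).dim + 1) → ℝ) ∞ C.c})
      (fun b => ⟨C₀ b, hC₀ b⟩)
      (fun i F b => ⟨Cs i b (F (T.Φ i b)), hCs i b (F (T.Φ i b))⟩)
  have e0 : fam 0 = fun b => ⟨C₀ b, hC₀ b⟩ := rfl
  have es : ∀ i : Fin k, fam i.succ =
      fun b => ⟨Cs i b (fam i.castSucc (T.Φ i b)), hCs i b (fam i.castSucc (T.Φ i b))⟩ :=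
    fun i => by
      simp only [fam, Fin.induction_succ]
  refine ⟨fun i b => (fam i b).1, fun i b => (fam i b).2, fun b q => ?_, fun i => ?_,
    fun i b => ?_⟩
  · simp only [e0]; exact hC₀' b q
  · obtain ⟨b⟩ := T.nonempty_B i.succ
    have := hd i b (fam i.castSucc (T.Φ i b))
    omega
  · simp only [es]
    exact ⟨hCU i b _, hCc i b _⟩

/-- Charts of `M` adapted to a tower; `lev j ≤ m` means that the coordinate number `j` comes from
the base number `m - 1`. -/
structure Charts where
  lev : Fin n → ℕ
  ch : ∀ p : M, MChart n p
  lev_eq_zero : ∀ j, lev j = 0 ↔ j = 0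
  lev_le : ∀ j, lev j ≤ k + 1
  subset : ∀ p ∈ 𝕌, (ch p).U ⊆ 𝕌
  smooth : ∀ p ∈ 𝕌, ContMDiffOn (𝓡∂ n) 𝓘(ℝ, 𝔼) ∞ (ch p).c 𝕌
  c_zero : ∀ p ∈ 𝕌, ∀ q ∈ 𝕌, (ch p).c q 0 = T.x q
  level : ∀ m p p', p ∈ 𝕌 → p' ∈ 𝕌 → T.SameFibre m p p' →
    ∀ j, lev j ≤ (m : ℕ) → ∀ q ∈ 𝕌, (ch p).c q j = (ch p').c q j
  same : ∀ m p p', p ∈ 𝕌 → p' ∈ 𝕌 → T.SameFibre m p p' →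
    ∀ q ∈ (ch p).U, ∀ q' ∈ (ch p').U,
      (T.SameFibre m q q' ↔ ∀ j, lev j ≤ (m : ℕ) → (ch p).c q j = (ch p').c q' j)
  pull : ∀ (i : Fin k) p j, p ∈ 𝕌 → lev j ≤ (i : ℕ) + 1 →
    ∃ u : (T.B i.castSucc).carrier → ℝ, ContMDiff (T.B i.castSucc).model 𝓘(ℝ, ℝ) ∞ u ∧
      ∀ q ∈ 𝕌, (ch p).c q j = u (T.proj i.castSucc q)

instance : CoeFun T.Charts fun _ => ∀ p : M, MChart n p := ⟨Charts.ch⟩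

lemma exists_top_chart {N : ℕ} [NeZero N] {p : M} (hp : p ∈ 𝕌)
    (C : HalfChart (T.B (Fin.last k)).model (univ : Set (T.B (Fin.last k)).carrier) N (T.emb p)) :
    ∃ C' : MChart n p, C'.U ⊆ 𝕌 ∧
      C'.U ⊆ T.emb ⁻¹' C.U ∧ n = N ∧
      ∀ q j (h : j < N) (h' : j < n), C'.c q ⟨j, h'⟩ = C.c (T.emb q) ⟨j, h⟩ := by
  have hU : IsOpen (𝕌 ∩ T.emb ⁻¹' C.U) := T.emb.isOpen_inter_preimage C.isOpen
  have ht : ∀ y, y ∈ T.emb.target := fun y => T.target_eq ▸ mem_univ y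
  let C₁ : HalfChart (𝓡∂ n) (univ : Set M) N p :=
    { c := C.c ∘ T.emb
      inv := T.emb.symm ∘ C.inv
      U := 𝕌 ∩ T.emb ⁻¹' C.U
      r := C.r
      isOpen := hU
      mem := ⟨hp, C.mem⟩
      r_pos := C.r_pos
      smooth := C.smooth.comp (T.smooth_emb.mono inter_subset_left) fun q hq => hq.2
      smooth_inv := T.smooth_symm.comp_contMDiffOn C.smooth_inv
      maps := fun q hq _ => C.c_mem hq.2
      inv_mem := fun w hw => ⟨T.emb.map_target (ht _), by
        rw [mem_preimage, Function.comp_apply, T.emb.right_inv (ht _)]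
        exact C.inv_mem w hw⟩
      inv_mem' := fun _ _ => mem_univ _
      right := fun w hw => by
        simp only [Function.comp_apply, T.emb.right_inv (ht _)]
        exact C.right w hw
      left := fun q hq _ => by
        simp only [Function.comp_apply, C.inv_c hq.2, T.emb.left_inv hq.1] }
  have hn : N = n := by rw [← C₁.finrank_eq, finrank_euclideanSpace_fin]
  obtain ⟨C', hU', hc'⟩ := C₁.exists_cast hn
  exact ⟨C', fun q hq => (hU' ▸ hq : q ∈ C₁.U).1, fun q hq => (hU' ▸ hq : q ∈ C₁.U).2, hn.symm, hc'⟩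

lemma exists_charts : Nonempty T.Charts := by
  classical
  obtain ⟨Ch, hsm, h0, hd, hcomp⟩ := T.exists_baseCharts
  set N : Fin (k + 1) → ℕ := fun i => (T.B i).dim + 1 with hN
  have hmono : Monotone N := Fin.monotone_iff_le_succ.2 fun i => Nat.succ_le_succ (hd i)
  have hnn : ∀ i, NeZero (N i) := fun i => ⟨Nat.succ_ne_zero _⟩
  have hcU : ∀ (i : Fin (k + 1)) b, (Ch (Fin.last k) b).U ⊆ T.fromTop i ⁻¹' (Ch i (T.fromTop i b)).U ∧
      ∀ q j (h : j < N i) (h' : j < N (Fin.last k)),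
        (Ch (Fin.last k) b).c q ⟨j, h'⟩ = (Ch i (T.fromTop i b)).c (T.fromTop i q) ⟨j, h⟩ := by
    intro i b
    induction i using Fin.reverseInduction with
    | last => rw [T.fromTop_last]; exact ⟨subset_rfl, fun _ _ _ _ => rfl⟩
    | cast i ih =>
      rw [fromTop_castSucc]
      refine ⟨fun q hq => (hcomp i _).1 (ih.1 hq), fun q j h h' => ?_⟩
      have h2 : j < N i.succ := h.trans_le (hmono i.castSucc_le_succ)
      rw [ih.2 q j h2 h']
      exact (hcomp i _).2 _ j h h2
  have htop : ∀ p : M, ∃ C' : MChart n p, p ∈ 𝕌 →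
      C'.U ⊆ 𝕌 ∧ C'.U ⊆ T.emb ⁻¹' (Ch (Fin.last k) (T.emb p)).U ∧ n = N (Fin.last k) ∧
      ∀ q j (h : j < N (Fin.last k)) (h' : j < n),
        C'.c q ⟨j, h'⟩ = (Ch (Fin.last k) (T.emb p)).c (T.emb q) ⟨j, h⟩ := fun p => by
    by_cases hp : p ∈ 𝕌
    · obtain ⟨C', h⟩ := T.exists_top_chart hp (Ch (Fin.last k) (T.emb p))
      exact ⟨C', fun _ => h⟩
    · obtain ⟨C', -⟩ := exists_halfChart (n := n) p
      exact ⟨C', fun h => absurd h hp⟩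
  choose ch hch using htop
  have hU : ∀ p ∈ 𝕌, ∀ i, ∀ q ∈ (ch p).U, T.proj i q ∈ (Ch i (T.proj i p)).U :=
    fun p hp i q hq => (hcU i _).1 ((hch p hp).2.1 hq)
  have hc : ∀ p ∈ 𝕌, ∀ i q j (h : j < N i) (h' : j < n),
      (ch p).c q ⟨j, h'⟩ = (Ch i (T.proj i p)).c (T.proj i q) ⟨j, h⟩ := fun p hp i q j h h' => by
    rw [(hch p hp).2.2.2 q j (h.trans_le (hmono (Fin.le_last i))) h']
    exact (hcU i _).2 _ j h _
  have hx : ∀ p ∈ 𝕌, ∀ q, (ch p).c q 0 = T.x q := fun p hp q => by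
    have := hc p hp 0 q 0 (Nat.succ_pos _) (NeZero.pos n)
    exact this.trans (h0 _ _)
  let lev : Fin n → ℕ := fun j => if j = 0 then 0 else sInf {m | ∃ i : Fin (k + 1), m = (i : ℕ) + 1 ∧ (j : ℕ) < N i}
  have hne : ∀ p ∈ 𝕌, ∀ j : Fin n, (k + 1) ∈ {m | ∃ i : Fin (k + 1), m = (i : ℕ) + 1 ∧ (j : ℕ) < N i} :=
    fun p hp j => ⟨Fin.last k, rfl, (hch p hp).2.2.1 ▸ j.2⟩
  have hnM : ∃ p, p ∈ 𝕌 := by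
    obtain ⟨b⟩ := T.nonempty_B (Fin.last k)
    exact ⟨T.emb.symm b, T.emb.map_target (T.target_eq ▸ mem_univ b)⟩
  obtain ⟨p₀, hp₀⟩ := hnM
  have hlev : ∀ (j : Fin n) (m : ℕ), lev j ≤ m → j = 0 ∨ ∃ i : Fin (k + 1), (i : ℕ) + 1 ≤ m ∧ (j : ℕ) < N i := by
    intro j m h
    by_cases hj : j = 0
    · exact Or.inl hj
    · right
      simp only [lev, if_neg hj] at h
      obtain ⟨i, hi, hi'⟩ := Nat.sInf_mem ⟨_, hne p₀ hp₀ j⟩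
      exact ⟨i, hi ▸ h, hi'⟩
  have hlev' : ∀ (j : Fin n) (m : ℕ) (i : Fin (k + 1)), (i : ℕ) + 1 ≤ m → (j : ℕ) < N i → lev j ≤ m := by
    intro j m i h h'
    simp only [lev]
    split_ifs
    · exact Nat.zero_le _
    · exact le_trans (Nat.sInf_le (by exact ⟨i, rfl, h'⟩)) h
  have hlev2 : ∀ (j : Fin n) (m : Fin (k + 1)), lev j ≤ m → j = 0 ∨ ∃ i : Fin k, i.succ ≤ m ∧
      (j : ℕ) < N i.castSucc := by
    intro j m h
    rcases hlev j m h with h0 | ⟨i, hi, hj⟩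
    · exact Or.inl h0
    have hik : (i : ℕ) < k := by have := m.2; omega
    exact Or.inr ⟨⟨i, hik⟩, by rw [Fin.le_def]; exact hi, hj⟩
  refine ⟨⟨lev, ch, fun j => ?_, fun j => ?_, fun p hp => (hch p hp).1, fun p hp => ?_,
    fun p hp q _ => hx p hp q, ?_, ?_, ?_⟩⟩
  · refine ⟨fun h => ?_, fun h => if_pos h⟩
    rcases hlev j 0 h.le with h | ⟨i, hi, -⟩
    · exact h
    · omega
  · simp only [lev]
    split_ifs
    · exact Nat.zero_le _
    · exact Nat.sInf_le (hne p₀ hp₀ j)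
  · rw [contMDiffOn_pi_space]
    intro j
    have hj : (j : ℕ) < N (Fin.last k) := j.2.trans_eq (hch p hp).2.2.1
    have h1 := contMDiffOn_pi_space.1 ((hsm (Fin.last k) (T.proj (Fin.last k) p)).comp_contMDiffOn
      (T.contMDiffOn_proj (Fin.last k))) ⟨j, hj⟩
    exact h1.congr fun q hq => hc p hp (Fin.last k) q j hj j.2
  · intro m p p' hp hp' hpp j hj q hq
    rcases hlev2 j m hj with rfl | ⟨i, hi, hji⟩
    · rw [hx p hp, hx p' hp']
    · rw [hc p hp i.castSucc q j hji j.2, hc p' hp' i.castSucc q j hji j.2, hpp.2 i hi]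
  · intro m p p' hp hp' hpp q hq q' hq'
    constructor
    · intro h j hj
      rcases hlev2 j m hj with rfl | ⟨i, hi, hji⟩
      · rw [hx p hp, hx p' hp', h.1]
      · rw [hc p hp i.castSucc q j hji j.2, hc p' hp' i.castSucc q' j hji j.2, hpp.2 i hi, h.2 i hi]
    · intro h
      refine ⟨?_, fun i hi => ?_⟩
      · have := h 0 (by simp [lev])
        rwa [hx p hp, hx p' hp'] at this
      · have h1 := hU p hp i.castSucc q hq
        have h2 := hU p' hp' i.castSucc q' hq'
        rw [← hpp.2 i hi] at h2
        rw [← (Ch _ _).inv_c h1, ← (Ch _ _).inv_c h2]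
        congr 1
        funext j
        have hjn : (j : ℕ) < n := j.2.trans_le
          ((hmono (Fin.le_last i.castSucc)).trans (hch p hp).2.2.1.ge)
        have := h ⟨j, hjn⟩ (hlev' _ _ i.castSucc (by exact Fin.le_def.1 hi) j.2)
        rw [hc p hp i.castSucc q j j.2 hjn, hc p' hp' i.castSucc q' j j.2 hjn, ← hpp.2 i hi] at this
        exact this
  · intro i p j hp hj
    have hji : (j : ℕ) < N i.castSucc := by
      rcases hlev j _ hj with rfl | ⟨i', hi', hj'⟩
      · exact Nat.succ_pos _
      · exact hj'.trans_le (hmono (by rw [Fin.le_def]; exact Nat.le_of_succ_le_succ hi'))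
    exact ⟨fun b => (Ch i.castSucc (T.proj i.castSucc p)).c b ⟨j, hji⟩,
      contMDiff_pi_space.1 (hsm _ _) _, fun q _ => hc p hp i.castSucc q j hji j.2⟩

end Tower

namespace Patch

variable {ι : Type} [Fintype ι] [DecidableEq ι] {W : Type*}

/-! ### Invariance of closures and corners -/

/-- The closure of the set of interior points which are mapped to `D`. -/
def lift (D : Set W) (P : Patch ι W) : Set ℝ^ι := closure {v | v ∈ P.int ∧ P.toFun v ∈ D}

lemma lift_mono {D D' : Set W} (h : D ⊆ D') (P : Patch ι W) : P.lift D ⊆ P.lift D' :=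
  closure_mono fun _ hv => ⟨hv.1, h hv.2⟩

lemma mem_lift_of_maps {D : Set W} {P P' : Patch ι W} {O : Set ℝ^ι} {h : ℝ^ι → ℝ^ι}
    (hO : IsOpen O) (hc : ContinuousOn h (P.dom ∩ O))
    (hi : ∀ w ∈ P.int ∩ O, h w ∈ P'.int) (he : ∀ w ∈ P.int ∩ O, P.toFun w = P'.toFun (h w))
    {v : ℝ^ι} (hv : v ∈ P.dom ∩ O) (hvl : v ∈ P.lift D) : h v ∈ P'.lift D := by
  have h1 : v ∈ closure (O ∩ {v | v ∈ P.int ∧ P.toFun v ∈ D}) := hO.inter_closure ⟨hv.2, hvl⟩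
  refine ((hc v hv).mono fun w hw => ⟨int_subset_dom _ hw.2.1, hw.1⟩).mem_closure h1 fun w hw => ?_
  exact ⟨hi w ⟨hw.2.1, hw.1⟩, by rw [← he w ⟨hw.2.1, hw.1⟩]; exact hw.2.2⟩

lemma mem_lift_of_locDiffeo {D : Set W} {P P' : Patch ι W} {O O' : Set ℝ^ι}
    {h h' : ℝ^ι → ℝ^ι} (H : LocDiffeo P.corners P'.corners O O' h h')
    (hO : O ⊆ P.O) (hO' : O' ⊆ P'.O) (he : ∀ w ∈ orth P.corners ∩ O, P.toFun w = P'.toFun (h w))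
    {v : ℝ^ι} (hv : v ∈ orth P.corners ∩ O) (hvl : v ∈ P.lift D) : h v ∈ P'.lift D := by
  have e1 : P.dom ∩ O = orth P.corners ∩ O := by
    rw [dom_inter, inter_eq_self_of_subset_right hO]
  have e2 : ∀ w ∈ P.int ∩ O, w ∈ orth P.corners ∩ O := fun w hw => ⟨(int_subset_dom _ hw.1).2, hw.2⟩
  refine mem_lift_of_maps H.isOpen (e1 ▸ H.smooth.continuousOn) (fun w hw => ?_)
    (fun w hw => he w (e2 w hw)) (e1 ▸ hv) hvl
  exact ⟨hO' (H.maps (e2 w hw)).2, H.mem_orthInt (e2 w hw) hw.1.2⟩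

lemma SamePoint.mem_lift {D : Set W} {P P' : Patch ι W} {v v' : ℝ^ι}
    (hz : SamePoint (P, v) (P', v')) (hv : v ∈ P.dom) (hvl : v ∈ P.lift D) : v' ∈ P'.lift D := by
  obtain ⟨O, hO, O', hO', h, h', H, hvO, hvO', hd, rfl, he⟩ := hz.exists_locDiffeo hv
  exact mem_lift_of_locDiffeo H hO hO' he ⟨hv.2, hvO⟩ hvl

lemma SamePoint.exists_zero {P P' : Patch ι W} {v v' : ℝ^ι}
    (hz : SamePoint (P, v) (P', v')) (hv : v ∈ P.dom) (h0 : ∃ j ∈ P.corners, v j = 0) :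
    ∃ j ∈ P'.corners, v' j = 0 := by
  obtain ⟨O, hO, O', hO', h, h', H, hvO, hvO', hd, rfl, he⟩ := hz.exists_locDiffeo hv
  obtain ⟨l, hl, hl0⟩ := h0
  obtain ⟨j, hj, hj0, -⟩ := H.corner ⟨hv.2, hvO⟩ hl hl0
  exact ⟨j, hj, hj0⟩

lemma SamePoint.exists_unique_zero {P P' : Patch ι W} {v v' : ℝ^ι}
    (hz : SamePoint (P, v) (P', v')) (hv : v ∈ P.dom) {i : ι} (hi : i ∈ P.corners) (hi0 : v i = 0)
    (hoff : ∀ j ∈ P.corners, j ≠ i → 0 < v j) :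
    ∃ i' ∈ P'.corners, v' i' = 0 ∧ ∀ j ∈ P'.corners, j ≠ i' → 0 < v' j := by
  obtain ⟨O, hO, O', hO', h, h', H, hvO, hvO', hd, rfl, he⟩ := hz.exists_locDiffeo hv
  obtain ⟨i', hi', hi0', -⟩ := H.corner ⟨hv.2, hvO⟩ hi hi0
  refine ⟨i', hi', hi0', fun j hj hne => lt_of_le_of_ne (hd.2 j hj) fun h0 => hne ?_⟩
  exact H.facet_unique ⟨hv.2, hvO⟩ hoff hj hi' h0.symm hi0'

lemma samePoint_pullX {Wi : Set W} {P P' : Patch ι W} (hP : P.IsGood Wi) (hP' : P'.IsGood Wi)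
    {a : ℕ} (ha : a ≠ 0) {R S R' S' : Finset ι} {i i' : ι} (hi : i ∈ R)
    (hR : R ⊆ P.corners) (hS : Disjoint S P.corners) (hi' : i' ∈ R') (hR' : R' ⊆ P'.corners)
    (hS' : Disjoint S' P'.corners) {O O' : Set ℝ^ι} {h h' : ℝ^ι → ℝ^ι}
    (H : LocDiffeo P.corners P'.corners O O' h h') (hO : O ⊆ P.O) (hO' : O' ⊆ P'.O)
    (he : ∀ w ∈ orth P.corners ∩ O, P.toFun w = P'.toFun (h w))
    {v : ℝ^ι} (hv : v ∈ (P.pullX a R S i).dom) (hvi : v i = 0) (hvO : blowX a R S i v ∈ O)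
    (hRR : ∀ j ∈ R', ∃ l ∈ R, (l = i ↔ j = i') ∧ ∃ r > 0, ∃ c : ℝ^ι → ℝ,
      C∞ c (orth P.corners ∩ ball (blowX a R S i v) r) ∧
      ∀ w ∈ orth P.corners ∩ ball (blowX a R S i v) r, 0 < c w ∧ h w j = w l * c w)
    (hRR' : ∀ j ∈ R, ∃ l ∈ R', (l = i' ↔ j = i) ∧ ∃ r > 0, ∃ c : ℝ^ι → ℝ,
      C∞ c (orth P'.corners ∩ ball (h (blowX a R S i v)) r) ∧
      ∀ w ∈ orth P'.corners ∩ ball (h (blowX a R S i v)) r, 0 < c w ∧ h' w j = w l * c w)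
    (hSS : ∀ w ∈ orth P.corners ∩ O, (∀ j ∈ S, w j = 0) → ∀ j ∈ S', h w j = 0)
    (hSS' : ∀ w ∈ orth P'.corners ∩ O', (∀ j ∈ S', w j = 0) → ∀ j ∈ S, h' w j = 0) :
    ∃ v', SamePoint (P.pullX a R S i, v) (P'.pullX a R' S' i', v') ∧ v' i' = 0 := by
  have e1 : P.dom ∩ O = orth P.corners ∩ O := by
    rw [dom_inter, inter_eq_self_of_subset_right hO]
  have e2 : P'.dom ∩ O' = orth P'.corners ∩ O' := by
    rw [dom_inter, inter_eq_self_of_subset_right hO']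
  have had : ∀ {C S S' : Finset ι} {O : Set ℝ^ι} {h : ℝ^ι → ℝ^ι}
      (_ : IsOpen O) (_ : C∞ h (orth C ∩ O))
      (_ : ∀ w ∈ orth C ∩ O, (∀ j ∈ S, w j = 0) → ∀ j ∈ S', h w j = 0)
      {w₀ : ℝ^ι} (_ : w₀ ∈ O) (_ : ∀ j ∈ S, w₀ j = 0),
      ∀ j ∈ S', ∃ r > 0, ∃ g : ι → ℝ^ι → ℝ,
      (∀ s, C∞ (g s) (orth C ∩ ball w₀ r)) ∧
      ∀ w ∈ orth C ∩ ball w₀ r, h w j = ∑ s ∈ S, w s * g s w := by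
    clear * -
    intro C S S' O h hO sm hz w₀ hw₀ h0 j hj
    obtain ⟨r, hr, hrO⟩ := Metric.isOpen_iff.1 hO w₀ hw₀
    have hsub : orth C ∩ ball w₀ r ⊆ orth C ∩ O :=
      inter_subset_inter_right _ hrO
    obtain ⟨g, hg, hg'⟩ := hadamard h0 ((contDiffOn_pi.1 sm j).mono hsub)
      fun w hw hwS => hz w (hsub hw) hwS j hj
    exact ⟨r, hr, g, hg, hg'⟩
  have hzero : ∀ j ∈ S, blowX a R S i v j = 0 := fun j hj => by
    have hji : j ≠ i := fun e => Finset.disjoint_left.1 hS (e ▸ hj) (hR hi)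
    rw [blowX_of_mem_S v hj hji, hvi, zero_pow ha, zero_mul]
  have hw₀ : blowX a R S i v ∈ orth P.corners ∩ O := ⟨(mem_dom_pullX (hR hi) hS hv).2, hvO⟩
  obtain ⟨O₁, hO₁, hvO₁, θ, sθ, mθ, bθ, eθ, d, hd⟩ := exists_lift (a := a) hi hR hS hi' hR' hS' H.isOpen
    hvO (e1 ▸ H.smooth) (fun w hw => by
      rw [e1] at hw; exact ⟨hO' (H.maps hw).2, (H.maps hw).1⟩) hRR
    (had H.isOpen H.smooth hSS hvO hzero)
  have hv1 := eθ v ⟨hv, hvO₁⟩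
  have hvi' : θ v i' = 0 := by rw [hd, hvi, zero_mul]
  obtain ⟨O₂, hO₂, hvO₂, θ', sθ', mθ', bθ', eθ', -⟩ := exists_lift (a := a) (v := θ v) hi' hR' hS' hi
    hR hS H.isOpen' (by rw [hv1]; exact (H.maps hw₀).2) (e2 ▸ H.smooth') (fun w hw => by
      rw [e2] at hw; exact ⟨hO (H.maps' hw).2, (H.maps' hw).1⟩) (by rw [hv1]; exact hRR')
    (by
      rw [hv1]
      exact had H.isOpen' H.smooth' hSS' (H.maps hw₀).2 (hSS _ hw₀ hzero))
  refine ⟨θ v, samePoint_of_maps (isGood_pullX hP (hR hi) hS) (isGood_pullX hP' (hR' hi') hS') hv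
    hO₁ hO₂ hvO₁ hvO₂ sθ sθ' mθ mθ' (fun w hw => ?_) (fun w hw => ?_), hvi'⟩
  · change P'.toFun (blowX a R' S' i' (θ w)) = P.toFun (blowX a R S i w)
    have hwd : blowX a R S i w ∈ orth P.corners ∩ O :=
      ⟨(mem_dom_pullX (hR hi) hS hw.1).2, bθ w hw⟩
    rw [eθ w hw, he _ hwd]
  · change P.toFun (blowX a R S i (θ' w)) = P'.toFun (blowX a R' S' i' w)
    have hwd : blowX a R' S' i' w ∈ orth P'.corners ∩ O' :=
      ⟨(mem_dom_pullX (hR' hi') hS' hw.1).2, bθ' w hw⟩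
    rw [eθ' w hw, he _ (H.maps' hwd), H.right _ hwd]

lemma samePoint_pullX_single {Wi : Set W} {P P' : Patch ι W} (hP : P.IsGood Wi)
    (hP' : P'.IsGood Wi) {a : ℕ} (ha : a ≠ 0) {S S' : Finset ι} {i i' : ι} {D : Set W}
    (hi : i ∈ P.corners) (hS : Disjoint S P.corners) (hi' : i' ∈ P'.corners)
    (hS' : Disjoint S' P'.corners)
    (hD : P.dom ∩ P.lift D = {u | u ∈ P.dom ∧ ∀ j ∈ S, u j = 0})
    (hD' : P'.dom ∩ P'.lift D = {u | u ∈ P'.dom ∧ ∀ j ∈ S', u j = 0})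
    {v w' : ℝ^ι} (hv : v ∈ (P.pullX a {i} S i).dom) (hvi : v i = 0)
    (hoff : ∀ j ∈ P.corners, j ≠ i → 0 < v j)
    (hz : SamePoint (P, blowX a {i} S i v) (P', w')) (hwi' : w' i' = 0) :
    ∃ v', SamePoint (P.pullX a {i} S i, v) (P'.pullX a {i'} S' i', v') ∧ v' i' = 0 := by
  have hd := mem_dom_pullX hi hS hv
  obtain ⟨O, hO, O', hO', h, h', H, hvO, hvO', hd', rfl, he⟩ := hz.exists_locDiffeo hd
  have hw₀ : blowX a {i} S i v ∈ orth P.corners ∩ O := ⟨hd.2, hvO⟩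
  have hoff' : ∀ j ∈ P.corners, j ≠ i → 0 < blowX a {i} S i v j := fun j hj hji => by
    rw [blowX_of_notMem v (by simpa using hji) (fun h => Finset.disjoint_left.1 hS h hj) hji]
    exact hoff j hj hji
  have hoff2 : ∀ j ∈ P'.corners, j ≠ i' → 0 < h (blowX a {i} S i v) j := fun j hj hji =>
    lt_of_le_of_ne (hd'.2 j hj) fun h0 => hji (H.facet_unique hw₀ hoff' hj hi' h0.symm hwi')
  refine samePoint_pullX hP hP' ha (mem_singleton_self i) (by simpa using hi) hS
    (mem_singleton_self i') (by simpa using hi') hS' H hO hO' he hv hvi hvO ?_ ?_ ?_ ?_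
  · intro j hj
    rw [Finset.mem_singleton.1 hj]
    obtain ⟨l, hl, hl0, r, hr, c, -, hc, hc'⟩ := H.corner_inv hw₀ hi' hwi'
    have hli : l = i := by_contra fun hne => (hoff' l hl hne).ne' hl0
    subst hli
    exact ⟨l, by simp, by simp, r, hr, c, hc, hc'⟩
  · intro j hj
    rw [Finset.mem_singleton.1 hj]
    obtain ⟨l, hl, hl0, r, hr, c, -, hc, hc'⟩ := H.symm.corner_inv (H.maps hw₀) hi (by
      rw [H.left _ hw₀, blowX_self, hvi])
    have hli : l = i' := by_contra fun hne => (hoff2 l hl hne).ne' hl0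
    subst hli
    exact ⟨l, by simp, by simp, r, hr, c, hc, hc'⟩
  · intro w hw hwS
    have h1 : w ∈ P.dom := ⟨hO hw.2, hw.1⟩
    have h2 : h w ∈ P'.dom := ⟨hO' (H.maps hw).2, (H.maps hw).1⟩
    have := mem_lift_of_locDiffeo H hO hO' he hw (hD.ge ⟨h1, hwS⟩).2
    exact (hD'.le ⟨h2, this⟩).2
  · intro w hw hwS
    have h1 : w ∈ P'.dom := ⟨hO' hw.2, hw.1⟩
    have h2 : h' w ∈ P.dom := ⟨hO (H.maps' hw).2, (H.maps' hw).1⟩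
    have := mem_lift_of_locDiffeo H.symm hO' hO
      (fun w hw => by rw [he _ (H.maps' hw), H.right w hw]) hw (hD'.ge ⟨h1, hwS⟩).2
    exact (hD.le ⟨h2, this⟩).2

end Patch

/-! ### The boundary defining function of a tower is proper -/

lemma IsFibration.exists_nhds {EX HX EY HY : Type*} {X : Type u} {Y : Type*}
    [NormedAddCommGroup EX] [NormedSpace ℝ EX] [TopologicalSpace HX]
    [NormedAddCommGroup EY] [NormedSpace ℝ EY] [TopologicalSpace HY]
    [TopologicalSpace X] [ChartedSpace HX X] [TopologicalSpace Y] [ChartedSpace HY Y]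
    {I : ModelWithCorners ℝ EX HX} {J : ModelWithCorners ℝ EY HY} {f : X → Y} {S : Set Y}
    (hf : IsFibration I J f S) {y : Y} (hy : y ∈ S) (hK : IsCompact (f ⁻¹' {y})) {U : Set X}
    (hU : IsOpen U) (hyU : f ⁻¹' {y} ⊆ U) : ∃ V, IsOpen V ∧ y ∈ V ∧ f ⁻¹' V ⊆ U := by
  obtain ⟨hsm, hr, htriv⟩ := hf
  obtain ⟨V, hV, hyV, d, F, _, _, _, ψ, χ, hψ, hχ, h1, h2⟩ := htriv y hy
  have hF : IsCompact (univ : Set F) := by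
    have : ψ '' (f ⁻¹' {y}) = univ := eq_univ_of_forall fun z =>
      ⟨χ (y, z), (h2 y ⟨hyV, hy⟩ z).1, (h2 y ⟨hyV, hy⟩ z).2⟩
    rw [← this]
    refine hK.image_of_continuousOn (hψ.continuousOn.mono fun q hq => ?_)
    rw [mem_preimage, mem_singleton_iff.1 hq]
    exact hyV
  obtain ⟨O, hO, hOe⟩ := continuousOn_iff'.1 hχ.continuousOn U hU
  have hsub : ({y} : Set Y) ×ˢ (univ : Set F) ⊆ O := by
    rintro ⟨y', z⟩ ⟨rfl, -⟩
    have hd : (y', z) ∈ (V ∩ S) ×ˢ (univ : Set F) := ⟨⟨hyV, hy⟩, mem_univ _⟩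
    exact (hOe.le ⟨hyU (h2 y' ⟨hyV, hy⟩ z).1, hd⟩).1
  obtain ⟨u, v, hu, -, hyu, hv, huv⟩ := generalized_tube_lemma isCompact_singleton hF hO hsub
  refine ⟨u ∩ V, hu.inter hV, ⟨hyu rfl, hyV⟩, fun q hq => ?_⟩
  have hd : (f q, ψ q) ∈ (V ∩ S) ×ˢ (univ : Set F) :=
    ⟨⟨hq.2, hr ▸ mem_range_self q⟩, mem_univ _⟩
  have := (hOe.ge ⟨huv ⟨hq.1, hv (mem_univ _)⟩, hd⟩).1
  rwa [mem_preimage, h1 q hq.2] at this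

namespace Tower

variable (T)

lemma surjective_fromTop (i : Fin (k + 1)) : Function.Surjective (T.fromTop i) := by
  induction i using Fin.reverseInduction with
  | last => rw [fromTop_last]; exact Function.surjective_id
  | cast i ih =>
    rw [fromTop_castSucc]
    exact (range_eq_univ.1 (T.fibration i).2.1).comp ih

lemma exists_nhds_fromTop (i : Fin (k + 1)) (y : (T.B i).carrier)
    (hK : IsCompact (T.fromTop i ⁻¹' {y})) {U : Set (T.B (Fin.last k)).carrier} (hU : IsOpen U)
    (hyU : T.fromTop i ⁻¹' {y} ⊆ U) : ∃ V, IsOpen V ∧ y ∈ V ∧ T.fromTop i ⁻¹' V ⊆ U := by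
  induction i using Fin.reverseInduction with
  | last =>
    rw [fromTop_last] at hyU ⊢
    exact ⟨U, hU, hyU rfl, subset_rfl⟩
  | cast i ih =>
    rw [fromTop_castSucc] at hK hyU ⊢
    have hcont := (T.contMDiff_fromTop i.succ).continuous
    have hb : ∀ b : T.Φ i ⁻¹' {y}, ∃ V, IsOpen V ∧ b.1 ∈ V ∧ T.fromTop i.succ ⁻¹' V ⊆ U := fun b => by
      have hs : T.fromTop i.succ ⁻¹' {b.1} ⊆ T.Φ i ∘ T.fromTop i.succ ⁻¹' {y} := fun q hq => by
        rw [mem_preimage, Function.comp_apply, mem_singleton_iff.1 hq]; exact b.2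
      exact ih b.1 (hK.of_isClosed_subset (isClosed_singleton.preimage hcont) hs) (hs.trans hyU)
    choose V hV hbV hVU using hb
    have hc : IsCompact (T.Φ i ⁻¹' {y}) := by
      have := hK.image hcont
      rwa [preimage_comp, image_preimage_eq _ (T.surjective_fromTop i.succ)] at this
    obtain ⟨V', hV', hyV', hVV⟩ := (T.fibration i).exists_nhds (mem_univ y) hc (isOpen_iUnion hV)
      fun b hb => mem_iUnion.2 ⟨⟨b, hb⟩, hbV ⟨b, hb⟩⟩
    refine ⟨V', hV', hyV', fun q hq => ?_⟩
    obtain ⟨b, hb⟩ := mem_iUnion.1 (hVV hq)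
    exact hVU b hb

lemma mem_boundary_iff {q : M} (hq : q ∈ 𝕌) :
    q ∈ ∂M ↔ T.x q = 0 := by
  obtain ⟨C⟩ := T.exists_charts
  rw [(C.ch q).mem_boundary_iff (C.ch q).mem, C.c_zero q hq q hq]

lemma mem_interior_iff {q : M} (hq : q ∈ 𝕌) :
    q ∈ M° ↔ 0 < T.x q := by
  rw [← ModelWithCorners.compl_boundary, mem_compl_iff, T.mem_boundary_iff hq, ← ne_eq,
    lt_iff_le_and_ne, and_iff_right (T.x_mem q).1, ne_comm]

lemma exists_x_lt [CompactSpace M] {U : Set M} (hU : IsOpen U)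
    (hbU : ∂M ⊆ U) :
    ∃ δ > 0, ∀ q ∈ 𝕌, T.x q < δ → q ∈ U := by
  have ht : ∀ y, y ∈ T.emb.target := fun y => T.target_eq ▸ mem_univ y
  have h0 : ∀ y, T.Φ₀ (T.fromTop 0 y) = 0 ↔ T.emb.symm y ∈ ∂M := fun y => by
    rw [T.mem_boundary_iff (T.emb.map_target (ht y)), x, proj, T.emb.right_inv (ht y)]
  have hcont := (T.contMDiff_fromTop 0).continuous
  have hK : IsCompact (T.Φ₀ ∘ T.fromTop 0 ⁻¹' {0}) := by
    have hc : IsCompact ∂M :=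
      (ModelWithCorners.isClosed_boundary (I := 𝓡∂ n) (n := ∞) (M := M) (by simp)).isCompact
    have := hc.image_of_continuousOn (T.smooth_emb.continuousOn.mono T.boundary_subset)
    convert this using 1
    ext y
    rw [mem_preimage, mem_singleton_iff, Function.comp_apply, h0]
    refine ⟨fun h => ⟨_, h, T.emb.right_inv (ht y)⟩, ?_⟩
    rintro ⟨q, hq, rfl⟩
    rwa [T.emb.left_inv (T.boundary_subset hq)]
  have hU' : IsOpen (T.emb.symm ⁻¹' U) := hU.preimage T.smooth_symm.continuous
  have hb : ∀ b : T.Φ₀ ⁻¹' {0}, ∃ V, IsOpen V ∧ b.1 ∈ V ∧ T.fromTop 0 ⁻¹' V ⊆ T.emb.symm ⁻¹' U :=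
    fun b => by
    have hs : T.fromTop 0 ⁻¹' {b.1} ⊆ T.Φ₀ ∘ T.fromTop 0 ⁻¹' {0} := fun q hq => by
      rw [mem_preimage, Function.comp_apply, mem_singleton_iff.1 hq]; exact b.2
    exact T.exists_nhds_fromTop 0 b.1 (hK.of_isClosed_subset (isClosed_singleton.preimage hcont) hs)
      hU' fun q hq => hbU ((h0 q).1 (hs hq))
  choose V hV hbV hVU using hb
  have hc : IsCompact (T.Φ₀ ⁻¹' {0}) := by
    have := hK.image hcont
    rwa [preimage_comp, image_preimage_eq _ (T.surjective_fromTop 0)] at this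
  obtain ⟨V', hV', h0V', hVV⟩ := T.fibration₀.exists_nhds ⟨le_rfl, T.ε_pos⟩ hc (isOpen_iUnion hV)
      fun b hb => mem_iUnion.2 ⟨⟨b, hb⟩, hbV ⟨b, hb⟩⟩
  obtain ⟨δ, hδ, hδV⟩ := Metric.isOpen_iff.1 hV' 0 h0V'
  refine ⟨δ, hδ, fun q hq hx => ?_⟩
  have h1 : T.x q ∈ V' := hδV (by
    rw [mem_ball, Real.dist_eq, sub_zero, abs_of_nonneg (T.x_mem q).1]; exact hx)
  obtain ⟨b, hb⟩ := mem_iUnion.1 (hVV (show T.proj 0 q ∈ T.Φ₀ ⁻¹' V' from h1))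
  have := hVU b hb
  rwa [mem_preimage, T.emb.left_inv hq] at this

lemma mem_boundary_of_mem_closure [CompactSpace M] {p p' : M} {i : Fin (k + 1)}
    (h : (p, p') ∈ closure (T.fibreDiagonal i)) :
    p ∈ ∂M ↔ p' ∈ ∂M := by
  have key : ∀ {p p' : M}, (p, p') ∈ closure {q : M × M | q.1 ∈ 𝕌 ∧ q.2 ∈ 𝕌 ∧
      T.x q.1 = T.x q.2} → p ∈ ∂M → p' ∈ ∂M := by
    clear h
    intro p p' h hp
    by_contra hp'
    have hcl : IsClosed ∂M :=
      ModelWithCorners.isClosed_boundary (I := 𝓡∂ n) (n := ∞) (M := M) (by simp)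
    obtain ⟨U, V, hU, hV, hbU, hpV, hUV⟩ := normal_separation hcl
      (isClosed_singleton (x := p')) (disjoint_singleton_right.2 hp')
    obtain ⟨δ, hδ, hδU⟩ := T.exists_x_lt hU hbU
    have hps := T.boundary_subset hp
    have h1 : {q | q ∈ 𝕌 ∧ T.x q < δ} ∈ 𝓝 p := by
      refine inter_mem (T.emb.open_source.mem_nhds hps) ?_
      have h0 : T.x p < δ := by rw [(T.mem_boundary_iff hps).1 hp]; exact hδ
      exact (T.contMDiffOn_x.continuousOn.continuousAt
        (T.emb.open_source.mem_nhds hps)).preimage_mem_nhds (Iio_mem_nhds h0)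
    have h2 : {q : M × M | (q.1 ∈ 𝕌 ∧ T.x q.1 < δ) ∧ q.2 ∈ V} ∈ 𝓝 (p, p') :=
      prod_mem_nhds h1 (hV.mem_nhds (hpV rfl))
    obtain ⟨q, hq, hq'⟩ := mem_closure_iff_nhds.1 h _ h2
    exact disjoint_left.1 hUV (hδU q.2 hq'.2.1 (hq'.2.2 ▸ hq.1.2)) hq.2
  have hle : T.fibreDiagonal i ⊆ {q : M × M | q.1 ∈ 𝕌 ∧ q.2 ∈ 𝕌 ∧
      T.x q.1 = T.x q.2} := fun q hq => ⟨hq.1, hq.2.1, hq.2.2.1⟩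
  have hsub := closure_mono hle h
  refine ⟨key hsub, key ?_⟩
  have hsw : MapsTo (Prod.swap : M × M → M × M) {q : M × M | q.1 ∈ 𝕌 ∧
      q.2 ∈ 𝕌 ∧ T.x q.1 = T.x q.2} {q : M × M | q.1 ∈ 𝕌 ∧
      q.2 ∈ 𝕌 ∧ T.x q.1 = T.x q.2} := fun q hq => ⟨hq.2.1, hq.1, hq.2.2.symm⟩
  exact continuous_swap.continuousWithinAt.mem_closure hsub hsw

lemma sameFibre_of_mem_closure {p p' : M} {i : Fin (k + 1)}
    (h : (p, p') ∈ closure (T.fibreDiagonal i)) (hp : p ∈ 𝕌) (hp' : p' ∈ 𝕌) :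
    T.SameFibre i p p' := by
  have key : ∀ {Y : Type u} [TopologicalSpace Y] [T2Space Y] (f : M → Y),
      ContinuousOn f 𝕌 → (∀ q ∈ T.fibreDiagonal i, f q.1 = f q.2) → f p = f p' := by
    intro Y _ _ f hf hfe
    have c1 : ContinuousWithinAt (fun q : M × M => (f q.1, f q.2)) (T.fibreDiagonal i) (p, p') := by
      have a1 := (hf p hp).continuousAt (T.emb.open_source.mem_nhds hp)
      have a2 := (hf p' hp').continuousAt (T.emb.open_source.mem_nhds hp')
      exact (ContinuousAt.prodMk (a1.comp (f := Prod.fst) (x := (p, p')) continuousAt_fst)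
        (a2.comp (f := Prod.snd) (x := (p, p')) continuousAt_snd)).continuousWithinAt
    have := c1.mem_closure h (t := diagonal Y) fun q hq => hfe q hq
    rwa [isClosed_diagonal.closure_eq] at this
  refine ⟨?_, fun j hj => key _ (T.contMDiffOn_proj _).continuousOn fun q hq => hq.2.2.2 j hj⟩
  have := key (fun q => ULift.up.{u} (T.x q))
    (continuous_uliftUp.comp_continuousOn T.contMDiffOn_x.continuousOn)
    fun q hq => congrArg _ hq.2.2.1
  exact ULift.up_injective this

end Tower

section

/-! ### Products of charts -/

/-- The left half of the coordinates. -/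
def lft (v : ℝⁿ) : 𝔼 := fun j => v (inl j)

/-- The right half of the coordinates. -/
def rgt (v : ℝⁿ) : 𝔼 := fun j => v (inr j)

lemma contDiff_lft {m : WithTop ℕ∞} : ContDiff ℝ m (lft : ℝⁿ → 𝔼) :=
  contDiff_pi.2 fun j => contDiff_apply ℝ ℝ (inl j : Idx n)

lemma contDiff_rgt {m : WithTop ℕ∞} : ContDiff ℝ m (rgt : ℝⁿ → 𝔼) :=
  contDiff_pi.2 fun j => contDiff_apply ℝ ℝ (inr j : Idx n)

variable (n M) in
/-- Pairs of interior points. -/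
def intPairs : Set (M × M) :=
  M° ×ˢ M°

lemma HalfChart.inv_mem_boundary_iff (C : MChart n p) {w : 𝔼}
    (hw : w ∈ C.D) : C.inv w ∈ ∂M ↔ w 0 = 0 := by
  rw [C.mem_boundary_iff (C.inv_mem w hw), C.right w hw]

lemma HalfChart.inv_mem_interior_iff (C : MChart n p) {w : 𝔼}
    (hw : w ∈ C.D) : C.inv w ∈ M° ↔ 0 < w 0 := by
  rw [← ModelWithCorners.compl_boundary, mem_compl_iff, C.inv_mem_boundary_iff hw, ← ne_eq,
    lt_iff_le_and_ne, and_iff_right (hw.1 0 (by simp)), ne_comm]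

/-- The product of two charts. -/
def prodPatch (C : MChart n p) (C' : MChart n p') :
    𝒫 where
  toFun v := (C.inv (lft v), C'.inv (rgt v))
  corners := {inl 0, inr 0}
  O := lft ⁻¹' ball (C.c p) C.r ∩ rgt ⁻¹' ball (C'.c p') C'.r
  isOpen := (isOpen_ball.preimage (contDiff_lft (m := 0)).continuous).inter
    (isOpen_ball.preimage (contDiff_rgt (m := 0)).continuous)

lemma mem_dom_prodPatch {C : MChart n p}
    {C' : MChart n p'} {v : ℝⁿ} :
    v ∈ (prodPatch C C').dom ↔ lft v ∈ C.D ∧ rgt v ∈ C'.D := by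
  constructor
  · rintro ⟨⟨h1, h2⟩, h3⟩
    refine ⟨⟨fun j hj => ?_, h1⟩, ⟨fun j hj => ?_, h2⟩⟩
    · rw [Finset.mem_singleton.1 hj]; exact h3 _ (by simp [prodPatch])
    · rw [Finset.mem_singleton.1 hj]; exact h3 _ (by simp [prodPatch])
  · rintro ⟨⟨h1, h2⟩, h3, h4⟩
    refine ⟨⟨h2, h4⟩, fun j hj => ?_⟩
    simp only [prodPatch, Finset.mem_insert, Finset.mem_singleton] at hj
    rcases hj with rfl | rfl
    · exact h1 0 (by simp)
    · exact h3 0 (by simp)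

lemma isLocalParam_prodPatch (C : MChart n p)
    (C' : MChart n p') :
    (prodPatch C C').IsLocalParam ((𝓡∂ n).prod (𝓡∂ n)) := by
  have him : (prodPatch C C').toFun '' (prodPatch C C').dom = C.U ×ˢ C'.U := by
    ext ⟨q, q'⟩
    constructor
    · rintro ⟨v, hv, he⟩
      rw [mem_dom_prodPatch] at hv
      rw [← he]
      exact ⟨C.inv_mem _ hv.1, C'.inv_mem _ hv.2⟩
    · rintro ⟨hq, hq'⟩
      exact ⟨elim (C.c q) (C'.c q'), mem_dom_prodPatch.2 ⟨C.c_mem hq, C'.c_mem hq'⟩,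
        Prod.ext (C.inv_c hq) (C'.inv_c hq')⟩
  refine ⟨?_, ?_, fun q => elim (C.c q.1) (C'.c q.2), ?_, fun v hv => ?_⟩
  · exact (C.smooth_inv.comp contDiff_lft.contMDiff.contMDiffOn
      fun v hv => (mem_dom_prodPatch.1 hv).1).prodMk
      (C'.smooth_inv.comp contDiff_rgt.contMDiff.contMDiffOn fun v hv => (mem_dom_prodPatch.1 hv).2)
  · rw [him]; exact C.isOpen.prod C'.isOpen
  · rw [him, contMDiffOn_pi_space]
    rintro (j | j)
    · exact (contMDiffOn_pi_space.1 (C.smooth.comp contMDiffOn_fst fun q hq => hq.1) j)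
    · exact (contMDiffOn_pi_space.1 (C'.smooth.comp contMDiffOn_snd fun q hq => hq.2) j)
  · rw [mem_dom_prodPatch] at hv
    funext j
    rcases j with j | j
    · exact congrFun (C.right _ hv.1) j
    · exact congrFun (C'.right _ hv.2) j

lemma prodPatch_mem_intPairs_iff {C : MChart n p}
    {C' : MChart n p'} {v : ℝⁿ} (hv : v ∈ (prodPatch C C').dom) :
    (prodPatch C C').toFun v ∈ intPairs n M ↔ v ∈ (prodPatch C C').int := by
  have hd := mem_dom_prodPatch.1 hv
  rw [intPairs, mem_prod]
  simp only [prodPatch]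
  rw [C.inv_mem_interior_iff hd.1, C'.inv_mem_interior_iff hd.2]
  constructor
  · rintro ⟨h1, h2⟩
    refine ⟨hv.1, fun j hj => ?_⟩
    simp only [Finset.mem_insert, Finset.mem_singleton] at hj
    rcases hj with rfl | rfl
    exacts [h1, h2]
  · intro h
    exact ⟨h.2 (inl 0) (by simp), h.2 (inr 0) (by simp)⟩

namespace Patch

variable {ι : Type} [Fintype ι] [DecidableEq ι] {W E H : Type*} [NormedAddCommGroup E]
  [NormedSpace ℝ E] [TopologicalSpace H] [TopologicalSpace W] [ChartedSpace H W]
  {J : ModelWithCorners ℝ E H}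

lemma IsLocalParam.samePoint {P P' : Patch ι W} (hP : P.IsLocalParam J) (hP' : P'.IsLocalParam J)
    {v v' : ℝ^ι} (hv : v ∈ P.dom) (hv' : v' ∈ P'.dom) (he : P.toFun v = P'.toFun v') :
    SamePoint (P, v) (P', v') := by
  obtain ⟨sm, hO, Q, hQ, hQl⟩ := hP
  obtain ⟨sm', hO', Q', hQ', hQl'⟩ := hP'
  have key : ∀ {P P' : Patch ι W} {Q' : W → ℝ^ι}, ContMDiffOn 𝓘(ℝ, ℝ^ι) J ∞ P.toFun P.dom →
      IsOpen (P'.toFun '' P'.dom) → ContMDiffOn J 𝓘(ℝ, ℝ^ι) ∞ Q' (P'.toFun '' P'.dom) →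
      (∀ u ∈ P'.dom, Q' (P'.toFun u) = u) →
      ∃ U, IsOpen U ∧ (∀ w ∈ P.dom, w ∈ U ↔ P.toFun w ∈ P'.toFun '' P'.dom) ∧
        C∞ (fun w => Q' (P.toFun w)) (P.dom ∩ U) ∧
        ∀ w ∈ P.dom ∩ U, Q' (P.toFun w) ∈ P'.dom ∧ P'.toFun (Q' (P.toFun w)) = P.toFun w := by
    clear * -
    intro P P' Q' sm hO' hQ' hQl'
    obtain ⟨U, hU, hUe⟩ := continuousOn_iff'.1 sm.continuousOn _ hO'
    have h1 : ∀ w ∈ P.dom, w ∈ U ↔ P.toFun w ∈ P'.toFun '' P'.dom := fun w hw =>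
      ⟨fun h => (hUe.ge ⟨h, hw⟩).1, fun h => (hUe.le ⟨h, hw⟩).1⟩
    refine ⟨U, hU, h1, ?_, fun w hw => ?_⟩
    · rw [← contMDiffOn_iff_contDiffOn]
      exact hQ'.comp (sm.mono inter_subset_left) fun w hw => (h1 w hw.1).1 hw.2
    · obtain ⟨w', hw', he⟩ := (h1 w hw.1).1 hw.2
      rw [← he, hQl' w' hw']
      exact ⟨hw', rfl⟩
  obtain ⟨U, hU, hU1, hU2, hU3⟩ := key sm hO' hQ' hQl'
  obtain ⟨U', hU', hU1', hU2', hU3'⟩ := key sm' hO hQ hQl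
  have a1 : ∀ w ∈ P.dom ∩ U, Q' (P.toFun w) ∈ P'.dom ∩ U' := fun w hw =>
    ⟨(hU3 w hw).1, (hU1' _ (hU3 w hw).1).2 ⟨w, hw.1, (hU3 w hw).2.symm⟩⟩
  have a2 : ∀ w ∈ P'.dom ∩ U', Q (P'.toFun w) ∈ P.dom ∩ U := fun w hw =>
    ⟨(hU3' w hw).1, (hU1 _ (hU3' w hw).1).2 ⟨w, hw.1, (hU3' w hw).2.symm⟩⟩
  refine ⟨fun w => Q' (P.toFun w), fun w => Q (P'.toFun w), U, U', hU, hU',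
    (hU1 v hv).2 ⟨v', hv', he.symm⟩, (hU1' v' hv').2 ⟨v, hv, he⟩, ?_, hU2, hU2', a1, a2, ?_, ?_, ?_⟩
  · simp only [he, hQl' v' hv']
  · intro w hw; simp only [(hU3 w hw).2, hQl w hw.1]
  · intro w hw; simp only [(hU3' w hw).2, hQl' w hw.1]
  · intro w hw; exact (hU3 w hw).2.symm

end Patch

lemma exists_samePoint_prodPatch {P : 𝒫}
    (hP : P.IsLocalParam ((𝓡∂ n).prod (𝓡∂ n))) {v : ℝⁿ} (hv : v ∈ P.dom)
    (C : MChart n p) (C' : MChart n p')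
    (h1 : (P.toFun v).1 ∈ C.U) (h2 : (P.toFun v).2 ∈ C'.U) :
    Patch.SamePoint (P, v)
      (prodPatch C C', elim (C.c (P.toFun v).1) (C'.c (P.toFun v).2)) :=
  hP.samePoint (isLocalParam_prodPatch C C') hv
    (mem_dom_prodPatch.2 ⟨C.c_mem h1, C'.c_mem h2⟩)
    (Prod.ext (C.inv_c h1).symm (C'.inv_c h2).symm)

lemma isGood_of_isLocalParam {P : 𝒫}
    (hP : P.IsLocalParam ((𝓡∂ n).prod (𝓡∂ n))) : P.IsGood (intPairs n M) := by
  refine ⟨fun v hv w hw he => ?_, fun v hv => ?_⟩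
  · obtain ⟨-, -, Q, -, hQ⟩ := hP
    rw [← hQ v (Patch.int_subset_dom _ hv), ← hQ w (Patch.int_subset_dom _ hw), he]
  · obtain ⟨C, -⟩ := exists_halfChart (n := n) (P.toFun v).1
    obtain ⟨C', -⟩ := exists_halfChart (n := n) (P.toFun v).2
    have hs := exists_samePoint_prodPatch hP hv C C' C.mem C'.mem
    have hd := hs.mem_dom hv
    rw [hs.apply_eq hv, prodPatch_mem_intPairs_iff hd, Patch.mem_int_iff hd, Patch.mem_int_iff hv]
    have e1 := hs.exists_zero hv
    have e2 := (hs.symm hv).exists_zero hd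
    constructor
    · intro h j hj h0
      obtain ⟨l, hl, hl0⟩ := e1 ⟨j, hj, h0⟩
      exact h l hl hl0
    · intro h j hj h0
      obtain ⟨l, hl, hl0⟩ := e2 ⟨j, hj, h0⟩
      exact h l hl hl0

/-! ### Model patches -/

/-- The coordinates of the second point in a model patch. -/
def snds (lev : Fin n → ℕ) (m : ℕ) (ν : Fin n → ℕ) (v : ℝⁿ) : 𝔼 := fun j =>
  if j = 0 then v (inl 0) * Real.exp (-(v (inl 0) ^ ν 0 * v (inr 0)))
  else if lev j ≤ m then v (inl j) - v (inl 0) ^ ν j * v (inr j) else v (inr j)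

lemma contDiff_snds (lev : Fin n → ℕ) (m : ℕ) (ν : Fin n → ℕ) :
    ContDiff ℝ ∞ (snds lev m ν) := by
  refine contDiff_pi.2 fun j => ?_
  unfold snds
  have h : ∀ i : Idx n, ContDiff ℝ ∞ fun v : ℝⁿ => v i := fun i => contDiff_apply ℝ ℝ i
  split_ifs
  · exact (h _).mul (((h _).pow _).mul (h _)).neg.exp
  · exact (h _).sub (((h _).pow _).mul (h _))
  · exact h _

lemma snds_zero (lev : Fin n → ℕ) (m : ℕ) (ν : Fin n → ℕ) (v : ℝⁿ) :
    snds lev m ν v 0 =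
      v (inl 0) * Real.exp (-(v (inl 0) ^ ν 0 * v (inr 0))) := if_pos rfl

lemma snds_of_le {lev : Fin n → ℕ} {m : ℕ} {j : Fin n} (hj : j ≠ 0) (hl : lev j ≤ m)
    (ν : Fin n → ℕ) (v : ℝⁿ) : snds lev m ν v j =
      v (inl j) - v (inl 0) ^ ν j * v (inr j) := by
  rw [snds, if_neg hj, if_pos hl]

lemma snds_of_lt {lev : Fin n → ℕ} {m : ℕ} {j : Fin n} (hj : j ≠ 0) (hl : m < lev j)
    (ν : Fin n → ℕ) (v : ℝⁿ) : snds lev m ν v j = v (inr j) := by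
  rw [snds, if_neg hj, if_neg hl.not_ge]

/-- The model patch with coordinates `x, c_j` of the first point, `x ^ (-ν_0) log (x / x')`,
`x ^ (-ν_j) (c_j - c_j')` for `lev j ≤ m`, and `c_j'` for `lev j > m`. -/
def model (lev : Fin n → ℕ) (m : ℕ) (ν : Fin n → ℕ) (C : MChart n p)
    (C' : MChart n p') : 𝒫 where
  toFun v := (C.inv (lft v), C'.inv (snds lev m ν v))
  corners := {inl 0}
  O := lft ⁻¹' ball (C.c p) C.r ∩ snds lev m ν ⁻¹' ball (C'.c p') C'.r
  isOpen := (isOpen_ball.preimage (contDiff_lft (m := 0)).continuous).inter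
    (isOpen_ball.preimage (contDiff_snds lev m ν).continuous)

section Model

variable {lev : Fin n → ℕ} {m : ℕ} {ν : Fin n → ℕ} {C : MChart n p} {C' :
  MChart n p'}

lemma corners_model : (model lev m ν C C').corners = {inl 0} := rfl

lemma mem_dom_model {v : ℝⁿ} :
    v ∈ (model lev m ν C C').dom ↔ lft v ∈ C.D ∧ snds lev m ν v ∈ C'.D := by
  constructor
  · rintro ⟨⟨h1, h2⟩, h3⟩
    have h0 : 0 ≤ v (inl 0) := h3 _ (by simp [model])
    refine ⟨⟨fun j hj => ?_, h1⟩, ⟨fun j hj => ?_, h2⟩⟩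
    · rw [Finset.mem_singleton.1 hj]; exact h0
    · rw [Finset.mem_singleton.1 hj, snds_zero]; exact mul_nonneg h0 (Real.exp_pos _).le
  · rintro ⟨⟨h1, h2⟩, h3, h4⟩
    refine ⟨⟨h2, h4⟩, fun j hj => ?_⟩
    rw [corners_model, Finset.mem_singleton] at hj
    rw [hj]
    exact h1 0 (by simp)

lemma mem_int_model {v : ℝⁿ} :
    v ∈ (model lev m ν C C').int ↔ v ∈ (model lev m ν C C').dom ∧ 0 < v (inl 0) := by
  constructor
  · intro h
    exact ⟨Patch.int_subset_dom _ h, h.2 _ (by simp [model])⟩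
  · rintro ⟨h1, h2⟩
    exact ⟨h1.1, fun j hj => by rw [corners_model, Finset.mem_singleton] at hj; rwa [hj]⟩

lemma contMDiffOn_model : ContMDiffOn 𝓘(ℝ, ℝⁿ) ((𝓡∂ n).prod (𝓡∂ n)) ∞
    (model lev m ν C C').toFun (model lev m ν C C').dom :=
  (C.smooth_inv.comp contDiff_lft.contMDiff.contMDiffOn
    fun _ hv => (mem_dom_model.1 hv).1).prodMk
    (C'.smooth_inv.comp (contDiff_snds lev m ν).contMDiff.contMDiffOn
      fun _ hv => (mem_dom_model.1 hv).2)

lemma isGood_model : (model lev m ν C C').IsGood (intPairs n M) := by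
  refine ⟨fun v hv w hw he => ?_, fun v hv => ?_⟩
  · rw [mem_int_model, mem_dom_model] at hv hw
    have h1 : lft v = lft w := by
      rw [← C.right _ hv.1.1, ← C.right _ hw.1.1]; exact congrArg (fun q => C.c q.1) he
    have h2 : snds lev m ν v = snds lev m ν w := by
      rw [← C'.right _ hv.1.2, ← C'.right _ hw.1.2]; exact congrArg (fun q => C'.c q.2) he
    have hl : ∀ j, v (inl j) = w (inl j) := fun j => congrFun h1 j
    have hx : ∀ N : ℕ, w (inl 0) ^ N ≠ 0 := fun N => pow_ne_zero _ hw.2.ne'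
    funext j
    rcases j with j | j
    · exact hl j
    · have hj := congrFun h2 j
      simp only [snds] at hj
      split_ifs at hj with h0 hm
      · rw [hl 0] at hj
        have := Real.exp_injective (mul_left_cancel₀ hw.2.ne' hj)
        rw [neg_inj] at this
        rw [h0]
        exact mul_left_cancel₀ (hx _) this
      · rw [hl 0, hl j, sub_right_inj] at hj
        exact mul_left_cancel₀ (hx _) hj
      · exact hj
  · have hd := mem_dom_model.1 hv
    rw [mem_int_model, and_iff_right hv, intPairs, mem_prod]
    simp only [model]
    rw [C.inv_mem_interior_iff hd.1, C'.inv_mem_interior_iff hd.2, snds_zero,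
      mul_pos_iff_of_pos_right (Real.exp_pos _)]
    exact and_self_iff

/-- The indices of the coordinates that vanish on the fibre diagonal number `m`. -/
def centre (lev : Fin n → ℕ) (m : ℕ) : Finset (Idx n) :=
  (Finset.univ.filter fun j => lev j ≤ m).map Function.Embedding.inr

lemma mem_centre {j : Idx n} : j ∈ centre lev m ↔ ∃ i, lev i ≤ m ∧ inr i = j := by
  simp [centre]

lemma inr_mem_centre {j : Fin n} : (inr j : Idx n) ∈ centre lev m ↔ lev j ≤ m := by
  simp [centre]

lemma inl_notMem_centre {j : Fin n} : (inl j : Idx n) ∉ centre lev m := by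
  simp [centre]

lemma disjoint_centre : Disjoint (centre lev m) (model lev m ν C C').corners := by
  rw [corners_model, Finset.disjoint_singleton_right]
  exact inl_notMem_centre

lemma snds_blowX {a : ℕ} (h0 : lev 0 ≤ m) (v : ℝⁿ) :
    snds lev m ν (Patch.blowX a {inl 0} (centre lev m) (inl 0) v) =
      snds lev m (fun j => ν j + if lev j ≤ m then a else 0) v := by
  have hl : ∀ j, Patch.blowX a {inl 0} (centre lev m) (inl 0) v (inl j) = v (inl j) :=
    fun j => by
      by_cases hj : j = 0
      · rw [hj, Patch.blowX_self]
      · rw [Patch.blowX_of_notMem _ (by simpa using hj) inl_notMem_centre (by simpa using hj)]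
  funext j
  simp only [snds, hl]
  split_ifs with hj hm
  · rw [Patch.blowX_of_mem_S _ (inr_mem_centre.2 h0) (by simp), pow_add, mul_assoc]
  · rw [Patch.blowX_of_mem_S _ (inr_mem_centre.2 hm) (by simp), pow_add, mul_assoc]
  · rw [Patch.blowX_of_notMem _ (by simp) (mt inr_mem_centre.1 (by assumption)) (by simp)]

lemma lft_blowX {a : ℕ} (v : ℝⁿ) :
    lft (Patch.blowX a {inl 0} (centre lev m) (inl 0) v) = lft v := by
  funext j
  by_cases hj : j = 0
  · rw [hj]; exact Patch.blowX_self v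
  · exact Patch.blowX_of_notMem _ (by simpa using hj) inl_notMem_centre (by simpa using hj)

lemma pullX_model {a : ℕ} (h0 : lev 0 ≤ m) :
    (model lev m ν C C').pullX a {inl 0} (centre lev m) (inl 0) =
      model lev m (fun j => ν j + if lev j ≤ m then a else 0) C C' := by
  simp only [Patch.pullX, model, Patch.mk.injEq]
  refine ⟨?_, trivial, ?_⟩
  · funext v
    simp only [Function.comp_apply, lft_blowX, snds_blowX h0]
  · ext v
    simp only [mem_preimage, mem_inter_iff, lft_blowX, snds_blowX h0]

lemma dom_inter_lift_model {D : Set (M × M)}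
    (hD : ∀ q ∈ C.U, ∀ q' ∈ C'.U, (q, q') ∈ D ↔ ∀ j, lev j ≤ m → C.c q j = C'.c q' j) :
    (model lev m ν C C').dom ∩ (model lev m ν C C').lift D =
      {v | v ∈ (model lev m ν C C').dom ∧ ∀ j ∈ centre lev m, v j = 0} := by
  have key : ∀ v ∈ (model lev m ν C C').int,
      (model lev m ν C C').toFun v ∈ D ↔ ∀ j ∈ centre lev m, v j = 0 := by
    intro v hv
    rw [mem_int_model, mem_dom_model] at hv
    have hx : ∀ N : ℕ, v (inl 0) ^ N ≠ 0 := fun N => pow_ne_zero _ hv.2.ne'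
    change (C.inv _, C'.inv _) ∈ D ↔ _
    rw [hD _ (C.inv_mem _ hv.1.1) _ (C'.inv_mem _ hv.1.2), C.right _ hv.1.1, C'.right _ hv.1.2]
    have : ∀ j, lev j ≤ m → (lft v j = snds lev m ν v j ↔ v (inr j) = 0) := by
      intro j hj
      by_cases h : j = 0
      · subst h
        rw [snds_zero, lft, eq_comm, mul_eq_left₀ hv.2.ne', Real.exp_eq_one_iff,
          neg_eq_zero, mul_eq_zero, or_iff_right (hx _)]
      · rw [snds_of_le h hj, lft, eq_comm, sub_eq_self, mul_eq_zero, or_iff_right (hx _)]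
    constructor
    · intro h j hj
      obtain ⟨i, hi, rfl⟩ := mem_centre.1 hj
      exact (this i hi).1 (h i hi)
    · intro h j hj
      exact (this j hj).2 (h _ (inr_mem_centre.2 hj))
  ext v
  constructor
  · rintro ⟨hv, hvl⟩
    refine ⟨hv, fun j hj => ?_⟩
    have hcl : IsClosed {w : ℝⁿ | w j = 0} := isClosed_eq (continuous_apply j) continuous_const
    exact closure_minimal (fun w hw => (key w hw.1).1 hw.2 j hj) hcl hvl
  · rintro ⟨hv, hvS⟩
    refine ⟨hv, mem_closure_of_tendsto (tendsto_push v (Pi.single (inl 0) 1)) ?_⟩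
    have hO := (tendsto_push v (Pi.single (inl 0) 1)).eventually
      ((model lev m ν C C').isOpen.mem_nhds hv.1)
    filter_upwards [hO, self_mem_nhdsWithin] with t ht ht0
    have ht0 : (0 : ℝ) < t := ht0
    have hi : v + t • Pi.single (inl 0) 1 ∈ (model lev m ν C C').int := by
      refine ⟨ht, fun j hj => ?_⟩
      have := hv.2 j hj
      rw [corners_model, Finset.mem_singleton] at hj
      subst hj
      simp only [Pi.add_apply, Pi.smul_apply, Pi.single_eq_same, smul_eq_mul, mul_one]
      linarith
    refine ⟨hi, (key _ hi).2 fun j hj => ?_⟩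
    have hne : j ≠ inl 0 := fun e => inl_notMem_centre (e ▸ hj)
    simp [hvS j hj, Pi.single_eq_of_ne hne]

end Model

end

lemma LocDiffeo.corner_inj {ι ι' : Type} [Fintype ι] [DecidableEq ι] [Fintype ι']
    [DecidableEq ι'] {C : Finset ι} {C' : Finset ι'} {O : Set ℝ^ι} {O' : Set ℝ^ι'}
    {h : ℝ^ι → ℝ^ι'} {h' : ℝ^ι' → ℝ^ι} (H : LocDiffeo C C' O O' h h') {v : ℝ^ι}
    (hv : v ∈ orth C ∩ O) {l : ι} {j j' : ι'} (hvj : h v j = 0) (hvj' : h v j' = 0)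
    {r r' : ℝ} (hr : 0 < r) (hr' : 0 < r') {c c' : ℝ^ι → ℝ}
    (h1 : ∀ w ∈ orth C ∩ ball v r, 0 < c w ∧ h w j = w l * c w)
    (h2 : ∀ w ∈ orth C ∩ ball v r', 0 < c' w ∧ h w j' = w l * c' w) : j = j' := by
  by_contra hne
  have hcont : Tendsto h' (𝓝[orth C' ∩ O'] (h v)) (𝓝 v) := by
    have := H.smooth'.continuousOn _ (H.maps hv)
    rwa [ContinuousWithinAt, H.left v hv] at this
  have hb : ball v r ∩ ball v r' ∈ 𝓝 v :=
    inter_mem (ball_mem_nhds _ hr) (ball_mem_nhds _ hr')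
  obtain ⟨N, hN, hNs⟩ := mem_nhdsWithin_iff_exists_mem_nhds_inter.1 (hcont hb)
  obtain ⟨w, hw, hwj, hwm⟩ := exists_pos_ne C' (H.maps hv).1 j
    (inter_mem hN (H.isOpen'.mem_nhds (H.maps hv).2))
  have hwO : w ∈ orth C' ∩ O' := ⟨hw.1, hw.2.2⟩
  have hb' := hNs ⟨hw.2.1, hwO⟩
  have hd := H.maps' hwO
  obtain ⟨a1, a2⟩ := h1 _ ⟨hd.1, hb'.1⟩
  obtain ⟨b1, b2⟩ := h2 _ ⟨hd.1, hb'.2⟩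
  rw [H.right w hwO, hwj, hvj, eq_comm, mul_eq_zero, or_iff_left a1.ne'] at a2
  rw [H.right w hwO, a2, zero_mul] at b2
  have := hwm j' (Ne.symm hne)
  rw [hvj', b2] at this
  exact lt_irrefl _ this

/-! ### Orders of the coordinates in the stages of the blow-up -/

/-- The sum of the orders `a_l` with `max 1 (lev j) ≤ l ≤ m`. -/
def nu {n k : ℕ} (a : Fin (k + 1) → ℕ) (lev : Fin n → ℕ) (m : ℕ) (j : Fin n) : ℕ :=
  ∑ l ∈ Finset.univ.filter (fun l : Fin (k + 1) => max 1 (lev j) ≤ (l : ℕ) ∧ (l : ℕ) ≤ m), a l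

section Nu

variable (a) (lev : Fin n → ℕ)

lemma nu_eq_zero {m : ℕ} {j : Fin n} (h : m < max 1 (lev j)) : nu a lev m j = 0 := by
  rw [nu, Finset.filter_false_of_mem, Finset.sum_empty]
  rintro l - ⟨h1, h2⟩
  omega

lemma nu_succ (i : Fin k) : nu a lev (i + 1) =
    fun j => nu a lev i j + if lev j ≤ i + 1 then a i.succ else 0 := by
  funext j
  simp only [nu]
  split_ifs with h
  · have : (Finset.univ.filter fun l : Fin (k + 1) => max 1 (lev j) ≤ (l : ℕ) ∧ (l : ℕ) ≤ i + 1) =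
        insert i.succ (Finset.univ.filter fun l : Fin (k + 1) =>
          max 1 (lev j) ≤ (l : ℕ) ∧ (l : ℕ) ≤ i) := by
      ext l
      simp only [mem_filter, Finset.mem_univ, true_and, Finset.mem_insert, Fin.ext_iff,
        Fin.val_succ]
      omega
    rw [this, Finset.sum_insert (by simp), add_comm]
  · rw [add_zero]
    refine sum_congr ?_ fun _ _ => rfl
    ext l
    simp only [mem_filter, Finset.mem_univ, true_and]
    omega

lemma nu_last (j : Fin n) : nu a lev k j = tailSum a (max 1 (lev j)) := by
  rw [nu, tailSum]
  refine sum_congr ?_ fun _ _ => rfl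
  ext l
  have := l.2
  simp only [mem_filter, Finset.mem_univ, true_and]
  omega

end Nu

/-! ### Relations between the models -/

section Models

variable {lev : Fin n → ℕ} {m : ℕ} {ν : Fin n → ℕ} (C : MChart n p) (C' :
  MChart n p')

/-- Replace `c_j'` by `c_j - c_j'` if `lev j = m`. -/
def flipCoords (lev : Fin n → ℕ) (m : ℕ) (v : ℝⁿ) : ℝⁿ :=
  elim (lft v) fun j =>
    if lev j = m then v (inl j) - v (inr j) else v (inr j)

lemma contDiff_flipCoords (lev : Fin n → ℕ) (m : ℕ) : ContDiff ℝ ∞ (flipCoords lev m) := by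
  have h : ∀ i : Idx n, ContDiff ℝ ∞ fun v : ℝⁿ => v i := fun i => contDiff_apply ℝ ℝ i
  refine contDiff_pi.2 ?_
  rintro (j | j)
  · exact h _
  · simp only [flipCoords, Sum.elim_inr]
    split_ifs
    exacts [(h _).sub (h _), h _]

lemma flipCoords_flipCoords (lev : Fin n → ℕ) (m : ℕ) (v : ℝⁿ) :
    flipCoords lev m (flipCoords lev m v) = v := by
  funext j
  rcases j with j | j
  · rfl
  · simp only [flipCoords, Sum.elim_inr, Sum.elim_inl, lft]
    split_ifs <;> ring

lemma snds_flipCoords (h0 : lev 0 = 0) (hν : ∀ j, lev j = m + 1 → ν j = 0)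
    (v : ℝⁿ) :
    snds lev (m + 1) ν (flipCoords lev (m + 1) v) = snds lev m ν v := by
  funext j
  simp only [snds, flipCoords, Sum.elim_inr, Sum.elim_inl, lft]
  by_cases hj : j = 0
  · simp [hj, h0]
  · simp only [hj, if_false]
    by_cases h1 : lev j ≤ m
    · simp [h1, h1.trans (Nat.le_succ m), (Nat.lt_succ_of_le h1).ne]
    · by_cases h2 : lev j = m + 1
      · simp [h2, hν j h2]
      · have h3 : ¬ lev j ≤ m + 1 := by omega
        simp [h1, h2, h3]

lemma locDiffeo_flipCoords (h0 : lev 0 = 0) (hν : ∀ j, lev j = m + 1 → ν j = 0) :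
    LocDiffeo (model lev m ν C C').corners (model lev (m + 1) ν C C').corners
      (model lev m ν C C').O (model lev (m + 1) ν C C').O (flipCoords lev (m + 1))
      (flipCoords lev (m + 1)) := by
  have hs : ∀ v, snds lev m ν (flipCoords lev (m + 1) v) = snds lev (m + 1) ν v :=
    fun v => by rw [← snds_flipCoords h0 hν, flipCoords_flipCoords]
  refine ⟨(model lev m ν C C').isOpen, (model lev (m + 1) ν C C').isOpen,
    (contDiff_flipCoords _ _).contDiffOn, (contDiff_flipCoords _ _).contDiffOn, fun v hv => ?_,
    fun v hv => ?_, fun v _ => flipCoords_flipCoords _ _ v, fun v _ => flipCoords_flipCoords _ _ v⟩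
  · rw [← Patch.dom_eq, mem_dom_model] at hv ⊢
    rw [snds_flipCoords h0 hν]
    exact hv
  · rw [← Patch.dom_eq, mem_dom_model] at hv ⊢
    rw [hs]
    exact hv

lemma toFun_flipCoords (h0 : lev 0 = 0) (hν : ∀ j, lev j = m + 1 → ν j = 0) (v : ℝⁿ) :
    (model lev m ν C C').toFun v =
      (model lev (m + 1) ν C C').toFun (flipCoords lev (m + 1) v) := by
  simp only [model, snds_flipCoords h0 hν]
  rfl

lemma samePoint_flipCoords (h0 : lev 0 = 0) (hν : ∀ j, lev j = m + 1 → ν j = 0) {v : ℝⁿ}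
    (hv : v ∈ (model lev m ν C C').dom) :
    Patch.SamePoint (model lev m ν C C', v) (model lev (m + 1) ν C C', flipCoords lev (m + 1) v) :=
  Patch.samePoint_of_locDiffeo (locDiffeo_flipCoords C C' h0 hν) subset_rfl subset_rfl hv.1
    ((locDiffeo_flipCoords C C' h0 hν).maps ⟨hv.2, hv.1⟩).2 rfl fun w _ =>
    toFun_flipCoords C C' h0 hν w

/-- The two faces of the corner. -/
def faces (n : ℕ) [NeZero n] : Finset (Idx n) := {inl 0, inr 0}

lemma snds_zero_zero (hlev : ∀ j, lev j = 0 ↔ j = 0) (v : ℝⁿ) (j : Fin n) :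
    snds lev 0 0 v j =
      if j = 0 then v (inl 0) * Real.exp (-v (inr 0)) else v (inr j) := by
  simp only [snds, Pi.zero_apply, pow_zero, one_mul, Nat.le_zero, hlev]
  split_ifs <;> rfl

lemma lft_blowX_corner (v : ℝⁿ) :
    lft (Patch.blowX 1 (faces n) ∅ (inl 0) v) = lft v := by
  funext j
  by_cases hj : j = 0
  · rw [hj]; exact Patch.blowX_self v
  · exact Patch.blowX_of_notMem _ (by simpa [faces] using hj) (Finset.notMem_empty _)
      (by simpa using hj)

lemma rgt_blowX_corner (v : ℝⁿ) (j : Fin n) :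
    rgt (Patch.blowX 1 (faces n) ∅ (inl 0) v) j =
      if j = 0 then v (inl 0) * v (inr 0) else v (inr j) := by
  split_ifs with hj
  · rw [hj]
    exact Patch.blowX_of_mem_R v (by simp [faces]) (Finset.notMem_empty _) (by simp)
  · exact Patch.blowX_of_notMem _ (by simpa [faces] using hj) (Finset.notMem_empty _) (by simp)

lemma rgt_blowX_corner' (v : ℝⁿ) :
    rgt (Patch.blowX 1 (faces n) ∅ (inr 0) v) = rgt v := by
  funext j
  by_cases hj : j = 0
  · rw [hj]; exact Patch.blowX_self v
  · exact Patch.blowX_of_notMem _ (by simpa [faces] using hj) (Finset.notMem_empty _)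
      (by simpa using hj)

lemma lft_blowX_corner' (v : ℝⁿ) (j : Fin n) :
    lft (Patch.blowX 1 (faces n) ∅ (inr 0) v) j =
      if j = 0 then v (inr 0) * v (inl 0) else v (inl j) := by
  split_ifs with hj
  · rw [hj]
    exact Patch.blowX_of_mem_R v (by simp [faces]) (Finset.notMem_empty _) (by simp)
  · exact Patch.blowX_of_notMem _ (by simpa [faces] using hj) (Finset.notMem_empty _) (by simp)

lemma locDiffeo_corner (hlev : ∀ j, lev j = 0 ↔ j = 0) :
    ∃ η η' O', O' ⊆ ((prodPatch C C').pullX 1 (faces n) ∅ (inl 0)).O ∧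
      LocDiffeo (model lev 0 0 C C').corners
        ((prodPatch C C').pullX 1 (faces n) ∅ (inl 0)).corners
        (model lev 0 0 C C').O O' η η' ∧
      (∀ v ∈ (model lev 0 0 C C').dom, (model lev 0 0 C C').toFun v =
        ((prodPatch C C').pullX 1 (faces n) ∅ (inl 0)).toFun (η v)) ∧
      ∀ v, 0 < v (inr 0) → v ∈ ((prodPatch C C').pullX 1 (faces n) ∅ (inl 0)).O →
        v ∈ O' := by
  have hc : ∀ i : Idx n, ContDiff ℝ ∞ fun v : ℝⁿ => v i := fun i => contDiff_apply ℝ ℝ i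
  set η : ℝⁿ → ℝⁿ := fun v j =>
    if j = inr 0 then Real.exp (-v (inr 0)) else v j with hη
  set η' : ℝⁿ → ℝⁿ := fun v j =>
    if j = inr 0 then -Real.log (v (inr 0)) else v j with hη'
  set Q := (prodPatch C C').pullX 1 (faces n) ∅ (inl 0) with hQ
  have e1 : ∀ v, lft (Patch.blowX 1 (faces n) ∅ (inl 0) (η v)) = lft v := fun v => by
    rw [lft_blowX_corner]; funext j; simp [lft, hη]
  have e2 : ∀ v, rgt (Patch.blowX 1 (faces n) ∅ (inl 0) (η v)) =
      snds lev 0 0 v := fun v => by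
    funext j
    rw [rgt_blowX_corner, snds_zero_zero hlev]
    by_cases hj : j = 0 <;> simp [hη, hj]
  have hO : ∀ v, v ∈ (model lev 0 0 C C').O ↔ η v ∈ Q.O := fun v => by
    simp only [model, hQ, Patch.pullX, prodPatch, mem_inter_iff, mem_preimage, e1, e2]
  have r1 : ∀ v, η' (η v) = v := fun v => by
    funext j
    by_cases hj : j = inr 0
    · subst hj; simp [hη, hη']
    · simp [hη, hη', hj]
  have r2 : ∀ v : ℝⁿ, 0 < v (inr 0) → η (η' v) = v := fun v hv => by
    funext j
    by_cases hj : j = inr 0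
    · subst hj; simp [hη, hη', Real.exp_log hv]
    · simp [hη, hη', hj]
  have hQc : Q.corners = {inl 0, inr 0} := rfl
  refine ⟨η, η', Q.O ∩ {v | 0 < v (inr 0)}, inter_subset_left,
    ⟨(model lev 0 0 C C').isOpen, Q.isOpen.inter (isOpen_lt continuous_const (continuous_apply _)),
      ?_, ?_, fun v hv => ?_, fun v hv => ?_, fun v _ => r1 v, fun v hv => r2 v hv.2.2⟩,
    fun v _ => ?_, fun v hv hvO => ⟨hvO, hv⟩⟩
  · refine ContDiff.contDiffOn (contDiff_pi.2 fun j => ?_)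
    simp only [hη]
    split_ifs
    exacts [(hc _).neg.exp, hc _]
  · refine contDiffOn_pi.2 fun j => ?_
    simp only [hη']
    split_ifs
    · exact ((hc _).contDiffOn.log fun v hv => hv.2.2.ne').neg
    · exact (hc _).contDiffOn
  · refine ⟨fun j hj => ?_, (hO v).1 hv.2, by simp [hη, Real.exp_pos]⟩
    rw [hQc] at hj
    simp only [Finset.mem_insert, Finset.mem_singleton] at hj
    rcases hj with rfl | rfl
    · simpa [hη] using hv.1 (inl 0) (by simp [corners_model])
    · simp [hη, (Real.exp_pos _).le]
  · refine ⟨fun j hj => ?_, (hO _).2 (by rw [r2 v hv.2.2]; exact hv.2.1)⟩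
    rw [corners_model, Finset.mem_singleton] at hj
    subst hj
    simpa [hη'] using hv.1 (inl 0) (by simp [hQc])
  · simp only [model, hQ, Patch.pullX, prodPatch, Function.comp_apply, e1, e2]

lemma corner_disjoint {P : 𝒫} : Disjoint (∅ : Finset (Idx n)) P.corners :=
  Finset.disjoint_empty_left _

lemma isGood_prodPatch : (prodPatch C C').IsGood (intPairs n M) :=
  isGood_of_isLocalParam (isLocalParam_prodPatch C C')

lemma exists_samePoint_corner (hlev : ∀ j, lev j = 0 ↔ j = 0) {i : Idx n}
    (hi : i ∈ faces n) {v : ℝⁿ}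
    (hv : v ∈ ((prodPatch C C').pullX 1 (faces n) ∅ i).dom)
    (hoff : ∀ j ∈ faces n, j ≠ i → 0 < v j) :
    ∃ w, Patch.SamePoint ((prodPatch C C').pullX 1 (faces n) ∅ i, v)
      (model lev 0 0 C C', w) := by
  have hc : ∀ i : Idx n, ContDiff ℝ ∞ fun v : ℝⁿ => v i := fun i => contDiff_apply ℝ ℝ i
  simp only [faces, Finset.mem_insert, Finset.mem_singleton] at hi
  rcases hi with rfl | rfl
  · obtain ⟨η, η', O', hO', H, he, hmem⟩ := locDiffeo_corner C C' hlev
    have hvO := hmem v (hoff _ (by simp [faces]) (by simp)) hv.1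
    have hs : Patch.SamePoint (model lev 0 0 C C', η' v) _ := Patch.samePoint_of_locDiffeo H
      subset_rfl hO' (H.maps' ⟨hv.2, hvO⟩).2 hvO (H.right v ⟨hv.2, hvO⟩) fun w hw =>
        he w (by rw [Patch.dom_eq]; exact hw)
    refine ⟨η' v, hs.symm ?_⟩
    rw [Patch.dom_eq]
    exact H.maps' ⟨hv.2, hvO⟩
  · set Q := (prodPatch C C').pullX 1 (faces n) ∅ (inr 0) with hQ
    have hQc : Q.corners = {inl 0, inr 0} := rfl
    set η : ℝⁿ → ℝⁿ := fun v j =>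
      if j = inl 0 then v (inr 0) * v (inl 0)
      else if j = inr 0 then Real.log (v (inl 0)) else v j with hη
    set η' : ℝⁿ → ℝⁿ := fun v j =>
      if j = inl 0 then Real.exp (v (inr 0))
      else if j = inr 0 then v (inl 0) * Real.exp (-v (inr 0)) else v j with hη'
    have e1 : ∀ v : ℝⁿ, lft (η v) = lft (Patch.blowX 1 (faces n) ∅ (inr 0) v) :=
      fun v => by
      funext j
      rw [lft_blowX_corner']
      by_cases hj : j = 0 <;> simp [hη, lft, hj]
    have e2 : ∀ v : ℝⁿ, 0 < v (inl 0) → snds lev 0 0 (η v) =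
        rgt (Patch.blowX 1 (faces n) ∅ (inr 0) v) := fun v hv => by
      funext j
      rw [rgt_blowX_corner', snds_zero_zero hlev]
      by_cases hj : j = 0
      · simp [hη, rgt, hj, Real.exp_neg, Real.exp_log hv, hv.ne']
      · simp [hη, rgt, hj]
    have e1' : ∀ v : ℝⁿ, lft (Patch.blowX 1 (faces n) ∅ (inr 0) (η' v)) = lft v :=
      fun v => by
      funext j
      rw [lft_blowX_corner']
      by_cases hj : j = 0
      · simp [hη', lft, hj, mul_assoc, ← Real.exp_add]
      · simp [hη', lft, hj]
    have e2' : ∀ v : ℝⁿ, rgt (Patch.blowX 1 (faces n) ∅ (inr 0) (η' v)) =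
        snds lev 0 0 v := fun v => by
      funext j
      rw [rgt_blowX_corner', snds_zero_zero hlev]
      by_cases hj : j = 0 <;> simp [hη', rgt, hj]
    have hpos : 0 < v (inl 0) := hoff _ (by simp [faces]) (by simp)
    have hQd : ∀ {w : ℝⁿ}, w ∈ Q.dom → Patch.blowX 1 (faces n) ∅ (inr 0) w ∈
        (prodPatch C C').dom := fun hw =>
      Patch.mem_dom_pullX (by simp [prodPatch]) corner_disjoint hw
    refine ⟨η v, Patch.samePoint_of_maps
      (Patch.isGood_pullX (isGood_prodPatch C C') (by simp [prodPatch]) corner_disjoint) isGood_model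
      hv (O := {v | 0 < v (inl 0)}) (O' := univ) (η' := η')
      (isOpen_lt continuous_const (continuous_apply _)) isOpen_univ hpos (mem_univ _) ?_ ?_
      (fun w hw => ?_) (fun w hw => ?_) (fun w hw => ?_) (fun w hw => ?_)⟩
    · refine contDiffOn_pi.2 fun j => ?_
      simp only [hη]
      split_ifs
      · exact ((hc _).mul (hc _)).contDiffOn
      · exact (hc _).contDiffOn.log fun v hv => hv.2.ne'
      · exact (hc _).contDiffOn
    · refine ContDiff.contDiffOn (contDiff_pi.2 fun j => ?_)
      simp only [hη']
      split_ifs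
      · exact (hc _).exp
      · exact (hc _).mul (hc _).neg.exp
      · exact hc _
    · rw [mem_dom_model, e1, e2 w hw.2]
      exact mem_dom_prodPatch.1 (hQd hw.1)
    · have h1 := mem_dom_model.1 hw.1
      have h2 : Patch.blowX 1 (faces n) ∅ (inr 0) (η' w) ∈ (prodPatch C C').dom := by
        rw [mem_dom_prodPatch, e1', e2']; exact h1
      have h0 : 0 ≤ w (inl 0) := h1.1.1 0 (by simp)
      refine ⟨h2.1, fun j hj => ?_⟩
      change j ∈ ({inl 0, inr 0} : Finset (Idx n)) at hj
      simp only [Finset.mem_insert, Finset.mem_singleton] at hj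
      rcases hj with rfl | rfl
      · simp [hη', (Real.exp_pos _).le]
      · simp [hη', mul_nonneg h0 (Real.exp_pos _).le]
    · simp only [model, Patch.pullX, prodPatch, Function.comp_apply, e1, e2 w hw.2]
    · simp only [model, Patch.pullX, prodPatch, Function.comp_apply, e1', e2']

end Models

section

lemma tendsto_add_single {ι : Type} [Fintype ι] [DecidableEq ι] {P : Patch ι (M × M)} {w : ℝ^ι}
    (hw : w ∈ P.dom) (l : ι) : ∀ᶠ t in 𝓝[>] (0 : ℝ), w + t • Pi.single l 1 ∈ P.dom := by
  filter_upwards [(tendsto_push w (Pi.single l 1)).eventually (P.isOpen.mem_nhds hw.1),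
    self_mem_nhdsWithin] with t ht ht0
  refine ⟨ht, fun j hj => ?_⟩
  have h1 := hw.2 j hj
  have ht0 : (0 : ℝ) < t := ht0
  by_cases hjl : j = l
  · subst hjl
    simp only [Pi.add_apply, Pi.smul_apply, Pi.single_eq_same, smul_eq_mul, mul_one]
    linarith
  · simpa [Pi.single_eq_of_ne hjl] using h1

/-! ### The first stage -/

variable (n M) in
/-- The corner `∂M × ∂M`. -/
def bdryPairs : Set (M × M) :=
  ∂M ×ˢ ∂M

lemma prodPatch_mem_bdryPairs_iff {C : MChart n p}
    {C' : MChart n p'} {v : ℝⁿ} (hv : v ∈ (prodPatch C C').dom) :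
    (prodPatch C C').toFun v ∈ bdryPairs n M ↔ v (inl 0) = 0 ∧ v (inr 0) = 0 := by
  have hd := mem_dom_prodPatch.1 hv
  rw [bdryPairs, mem_prod]
  simp only [prodPatch]
  rw [C.inv_mem_boundary_iff hd.1, C'.inv_mem_boundary_iff hd.2]
  rfl

lemma adapted_prodPatch (C : MChart n p)
    (C' : MChart n p') :
    (prodPatch C C').Adapted univ ((prodPatch C C').toFun ⁻¹' bdryPairs n M) (faces n) ∅ := by
  refine ⟨subset_rfl, corner_disjoint, by simp, ?_⟩
  ext v
  constructor
  · rintro ⟨hv, hv'⟩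
    have := (prodPatch_mem_bdryPairs_iff hv).1 hv'
    refine ⟨hv, fun j hj => ?_, by simp⟩
    simp only [faces, Finset.mem_insert, Finset.mem_singleton] at hj
    rcases hj with rfl | rfl
    exacts [this.1, this.2]
  · rintro ⟨hv, h, -⟩
    exact ⟨hv, (prodPatch_mem_bdryPairs_iff hv).2
      ⟨h _ (by simp [faces]), h _ (by simp [faces])⟩⟩

lemma Patch.Adapted.eq_empty {P : 𝒫} {R S : Finset (Idx n)}
    {Z : Set ℝⁿ} (hA : P.Adapted univ Z R S) {w : ℝⁿ} (hw : w ∈ P.dom) :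
    S = ∅ := by
  by_contra hne
  obtain ⟨j, hj⟩ := Finset.nonempty_iff_ne_empty.2 hne
  have h1 := hA.2.2.1
  rw [inter_univ] at h1
  obtain ⟨t, ht, ht0⟩ := ((tendsto_add_single hw j).and self_mem_nhdsWithin).exists
  have ht0 : (0 : ℝ) < t := ht0
  have e1 := (h1.le hw).2 j hj
  have e2 := (h1.le ht).2 j hj
  simp only [Pi.add_apply, Pi.smul_apply, Pi.single_eq_same, smul_eq_mul, mul_one, e1] at e2
  linarith

lemma exists_samePoint_firstStage {P : 𝒫}
    (hP : P.IsLocalParam ((𝓡∂ n).prod (𝓡∂ n))) {R S : Finset (Idx n)}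
    (hA : P.Adapted univ (P.toFun ⁻¹' bdryPairs n M) R S) {i : Idx n} (hi : i ∈ R) {v : ℝⁿ}
    (hv : v ∈ (P.pullX 1 R S i).dom) (hvi : v i = 0)
    (C : MChart n p) (C' : MChart n p')
    (h1 : ((P.pullX 1 R S i).toFun v).1 ∈ C.U) (h2 : ((P.pullX 1 R S i).toFun v).2 ∈ C'.U) :
    (P.pullX 1 R S i).toFun v ∈ bdryPairs n M ∧ ∃ i' ∈ faces n, ∃ v',
      Patch.SamePoint (P.pullX 1 R S i, v)
        ((prodPatch C C').pullX 1 (faces n) ∅ i', v') ∧ v' i' = 0 := by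
  have hd := Patch.mem_dom_pullX (hA.1 hi) hA.2.1 hv
  have hS : S = ∅ := hA.eq_empty hd
  subst hS
  set w := Patch.blowX 1 R ∅ i v with hw
  have hwR : ∀ j ∈ R, w j = 0 := fun j hj => by
    by_cases hji : j = i
    · rw [hji, hw, Patch.blowX_self, hvi]
    · rw [hw, Patch.blowX_of_mem_R v hj (Finset.notMem_empty _) hji, hvi, zero_mul]
  have hwZ : P.toFun w ∈ bdryPairs n M := (hA.2.2.2.ge ⟨hd, hwR, by simp⟩).2
  have hz := exists_samePoint_prodPatch hP hd C C' h1 h2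
  set Q := prodPatch C C' with hQ
  obtain ⟨O, hO, O', hO', h, h', H, hvO, hvO', hd', hh, he⟩ := hz.exists_locDiffeo hd
  have hw₀ : w ∈ orth P.corners ∩ O := ⟨hd.2, hvO⟩
  have hQc : Q.corners = faces n := rfl
  have hQZ : ∀ u ∈ Q.dom, Q.toFun u ∈ bdryPairs n M → ∀ j ∈ faces n, u j = 0 :=
    fun u hu hub => ((adapted_prodPatch C C').2.2.2.le ⟨hu, hub⟩).2.1
  have hdO : ∀ u ∈ orth P.corners ∩ O, u ∈ P.dom ∧ h u ∈ Q.dom := fun u hu =>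
    ⟨⟨hO hu.2, hu.1⟩, hO' (H.maps hu).2, (H.maps hu).1⟩
  have hw0 : ∀ j ∈ faces n, h w j = 0 := hQZ _ (hdO w hw₀).2 (by rw [← he w hw₀]; exact hwZ)
  obtain ⟨i', hi', hi'0, r, hr, c, hrO, hc, hcf⟩ := H.corner hw₀ (hA.1 hi) (hwR i hi)
  have hmemR : ∀ j ∈ faces n, ∀ l ∈ P.corners, ∀ r > 0, ∀ c : ℝⁿ → ℝ,
      (∀ u ∈ orth P.corners ∩ ball w r, 0 < c u ∧ h u j = u l * c u) → l ∈ R := by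
    intro j hj l hl r hr c hc
    by_contra hlR
    have hb : ∀ᶠ t in 𝓝[>] (0 : ℝ), w + t • Pi.single l 1 ∈ ball w r ∩ O :=
      (tendsto_push w (Pi.single l 1)).eventually
        (inter_mem (ball_mem_nhds _ hr) (H.isOpen.mem_nhds hvO))
    obtain ⟨t, ⟨ht, ht'⟩, ht0⟩ :=
      (((tendsto_add_single hd l).and hb).and self_mem_nhdsWithin).exists
    have ht0 : (0 : ℝ) < t := ht0
    set u := w + t • Pi.single l 1 with hu
    have huR : ∀ j ∈ R, u j = 0 := fun j hj => by
      have hjl : j ≠ l := fun e => hlR (e ▸ hj)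
      simp [hu, hwR j hj, Pi.single_eq_of_ne hjl]
    have huZ : P.toFun u ∈ bdryPairs n M := (hA.2.2.2.ge ⟨ht, huR, by simp⟩).2
    have huO : u ∈ orth P.corners ∩ O := ⟨ht.2, ht'.2⟩
    have e1 := hQZ _ (hdO u huO).2 (by rw [← he u huO]; exact huZ) j hj
    obtain ⟨c1, c2⟩ := hc u ⟨ht.2, ht'.1⟩
    rw [e1, eq_comm, mul_eq_zero, or_iff_left c1.ne'] at c2
    simp only [hu, Pi.add_apply, Pi.smul_apply, Pi.single_eq_same, smul_eq_mul, mul_one] at c2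
    have := hd.2 l hl
    linarith
  have hQi : ∀ j ∈ Q.corners, h w j = 0 := fun j hj => hw0 j hj
  refine ⟨hwZ, i', hi', Patch.samePoint_pullX (isGood_of_isLocalParam hP) (isGood_prodPatch C C')
    one_ne_zero hi hA.1 hA.2.1 hi' subset_rfl corner_disjoint H hO hO' he hv hvi hvO ?_ ?_ (by simp)
    (by simp)⟩
  · intro j hj
    by_cases hji : j = i'
    · subst hji
      exact ⟨i, hi, by simp, r, hr, c, hc.mono (by exact subset_rfl), hcf⟩
    · obtain ⟨l, hl, hl0, r', hr', c', -, hc', hcf'⟩ := H.corner_inv hw₀ hj (hw0 j hj)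
      refine ⟨l, hmemR j hj l hl r' hr' c' hcf', ⟨fun e => ?_, fun e => absurd e hji⟩, r', hr', c',
        hc', hcf'⟩
      subst e
      exact absurd (H.corner_inj hw₀ (hw0 j hj) hi'0 hr' hr hcf' hcf) hji
  · intro j hj
    have hj0 : h' (h w) j = 0 := by rw [H.left w hw₀]; exact hwR j hj
    obtain ⟨l, hl, hl0, r', hr', c', -, hc', hcf'⟩ := H.symm.corner_inv (H.maps hw₀) (hA.1 hj) hj0
    refine ⟨l, hl, ?_, r', hr', c', hc', hcf'⟩
    have hi0 : h' (h w) i = 0 := by rw [H.left w hw₀]; exact hwR i hi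
    obtain ⟨l₁, hl₁, hl₁0, r₁, hr₁, c₁, -, hc₁, hcf₁⟩ :=
      H.symm.corner_inv (H.maps hw₀) (hA.1 hi) hi0
    have hl₁' : l₁ = i' := by
      by_contra hne
      -- a point where only the coordinate `l₁` vanishes
      have hcont : Tendsto h' (𝓝[orth Q.corners ∩ O'] (h w)) (𝓝 w) := by
        have := H.smooth'.continuousOn _ (H.maps hw₀)
        rwa [ContinuousWithinAt, H.left w hw₀] at this
      obtain ⟨N, hN, hNs⟩ := mem_nhdsWithin_iff_exists_mem_nhds_inter.1
        (hcont (ball_mem_nhds w hr))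
      obtain ⟨u, hu, hul, hum⟩ := LocDiffeo.exists_pos_ne Q.corners (H.maps hw₀).1 l₁
        (inter_mem (inter_mem hN (H.isOpen'.mem_nhds (H.maps hw₀).2)) (ball_mem_nhds _ hr₁))
      have huO : u ∈ orth Q.corners ∩ O' := ⟨hu.1, hu.2.1.2⟩
      have hb := hNs ⟨hu.2.1.1, huO⟩
      obtain ⟨a1, a2⟩ := hcf _ ⟨(H.maps' huO).1, hb⟩
      obtain ⟨b1, b2⟩ := hcf₁ u ⟨hu.1, hu.2.2⟩
      rw [hul, hl₁0, zero_mul] at b2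
      rw [H.right u huO, b2, zero_mul] at a2
      have := hum i' (Ne.symm hne)
      rw [hi'0, a2] at this
      exact lt_irrefl _ this
    subst hl₁'
    constructor
    · intro e
      subst e
      exact (H.symm.corner_inj (H.maps hw₀) hj0 hi0 hr' hr₁ hcf' hcf₁)
    · intro e
      subst e
      exact LocDiffeo.corner_unique (H.maps hw₀).1 hl hr₁ hr' hl₁0 hcf₁ hcf'

end

namespace Tower

variable (T) (a)

lemma atlas_zero : T.atlas a 0 = Patch.BlowUp {P | P.IsLocalParam ((𝓡∂ n).prod (𝓡∂ n))}
    (fun _ => univ) (fun P => P.toFun ⁻¹' bdryPairs n M) 1 := rfl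

lemma atlas_succ (i : Fin k) : T.atlas a i.succ =
    Patch.BlowUp (Patch.saturate {P | ∃ o, T.atlas a i.castSucc o P})
      (T.liftDiagonal i.succ) (T.liftBoundary i.succ) (a i.succ) := by
  simp only [atlas, Fin.induction_succ]

lemma fibreDiagonal_mono {i j : Fin (k + 1)} (h : i ≤ j) :
    T.fibreDiagonal j ⊆ T.fibreDiagonal i := fun _ hq =>
  ⟨hq.1, hq.2.1, hq.2.2.1, fun l hl => hq.2.2.2 l (hl.trans h)⟩

variable {T}

namespace Charts

variable (Γ : T.Charts)

lemma lev_zero : Γ.lev 0 = 0 := (Γ.lev_eq_zero 0).2 rfl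

/-- The model patches of the stage `m` of the blow-up. -/
abbrev stage (m : ℕ) (p p' : M) : 𝒫 :=
  model Γ.lev m (nu a Γ.lev m) (Γ p) (Γ p')

/-- The model patches before the blow-up number `m`. -/
abbrev preStage (m : ℕ) (p p' : M) : 𝒫 :=
  model Γ.lev (m + 1) (nu a Γ.lev m) (Γ p) (Γ p')

lemma nu_flip (m : ℕ) (j : Fin n) (h : Γ.lev j = m + 1) : nu a Γ.lev m j = 0 :=
  nu_eq_zero a _ (by omega)

lemma pullX_preStage (i : Fin k) (p p' : M) :
    (Γ.preStage a i p p').pullX (a i.succ) {inl 0} (centre Γ.lev (i + 1)) (inl 0) =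
      Γ.stage a (i + 1) p p' := by
  have h0 : Γ.lev 0 ≤ (i : ℕ) + 1 := by rw [Γ.lev_zero]; exact Nat.zero_le _
  rw [pullX_model h0, stage, nu_succ]

lemma mem_fibreDiagonal_iff {m : Fin (k + 1)} {p p' : M} (hp : p ∈ 𝕌)
    (hp' : p' ∈ 𝕌) (h : T.SameFibre m p p') :
    ∀ q ∈ (Γ p).U, ∀ q' ∈ (Γ p').U, (q, q') ∈ T.fibreDiagonal m ↔
      ∀ j, Γ.lev j ≤ (m : ℕ) → (Γ p).c q j = (Γ p').c q' j := fun q hq q' hq' => by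
  rw [← Γ.same m p p' hp hp' h q hq q' hq']
  exact ⟨fun h => h.2.2, fun h => ⟨Γ.subset p hp hq, Γ.subset p' hp' hq', h⟩⟩

lemma dom_inter_liftDiagonal {m : Fin (k + 1)} {ν : Fin n → ℕ} {p p' : M} (hp : p ∈ 𝕌)
    (hp' : p' ∈ 𝕌) (h : T.SameFibre m p p') :
    (model Γ.lev m ν (Γ p) (Γ p')).dom ∩
      (model Γ.lev m ν (Γ p) (Γ p')).lift (T.fibreDiagonal m) =
    {v | v ∈ (model Γ.lev m ν (Γ p) (Γ p')).dom ∧ ∀ j ∈ centre Γ.lev m, v j = 0} :=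
  dom_inter_lift_model (Γ.mem_fibreDiagonal_iff hp hp' h)

lemma adapted_preStage (i : Fin k) {p p' : M} (hp : p ∈ 𝕌)
    (hp' : p' ∈ 𝕌) (h : T.SameFibre i.succ p p') :
    (Γ.preStage a i p p').Adapted (T.liftDiagonal i.succ (Γ.preStage a i p p'))
      (T.liftBoundary i.succ (Γ.preStage a i p p')) {inl 0} (centre Γ.lev (i + 1)) := by
  have h1 : (Γ.preStage a i p p').dom ∩ T.liftDiagonal i.succ (Γ.preStage a i p p') =
      {u | u ∈ (Γ.preStage a i p p').dom ∧ ∀ j ∈ centre Γ.lev (i + 1), u j = 0} :=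
    Γ.dom_inter_liftDiagonal (m := i.succ) (ν := nu a Γ.lev i) hp hp' h
  refine ⟨subset_rfl, disjoint_centre, h1, ?_⟩
  ext v
  constructor
  · rintro ⟨hv, hvl, j, hj, hj0⟩
    rw [corners_model, Finset.mem_singleton] at hj
    subst hj
    exact ⟨hv, by simpa using hj0, (h1.le ⟨hv, hvl⟩).2⟩
  · rintro ⟨hv, h0, hS⟩
    exact ⟨hv, (h1.ge ⟨hv, hS⟩).2, inl 0, by simp [corners_model], h0 _ (by simp)⟩

/-- Properties of the patches of the stage `m` of the blow-up. -/
structure AtlasFacts (m : Fin (k + 1)) (o : Option (Idx n)) (P : 𝒫) : Prop where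
  good : P.IsGood (intPairs n M)
  smooth : ContMDiffOn 𝓘(ℝ, ℝⁿ) ((𝓡∂ n).prod (𝓡∂ n)) ∞ P.toFun P.dom
  front_mem : ∀ i, o = some i → i ∈ P.corners
  loc : ∀ i, o = some i → ∀ v ∈ P.dom, v i = 0 → OffOtherFaces i P v →
    P.toFun v ∈ bdryPairs n M ∧ T.SameFibre m (P.toFun v).1 (P.toFun v).2 ∧
      ∃ w, Patch.SamePoint (P, v) (Γ.stage a m (P.toFun v).1 (P.toFun v).2, w)
  diag : ∀ v ∈ P.dom, (∃ j ∈ P.corners, v j = 0) → v ∈ P.lift (T.fibreDiagonal m) →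
    ∃ i, o = some i ∧ v i = 0 ∧ OffOtherFaces i P v

lemma _root_.MultiFibred.contMDiffOn_of_mem_saturate {𝒜 : Set (𝒫)}
    (h𝒜 : ∀ P ∈ 𝒜, ContMDiffOn 𝓘(ℝ, ℝⁿ) ((𝓡∂ n).prod (𝓡∂ n)) ∞ P.toFun P.dom)
    {P : 𝒫} (hP : P ∈ Patch.saturate 𝒜) :
    ContMDiffOn 𝓘(ℝ, ℝⁿ) ((𝓡∂ n).prod (𝓡∂ n)) ∞ P.toFun P.dom := by
  obtain ⟨P', hP', h, h', O', hO', H, he⟩ := Patch.exists_of_mem_saturate hP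
  refine ((h𝒜 P' hP').comp (t := P'.dom) (f := h) ?_ fun v hv => ?_).congr he
  · rw [P.dom_eq, contMDiffOn_iff_contDiffOn]; exact H.smooth
  · rw [P.dom_eq] at hv
    exact ⟨hO' (H.maps hv).2, (H.maps hv).1⟩

lemma _root_.MultiFibred.mem_intPairs_or {q : M × M} (h : q ∉ intPairs n M) :
    q.1 ∈ ∂M ∨ q.2 ∈ ∂M := by
  by_contra! hh
  refine h ⟨?_, ?_⟩
  · rw [← ModelWithCorners.compl_boundary]; exact hh.1
  · rw [← ModelWithCorners.compl_boundary]; exact hh.2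

lemma _root_.MultiFibred.continuousWithinAt_mem_closure {D : Set (M × M)}
    {P : 𝒫}
    (hs : ContMDiffOn 𝓘(ℝ, ℝⁿ) ((𝓡∂ n).prod (𝓡∂ n)) ∞ P.toFun P.dom) {v : ℝⁿ}
    (hv : v ∈ P.dom) (hvl : v ∈ P.lift D) : P.toFun v ∈ closure D :=
  ((hs.continuousOn v hv).mono fun _ hw => Patch.int_subset_dom _ hw.1).mem_closure hvl
    fun _ hw => hw.2

lemma mem_bdryPairs {D : Fin (k + 1)} {P : 𝒫}
    (hs : ContMDiffOn 𝓘(ℝ, ℝⁿ) ((𝓡∂ n).prod (𝓡∂ n)) ∞ P.toFun P.dom)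
    (hg : P.IsGood (intPairs n M)) {v : ℝⁿ}
    (hv : v ∈ P.dom) (h0 : ∃ j ∈ P.corners, v j = 0) (hvl : v ∈ P.lift (T.fibreDiagonal D)) :
    P.toFun v ∈ bdryPairs n M ∧ T.SameFibre D (P.toFun v).1 (P.toFun v).2 := by
  have hcl := continuousWithinAt_mem_closure hs hv hvl
  have hn : P.toFun v ∉ intPairs n M := by
    rw [hg.int_iff v hv, Patch.mem_int_iff hv]
    push Not
    exact h0
  have h1 := T.mem_boundary_of_mem_closure (p := (P.toFun v).1) (p' := (P.toFun v).2) hcl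
  have h2 : P.toFun v ∈ bdryPairs n M := by
    rcases mem_intPairs_or hn with h | h
    · exact ⟨h, h1.1 h⟩
    · exact ⟨h1.2 h, h⟩
  exact ⟨h2, T.sameFibre_of_mem_closure hcl (T.boundary_subset h2.1) (T.boundary_subset h2.2)⟩

lemma atlasFacts_zero {o : Option (Idx n)} {P : 𝒫}
    (hP : T.atlas a 0 o P) : Γ.AtlasFacts a 0 o P := by
  rw [atlas_zero] at hP
  have hstage : ∀ p p', Γ.stage a ((0 : Fin (k + 1)) : ℕ) p p' =
      model Γ.lev 0 0 (Γ p) (Γ p') := fun p p' => by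
    have : nu a Γ.lev 0 = 0 := by
      funext j
      exact nu_eq_zero a _ (by simp)
    simp only [stage, Fin.val_zero, this]
  cases hP with
  | off P hP hdis =>
    have hg := isGood_of_isLocalParam hP
    refine ⟨hg, hP.1, by simp, by simp, fun v hv h0 hvl => ?_⟩
    exact absurd (mem_bdryPairs hP.1 hg hv h0 hvl).1 (disjoint_left.1 hdis hv)
  | projX P hP R S hA i hi =>
    have hg := isGood_of_isLocalParam hP
    have hg' := Patch.isGood_pullX (a := 1) (R := R) hg (hA.1 hi) hA.2.1
    have hs' : ContMDiffOn 𝓘(ℝ, ℝⁿ) ((𝓡∂ n).prod (𝓡∂ n)) ∞ (P.pullX 1 R S i).toFun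
        (P.pullX 1 R S i).dom :=
      hP.1.comp (Patch.contDiff_blowX 1 R S i).contMDiff.contMDiffOn fun v hv =>
        Patch.mem_dom_pullX (hA.1 hi) hA.2.1 hv
    -- front face points in product coordinates
    have key : ∀ v ∈ (P.pullX 1 R S i).dom, v i = 0 →
        (P.pullX 1 R S i).toFun v ∈ bdryPairs n M ∧ ∃ i' ∈ faces n, ∃ v',
          Patch.SamePoint (P.pullX 1 R S i, v)
            ((prodPatch (Γ ((P.pullX 1 R S i).toFun v).1)
              (Γ ((P.pullX 1 R S i).toFun v).2)).pullX 1 (faces n) ∅ i', v') ∧ v' i' = 0 :=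
      fun v hv hvi => exists_samePoint_firstStage hP hA hi hv hvi _ _ (HalfChart.mem _)
        (HalfChart.mem _)
    refine ⟨hg', hs', fun j hj => by cases hj; exact hA.1 hi, fun j hj v hv hvi hoff => ?_,
      fun v hv h0 hvl => ?_⟩
    · cases hj
      obtain ⟨hb, i', hi', v', hz, hv'⟩ := key v hv hvi
      obtain ⟨j, hj, hj0, hoff'⟩ := hz.exists_unique_zero hv (hA.1 hi) hvi hoff
      have hij : i' = j := by
        by_contra hne
        exact (hoff' i' hi' hne).ne' hv'
      subst hij
      obtain ⟨w, hw⟩ := exists_samePoint_corner _ _ Γ.lev_eq_zero hi' (hz.mem_dom hv) hoff'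
      refine ⟨hb, ⟨?_, by simp⟩, w, ?_⟩
      · rw [(T.mem_boundary_iff (T.boundary_subset hb.1)).1 hb.1,
          (T.mem_boundary_iff (T.boundary_subset hb.2)).1 hb.2]
      · rw [hstage]; exact hz.trans hv hw
    · have hb := (mem_bdryPairs hs' hg' hv h0 hvl).1
      have hd := Patch.mem_dom_pullX (hA.1 hi) hA.2.1 hv
      have hvi : v i = 0 := by
        have := (hA.2.2.2.le ⟨hd, hb⟩).2.1 i hi
        rwa [Patch.blowX_self] at this
      refine ⟨i, rfl, hvi, ?_⟩
      obtain ⟨-, i', hi', v', hz, hv'⟩ := key v hv hvi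
      have hvl' := hz.mem_lift hv hvl
      have hvd' := hz.mem_dom hv
      have hone : ∀ j ∈ faces n, j ≠ i' → v' j = 1 := by
        intro j hj hne
        refine closure_minimal (s := {v | v ∈ Patch.int _ ∧ Patch.toFun _ v ∈ T.fibreDiagonal 0})
          (t := {w : ℝⁿ | w j = 1}) (fun w hw => ?_)
          (isClosed_eq (continuous_apply j) continuous_const) hvl'
        obtain ⟨hwi, hwD⟩ := hw
        have hc : (prodPatch (Γ ((P.pullX 1 R S i).toFun v).1)
          (Γ ((P.pullX 1 R S i).toFun v).2)).corners = faces n := rfl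
        have hwd := Patch.mem_dom_pullX (a := 1) (R := faces n) (S := ∅)
          (by rw [hc]; exact hi') corner_disjoint (Patch.int_subset_dom _ hwi)
        have hwd' := mem_dom_prodPatch.1 hwd
        have hx := hwD.2.2.1
        have hs1 := T.boundary_subset hb.1
        have hs2 := T.boundary_subset hb.2
        change T.x ((Γ _).inv _) = T.x ((Γ _).inv _) at hx
        rw [← Γ.c_zero _ hs1 _ (Γ.subset _ hs1 ((Γ _).inv_mem _ hwd'.1)),
          ← Γ.c_zero _ hs2 _ (Γ.subset _ hs2 ((Γ _).inv_mem _ hwd'.2)),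
          (Γ _).right _ hwd'.1, (Γ _).right _ hwd'.2] at hx
        have hpos : 0 < w i' := hwi.2 i' hi'
        simp only [faces, Finset.mem_insert, Finset.mem_singleton] at hi' hj
        rcases hi' with rfl | rfl
        · rw [lft_blowX_corner, rgt_blowX_corner, if_pos rfl] at hx
          have hj' : j = inr 0 := hj.resolve_left hne
          subst hj'
          exact mul_left_cancel₀ hpos.ne' (hx.symm.trans (mul_one _).symm)
        · rw [rgt_blowX_corner', lft_blowX_corner', if_pos rfl] at hx
          have hj' : j = inl 0 := hj.resolve_right hne
          subst hj'
          exact mul_left_cancel₀ hpos.ne' (hx.trans (mul_one _).symm)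
      obtain ⟨j₀, hj₀, hj₀0, hoff⟩ := (hz.symm hv).exists_unique_zero hvd' hi' hv'
        fun j hj hne => by rw [hone j hj hne]; exact one_pos
      have hij : i = j₀ := by
        by_contra hne
        exact (hoff i (hA.1 hi) hne).ne' hvi
      subst hij
      exact hoff
  | projY P hP R S hA p hp ε hε =>
    have hg := isGood_of_isLocalParam hP
    have hemp : ∀ v, v ∉ (P.pullY 1 R S p ε).dom := fun v hv => by
      have := hA.eq_empty (Patch.mem_dom_pullY hp hA.2.1 hv)
      rw [this] at hp
      exact absurd hp (Finset.notMem_empty _)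
    refine ⟨⟨fun v hv => absurd (Patch.int_subset_dom _ hv) (hemp v), fun v hv => absurd hv (hemp v)⟩,
      fun v hv => absurd hv (hemp v), ?_, fun _ _ v hv => absurd hv (hemp v),
      fun v hv => absurd hv (hemp v)⟩
    intro i hi
    cases hi
    exact mem_insert_self _ _

end Charts

end Tower

namespace Tower

namespace Charts

variable (Γ : T.Charts)

section Step

variable {i : Fin k} {P : Patch (Idx n) (M × M)} {R S : Finset (Idx n)}

lemma isGood_of_step
    (ih : ∀ o P, T.atlas a i.castSucc o P → Γ.AtlasFacts a i.castSucc o P)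
    (hP : P ∈ Patch.saturate {P | ∃ o, T.atlas a i.castSucc o P}) : P.IsGood (intPairs n M) :=
  Patch.isGood_of_mem_saturate (𝒜 := {P | ∃ o, T.atlas a i.castSucc o P})
    (fun P' h => (ih _ P' h.choose_spec).good) hP

lemma contMDiffOn_of_step
    (ih : ∀ o P, T.atlas a i.castSucc o P → Γ.AtlasFacts a i.castSucc o P)
    (hP : P ∈ Patch.saturate {P | ∃ o, T.atlas a i.castSucc o P}) :
    ContMDiffOn 𝓘(ℝ, ℝⁿ) ((𝓡∂ n).prod (𝓡∂ n)) ∞ P.toFun P.dom :=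
  contMDiffOn_of_mem_saturate (𝒜 := {P | ∃ o, T.atlas a i.castSucc o P})
    (fun P' h => (ih _ P' h.choose_spec).smooth) hP

lemma exists_samePoint_preStage
    (ih : ∀ o P, T.atlas a i.castSucc o P → Γ.AtlasFacts a i.castSucc o P)
    (hP : P ∈ Patch.saturate {P | ∃ o, T.atlas a i.castSucc o P})
    {w : ℝⁿ} (hw : w ∈ P.dom)
    (hwZ : w ∈ T.liftBoundary i.succ P) :
    P.toFun w ∈ bdryPairs n M ∧ T.SameFibre i.succ (P.toFun w).1 (P.toFun w).2 ∧
      (∃ w', Patch.SamePoint (P, w) (Γ.preStage a i (P.toFun w).1 (P.toFun w).2, w') ∧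
        w' (inl 0) = 0) ∧
      ∃ l ∈ P.corners, w l = 0 ∧ ∀ j ∈ P.corners, j ≠ l → 0 < w j := by
  obtain ⟨hwl, hw0⟩ := hwZ
  have hb := mem_bdryPairs (contMDiffOn_of_step Γ ih hP) (isGood_of_step Γ ih hP) hw hw0 hwl
  obtain ⟨P', ⟨o, hP'⟩, v', hz⟩ := Patch.exists_samePoint_of_mem_saturate hP hw
  have hv' := hz.mem_dom hw
  have hF := ih o P' hP'
  obtain ⟨i', ho, hi', hoff⟩ := hF.diag v' hv' (hz.exists_zero hw hw0)
    (Patch.lift_mono (T.fibreDiagonal_mono (Fin.castSucc_lt_succ).le) _ (hz.mem_lift hw hwl))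
  obtain ⟨-, -, w', hz'⟩ := hF.loc i' ho v' hv' hi' hoff
  rw [← hz.apply_eq hw] at hz'
  have hz'' := hz'.trans hv' (samePoint_flipCoords (ν := nu a Γ.lev i) _ _ Γ.lev_zero
    (Γ.nu_flip a _) (hz'.mem_dom hv'))
  have hz₁ := hz.trans hw hz''
  refine ⟨hb.1, hb.2, ⟨_, hz₁, ?_⟩,
    (hz.symm hw).exists_unique_zero hv' (hF.front_mem i' ho) hi' hoff⟩
  obtain ⟨j, hj, hj0⟩ := hz₁.exists_zero hw hw0
  rw [corners_model, Finset.mem_singleton] at hj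
  exact hj ▸ hj0

lemma eq_singleton
    (ih : ∀ o P, T.atlas a i.castSucc o P → Γ.AtlasFacts a i.castSucc o P)
    (hP : P ∈ Patch.saturate {P | ∃ o, T.atlas a i.castSucc o P})
    (hA : P.Adapted (T.liftDiagonal i.succ P) (T.liftBoundary i.succ P) R S)
    {w : ℝⁿ} (hw : w ∈ P.dom) (hR : ∀ j ∈ R, w j = 0)
    (hS : ∀ j ∈ S, w j = 0) :
    w ∈ T.liftBoundary i.succ P ∧ ∃ l, R = {l} ∧ ∀ j ∈ P.corners, j ≠ l → 0 < w j := by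
  have hwZ : w ∈ T.liftBoundary i.succ P := (hA.2.2.2.ge ⟨hw, hR, hS⟩).2
  obtain ⟨-, -, -, l, hl, hl0, hoff⟩ := exists_samePoint_preStage Γ ih hP hw hwZ
  refine ⟨hwZ, l, ?_, hoff⟩
  have hsub : R ⊆ {l} := fun j hj => by
    by_contra hne
    exact (hoff j (hA.1 hj) (by simpa using hne)).ne' (hR j hj)
  rcases Finset.subset_singleton_iff.1 hsub with h | h
  · exfalso
    have hpush := tendsto_push w (fun j => if j ∈ P.corners then (1 : ℝ) else 0)
    obtain ⟨t, ht, ht0⟩ := ((hpush.eventually (P.isOpen.mem_nhds hw.1)).and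
      self_mem_nhdsWithin).exists
    have ht0 : (0 : ℝ) < t := ht0
    set w₁ := w + t • fun j => if j ∈ P.corners then (1 : ℝ) else 0
    have hpos : ∀ j ∈ P.corners, 0 < w₁ j := fun j hj => by
      simp only [w₁, Pi.add_apply, Pi.smul_apply, if_pos hj, smul_eq_mul, mul_one]
      exact add_pos_of_nonneg_of_pos (hw.2 j hj) ht0
    have hw₁ : w₁ ∈ P.dom ∩ T.liftBoundary i.succ P := by
      rw [hA.2.2.2]
      exact ⟨⟨ht, fun j hj => (hpos j hj).le⟩, by simp [h], fun j hj => by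
        have : j ∉ P.corners := Finset.disjoint_left.1 hA.2.1 hj
        simp [w₁, this, hS j hj]⟩
    obtain ⟨-, -, j, hj, hj0⟩ := hw₁
    exact (hpos j hj).ne' hj0
  · exact h

lemma loc_pullX
    (ih : ∀ o P, T.atlas a i.castSucc o P → Γ.AtlasFacts a i.castSucc o P)
    (hP : P ∈ Patch.saturate {P | ∃ o, T.atlas a i.castSucc o P})
    (hA : P.Adapted (T.liftDiagonal i.succ P) (T.liftBoundary i.succ P) R S)
    (ha : a i.succ ≠ 0) {r : Idx n} (hr : r ∈ R) {v : ℝⁿ}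
    (hv : v ∈ (P.pullX (a i.succ) R S r).dom) (hv0 : v r = 0)
    (hoff : OffOtherFaces r (P.pullX (a i.succ) R S r) v) :
    (P.pullX (a i.succ) R S r).toFun v ∈ bdryPairs n M ∧
      T.SameFibre i.succ ((P.pullX (a i.succ) R S r).toFun v).1
        ((P.pullX (a i.succ) R S r).toFun v).2 ∧
      ∃ w, Patch.SamePoint (P.pullX (a i.succ) R S r, v)
        (Γ.stage a (i.succ : Fin (k + 1)) ((P.pullX (a i.succ) R S r).toFun v).1
          ((P.pullX (a i.succ) R S r).toFun v).2, w) := by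
  have hd := Patch.mem_dom_pullX (hA.1 hr) hA.2.1 hv
  have hSC : ∀ j ∈ S, j ≠ r := fun j hj h =>
    Finset.disjoint_left.1 hA.2.1 hj (h ▸ hA.1 hr)
  have hRz : ∀ j ∈ R, Patch.blowX (a i.succ) R S r v j = 0 := fun j hj => by
    by_cases h : j = r
    · rw [h, Patch.blowX_self, hv0]
    · rw [Patch.blowX_of_mem_R v hj (fun h' => Finset.disjoint_left.1 hA.2.1 h' (hA.1 hj)) h, hv0,
        zero_mul]
  have hSz : ∀ j ∈ S, Patch.blowX (a i.succ) R S r v j = 0 := fun j hj => by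
    rw [Patch.blowX_of_mem_S v hj (hSC j hj), hv0, zero_pow ha, zero_mul]
  obtain ⟨hwZ, l, hRl, -⟩ := eq_singleton Γ ih hP hA hd hRz hSz
  obtain ⟨hb, hsame, ⟨w', hz, hw'⟩, -⟩ := exists_samePoint_preStage Γ ih hP hd hwZ
  refine ⟨hb, hsame, ?_⟩
  rw [hRl, Finset.mem_singleton] at hr
  subst hr
  subst hRl
  have hs1 := T.boundary_subset hb.1
  have hs2 := T.boundary_subset hb.2
  obtain ⟨v', hv', -⟩ := Patch.samePoint_pullX_single (isGood_of_step Γ ih hP) isGood_model ha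
    (hA.1 (mem_singleton_self _)) hA.2.1 (by simp [corners_model]) disjoint_centre
    hA.2.2.1 (Γ.adapted_preStage a i hs1 hs2 hsame).2.2.1 hv hv0 hoff hz hw'
  rw [pullX_preStage] at hv'
  exact ⟨v', hv'⟩

end Step

lemma atlasFacts (ha : ∀ i, a i ≠ 0) (m : Fin (k + 1)) :
    ∀ o P, T.atlas a m o P → Γ.AtlasFacts a m o P := by
  induction m using Fin.induction with
  | zero => exact fun o P hP => Γ.atlasFacts_zero a hP
  | succ i ih =>
    intro o P hP
    rw [atlas_succ] at hP
    cases hP with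
    | off P hP hdis =>
      refine ⟨isGood_of_step Γ ih hP, contMDiffOn_of_step Γ ih hP, by simp, by simp,
        fun v hv h0 hvl => absurd ⟨hvl, h0⟩ (disjoint_left.1 hdis hv)⟩
    | projX P hP R S hA r hr =>
      have hg := isGood_of_step Γ ih hP
      have hdom : ∀ v ∈ (P.pullX (a i.succ) R S r).dom, Patch.blowX (a i.succ) R S r v ∈ P.dom :=
        fun v hv => Patch.mem_dom_pullX (hA.1 hr) hA.2.1 hv
      refine ⟨Patch.isGood_pullX hg (hA.1 hr) hA.2.1, (contMDiffOn_of_step Γ ih hP).comp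
        (Patch.contDiff_blowX _ R S r).contMDiff.contMDiffOn hdom,
        fun j hj => by cases hj; exact hA.1 hr, fun j hj v hv hv0 hoff => ?_,
        fun v hv h0 hvl => ⟨r, rfl, ?_⟩⟩
      · cases hj
        exact loc_pullX Γ ih hP hA (ha _) hr hv hv0 hoff
      · have hl : Patch.blowX (a i.succ) R S r v ∈ P.lift (T.fibreDiagonal i.succ) :=
          Patch.mem_lift_of_maps (P := P.pullX (a i.succ) R S r) (P' := P) isOpen_univ
            (Patch.contDiff_blowX _ R S r).continuous.continuousOn
            (fun w hw => (Patch.mem_int_pullX_iff (hA.1 hr) hA.2.1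
              (Patch.int_subset_dom _ hw.1)).2 hw.1) (fun _ _ => rfl) ⟨hv, mem_univ _⟩ hvl
        have h0' : ∃ j ∈ P.corners, Patch.blowX (a i.succ) R S r v j = 0 := by
          have h1 : Patch.blowX (a i.succ) R S r v ∉ P.int := by
            rw [Patch.mem_int_pullX_iff (hA.1 hr) hA.2.1 hv, Patch.mem_int_iff hv]
            push Not
            exact h0
          rw [Patch.mem_int_iff (hdom v hv)] at h1
          push Not at h1
          exact h1
        obtain ⟨-, hRz, hSz⟩ := hA.2.2.2.le ⟨hdom v hv, hl, h0'⟩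
        obtain ⟨-, l, hRl, hoff⟩ := eq_singleton Γ ih hP hA (hdom v hv) hRz hSz
        subst hRl
        rw [Finset.mem_singleton] at hr
        subst hr
        refine ⟨by simpa [Patch.blowX_self] using hRz, fun j hj hne => ?_⟩
        have := hoff j hj hne
        rwa [Patch.blowX_of_notMem v (by simpa using hne)
          (fun h' => Finset.disjoint_left.1 hA.2.1 h' hj) hne] at this
    | projY P hP R S hA q hq ε hε =>
      have hg := isGood_of_step Γ ih hP
      have hε0 : ε ≠ 0 := by rcases hε with rfl | rfl <;> norm_num
      have hdom : ∀ v ∈ (P.pullY (a i.succ) R S q ε).dom,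
          Patch.blowY (a i.succ) R S q ε v ∈ P.dom :=
        fun v hv => Patch.mem_dom_pullY hq hA.2.1 hv
      have hRS : ∀ w ∈ P.dom, (∀ j ∈ R, w j = 0) → (∀ j ∈ S, w j = 0) → ∃ j ∈ P.corners, w j = 0 :=
        fun w hw h h' => (hA.2.2.2.ge ⟨hw, h, h'⟩).2.2
      have hgY := Patch.isGood_pullY (ε := ε) hg (ha i.succ) hε0 hq hA.1 hA.2.1 hRS
      have hSR : Disjoint S R := hA.2.1.mono_right hA.1
      refine ⟨hgY, (contMDiffOn_of_step Γ ih hP).comp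
        (Patch.contDiff_blowY _ R S q ε).contMDiff.contMDiffOn hdom,
        fun j hj => by cases hj; exact mem_insert_self _ _, fun j hj v hv hv0 hoff => ?_,
        fun v hv h0 hvl => ?_⟩
      · cases hj
        obtain ⟨-, l, hRl, -⟩ := eq_singleton Γ ih hP hA (hdom v hv)
          (fun j hj => by simp [Patch.blowY, Finset.disjoint_right.1 hSR hj, hj, hv0]; grind)
          fun j hj => by simp [Patch.blowY, hj, hv0, ha]
        have hl : l ∈ R := by simp [hRl]
        have hlc := hA.1 hl
        have hlq : l ≠ q := fun h => Finset.disjoint_left.1 hSR hq (h ▸ hl)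
        have hgX := Patch.isGood_pullX (a := a i.succ) (R := R) hg hlc hA.2.1
        obtain ⟨w, hz, hw⟩ := Patch.exists_samePoint_pullY (ha i.succ) hl hq hA.1 hA.2.1 hε hgX
          hgY hv (hoff l (Finset.mem_insert_of_mem hlc) hlq)
        rw [hv0, zero_mul] at hw
        obtain ⟨l', hl', hl'0, hoff'⟩ := hz.exists_unique_zero hv (mem_insert_self _ _) hv0
          hoff
        have hll : l = l' := by
          by_contra hne
          exact (hoff' l hlc hne).ne' hw
        subst hll
        obtain ⟨hb, hs, w', hz'⟩ := loc_pullX Γ ih hP hA (ha _) hl (hz.mem_dom hv) hw hoff'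
        rw [← hz.apply_eq hv] at hb hs hz'
        exact ⟨hb, hs, w', hz.trans hv hz'⟩
      · exfalso
        have hemp : {w | w ∈ (P.pullY (a i.succ) R S q ε).int ∧
            (P.pullY (a i.succ) R S q ε).toFun w ∈ T.fibreDiagonal i.succ} = ∅ := by
          refine eq_empty_of_forall_notMem fun w hw => ?_
          have hwd := Patch.int_subset_dom _ hw.1
          have hwi := (Patch.mem_int_pullY_iff (ha i.succ) hq hA.1 hA.2.1 hRS hwd).2 hw.1
          have := (hA.2.2.1.le ⟨hdom w hwd, subset_closure ⟨hwi, hw.2⟩⟩).2 q hq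
          have hpos : 0 < w q := hw.1.2 q (mem_insert_self _ _)
          simp only [Patch.blowY, if_pos] at this
          exact mul_ne_zero hε0 (pow_pos hpos _).ne' this
        rw [Patch.lift, hemp, closure_empty] at hvl
        exact hvl

lemma stage_mem_saturate_zero (p p' : M) :
    T.atlas a 0 (some (inl 0)) ((prodPatch (Γ p) (Γ p')).pullX 1 (faces n) ∅
      (inl 0)) := by
  rw [atlas_zero]
  exact Patch.BlowUp.projX _ (isLocalParam_prodPatch _ _) _ _ (adapted_prodPatch _ _) _
    (by simp [faces])

lemma stage_zero (p p' : M) : Γ.stage a ((0 : Fin (k + 1)) : ℕ) p p' =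
    model Γ.lev 0 0 (Γ p) (Γ p') := by
  have : nu a Γ.lev 0 = 0 := by
    funext j
    exact nu_eq_zero a _ (by simp)
  simp only [stage, Fin.val_zero, this]

lemma stage_mem_atlas_succ {i : Fin k} {p p' : M} (hp : p ∈ 𝕌)
    (hp' : p' ∈ 𝕌) (h : T.SameFibre i.succ p p')
    (hst : Γ.stage a i p p' ∈ Patch.saturate {P | ∃ o, T.atlas a i.castSucc o P}) :
    T.atlas a i.succ (some (inl 0)) (Γ.stage a (i.succ : Fin (k + 1)) p p') := by
  rw [atlas_succ, Fin.val_succ, ← pullX_preStage]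
  refine Patch.BlowUp.projX _ ?_ _ _ (Γ.adapted_preStage a i hp hp' h) _ (by simp)
  have H := (locDiffeo_flipCoords (Γ p) (Γ p') Γ.lev_zero (Γ.nu_flip a i)).symm
  refine Patch.mem_saturate_of_mem_saturate hst subset_rfl H fun v _ => ?_
  have := toFun_flipCoords (Γ p) (Γ p') Γ.lev_zero (Γ.nu_flip a i)
    (flipCoords Γ.lev (i + 1) v)
  rw [flipCoords_flipCoords] at this
  exact this.symm

lemma stage_mem_saturate (m : Fin (k + 1)) {p p' : M} (hp : p ∈ 𝕌)
    (hp' : p' ∈ 𝕌) (h : T.SameFibre m p p') :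
    Γ.stage a m p p' ∈ Patch.saturate {P | ∃ o, T.atlas a m o P} := by
  induction m using Fin.induction with
  | zero =>
    obtain ⟨η, η', O', hO', H, he, -⟩ := locDiffeo_corner (lev := Γ.lev) (Γ p) (Γ p')
      Γ.lev_eq_zero
    rw [stage_zero]
    exact Patch.mem_saturate_of_locDiffeo (P := model Γ.lev 0 0 (Γ p) (Γ p'))
      ⟨_, Γ.stage_mem_saturate_zero p p'⟩ hO' H he
  | succ i ih =>
    exact Patch.subset_saturate _ ⟨some (inl 0), Γ.stage_mem_atlas_succ hp hp' h
      (ih ⟨h.1, fun j hj => h.2 j (hj.trans (Fin.castSucc_lt_succ).le)⟩)⟩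

lemma exists_front_of_stage (m : Fin (k + 1)) {p p' : M} (hp : p ∈ 𝕌)
    (hp' : p' ∈ 𝕌) (h : T.SameFibre m p p') {v : ℝⁿ}
    (hv : v ∈ (Γ.stage a m p p').dom) (hv0 : v (inl 0) = 0) :
    ∃ i P w, T.atlas a m (some i) P ∧ Patch.SamePoint (Γ.stage a m p p', v) (P, w) ∧
      w i = 0 ∧ OffOtherFaces i P w := by
  have huni : ∀ j ∈ (Γ.stage a m p p').corners, j ≠ inl 0 → 0 < v j := fun j hj hne =>
    absurd (Finset.mem_singleton.1 hj) hne
  obtain rfl | ⟨i, rfl⟩ := Fin.eq_zero_or_eq_succ m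
  · obtain ⟨η, η', O', hO', H, he, -⟩ := locDiffeo_corner (lev := Γ.lev) (Γ p) (Γ p')
      Γ.lev_eq_zero
    rw [stage_zero] at hv ⊢
    replace huni : ∀ j ∈ (model Γ.lev 0 0 (Γ p) (Γ p')).corners, j ≠ inl 0 → 0 < v j :=
      huni
    have hv1 : v ∈ (model Γ.lev 0 0 (Γ p) (Γ p')).O := hv.1
    have hmv := H.maps (by rw [← Patch.dom_eq]; exact hv)
    have hz : Patch.SamePoint (model Γ.lev 0 0 (Γ p) (Γ p'), v)
        ((prodPatch (Γ p) (Γ p')).pullX 1 (faces n) ∅ (inl 0), η v) :=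
      Patch.samePoint_of_locDiffeo H subset_rfl hO' hv1 hmv.2 rfl fun w hw =>
        he w (by rw [Patch.dom_eq]; exact hw)
    obtain ⟨j, hj, hj0, hoff⟩ := hz.exists_unique_zero hv (by simp [corners_model]) hv0 huni
    refine ⟨inl 0, _, η v, Γ.stage_mem_saturate_zero p p', hz, ?_⟩
    have hη := hz.mem_dom hv
    have hb := Patch.mem_dom_pullX (a := 1) (R := faces n) (S := ∅) (i := inl 0)
      (P := prodPatch (Γ p) (Γ p')) (by simp [prodPatch]) corner_disjoint hη
    have hq := mem_dom_prodPatch.1 hb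
    have hq1 := hz.apply_eq hv
    have h1 : (Γ p).inv (lft v) = (Γ p).inv (lft (Patch.blowX 1 (faces n) ∅
        (inl 0) (η v))) := congrArg Prod.fst hq1
    have h2 := congrArg (fun q => (Γ p).c q 0) h1
    rw [(Γ p).right _ hq.1, (Γ p).right _ (mem_dom_model.1 hv).1, lft_blowX_corner] at h2
    have h3 : η v (inl 0) = 0 := h2.symm.trans hv0
    refine ⟨h3, ?_⟩
    have hij : inl 0 = j := by
      by_contra hne
      exact (hoff _ (by simp [Patch.pullX, prodPatch]) hne).ne' h3
    subst hij
    exact hoff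
  · refine ⟨inl 0, _, v, ?_, Patch.SamePoint.refl _, hv0, huni⟩
    exact Γ.stage_mem_atlas_succ hp hp' h (Γ.stage_mem_saturate i.castSucc hp hp'
      ⟨h.1, fun j hj => h.2 j (hj.trans (Fin.castSucc_lt_succ).le)⟩)

end Charts

end Tower

/-! ### Derivatives along vector fields -/

lemma contMDiffOn_dirDeriv {V : VField n M} (hV : SmoothField V) {f : M → ℝ} {U : Set M}
    (hU : IsOpen U) (hf : CM∞ f U) :
    CM∞ (dirDeriv V f) U := by
  have h1 := hf.contMDiffOn_tangentMapWithin (m := ∞) (by simp) hU.uniqueMDiffOn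
  have h2 := h1.comp (t := Bundle.TotalSpace.proj ⁻¹' U) (s := U) hV.contMDiffOn fun q hq => hq
  have h3 := (contMDiff_snd_tangentBundle_modelSpace ℝ 𝓘(ℝ, ℝ)).comp_contMDiffOn h2
  refine h3.congr fun q hq => ?_
  exact (congrArg (fun A => A (V q)) (mfderivWithin_of_isOpen (I := 𝓡∂ n) (I' := 𝓘(ℝ, ℝ))
    (f := f) hU hq)).symm

lemma dirDeriv_congr {V : VField n M} {f g : M → ℝ} {q : M} (h : f =ᶠ[𝓝 q] g) :
    dirDeriv V f q = dirDeriv V g q := by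
  unfold dirDeriv
  rw [h.mfderiv_eq]
  rfl

/-- The product of a vector field and a function. -/
def fmul (φ : M → ℝ) (V : VField n M) : VField n M := fun q => φ q • V q

lemma dirDeriv_fmul (φ : M → ℝ) (V : VField n M) (f : M → ℝ) (q : M) :
    dirDeriv (fmul φ V) f q = φ q * dirDeriv V f q := by
  simp only [dirDeriv, fmul]
  exact map_smul _ _ _

lemma dirDeriv_sum {ι : Type*} (s : Finset ι) (V : ι → VField n M) (f : M → ℝ) (q : M) :
    dirDeriv (∑ i ∈ s, V i) f q = ∑ i ∈ s, dirDeriv (V i) f q := by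
  simp only [dirDeriv, Finset.sum_apply]
  exact map_sum _ _ _

lemma dirDeriv_comp {V : VField n M} {f : M → ℝ} {φ : ℝ → ℝ} {q : M} {φ' : ℝ}
    (hφ : HasDerivAt φ φ' (f q)) (hf : MDifferentiableAt (𝓡∂ n) 𝓘(ℝ, ℝ) f q) :
    dirDeriv V (fun p => φ (f p)) q = φ' * dirDeriv V f q := by
  have h1 := hφ.hasFDerivAt.hasMFDerivAt.comp q hf.hasMFDerivAt
  exact (congrArg (fun A => A (V q)) h1.mfderiv).trans (mul_comm (dirDeriv V f q) φ')

lemma SmoothField.fmul {φ : M → ℝ} (hφ : ContMDiff (𝓡∂ n) 𝓘(ℝ, ℝ) ∞ φ) {V : VField n M}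
    (hV : SmoothField V) : SmoothField (fmul φ V) :=
  ContMDiff.smul_section hφ hV

lemma Tower.fmul_mem_fields {φ : M → ℝ}
    (hφ : ContMDiff (𝓡∂ n) 𝓘(ℝ, ℝ) ∞ φ) {V : VField n M} (hV : V ∈ T.fields a) :
    fmul φ V ∈ T.fields a := by
  have key : ∀ {u : M → ℝ} {A : ℕ}, BigO (n := n) 𝕌 T.x (dirDeriv V u) A →
      BigO (n := n) 𝕌 T.x (dirDeriv (fmul φ V) u) A := by
    rintro u A ⟨w, hw, hw'⟩
    refine ⟨fun q => φ q * w q, hφ.contMDiffOn.mul hw, fun q hq => ?_⟩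
    rw [dirDeriv_fmul, hw' q hq]; ring
  exact ⟨hV.1.fmul hφ, fun u hu => key (hV.2.1 u hu), fun i u hu => key (hV.2.2 i u hu)⟩

/-! ### Coordinate vector fields -/

namespace HalfChart

variable (C : MChart n p)

/-- The coordinate vector field number `j`, multiplied by `κ`. -/
def field (κ : M → ℝ) (j : Fin n) : VField n M := fun q =>
  κ q • (mfderivWithin 𝓘(ℝ, 𝔼) (𝓡∂ n) C.inv C.D (C.c q)
    (Pi.single j 1 : 𝔼) : EuclideanSpace ℝ (Fin n))

lemma inv_smooth_within {w : 𝔼} (hw : w ∈ C.D) :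
    MDifferentiableWithinAt 𝓘(ℝ, 𝔼) (𝓡∂ n) C.inv C.D w :=
  (C.smooth_inv w hw).mdifferentiableWithinAt (by simp)

lemma dirDeriv_field (κ : M → ℝ) (j : Fin n) {f : M → ℝ} {q : M} (hq : q ∈ C.U)
    (hf : MDifferentiableAt (𝓡∂ n) 𝓘(ℝ, ℝ) f q) :
    dirDeriv (C.field κ j) f q = κ q * pd C.D (f ∘ C.inv) j (C.c q) := by
  have hcq : C.c q ∈ C.D := C.c_mem hq
  have hi : C.inv (C.c q) = q := C.inv_c hq
  have hu : UniqueMDiffWithinAt 𝓘(ℝ, 𝔼) C.D (C.c q) :=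
    (C.uniqueDiffOn_D _ hcq).uniqueMDiffWithinAt
  have h1 : MDifferentiableAt (𝓡∂ n) 𝓘(ℝ, ℝ) f (C.inv (C.c q)) := by rw [hi]; exact hf
  have h2 := h1.hasMFDerivAt.comp_hasMFDerivWithinAt (C.c q) (C.inv_smooth_within hcq).hasMFDerivWithinAt
  have h3 := h2.mfderivWithin hu
  rw [mfderivWithin_eq_fderivWithin] at h3
  rw [pd, h3]
  have key : ∀ q', q' = q → ∀ v : EuclideanSpace ℝ (Fin n),
      (mfderiv (𝓡∂ n) 𝓘(ℝ, ℝ) f q v : ℝ) = mfderiv (𝓡∂ n) 𝓘(ℝ, ℝ) f q' v := by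
    rintro q' rfl v; rfl
  refine (map_smul (mfderiv (𝓡∂ n) 𝓘(ℝ, ℝ) f q) (κ q) _).trans ?_
  exact congrArg (κ q * ·) (key _ hi _)

lemma smoothField_field {κ : M → ℝ} (hκ : CM∞ κ C.U)
    (hs : tsupport κ ⊆ C.U) (j : Fin n) : SmoothField (C.field κ j) := by
  have hU : UniqueMDiffOn 𝓘(ℝ, 𝔼) C.D := C.uniqueDiffOn_D.uniqueMDiffOn
  have h1 := ContMDiffOn.contMDiffOn_tangentMapWithin (m := ∞) C.smooth_inv (by simp) hU
  have h2 : ContMDiff 𝓘(ℝ, 𝔼) 𝓘(ℝ, 𝔼).tangent ∞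
      (fun w => (⟨w, Pi.single j 1⟩ : TangentBundle 𝓘(ℝ, 𝔼) 𝔼)) :=
    contMDiff_vectorSpace_iff_contDiff.2 contDiff_const
  have h3 := h1.comp (t := Bundle.TotalSpace.proj ⁻¹' C.D) (s := C.U)
    (h2.comp_contMDiffOn C.smooth) fun q hq => C.c_mem hq
  have h4 : ContMDiffOn (𝓡∂ n) (𝓡∂ n).tangent ∞ (fun q => (⟨q, (mfderivWithin 𝓘(ℝ, 𝔼)
      (𝓡∂ n) C.inv C.D (C.c q) (Pi.single j 1 : 𝔼) : EuclideanSpace ℝ (Fin n))⟩ :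
      TangentBundle (𝓡∂ n) M)) C.U := by
    refine h3.congr fun q hq => ?_
    have key : ∀ q' : M, q' = q → ∀ v : EuclideanSpace ℝ (Fin n),
        (⟨q, v⟩ : TangentBundle (𝓡∂ n) M) = ⟨q', v⟩ := by rintro q' rfl v; rfl
    exact key _ (C.inv_c hq) _
  exact ContMDiffOn.smul_section_of_tsupport hκ C.isOpen hs h4

lemma pd_coord {w : 𝔼} (hw : w ∈ C.D) (j l : Fin n) :
    pd C.D ((fun q => C.c q l) ∘ C.inv) j w = if l = j then 1 else 0 := by
  have h : HasFDerivWithinAt ((fun q => C.c q l) ∘ C.inv)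
      (ContinuousLinearMap.proj (R := ℝ) (φ := fun _ : Fin n => ℝ) l) C.D w :=
    ((ContinuousLinearMap.proj (R := ℝ) (φ := fun _ : Fin n => ℝ) l).hasFDerivWithinAt).congr
      (fun w hw => by
        simp only [Function.comp_apply]
        rw [C.right w hw]; rfl) (by
        simp only [Function.comp_apply]
        rw [C.right w hw]; rfl)
  rw [pd, h.fderivWithin (C.uniqueDiffOn_D w hw)]
  simp [Pi.single_apply]

lemma mdifferentiableAt_c {q : M} (hq : q ∈ C.U) (l : Fin n) :
    MDifferentiableAt (𝓡∂ n) 𝓘(ℝ, ℝ) (fun q => C.c q l) q :=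
  ((((contMDiff_pi_space.1 contMDiff_id l).comp_contMDiffOn C.smooth) q hq).contMDiffAt
    (C.isOpen.mem_nhds hq)).mdifferentiableAt (by simp)

lemma eq_sum_field (V : VField n M) {q : M} (hq : q ∈ C.U) :
    V q = ∑ j, dirDeriv V (fun q => C.c q j) q • C.field 1 j q := by
  have hcq : C.c q ∈ C.D := C.c_mem hq
  have hi : C.inv (C.c q) = q := C.inv_c hq
  have h1 : MDifferentiableAt (𝓡∂ n) 𝓘(ℝ, 𝔼) C.c q :=
    ((C.smooth q hq).contMDiffAt (C.isOpen.mem_nhds hq)).mdifferentiableAt (by simp)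
  have f1 := h1.hasMFDerivAt
  have f2 := (C.inv_smooth_within hcq).hasMFDerivWithinAt
  have g2 := HasMFDerivWithinAt.comp q f2 (f1.hasMFDerivWithinAt (s := C.U)) (fun q hq => C.c_mem hq)
  have g2' := g2.hasMFDerivAt (C.isOpen.mem_nhds hq)
  have g3 : HasMFDerivAt (𝓡∂ n) (𝓡∂ n) (C.inv ∘ C.c) q (ContinuousLinearMap.id ℝ _) :=
    (hasMFDerivAt_id q).congr_of_eventuallyEq
      (Filter.eventually_of_mem (C.isOpen.mem_nhds hq) fun q hq => C.inv_c hq)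
  have e2 := hasMFDerivAt_unique g2' g3
  have e3 : (V q : EuclideanSpace ℝ (Fin n)) = mfderivWithin 𝓘(ℝ, 𝔼) (𝓡∂ n) C.inv C.D
      (C.c q) (mfderiv (𝓡∂ n) 𝓘(ℝ, 𝔼) C.c q (V q)) :=
    (congrArg (fun A => A (V q)) e2).symm
  have e4 : ∀ j, (mfderiv (𝓡∂ n) 𝓘(ℝ, 𝔼) C.c q (V q) : 𝔼) j =
      dirDeriv V (fun q => C.c q j) q := fun j => by
    have h5 := ((ContinuousLinearMap.proj (R := ℝ) (φ := fun _ : Fin n => ℝ) j).hasFDerivAt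
      (x := C.c q)).hasMFDerivAt.comp q f1
    rw [dirDeriv]
    have h6 : mfderiv (𝓡∂ n) 𝓘(ℝ, ℝ) (fun q => C.c q j) q = _ := h5.mfderiv
    rw [h6]
    rfl
  have e5 : (mfderiv (𝓡∂ n) 𝓘(ℝ, 𝔼) C.c q (V q) : 𝔼) =
      ∑ j, dirDeriv V (fun q => C.c q j) q • (Pi.single j 1 : 𝔼) := by
    funext j
    rw [e4 j]
    simp [Finset.sum_apply, Pi.single_apply]
  refine e3.trans ((congrArg _ e5).trans ?_)
  refine (map_sum _ _ _).trans (sum_congr rfl fun j _ => (map_smul _ _ _).trans ?_)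
  simp only [field, Pi.one_apply, one_smul]
  rfl

end HalfChart

/-! ### Orders -/

section Orders

variable (a)

lemma tailSum_anti {i j : ℕ} (h : i ≤ j) : tailSum a j ≤ tailSum a i :=
  Finset.sum_le_sum_of_subset fun l hl => by
    simp only [mem_filter, Finset.mem_univ, true_and] at hl ⊢
    omega

lemma tailSum_of_lt {i : ℕ} (h : k < i) : tailSum a i = 0 := by
  refine sum_eq_zero fun l hl => ?_
  simp only [mem_filter, Finset.mem_univ, true_and] at hl
  omega

lemma le_tailSum {i : ℕ} (j : Fin (k + 1)) (h : i ≤ j) : a j ≤ tailSum a i :=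
  single_le_sum (f := a) (fun _ _ => Nat.zero_le _) (by simpa using h)

lemma tailSum_pos (ha : ∀ i, 1 ≤ a i) {i : ℕ} (h : i ≤ k) : 1 ≤ tailSum a i :=
  (ha (Fin.last k)).trans (le_tailSum a (Fin.last k) h)

lemma tailSum_succ (i : Fin (k + 1)) : tailSum a i = a i + tailSum a (i + 1) := by
  have h : (Finset.univ.filter fun j : Fin (k + 1) => (i : ℕ) ≤ j) =
      insert i (Finset.univ.filter fun j : Fin (k + 1) => (i : ℕ) + 1 ≤ j) := by
    ext j
    simp only [mem_filter, Finset.mem_univ, true_and, Finset.mem_insert, Fin.ext_iff]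
    omega
  rw [tailSum, h, Finset.sum_insert (by simp)]
  rfl

lemma tailSum_refineOrder {i : ℕ} (h : i ≤ k) :
    tailSum (refineOrder a) i = tailSum a i + 1 := by
  have hl : Fin.last k ∈ Finset.univ.filter fun j : Fin (k + 1) => i ≤ (j : ℕ) := by simpa using h
  rw [tailSum, tailSum, ← Finset.add_sum_erase _ _ hl, ← Finset.add_sum_erase _ a hl]
  have h1 : refineOrder a (Fin.last k) = a (Fin.last k) + 1 := by simp [refineOrder]
  have h2 : ∀ j ∈ (Finset.univ.filter fun j : Fin (k + 1) => i ≤ (j : ℕ)).erase (Fin.last k),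
      refineOrder a j = a j := fun j hj => by
    rw [refineOrder, Function.update_of_ne (Finset.ne_of_mem_erase hj)]
  rw [h1, sum_congr rfl h2]
  ring

end Orders

lemma pd_eq_zero {O : Set 𝔼} (hO : IsOpen O) {f : 𝔼 → ℝ}
    {j : Fin n} (hj : j ≠ 0) {w : 𝔼} (hw : w ∈ orth {0} ∩ O)
    (h : ∀ t : ℝ, w + t • Pi.single j 1 ∈ orth {0} ∩ O → f (w + t • Pi.single j 1) = f w) :
    pd (orth {0} ∩ O) f j w = 0 := by
  by_cases hf : DifferentiableWithinAt ℝ f (orth {0} ∩ O) w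
  · have hγ : HasDerivAt (fun t : ℝ => w + t • (Pi.single j 1 : 𝔼)) (Pi.single j 1) 0 := by
      simpa using ((hasDerivAt_id (0 : ℝ)).smul_const (Pi.single j 1 : 𝔼)).const_add w
    have hS : ∀ᶠ t in 𝓝 (0 : ℝ), w + t • (Pi.single j 1 : 𝔼) ∈ orth {0} ∩ O := by
      have h1 : Tendsto (fun t : ℝ => w + t • (Pi.single j 1 : 𝔼)) (𝓝 0) (𝓝 w) := by
        have := hγ.continuousAt.tendsto
        simpa using this
      filter_upwards [h1.eventually (hO.mem_nhds hw.2)] with t ht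
      refine ⟨fun l hl => ?_, ht⟩
      rw [Finset.mem_singleton] at hl
      subst hl
      have : (0 : Fin n) ≠ j := hj.symm
      simpa [Pi.single_apply, this] using hw.1 0 (by simp)
    have hf' : HasFDerivWithinAt f (fderivWithin ℝ f (orth {0} ∩ O) w) (orth {0} ∩ O)
        ((fun t : ℝ => w + t • (Pi.single j 1 : 𝔼)) 0) := by
      simpa using hf.hasFDerivWithinAt
    have h2 := hf'.comp_hasDerivWithinAt (0 : ℝ)
      (hγ.hasDerivWithinAt (s := {t : ℝ | w + t • (Pi.single j 1 : 𝔼) ∈ orth {0} ∩ O}))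
      fun t ht => ht
    have h3 := h2.hasDerivAt hS
    have h4 : HasDerivAt (f ∘ fun t : ℝ => w + t • (Pi.single j 1 : 𝔼)) 0 0 :=
      (hasDerivAt_const (0 : ℝ) (f w)).congr_of_eventuallyEq (hS.mono h)
    exact h3.unique h4
  · rw [pd, fderivWithin_zero_of_not_differentiableWithinAt hf]
    rfl

lemma mem_closure_interior (q : M) : q ∈ closure M° := by
  obtain ⟨C, -⟩ := exists_halfChart (n := n) q
  have hcq := C.c_mem C.mem
  have h1 : C.c q ∈ closure (orthInt {0} ∩ ball (C.c q) C.r) :=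
    mem_closure_orthInt_inter isOpen_ball hcq
  have h2 : ContinuousWithinAt C.inv C.D (C.c q) := C.smooth_inv.continuousOn _ hcq
  have h3 := (h2.mono fun w hw => ⟨fun j hj => (hw.1 j hj).le, hw.2⟩).mem_closure h1
    (t := M°) fun w hw =>
      (C.inv_mem_interior_iff ⟨fun j hj => (hw.1 j hj).le, hw.2⟩).2 (hw.1 0 (by simp))
  rwa [C.inv_c C.mem] at h3

lemma eqOn_of_eqOn_interior {U : Set M} (hU : IsOpen U) {f g : M → ℝ} (hf : ContinuousOn f U)
    (hg : ContinuousOn g U) (h : ∀ q ∈ U ∩ M°, f q = g q) : ∀ q ∈ U, f q = g q := by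
  intro q hq
  have h1 : q ∈ closure (U ∩ M°) :=
    hU.inter_closure ⟨hq, mem_closure_interior q⟩
  have h2 : (fun q => f q - g q) q ∈ closure {(0 : ℝ)} :=
    ((hf.sub hg) q hq |>.mono inter_subset_left).mem_closure h1 fun w hw => by
      simp [h w hw]
  rw [closure_singleton, mem_singleton_iff] at h2
  exact sub_eq_zero.1 h2

/-! ### Fibres of the bundle of a module of vector fields -/

section Module

/-- Closed under multiplication by smooth functions. -/
def IsModule (𝒱 : Submodule ℝ (VField n M)) : Prop :=
  ∀ φ : M → ℝ, ContMDiff (𝓡∂ n) 𝓘(ℝ, ℝ) ∞ φ → ∀ V ∈ 𝒱, fmul φ V ∈ 𝒱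

lemma atVal_fmul (h𝒱 : IsModule 𝒱) {φ : M → ℝ} (hφ : ContMDiff (𝓡∂ n) 𝓘(ℝ, ℝ) ∞ φ) (V : 𝒱)
    (q : M) : atVal q (⟨fmul φ V.1, h𝒱 φ hφ _ V.2⟩ : 𝒱) = φ q • atVal q V := by
  rw [atVal, atVal, ← Submodule.Quotient.mk_smul, Submodule.Quotient.eq]
  refine Submodule.subset_span ⟨fun q' => φ q' - φ q, hφ.sub contMDiff_const, sub_self _, V,
    fun q' => ?_⟩
  simp only [Submodule.coe_sub, Submodule.coe_smul, Pi.sub_apply, Pi.smul_apply, fmul, sub_smul]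

lemma atVal_eq_zero {V : 𝒱} {q : M} {N : Set M} (hN : N ∈ 𝓝 q)
    (h : ∀ q' ∈ N, V.1 q' = 0) : atVal q V = 0 := by
  obtain ⟨χ, hχ, hs, N', -, hq, -, h1⟩ := exists_bump (𝓡∂ n) hN
  refine (Submodule.Quotient.mk_eq_zero _).2 (Submodule.subset_span
    ⟨fun q' => 1 - χ q', contMDiff_const.sub hχ, by simp [h1 q hq], V, fun q' => ?_⟩)
  by_cases hq' : q' ∈ N
  · rw [h q' hq', smul_zero]
  · have : χ q' = 0 := by
      by_contra hne
      exact hq' (hs (subset_tsupport _ hne))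
    change V.1 q' = (1 - χ q') • V.1 q'
    rw [this, sub_zero, one_smul]

lemma atVal_congr {V W : 𝒱} {q : M} {N : Set M} (hN : N ∈ 𝓝 q)
    (h : ∀ q' ∈ N, V.1 q' = W.1 q') : atVal q V = atVal q W := by
  have := atVal_eq_zero (V := V - W) hN fun q' hq' => by
    simp only [Submodule.coe_sub, Pi.sub_apply, h q' hq', sub_self]
  rw [atVal, Submodule.Quotient.mk_sub, sub_eq_zero] at this
  exact this

lemma atVal_sum {ι : Type*} (s : Finset ι) (X : ι → 𝒱) (q : M) :
    atVal q (∑ j ∈ s, X j) = ∑ j ∈ s, atVal q (X j) :=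
  map_sum (vanishing 𝒱 q).mkQ X s

lemma atVal_eq_sum (h𝒱 : IsModule 𝒱) {ι : Type*} [Fintype ι] {V : 𝒱} {X : ι → 𝒱}
    {v : ι → M → ℝ} {N : Set M} (hN : IsOpen N)
    (hv : ∀ j, CM∞ (v j) N)
    (h : ∀ q ∈ N, V.1 q = ∑ j, v j q • (X j).1 q) {q : M} (hq : q ∈ N) :
    atVal q V = ∑ j, v j q • atVal q (X j) := by
  choose g hg N' hN' hgv using fun j => exists_global_extension (I := 𝓡∂ n) hN hq (hv j)
  have h1 : atVal q V = atVal q (∑ j, (⟨fmul (g j) (X j).1, h𝒱 _ (hg j) _ (X j).2⟩ : 𝒱)) := by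
    refine atVal_congr (N := N ∩ ⋂ j, N' j)
      (inter_mem (hN.mem_nhds hq) (iInter_mem.2 hN')) fun q' hq' => ?_
    rw [h q' hq'.1, Submodule.coe_sum, Finset.sum_apply]
    exact sum_congr rfl fun j _ => by
      simp only [fmul, hgv j q' (mem_iInter.1 hq'.2 j)]
  rw [h1, atVal_sum]
  refine sum_congr rfl fun j _ => ?_
  rw [atVal_fmul h𝒱 (hg j), hgv j q (mem_of_mem_nhds (hN' j))]

end Module

/-- `σ` is the symbol of `f`, to the order `A` with respect to `x`, on `U`: `V f = x ^ A σ(V)` for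
all the vector fields of the structure. -/
structure IsSymbol {𝒱 : Submodule ℝ (VField n M)} (x : M → ℝ) (U : Set M) (f : M → ℝ) (A : ℕ)
    (σ : ACoField 𝒱) : Prop where
  smooth : CM∞ f (U ∩ M°)
  smooth_val : ∀ V : 𝒱, CM∞ (fun q => σ q (atVal q V)) U
  eq : ∀ V : 𝒱, ∀ q ∈ U ∩ M°, dirDeriv V.1 f q = x q ^ A * σ q (atVal q V)

lemma IsSymbol.mono {𝒱 : Submodule ℝ (VField n M)} {x : M → ℝ} {U U' : Set M} {f : M → ℝ} {A : ℕ}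
    {σ : ACoField 𝒱} (h : IsSymbol x U f A σ) (hU : U' ⊆ U) : IsSymbol x U' f A σ :=
  ⟨h.smooth.mono (inter_subset_inter_left _ hU), fun V => (h.smooth_val V).mono hU,
    fun V q hq => h.eq V q ⟨hU hq.1, hq.2⟩⟩

lemma exists_symbol {𝒱 : Submodule ℝ (VField n M)} {x : M → ℝ} {U : Set M} (hU : IsOpen U)
    {f : M → ℝ} {A : ℕ} (hx : ∀ q ∈ U ∩ M°, x q ≠ 0)
    (hf : CM∞ f (U ∩ M°))
    (h : ∀ V : 𝒱, ∃ w : M → ℝ, CM∞ w U ∧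
      ∀ q ∈ U ∩ M°, dirDeriv V.1 f q = x q ^ A * w q) :
    ∃ σ : ACoField 𝒱, IsSymbol x U f A σ := by
  classical
  choose w hw hfw using h
  have hx' : ∀ q ∈ U ∩ M°, x q ^ A ≠ 0 := fun q hq => pow_ne_zero _ (hx q hq)
  have hadd : ∀ V W : 𝒱, ∀ q ∈ U, w (V + W) q = w V q + w W q := fun V W =>
    eqOn_of_eqOn_interior hU (hw _).continuousOn ((hw V).continuousOn.add (hw W).continuousOn)
      fun q hq => mul_left_cancel₀ (hx' q hq) (by
        rw [← hfw _ q hq, Submodule.coe_add, dirDeriv_add, hfw V q hq, hfw W q hq]; ring)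
  have hsmul : ∀ (c : ℝ) (V : 𝒱), ∀ q ∈ U, w (c • V) q = c * w V q := fun c V =>
    eqOn_of_eqOn_interior hU (hw _).continuousOn (continuousOn_const.mul (hw V).continuousOn)
      fun q hq => mul_left_cancel₀ (hx' q hq) (by
        rw [← hfw _ q hq, Submodule.coe_smul, dirDeriv_smul, hfw V q hq]; ring)
  let L : ∀ q, 𝒱 →ₗ[ℝ] ℝ := fun q => if hq : q ∈ U then
    { toFun := fun V => w V q
      map_add' := fun V W => hadd V W q hq
      map_smul' := fun c V => hsmul c V q hq } else 0
  have hL : ∀ q ∈ U, ∀ V, L q V = w V q := fun q hq V => by simp [L, hq]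
  have hker : ∀ q, vanishing 𝒱 q ≤ LinearMap.ker (L q) := fun q => by
    refine Submodule.span_le.2 ?_
    rintro W ⟨φ, hφ, hφq, V, hV⟩
    by_cases hq : q ∈ U
    · have h1 : w W q = φ q * w V q :=
        eqOn_of_eqOn_interior hU (hw _).continuousOn
          (show ContinuousOn (fun q => φ q * w V q) U from
            hφ.continuous.continuousOn.mul (hw V).continuousOn)
          (fun q hq => mul_left_cancel₀ (hx' q hq) (by
            have : dirDeriv W.1 f q = φ q * dirDeriv V.1 f q := by
              rw [← dirDeriv_fmul]
              simp only [dirDeriv, fmul, hV q]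
              rfl
            rw [← hfw _ q hq, this, hfw V q hq]; ring)) q hq
      rw [hφq, zero_mul] at h1
      change L q W = 0
      rw [hL q hq, h1]
    · change L q W = 0
      simp [L, hq]
  refine ⟨fun q => (vanishing 𝒱 q).liftQ (L q) (hker q), hf, fun V => (hw V).congr fun q hq => ?_,
    fun V q hq => ?_⟩
  · exact ((vanishing 𝒱 q).liftQ_apply _ _).trans (hL q hq V)
  · rw [hfw V q hq, ← hL q hq.1]
    rfl

lemma HalfChart.field_apply
    {p : M}
    (C : MChart n p) (κ : M → ℝ) (j : Fin n) (q : M) :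
    C.field κ j q = κ q • C.field 1 j q :=
  congrArg (κ q • ·) (one_smul ℝ _).symm

namespace Tower

lemma isModule_fields : IsModule (T.fields a) := fun _ hφ _ hV => fmul_mem_fields hφ hV

namespace Charts

variable (Γ : T.Charts)

/-- The weight of the coordinate number `j`. -/
def wt (a : Fin (k + 1) → ℕ) (j : Fin n) : ℕ := tailSum a (Γ.lev j)

lemma wt_zero : Γ.wt a 0 = tailSum a 0 := by rw [wt, Γ.lev_zero]

lemma wt_of_lt {j : Fin n} (h : k < Γ.lev j) : Γ.wt a j = 0 := tailSum_of_lt a h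

lemma one_le_wt (ha : ∀ i, 1 ≤ a i) {j : Fin n} (h : Γ.lev j ≤ k) : 1 ≤ Γ.wt a j :=
  tailSum_pos a ha h

lemma contMDiffOn_c {p : M} (hp : p ∈ 𝕌) (j : Fin n) :
    CM∞ (fun q => (Γ p).c q j) 𝕌 :=
  (contMDiff_pi_space.1 contMDiff_id j).comp_contMDiffOn (Γ.smooth p hp)

lemma exists_coeff {V : VField n M} (hV : V ∈ T.fields a) {p : M} (hp : p ∈ 𝕌)
    (j : Fin n) : ∃ w : M → ℝ, CM∞ w 𝕌 ∧
      ∀ q ∈ 𝕌, dirDeriv V (fun q => (Γ p).c q j) q = T.x q ^ Γ.wt a j * w q := by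
  have hcong : ∀ f : M → ℝ, (∀ q ∈ 𝕌, (Γ p).c q j = f q) → ∀ q ∈ 𝕌,
      dirDeriv V (fun q => (Γ p).c q j) q = dirDeriv V f q := fun f hf q hq =>
    dirDeriv_congr (Filter.eventually_of_mem (T.emb.open_source.mem_nhds hq) hf)
  rcases h : Γ.lev j with _ | i
  · obtain ⟨w, hw, hw'⟩ := hV.2.1 id contDiff_id
    refine ⟨w, hw, fun q hq => ?_⟩
    rw [hcong T.x (fun q hq => by rw [(Γ.lev_eq_zero j).1 h]; exact Γ.c_zero p hp q hq) q hq, wt, h]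
    exact hw' q hq
  · rcases lt_or_ge i k with hi | hi
    · obtain ⟨u, hu, hcu⟩ := Γ.pull ⟨i, hi⟩ p j hp h.le
      obtain ⟨w, hw, hw'⟩ := hV.2.2 ⟨i, hi⟩ u hu
      refine ⟨w, hw, fun q hq => ?_⟩
      rw [hcong _ hcu q hq, wt, h]
      exact hw' q hq
    · refine ⟨_, contMDiffOn_dirDeriv hV.1 T.emb.open_source (Γ.contMDiffOn_c hp j), fun q _ => ?_⟩
      rw [Γ.wt_of_lt (by omega), pow_zero, one_mul]

lemma c_mdifferentiableAt {p : M} (hp : p ∈ 𝕌) {f : M → ℝ}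
    (hf : CM∞ f 𝕌) {q : M} (hq : q ∈ (Γ p).U) :
    MDifferentiableAt (𝓡∂ n) 𝓘(ℝ, ℝ) f q :=
  ((hf q (Γ.subset p hp hq)).contMDiffAt
    (T.emb.open_source.mem_nhds (Γ.subset p hp hq))).mdifferentiableAt (by simp)

section Frame

variable {χ : M → ℝ}

lemma frame_eq_zero (hs : tsupport χ ⊆ (Γ p).U) (κ : M → ℝ) (j : Fin n) {q : M}
    (hq : q ∉ (Γ p).U) : (Γ p).field (fun q => χ q * κ q) j q = 0 := by
  have : χ q = 0 := by
    by_contra hne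
    exact hq (hs (subset_tsupport _ hne))
  rw [HalfChart.field_apply, this, zero_mul, zero_smul]

lemma smoothField_frame (hp : p ∈ 𝕌) (hχ : ContMDiff (𝓡∂ n) 𝓘(ℝ, ℝ) ∞ χ)
    (hs : tsupport χ ⊆ (Γ p).U) (A : ℕ) (j : Fin n) :
    SmoothField ((Γ p).field (fun q => χ q * T.x q ^ A) j) := by
  refine (Γ p).smoothField_field ?_ ((tsupport_mul_subset_left).trans hs) j
  exact hχ.contMDiffOn.mul ((T.contMDiffOn_x.mono (Γ.subset p hp)).pow A)

lemma bigO_frame (hp : p ∈ 𝕌) (hχ : ContMDiff (𝓡∂ n) 𝓘(ℝ, ℝ) ∞ χ)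
    (hs : tsupport χ ⊆ (Γ p).U) {f : M → ℝ}
    (hf : CM∞ f 𝕌) {A B : ℕ} {j : Fin n}
    (h : A ≤ B ∨ (j ≠ 0 ∧ ∀ q ∈ (Γ p).U, ∀ q' ∈ (Γ p).U,
      (∀ l, l ≠ j → (Γ p).c q l = (Γ p).c q' l) → f q = f q')) :
    BigO (n := n) 𝕌 T.x
      (dirDeriv ((Γ p).field (fun q => χ q * T.x q ^ B) j) f) A := by
  rcases h with h | ⟨hj, h⟩
  · refine ⟨_, contMDiffOn_dirDeriv (Γ.smoothField_frame hp hχ hs (B - A) j) T.emb.open_source hf,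
      fun q hq => ?_⟩
    rw [← dirDeriv_fmul (fun q => T.x q ^ A)]
    simp only [dirDeriv, fmul]
    congr 1
    rw [HalfChart.field_apply, HalfChart.field_apply _ (fun q => χ q * T.x q ^ (B - A)), smul_smul]
    congr 1
    rw [← pow_sub_mul_pow (T.x q) h]
    ring
  · refine ⟨fun _ => 0, contMDiffOn_const, fun q hq => ?_⟩
    rw [mul_zero]
    by_cases hqU : q ∈ (Γ p).U
    · rw [(Γ p).dirDeriv_field _ j hqU (Γ.c_mdifferentiableAt hp hf hqU)]
      have hcq := (Γ p).c_mem hqU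
      have := pd_eq_zero isOpen_ball (f := f ∘ (Γ p).inv) hj hcq fun t ht => by
        refine h _ ((Γ p).inv_mem _ ht) _ ((Γ p).inv_mem _ hcq) fun l hl => ?_
        rw [(Γ p).right _ ht, (Γ p).right _ hcq]
        simp [hl]
      rw [HalfChart.D, this, mul_zero]
    · rw [dirDeriv, Γ.frame_eq_zero hs _ j hqU]
      exact map_zero _

lemma frame_mem_fields (hp : p ∈ 𝕌) (hχ : ContMDiff (𝓡∂ n) 𝓘(ℝ, ℝ) ∞ χ)
    (hs : tsupport χ ⊆ (Γ p).U) (a : Fin (k + 1) → ℕ) (j : Fin n) :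
    (Γ p).field (fun q => χ q * T.x q ^ Γ.wt a j) j ∈ T.fields a := by
  refine ⟨Γ.smoothField_frame hp hχ hs _ j, fun u hu => ?_, fun i u hu => ?_⟩
  · refine Γ.bigO_frame hp hχ hs (hu.contMDiff.comp_contMDiffOn T.contMDiffOn_x) ?_
    by_cases hj : j = 0
    · exact Or.inl (by rw [hj, wt_zero])
    · refine Or.inr ⟨hj, fun q hq q' hq' h => ?_⟩
      have := h 0 (Ne.symm hj)
      rw [Γ.c_zero p hp q (Γ.subset p hp hq), Γ.c_zero p hp q' (Γ.subset p hp hq')] at this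
      exact congrArg u this
  · refine Γ.bigO_frame hp hχ hs (hu.comp_contMDiffOn (T.contMDiffOn_proj _)) ?_
    by_cases hj : Γ.lev j ≤ i + 1
    · exact Or.inl (tailSum_anti a hj)
    · refine Or.inr ⟨fun h => hj (by rw [h, Γ.lev_zero]; omega), fun q hq q' hq' h => ?_⟩
      exact congrArg u (((Γ.same i.succ p p hp hp ⟨rfl, fun _ _ => rfl⟩ q hq q' hq').2 fun l hl =>
        h l fun hlj => hj (by rw [← hlj]; simpa using hl)).2 i le_rfl)

end Frame

/-- A local frame of the bundle of a structure, and the dual coframe. -/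
structure Frame {𝒱 : Submodule ℝ (VField n M)} (a : Fin (k + 1) → ℕ) (p : M) where
  N : Set M
  isOpen : IsOpen N
  mem : p ∈ N
  subset : N ⊆ (Γ p).U
  X : Fin n → 𝒱
  X_eq : ∀ q ∈ N, ∀ j, (X j).1 q = (Γ p).field (fun q => T.x q ^ Γ.wt a j) j q
  X_mem : ∀ j, k < Γ.lev j → ∀ b, (X j).1 ∈ T.fields b
  β : Fin n → ACoField 𝒱
  smooth_β : ∀ j (V : 𝒱),
    CM∞ (fun q => β j q (atVal q V)) 𝕌
  β_eq : ∀ j (V : 𝒱), ∀ q ∈ 𝕌,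
    dirDeriv V.1 (fun q => (Γ p).c q j) q = T.x q ^ Γ.wt a j * β j q (atVal q V)

lemma x_pos {q : M} (hq : q ∈ 𝕌 ∩ M°) : 0 < T.x q :=
  (T.mem_interior_iff hq.1).1 hq.2

lemma exists_frame {𝒱 : Submodule ℝ (VField n M)} (h𝒱 : T.fields a = 𝒱) {p : M}
    (hp : p ∈ 𝕌) : Nonempty (Γ.Frame (𝒱 := 𝒱) a p) := by
  subst h𝒱
  obtain ⟨χ, hχ, hs, N, hN, hpN, hNU, h1⟩ :=
    exists_bump (𝓡∂ n) ((Γ p).isOpen.mem_nhds (Γ p).mem)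
  have hβ : ∀ j, ∃ σ : ACoField _, IsSymbol T.x _
      (fun q => (Γ p).c q j) (Γ.wt a j) σ := fun j =>
    exists_symbol T.emb.open_source (fun q hq => (x_pos hq).ne')
      ((Γ.contMDiffOn_c hp j).mono inter_subset_left) fun V => by
        obtain ⟨w, hw, hw'⟩ := Γ.exists_coeff V.2 hp j
        exact ⟨w, hw, fun q hq => hw' q hq.1⟩
  choose β hβ using hβ
  refine ⟨⟨N, hN, hpN, hNU, fun j => ⟨_, Γ.frame_mem_fields hp hχ hs a j⟩, fun q hq j => ?_,
    fun j hj b => ?_, β, fun j => (hβ j).smooth_val, fun j V => ?_⟩⟩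
  · refine (HalfChart.field_apply _ (fun q => χ q * T.x q ^ Γ.wt a j) j q).trans ?_
    rw [HalfChart.field_apply _ (fun q => T.x q ^ Γ.wt a j), h1 q hq, one_mul]
  · have h2 : Γ.wt a j = Γ.wt b j := by rw [Γ.wt_of_lt hj, Γ.wt_of_lt hj]
    simpa only [h2] using Γ.frame_mem_fields hp hχ hs b j
  · exact eqOn_of_eqOn_interior T.emb.open_source
      (contMDiffOn_dirDeriv V.2.1 T.emb.open_source (Γ.contMDiffOn_c hp j)).continuousOn
      ((T.contMDiffOn_x.continuousOn.pow _).mul ((hβ j).smooth_val V).continuousOn)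
      ((hβ j).eq V)

namespace Frame

variable {Γ} (F : Γ.Frame (𝒱 := 𝒱) a p)

lemma mem_source (hp : p ∈ 𝕌) {q : M} (hq : q ∈ F.N) : q ∈ 𝕌 :=
  Γ.subset p hp (F.subset hq)

lemma dirDeriv_X (j : Fin n) {q : M} (hq : q ∈ F.N) {f : M → ℝ}
    (hf : MDifferentiableAt (𝓡∂ n) 𝓘(ℝ, ℝ) f q) : dirDeriv (F.X j).1 f q =
      T.x q ^ Γ.wt a j * pd (Γ p).D (f ∘ (Γ p).inv) j ((Γ p).c q) := by
  rw [← (Γ p).dirDeriv_field (fun q => T.x q ^ Γ.wt a j) j (F.subset hq) hf]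
  simp [dirDeriv, F.X_eq q hq]
  rfl

lemma β_X (hp : p ∈ 𝕌) (j l : Fin n) {q : M} (hq : q ∈ F.N) :
    F.β j q (atVal q (F.X l)) = if j = l then 1 else 0 := by
  refine eqOn_of_eqOn_interior (n := n) F.isOpen
    ((F.smooth_β j _).continuousOn.mono fun q hq => F.mem_source hp hq)
    continuousOn_const (fun q hq => ?_) q hq
  have hqs := F.mem_source hp hq.1
  have hx := x_pos ⟨hqs, hq.2⟩
  have h1 := F.β_eq j (F.X l) q hqs
  rw [F.dirDeriv_X l hq.1 ((Γ p).mdifferentiableAt_c (F.subset hq.1) j),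
    (Γ p).pd_coord ((Γ p).c_mem (F.subset hq.1))] at h1
  split_ifs at h1 ⊢ with h
  · subst h
    exact mul_left_cancel₀ (pow_pos hx _).ne' h1.symm
  · exact (mul_eq_zero.1 (h1.symm.trans (mul_zero _))).resolve_left (pow_pos hx _).ne'

lemma eq_sum_X (hp : p ∈ 𝕌) (V : 𝒱) {q : M} (hq : q ∈ F.N) :
    V.1 q = ∑ j, F.β j q (atVal q V) • (F.X j).1 q := by
  rw [(Γ p).eq_sum_field V.1 (F.subset hq)]
  refine sum_congr rfl fun j _ => ?_
  rw [F.X_eq q hq j, F.β_eq j V q (F.mem_source hp hq),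
    HalfChart.field_apply _ (fun q => T.x q ^ Γ.wt a j), smul_smul, mul_comm]

lemma eq_sum (h𝒱 : IsModule 𝒱) (hp : p ∈ 𝕌) {q : M} (hq : q ∈ F.N) (α : AT 𝒱 q) :
    α = ∑ j, F.β j q α • atVal q (F.X j) := by
  obtain ⟨V, rfl⟩ := Submodule.Quotient.mk_surjective _ α
  exact atVal_eq_sum h𝒱 F.isOpen
    (fun j => (F.smooth_β j V).mono fun q hq => F.mem_source hp hq)
    (fun q hq => F.eq_sum_X hp V hq) hq

lemma mem_ANormal_iff (h𝒱 : IsModule 𝒱) (ha : ∀ i, 1 ≤ a i) (hp : p ∈ 𝕌) {q : M}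
    (hq : q ∈ F.N) (hx : T.x q = 0) (α : AT 𝒱 q) :
    α ∈ ANormal 𝒱 q ↔ ∀ j, k < Γ.lev j → F.β j q α = 0 := by
  constructor
  · intro h j hj
    obtain ⟨V, rfl⟩ := Submodule.Quotient.mk_surjective _ α
    have h1 : V.1 q = 0 := h
    have h2 := F.β_eq j V q (F.mem_source hp hq)
    rw [Γ.wt_of_lt hj, pow_zero, one_mul, dirDeriv, h1] at h2
    exact h2.symm.trans (map_zero _)
  · intro h
    rw [F.eq_sum h𝒱 hp hq α]
    refine Submodule.sum_mem _ fun j _ => ?_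
    rcases lt_or_ge k _ with hj | hj
    · rw [h j hj, zero_smul]; exact Submodule.zero_mem _
    · refine Submodule.smul_mem _ _ ?_
      have h1 : (F.X j).1 q = 0 := by
        rw [F.X_eq q hq j]
        rw [HalfChart.field_apply, hx, zero_pow (by have := Γ.one_le_wt ha hj; omega), zero_smul]
      exact h1

end Frame

end Charts

end Tower

/-! ### Paths -/

section Path

/-- The starting point of the path with parameters `v`. -/
def pstart (v : ℝⁿ) : 𝔼 := fun j =>
  if j = 0 then v (inl 0) * Real.exp (-v (inr 0)) else v (inr j)

/-- A path from `pstart v` to `lft v`. -/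
def path (v : ℝⁿ) (t : ℝ) : 𝔼 := fun j =>
  if j = 0 then v (inl 0) * Real.exp (-((1 - t) * v (inr 0)))
  else v (inr j) + t * (v (inl j) - v (inr j))

/-- The total variation of the coordinates along the path. -/
def pathIncr (v : ℝⁿ) (j : Fin n) : ℝ :=
  if j = 0 then v (inr 0) else v (inl j) - v (inr j)

lemma path_zero (v : ℝⁿ) : path v 0 = pstart v := by
  funext j
  simp [path, pstart]

lemma path_one (v : ℝⁿ) : path v 1 = lft v := by
  funext j
  by_cases h : j = 0 <;> simp [path, lft, h]

lemma contDiff_path : ContDiff ℝ ∞ (Function.uncurry (path : ℝⁿ → ℝ → 𝔼)) := by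
  rw [contDiff_pi]
  intro j
  unfold path
  by_cases h : j = 0 <;> simp [Function.uncurry_def, h, if_true, if_false] <;> fun_prop

lemma contDiff_pstart : ContDiff ℝ ∞ (pstart : ℝⁿ → 𝔼) := by
  rw [contDiff_pi]
  intro j
  unfold pstart
  by_cases h : j = 0 <;> simp [h, if_true, if_false] <;> fun_prop

/-- The parameters of the paths in a ball. -/
def pathDom (c : 𝔼) (ρ : ℝ) : Set ℝⁿ :=
  {v | lft v ∈ ball c ρ ∧ pstart v ∈ ball c ρ}

lemma isOpen_pathDom (c : 𝔼) (ρ : ℝ) : IsOpen (pathDom c ρ) :=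
  (isOpen_ball.preimage (contDiff_lft (m := 0)).continuous).inter
    (isOpen_ball.preimage (contDiff_pstart.continuous))

lemma path_mem {c : 𝔼} {ρ : ℝ} {v : ℝⁿ} (hv : v ∈ orth {inl 0} ∩ pathDom c ρ)
    {t : ℝ} (ht : t ∈ Icc (0 : ℝ) 1) : path v t ∈ orth {0} ∩ ball c ρ := by
  have hx : 0 ≤ v (inl 0) := hv.1 _ (by simp)
  have hρ := (dist_nonneg).trans_lt (mem_ball.1 hv.2.1)
  have h1 := (dist_pi_lt_iff hρ).1 (mem_ball.1 hv.2.1)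
  have h2 := (dist_pi_lt_iff hρ).1 (mem_ball.1 hv.2.2)
  refine ⟨fun j hj => ?_, mem_ball.2 ((dist_pi_lt_iff hρ).2 fun j => ?_)⟩
  · rw [Finset.mem_singleton] at hj
    simp [path, hj, if_true]
    positivity
  · have hoc := (convex_ball (c j) ρ).ordConnected
    refine mem_ball.1 (hoc.uIcc_subset (mem_ball.2 (h2 j)) (mem_ball.2 (h1 j)) ?_)
    by_cases h : j = 0
    · subst h
      rcases le_total 0 (v (inr 0)) with h0 | h0
      · refine mem_uIcc.2 (Or.inl ⟨mul_le_mul_of_nonneg_left (Real.exp_le_exp.2 ?_) hx, ?_⟩)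
        · nlinarith [ht.1, ht.2]
        · exact mul_le_of_le_one_right hx (Real.exp_le_one_iff.2 (by nlinarith [ht.1, ht.2]))
      · refine mem_uIcc.2 (Or.inr ⟨?_, mul_le_mul_of_nonneg_left (Real.exp_le_exp.2 ?_) hx⟩)
        · exact le_mul_of_one_le_right hx (Real.one_le_exp (by nlinarith [ht.1, ht.2]))
        · nlinarith [ht.1, ht.2]
    · simp [path, pstart, lft, h, if_false]
      rcases le_total (v (inr j)) (v (inl j)) with h0 | h0
      · exact mem_uIcc.2 (Or.inl ⟨by nlinarith [ht.1, ht.2], by nlinarith [ht.1, ht.2]⟩)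
      · exact mem_uIcc.2 (Or.inr ⟨by nlinarith [ht.1, ht.2], by nlinarith [ht.1, ht.2]⟩)

lemma hasDerivAt_path (v : ℝⁿ) (t : ℝ) :
    HasDerivAt (path v) (fun j => pathIncr v j * if j = 0 then path v t 0 else 1) t := by
  rw [hasDerivAt_pi]
  intro j
  by_cases h : j = 0
  · subst h
    have h1 : HasDerivAt (fun t : ℝ => -((1 - t) * v (inr 0))) (v (inr 0)) t := by
      exact (((hasDerivAt_id t).const_sub 1).mul_const _).neg.congr_deriv (by simp)
    simp [path, pathIncr, if_true]
    exact (h1.exp.const_mul (v (inl 0))).congr_deriv (by ring)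
  · simp [path, pathIncr, h, if_false, mul_one]
    simpa using ((hasDerivAt_id t).mul_const _).const_add
      (v (inr j))

end Path

namespace Tower.Charts

variable (Γ : T.Charts)

/-- The exponents of the projective coordinates. -/
def ex (a : Fin (k + 1) → ℕ) (j : Fin n) : ℕ := tailSum a (max 1 (Γ.lev j))

lemma ex_zero : Γ.ex a 0 = tailSum a 1 := by rw [ex, Γ.lev_zero]; rfl

lemma wt_zero_eq (ha₀ : a 0 = 1) : Γ.wt a 0 = Γ.ex a 0 + 1 := by
  rw [wt_zero, ex_zero, show 0 = ((0 : Fin (k + 1)) : ℕ) from rfl, tailSum_succ, ha₀]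
  simp [add_comm]

lemma ex_of_ne {j : Fin n} (hj : j ≠ 0) : Γ.ex a j = Γ.wt a j := by
  rw [ex, max_eq_right (Nat.one_le_iff_ne_zero.2 fun h => hj ((Γ.lev_eq_zero j).1 h)), wt]

namespace Frame

variable {Γ} (F : Γ.Frame (𝒱 := 𝒱) a p)

/-- The averages of the symbol over the paths. -/
def avg (σ : ACoField 𝒱) (A : ℕ) (j : Fin n) (v : ℝⁿ) : ℝ :=
  ∫ t in (0 : ℝ)..1, Real.exp ((1 - t) * v (inr 0) * ((Γ.ex a j : ℝ) - A)) *
    σ ((Γ p).inv (path v t)) (atVal ((Γ p).inv (path v t)) (F.X j))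

variable {U : Set M} {f : M → ℝ} {A : ℕ} {σ : ACoField 𝒱} {ρ : ℝ}

lemma contDiffOn_symbol (hσ : IsSymbol T.x U f A σ) (hρr : ρ ≤ (Γ p).r)
    (hρ : ∀ w ∈ orth {0} ∩ ball ((Γ p).c p) ρ, (Γ p).inv w ∈ F.N ∩ U) (j : Fin n) :
    C∞ (fun w => σ ((Γ p).inv w) (atVal ((Γ p).inv w) (F.X j)))
      (orth {0} ∩ ball ((Γ p).c p) ρ) := by
  rw [← contMDiffOn_iff_contDiffOn]
  exact (hσ.smooth_val (F.X j)).comp ((Γ p).smooth_inv.mono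
    (inter_subset_inter_right _ (ball_subset_ball hρr))) fun w hw => (hρ w hw).2

lemma contDiffOn_avg (hσ : IsSymbol T.x U f A σ) (hρr : ρ ≤ (Γ p).r)
    (hρ : ∀ w ∈ orth {0} ∩ ball ((Γ p).c p) ρ, (Γ p).inv w ∈ F.N ∩ U) (j : Fin n) :
    C∞ (F.avg σ A j) (orth {inl 0} ∩ pathDom ((Γ p).c p) ρ) := by
  refine contDiffOn_integral_orth (isOpen_pathDom _ _) ?_
  have h1 := (F.contDiffOn_symbol hσ hρr hρ j).comp (contDiff_path).contDiffOn
    (s := (orth _ ∩ pathDom _ ρ) ×ˢ Icc 0 1)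
    fun z hz => path_mem hz.1 hz.2
  refine ContDiffOn.mul ?_ h1
  refine ContDiff.contDiffOn ?_
  fun_prop

lemma path_formula (ha₀ : a 0 = 1) (hp : p ∈ 𝕌) (hU : IsOpen U)
    (hσ : IsSymbol T.x U f A σ) (hρr : ρ ≤ (Γ p).r)
    (hρ : ∀ w ∈ orth {0} ∩ ball ((Γ p).c p) ρ, (Γ p).inv w ∈ F.N ∩ U)
    {v : ℝⁿ} (hv : v ∈ orth {inl 0} ∩ pathDom ((Γ p).c p) ρ)
    (hx : 0 < v (inl 0)) :
    f ((Γ p).inv (lft v)) - f ((Γ p).inv (pstart v)) =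
      v (inl 0) ^ A * ∑ j, pathIncr v j / v (inl 0) ^ Γ.ex a j * F.avg σ A j v := by
  set C := Γ p with hC
  set K := {w : 𝔼 | 0 < w 0} ∩ ball (C.c p) ρ with hK
  have hKo : IsOpen K :=
    (isOpen_lt continuous_const (continuous_apply 0)).inter isOpen_ball
  have hKD' : K ⊆ orth {0} ∩ ball (C.c p) ρ := fun w hw =>
    ⟨fun j hj => by rw [Finset.mem_singleton] at hj; rw [hj]; exact hw.1.le, hw.2⟩
  have hKD : K ⊆ C.D := hKD'.trans (inter_subset_inter_right _ (ball_subset_ball hρr))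
  have hKi : ∀ w ∈ K, C.inv w ∈ U ∩ M° := fun w hw =>
    ⟨(hρ w (hKD' hw)).2, (C.inv_mem_interior_iff (hKD hw)).2 hw.1⟩
  have hsm : C∞ (f ∘ C.inv) K := by
    rw [← contMDiffOn_iff_contDiffOn]
    exact hσ.smooth.comp (C.smooth_inv.mono hKD) hKi
  have hpath : ∀ t ∈ Icc 0 1, path v t ∈ K := fun t ht => by
    refine ⟨?_, (path_mem hv ht).2⟩
    simp only [mem_ofPred_eq, path, if_true]
    positivity
  have hpd : ∀ w ∈ K, ∀ j, w 0 ^ Γ.wt a j * pd K (f ∘ C.inv) j w =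
      w 0 ^ A * σ (C.inv w) _ := fun w hw j => by
    have hi := hKi w hw
    have hN := (hρ w (hKD' hw)).1
    have hxw : T.x (C.inv w) = w 0 := by
      rw [← Γ.c_zero p hp _ (F.mem_source hp hN), ← hC, C.right w (hKD hw)]
    have h1 := hσ.eq (F.X j) _ hi
    have hio : IsOpen M° := ModelWithCorners.isOpen_interior (n := ∞) (by simp)
    rw [F.dirDeriv_X j hN (((hσ.smooth _ hi).contMDiffAt ((hU.inter hio).mem_nhds hi)).mdifferentiableAt (by simp)), ← hC, C.right w (hKD hw), hxw] at h1
    rw [← h1, pd, pd, fderivWithin_of_isOpen hKo hw,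
      fderivWithin_of_mem_nhds (mem_of_superset (hKo.mem_nhds hw) hKD)]
  have hint := sub_eq_integral_path (hsm.differentiableOn (by simp))
    ((hsm.continuousOn_fderivWithin hKo.uniqueDiffOn (by simp)))
    hpath (fun t _ => hasDerivAt_path v t) (by
      refine (continuous_pi fun j => continuous_const.mul ?_).continuousOn
      by_cases h : j = 0
      · simp only [h, if_true]
        exact ((continuous_apply 0).comp (contDiff_path (n := n)).continuous).comp
          (Continuous.prodMk_right v)
      · simp only [h, if_false]; exact continuous_const)
  rw [path_one, path_zero] at hint
  refine hint.trans ?_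
  have hterm : ∀ t ∈ Icc (0 : ℝ) 1, fderivWithin ℝ (f ∘ C.inv) K (path v t)
      (fun j => pathIncr v j * if j = 0 then path v t 0 else 1) =
      ∑ j, v (inl 0) ^ A * (pathIncr v j / v (inl 0) ^ Γ.ex a j *
        (Real.exp ((1 - t) * v (inr 0) * ((Γ.ex a j) - A)) *
        σ (C.inv (path v t)) (atVal (C.inv (path v t)) (F.X j)))) := fun t ht => by
    rw [fderivWithin_eq_sum_pd]
    refine sum_congr rfl fun j _ => ?_
    have hx0 : path v t 0 = v (inl 0) * Real.exp (-((1 - t) * v (inr 0))) := by simp [path]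
    set E := Real.exp (-((1 - t) * v (inr 0))) with hE
    have hEpos : 0 < E := Real.exp_pos _
    have hexp : Real.exp ((1 - t) * v (inr 0) * ((Γ.ex a j : ℝ) - A)) =
        E ^ A / E ^ Γ.ex a j := by
      rw [eq_div_iff (pow_pos hEpos _).ne', hE, ← Real.exp_nat_mul, ← Real.exp_nat_mul,
        ← Real.exp_add]
      congr 1; ring
    have hp1 := hpd _ (hpath t ht) j
    rw [hx0, mul_pow, mul_pow] at hp1
    rw [hexp]
    set s := σ (C.inv (path v t)) _
    set x := v (inl 0)
    by_cases hj : j = 0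
    · subst hj
      rw [if_pos rfl, hx0]
      rw [Γ.wt_zero_eq ha₀] at hp1
      field_simp
      rw [pow_succ, pow_succ] at hp1
      linear_combination pathIncr v 0 * hp1
    · rw [if_neg hj]
      rw [Γ.ex_of_ne hj]
      field_simp
      linear_combination pathIncr v j * hp1
  have hcont : ∀ j, ContinuousOn (fun t => Real.exp ((1 - t) * v (inr 0) *
      ((Γ.ex a j) - A)) * σ (C.inv (path v t)) (atVal (C.inv (path v t)) (F.X j)))
      (Icc (0 : ℝ) 1) := fun j => by
    refine ContinuousOn.mul (Continuous.continuousOn (by fun_prop)) ?_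
    exact (F.contDiffOn_symbol hσ hρr hρ j).continuousOn.comp
      ((contDiff_path (n := n)).continuous.comp (Continuous.prodMk_right v)).continuousOn
      fun t ht => hKD' (hpath t ht)
  rw [intervalIntegral.integral_congr (g := fun t => ∑ j, v (inl 0) ^ A *
    (pathIncr v j / v (inl 0) ^ Γ.ex a j *
        (Real.exp _ *
        σ (C.inv (path v t)) (atVal (C.inv (path v t)) (F.X j)))))
    (fun t ht => hterm t (by rwa [uIcc_of_le zero_le_one] at ht)),
    intervalIntegral.integral_finsetSum fun j _ => ?_, mul_sum]
  · refine sum_congr rfl fun j _ => ?_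
    rw [intervalIntegral.integral_const_mul, intervalIntegral.integral_const_mul]
    rfl
  · refine ContinuousOn.intervalIntegrable ?_
    rw [uIcc_of_le zero_le_one]
    exact continuousOn_const.mul (continuousOn_const.mul (hcont j))

end Frame

end Tower.Charts

lemma contDiff_sumElim {E : Type*} [NormedAddCommGroup E] [NormedSpace ℝ E]
    {s : Set E} {f g : E → 𝔼} (hf : C∞ f s) (hg : C∞ g s) :
    C∞ (fun v => (elim (f v) (g v) : ℝⁿ)) s := by
  rw [contDiffOn_pi]
  rintro (j | j)
  · exact contDiffOn_pi.1 hf j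
  · exact contDiffOn_pi.1 hg j

lemma mem_orth_faces {v : ℝⁿ} :
    v ∈ orth (faces n) ↔ 0 ≤ v (inl 0) ∧ 0 ≤ v (inr 0) := by
  simp [orth, faces]

namespace Tower.Charts

variable (Γ : T.Charts)

/-- The difference quotients of order `A` of `f` along the fibres, between neighbourhoods of `p` and
`p'`, are given by the smooth function `R`. -/
structure IsQuot (f : M → ℝ) (A : ℕ) (p p' : M) (O : Set ℝⁿ)
    (R : ℝⁿ → ℝ) : Prop where
  isOpen : IsOpen O
  mem : (elim ((Γ p).c p) ((Γ p').c p') : ℝⁿ) ∈ O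
  smooth : C∞ R (orth (faces n) ∩ O)
  eq : ∀ w w' : 𝔼, (elim w w' : ℝⁿ) ∈ O → (∀ j, Γ.lev j ≤ k → w j = w' j) →
    0 < w 0 → w ∈ (Γ p).D ∧ w' ∈ (Γ p').D ∧
      f ((Γ p).inv w) - f ((Γ p').inv w') = w 0 ^ A * R (elim w w')

namespace IsQuot

variable {Γ} {f : M → ℝ} {A : ℕ} {O O' : Set (Idx n → ℝ)} {R R' : (Idx n → ℝ) → ℝ}

lemma symm (h : Γ.IsQuot f A p p' O R) : ∃ O R, Γ.IsQuot f A p' p O R := by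
  have hs : ContDiff ℝ ∞ (fun v => (elim (rgt v) (lft v) : ℝⁿ)) :=
    contDiffOn_univ.1 (contDiff_sumElim contDiff_rgt.contDiffOn contDiff_lft.contDiffOn)
  refine ⟨_,
    fun v => -R _, h.isOpen.preimage hs.continuous, h.mem,
    (h.smooth.comp hs.contDiffOn fun v hv => ⟨?_, hv.2⟩).neg, fun w w' hw hb h0 => ?_⟩
  · have := mem_orth_faces.1 hv.1
    exact mem_orth_faces.2 ⟨this.2, this.1⟩
  · have h00 := hb 0 (by rw [Γ.lev_zero]; exact Nat.zero_le _)
    obtain ⟨h1, h2, h3⟩ := h.eq w' w hw (fun j hj => (hb j hj).symm) (h00 ▸ h0)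
    refine ⟨h2, h1, ?_⟩
    have : f ((Γ p').inv w) - f ((Γ p).inv w') =
      -(f ((Γ p).inv w') - f ((Γ p').inv w)) := by ring
    rw [this, h3, h00]
    simp only [mul_neg]
    rfl

lemma trans (h : Γ.IsQuot f A p p' O R) (h' : Γ.IsQuot f A p' p'' O' R')
    (hb : ∀ j, Γ.lev j ≤ k → (Γ p).c p j = (Γ p').c p' j) :
    ∃ O R, Γ.IsQuot f A p p'' O R := by
  set m : ℝⁿ → 𝔼 := fun v j =>
    if Γ.lev j ≤ k then v (inl j) else (Γ p').c p' j with hm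
  have hms : ContDiff ℝ ∞ m := by
    rw [contDiff_pi]
    intro j
    by_cases hj : Γ.lev j ≤ k <;> simp [hm, hj, if_true, if_false] <;> fun_prop
  have h0k : Γ.lev 0 ≤ k := by rw [Γ.lev_zero]; exact Nat.zero_le _
  have hm0 : ∀ v, m v 0 = v (inl 0) := fun v => by simp [hm, h0k]
  have s1 :=
    contDiffOn_univ.1 (contDiff_sumElim contDiff_lft.contDiffOn hms.contDiffOn)
  have s2 :=
    contDiffOn_univ.1 (contDiff_sumElim hms.contDiffOn contDiff_rgt.contDiffOn)
  have hmc : m (elim ((Γ p).c p) ((Γ p'').c p'')) = (Γ p').c p' := by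
    funext j
    by_cases hj : Γ.lev j ≤ k
    · simp [hm, hj, hb j hj]
    · simp [hm, hj]
  refine ⟨_,
    fun v => R _ + R' _,
    (h.isOpen.preimage s1.continuous).inter (h'.isOpen.preimage s2.continuous), ⟨?_, ?_⟩,
    (h.smooth.comp s1.contDiffOn fun v hv => ⟨?_, hv.2.1⟩).add
      (h'.smooth.comp s2.contDiffOn fun v hv => ⟨?_, hv.2.2⟩), fun w w' hw hbw h0 => ?_⟩
  · simp [mem_preimage, hmc]; exact h.mem
  · simp [mem_preimage, hmc]; exact h'.mem
  · have := mem_orth_faces.1 hv.1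
    exact mem_orth_faces.2 ⟨this.1, (this.1.trans_eq (hm0 v).symm :)⟩
  · have := mem_orth_faces.1 hv.1
    exact mem_orth_faces.2 ⟨(this.1.trans_eq (hm0 v).symm :), this.2⟩
  · have hml : ∀ j, Γ.lev j ≤ k → w j = m (elim w w') j := fun j hj => by simp [hm, hj]
    obtain ⟨h1, -, h3⟩ := h.eq w _ hw.1 hml h0
    obtain ⟨-, h2, h4⟩ := h'.eq _ w' hw.2
      (fun j hj => (hml j hj).symm.trans (hbw j hj)) (by rw [hm0]; exact h0)
    refine ⟨h1, h2, ?_⟩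
    rw [hm0, Sum.elim_inl] at h4
    rw [mul_add]
    exact (by linear_combination h3 + h4 : f ((Γ p).inv w) - f ((Γ p'').inv w') =
      w 0 ^ A * R _ + w 0 ^ A * R' _)

end IsQuot

lemma base_eq {p p' : M} (hp : p ∈ 𝕌) (hp' : p' ∈ 𝕌)
    (h : p ∼ p') (j : Fin n) (hj : Γ.lev j ≤ k) :
    (Γ p).c p j = (Γ p').c p' j :=
  (Γ.same _ p p' hp hp' h p (Γ p).mem p' (Γ p').mem).1 h j (by simpa using hj)

lemma exists_radius {𝒱 : Submodule ℝ (VField n M)} {p : M} (F : Γ.Frame (𝒱 := 𝒱) a p)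
    {U : Set M} (hU : IsOpen U) (hpU : p ∈ U) : ∃ ρ > 0, ρ ≤ (Γ p).r ∧
      ∀ w ∈ orth {0} ∩ ball ((Γ p).c p) ρ, (Γ p).inv w ∈ F.N ∩ U := by
  have hc := (Γ p).c_mem (Γ p).mem
  obtain ⟨ρ, hρ, hρs⟩ := Metric.mem_nhdsWithin_iff.1 (((Γ p).smooth_inv.continuousOn _ hc).eventually ((F.isOpen.inter hU).mem_nhds
      (by rw [(Γ p).inv_c (Γ p).mem]; exact ⟨F.mem, hpU⟩)))
  exact ⟨_, lt_min hρ (Γ p).r_pos, min_le_right _ _, fun w hw =>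
    hρs ⟨ball_subset_ball (min_le_left _ _) hw.2, hw.1,
      ball_subset_ball (min_le_right _ _) hw.2⟩⟩

section Local

variable {U : Set M} {f : M → ℝ} {A : ℕ} {σ : ACoField 𝒱}

lemma eventually_isFibreQuotient (ha₀ : a 0 = 1) (hU : IsOpen U)
    (hσ : IsSymbol T.x U f A σ) {p : M} (hp : p ∈ 𝕌) (hpU : p ∈ U)
    (F : Γ.Frame (𝒱 := 𝒱) a p) :
    ∀ᶠ p' in 𝓝 p, p' ∈ 𝕌 → p ∼ p' →
      ∃ O R, Γ.IsQuot f A p p' O R ∧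
        R (elim ((Γ p).c p) ((Γ p').c p')) =
          ∑ j, (if Γ.lev j ≤ k then 0 else (Γ p).c p j - (Γ p).c p' j) *
            F.avg σ A j (elim ((Γ p).c p) fun j => if j = 0 then 0 else (Γ p).c p' j) := by
  obtain ⟨ρ, hρ0, hρr, hρ⟩ := Γ.exists_radius F hU hpU
  have hcont : ∀ᶠ p' in 𝓝 p, p' ∈ (Γ p).U ∧ (Γ p).c p' ∈ ball ((Γ p).c p) ρ := by
    refine Filter.Eventually.and ((Γ p).isOpen.mem_nhds (Γ p).mem) ?_
    exact ((Γ p).smooth.continuousOn.continuousAt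
      ((Γ p).isOpen.mem_nhds (Γ p).mem)).eventually (ball_mem_nhds _ hρ0)
  filter_upwards [hcont] with p' hp'U hp's hsame
  obtain ⟨O₁, O₂, H, hO₁, hO₂, hO₁m, -⟩ := (Γ p').exists_locDiffeo (Γ p)
  obtain ⟨B, hB, hBm, H'⟩ := H.exists_restrict
    (isOpen_ball)
  set C := Γ p
  set C' := Γ p'
  set g : ℝⁿ → 𝔼 := fun v => C.c _ with hg
  have hgs : C∞ g (orth _ ∩ rgt ⁻¹' B) :=
    H'.smooth.comp contDiff_rgt.contDiffOn fun v hv =>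
      ⟨fun j hj => by
        rw [Finset.mem_singleton] at hj; rw [hj]; exact (mem_orth_faces.1 hv.1).2, hv.2⟩
  set P : ℝⁿ → ℝⁿ := fun v =>
    elim (lft v) (fun j => if j = 0 then 0 else g v j) with hP
  have hPs : C∞ P (orth (faces n) ∩ rgt ⁻¹' B) := by
    refine contDiff_sumElim contDiff_lft.contDiffOn (contDiffOn_pi.2 fun j => ?_)
    by_cases hj : j = 0
    · simp [hj, if_true]; exact contDiffOn_const
    · simp [hj, if_false]; exact contDiffOn_pi.1 hgs j
  have hrgt : ∀ v ∈ orth _ ∩ rgt ⁻¹' B, rgt v ∈ C'.D := fun v hv =>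
    ⟨fun j hj => by
      rw [Finset.mem_singleton] at hj; rw [hj]; exact (mem_orth_faces.1 hv.1).2,
      hO₁ (hB hv.2)⟩
  have hgU : ∀ v ∈ orth _ ∩ rgt ⁻¹' B, C'.inv (rgt v) ∈ C.U ∧
      g v ∈ ball (C.c p) ρ := fun v hv =>
    ⟨(hO₁m _ (hrgt v hv)).1 (hB hv.2), ((hBm _ (hrgt v hv).1).1 hv.2).2⟩
  have hPO : ∀ v ∈ orth _ ∩ (rgt ⁻¹' B ∩ lft ⁻¹' ball (C.c p) ρ),
      P v ∈ orth {inl 0} ∩ pathDom (C.c p) ρ := fun v hv => by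
    refine ⟨fun j hj => ?_, hv.2.2, ?_⟩
    · rw [Finset.mem_singleton] at hj; rw [hj]; exact (mem_orth_faces.1 hv.1).1
    · refine mem_ball.2 ((dist_pi_lt_iff hρ0).2 fun j => ?_)
      by_cases hj : j = 0
      · subst hj
        simpa [pstart, hP] using (dist_pi_lt_iff hρ0).1 (mem_ball.1 hv.2.2) 0
      · simpa [pstart, hP, hj] using
          (dist_pi_lt_iff hρ0).1 (mem_ball.1 (hgU v ⟨hv.1, hv.2.1⟩).2) j
  refine ⟨rgt ⁻¹' B ∩ lft ⁻¹' ball (C.c p) ρ, fun v =>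
    ∑ j, (if Γ.lev j ≤ k then 0 else v (inl j) - g v j) * F.avg σ A j (P v), ⟨?_, ?_, ?_, ?_⟩, ?_⟩
  · exact (H'.isOpen.preimage (contDiff_rgt (m := 0)).continuous).inter
      (isOpen_ball.preimage (contDiff_lft (m := 0)).continuous)
  · have hc' := C'.c_mem C'.mem
    refine ⟨(hBm _ hc'.1).2 ⟨(hO₁m _ hc').2 ?_, ?_⟩, mem_ball_self hρ0⟩
    · rw [C'.inv_c C'.mem]; exact hp'U.1
    · change C.c _ ∈ _
      rw [C'.inv_c C'.mem]; exact hp'U.2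
  · refine ContDiffOn.sum fun j _ => ContDiffOn.mul ?_ ?_
    · by_cases hj : Γ.lev j ≤ k
      · simp [hj, if_true]; exact contDiffOn_const
      · simp [hj, if_false]
        exact (contDiff_apply ℝ ℝ _).contDiffOn.sub
          ((contDiffOn_pi.1 hgs j).mono fun v hv => ⟨hv.1, hv.2.1⟩)
    · exact (F.contDiffOn_avg hσ hρr hρ j).comp (hPs.mono fun v hv => ⟨hv.1, hv.2.1⟩) hPO
  · intro w w' hw hb h0
    have hv : (elim w w') ∈
        orth _ ∩ (rgt ⁻¹' B ∩ lft ⁻¹' ball (C.c p) ρ) :=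
      ⟨mem_orth_faces.2 ⟨h0.le, (hb 0 (by rw [Γ.lev_zero]; exact Nat.zero_le _) ▸ h0.le :)⟩, hw⟩
    have hr := hrgt _ ⟨hv.1, hv.2.1⟩
    have hgm := hgU _ ⟨hv.1, hv.2.1⟩
    have hs := Γ.subset p' hp's (C'.inv_mem _ hr)
    have hgb : ∀ j, Γ.lev j ≤ k → g _ j = w j := fun j hj => by
      rw [hb j hj]
      exact (Γ.level (Fin.last k) p p' hp hp's hsame j (by simpa using hj) _ hs).trans (congrFun (C'.right _ hr) j)
    have hstart : pstart (P (elim w w')) = g (elim w w') := by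
      funext j
      by_cases hj : j = 0
      · subst hj
        rw [hgb 0 (by rw [Γ.lev_zero]; exact Nat.zero_le _)]
        simp [pstart, hP, lft]
      · simp [pstart, hP, hj]
    have hform := F.path_formula ha₀ hp hU hσ hρr hρ (hPO _ hv) h0
    rw [hstart] at hform
    refine ⟨⟨fun j hj => by rw [Finset.mem_singleton] at hj; rw [hj]; exact h0.le,
      ball_subset_ball hρr hw.2⟩, hr, ?_⟩
    rw [C.inv_c hgm.1] at hform
    refine hform.trans (congrArg _ (sum_congr rfl fun j _ => ?_))
    congr 1
    by_cases hj : Γ.lev j ≤ k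
    · rw [if_pos hj]
      have : pathIncr (P (elim w w')) j = 0 := by
        by_cases hj0 : j = 0
        · simp [pathIncr, hP, hj0]
        · simp [pathIncr, hP, hj0, hgb j hj, lft]
      rw [this, zero_div]
    · rw [if_neg hj]
      have hj0 : j ≠ 0 := fun h => hj (by rw [h, Γ.lev_zero]; exact Nat.zero_le _)
      rw [Γ.ex_of_ne hj0, Γ.wt_of_lt (by omega), pow_zero, div_one]
      simp [pathIncr, hP, hj0, lft]
  · have hgc : g (elim (C.c p) _) = C.c p' := congrArg C.c (C'.inv_c C'.mem)
    simp [hP, hgc]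
    rfl

lemma exists_isFibreQuotient (ha₀ : a 0 = 1) (h𝒱 : T.fields a = 𝒱) (hU : IsOpen U)
    (hbU : ∂M ⊆ U) (hσ : IsSymbol T.x U f A σ) {p p' : M}
    (hp : p ∈ ∂M) (hp' : p' ∈ ∂M)
    (hs : p ∼ p')
    (hconn : IsPreconnected {p' | p' ∈ ∂M ∧ p ∼ p'}) :
    ∃ O R, Γ.IsQuot f A p p' O R := by
  have hfib : ∀ {x y : M}, T.SameFibre _ p x → T.SameFibre _ p y →
      x ∼ y := fun h h' =>
    ⟨h.1.symm.trans h'.1, fun j hj => (h.2 j hj).symm.trans (h'.2 j hj)⟩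
  refine hconn.induction₂ (fun x y => ∃ O R, Γ.IsQuot f A x y O R) (fun x hx => ?_)
    (fun x y z hx hy hz h h' => ?_) (fun x y hx hy h => ?_) ⟨hp, rfl, fun _ _ => rfl⟩ ⟨hp', hs⟩
  · obtain ⟨F⟩ := Γ.exists_frame h𝒱 (T.boundary_subset hx.1)
    filter_upwards [nhdsWithin_le_nhds (Γ.eventually_isFibreQuotient ha₀ hU hσ
      (T.boundary_subset hx.1) (hbU hx.1) F), self_mem_nhdsWithin] with y hy hys
    obtain ⟨O, R, h, -⟩ := hy (T.boundary_subset hys.1) (hfib hx.2 hys.2)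
    exact ⟨O, R, h⟩
  · obtain ⟨O, R, h⟩ := h
    obtain ⟨O', R', h'⟩ := h'
    exact h.trans h' fun j hj => Γ.base_eq (T.boundary_subset hx.1) (T.boundary_subset hy.1)
      (hfib hx.2 hy.2) j hj
  · obtain ⟨O, R, h⟩ := h
    exact h.symm

end Local

end Tower.Charts

namespace Tower.Charts

variable (Γ : T.Charts)

/-- The parameters of the path, in a chart, that changes the base coordinates of the first point into
those of the second point. -/
def baseMove (ν : Fin n → ℕ) (v : ℝⁿ) : ℝⁿ :=
  elim (lft v) fun j => if j = 0 then v (inl 0) ^ ν 0 * v (inr 0)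
    else if Γ.lev j ≤ k then snds Γ.lev k ν v j else v (inl j)

lemma contDiff_baseMove (ν : Fin n → ℕ) : ContDiff ℝ ∞ (Γ.baseMove ν) := by
  refine contDiffOn_univ.1 (contDiff_sumElim contDiff_lft.contDiffOn
    (contDiff_pi.2 fun j => ?_).contDiffOn)
  by_cases hj : j = 0
  · simp [hj, if_true]; fun_prop
  · by_cases hl : Γ.lev j ≤ k
    · simp [hj, hl, if_true, if_false]
      exact contDiff_pi.1 (contDiff_snds Γ.lev k ν) j
    · simp [hj, hl, if_false]; fun_prop

lemma lev_zero_le : Γ.lev 0 ≤ k := by rw [Γ.lev_zero]; exact Nat.zero_le _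

lemma pstart_baseMove_of_le {ν : Fin n → ℕ} (v : ℝⁿ) {j : Fin n} (hj : Γ.lev j ≤ k) :
    pstart (Γ.baseMove ν v) j = snds Γ.lev k ν v j := by
  by_cases h : j = 0
  · subst h
    simp [pstart, baseMove, snds_zero, lft]
  · simp [pstart, baseMove, h, hj]

lemma pstart_baseMove_of_lt {ν : Fin n → ℕ} (v : ℝⁿ) {j : Fin n} (hj : k < Γ.lev j) :
    pstart (Γ.baseMove ν v) j = v (inl j) := by
  have h : j ≠ 0 := fun h => by rw [h, Γ.lev_zero] at hj; omega
  simp [pstart, baseMove, h, not_le.2 hj]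

lemma pathIncr_baseMove {ν : Fin n → ℕ} (v : ℝⁿ) (j : Fin n) :
    pathIncr (Γ.baseMove ν v) j =
      if Γ.lev j ≤ k then v (inl 0) ^ ν j * v (inr j) else 0 := by
  by_cases h : j = 0
  · subst h
    simp [pathIncr, baseMove, Γ.lev_zero_le]
  · by_cases hj : Γ.lev j ≤ k
    · simp [pathIncr, baseMove, h, hj, snds_of_le h hj, lft]
    · simp [pathIncr, baseMove, h, hj, lft]

namespace Frame

variable {Γ} (F : Γ.Frame (𝒱 := 𝒱) a p) {U : Set M} {f : M → ℝ} {A : ℕ} {σ : ACoField 𝒱}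

/-- The coefficient functions of the difference quotients in the model patches. -/
def quot (σ : ACoField 𝒱) (A : ℕ) (ν : Fin n → ℕ) (R : ℝⁿ → ℝ) (e : ℕ) (v : ℝⁿ) :
    ℝ :=
  (∑ j, if Γ.lev j ≤ k then v (inr j) * F.avg σ A j (Γ.baseMove ν v) else 0) +
    v (inl 0) ^ e * (Real.exp (-(A * (v (inl 0) ^ ν 0 * v (inr 0)))) *
      R (elim (pstart (Γ.baseMove ν v)) (snds Γ.lev k ν v)))

lemma exists_contDiffOn_quot (ha₀ : a 0 = 1) (hp : p ∈ 𝕌) (hU : IsOpen U)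
    (hpU : p ∈ U) (hσ : IsSymbol T.x U f A σ) {p' : M} {O : Set ℝⁿ}
    {R : ℝⁿ → ℝ} (hR : Γ.IsQuot f A p p' O R) {ν : Fin n → ℕ} {e : ℕ}
    (hν : ∀ j, Γ.lev j ≤ k → ν j + e = Γ.ex a j) {v₀ : ℝⁿ}
    (h1 : lft v₀ = (Γ p).c p) (h2 : snds Γ.lev k ν v₀ = (Γ p').c p')
    (hb : ∀ j, Γ.lev j ≤ k → (Γ p).c p j = (Γ p').c p' j) :
    ∃ B : Set ℝⁿ, IsOpen B ∧ v₀ ∈ B ∧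
      C∞ (F.quot σ A ν R e) (orth {inl 0} ∩ B) ∧
      ∀ v ∈ orth {inl 0} ∩ B, 0 < v (inl 0) →
        v (inl 0) ^ e * (f ((Γ p).inv (lft v)) -
          f ((Γ p').inv (snds Γ.lev k ν v))) = v (inl 0) ^ A * F.quot σ A ν R e v := by
  obtain ⟨ρ, hρ0, hρr, hρ⟩ := Γ.exists_radius F hU hpU
  have hbm := Γ.contDiff_baseMove ν
  have hE :=
    contDiffOn_univ.1 (contDiff_sumElim ((contDiff_pstart (n := n)).comp hbm).contDiffOn
      (contDiff_snds Γ.lev k ν).contDiffOn)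
  have hstart : pstart (Γ.baseMove ν v₀) = (Γ p).c p := by
    funext j
    rcases le_or_gt (Γ.lev j) k with hj | hj
    · rw [Γ.pstart_baseMove_of_le _ hj, h2, hb j hj]
    · rw [Γ.pstart_baseMove_of_lt _ hj, ← h1]; rfl
  set B := Γ.baseMove ν ⁻¹' pathDom _ ρ ∩ (fun v =>
    (elim (pstart _) _ : ℝⁿ)) ⁻¹' O with hB
  have horth : ∀ v ∈ orth {inl 0} ∩ B,
      Γ.baseMove ν v ∈ orth {inl 0} ∩ pathDom ((Γ p).c p) ρ := fun v hv =>
    ⟨fun j hj => by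
      rw [Finset.mem_singleton] at hj; rw [hj]; exact hv.1 _ (by simp), hv.2.1⟩
  have hsec0 : ∀ v, pstart (Γ.baseMove ν v) 0 =
      v _ * Real.exp _ := fun v => by
    rw [Γ.pstart_baseMove_of_le _ Γ.lev_zero_le, snds_zero]
  refine ⟨B, ((isOpen_pathDom _ _).preimage hbm.continuous).inter (hR.isOpen.preimage hE.continuous),
    ⟨⟨?_, ?_⟩, ?_⟩, ?_, fun v hv hx => ?_⟩
  · change lft v₀ ∈ _
    rw [h1]; exact mem_ball_self hρ0
  · rw [hstart]; exact mem_ball_self hρ0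
  · rw [mem_preimage, hstart, h2]; exact hR.mem
  · refine ContDiffOn.add (ContDiffOn.sum fun j _ => ?_) (ContDiffOn.mul ?_ (ContDiffOn.mul ?_ ?_))
    · by_cases hj : Γ.lev j ≤ k
      · simp [hj, if_true]
        exact (contDiff_apply ℝ ℝ _).contDiffOn.mul
          ((F.contDiffOn_avg hσ hρr hρ j).comp hbm.contDiffOn horth)
      · simp [hj, if_false]; exact contDiffOn_const
    · exact ContDiff.contDiffOn (by fun_prop)
    · exact ContDiff.contDiffOn (by fun_prop)
    · exact hR.smooth.comp hE.contDiffOn (fun v hv => by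
    have hx : 0 ≤ v (inl 0) := hv.1 (inl 0) (by simp)
    refine ⟨mem_orth_faces.2 ⟨?_, ?_⟩, hv.2.2⟩
    · rw [Sum.elim_inl, hsec0]; positivity
    · rw [Sum.elim_inr, snds_zero]; positivity)
  · have hf1 := F.path_formula ha₀ hp hU hσ hρr hρ (horth v hv) hx
    obtain ⟨-, -, hf2⟩ := hR.eq _ _ hv.2.2
      (fun j hj => Γ.pstart_baseMove_of_le v hj) (by rw [hsec0]; positivity)
    rw [hsec0, mul_pow, ← Real.exp_nat_mul] at hf2
    have hl : lft (Γ.baseMove ν v) = lft v := rfl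
    have hl0 : Γ.baseMove ν v (inl 0) = v (inl 0) := rfl
    rw [hl, hl0] at hf1
    have hsum : v (inl 0) ^ e * ∑ j, pathIncr (Γ.baseMove ν v) j / v (inl 0) ^ Γ.ex a j *
        F.avg σ A j (Γ.baseMove ν v) =
        ∑ j, if Γ.lev j ≤ k then v (inr j) * F.avg σ A j (Γ.baseMove ν v) else 0 := by
      rw [mul_sum]
      refine sum_congr rfl fun j _ => ?_
      rw [pathIncr_baseMove]
      by_cases hj : Γ.lev j ≤ k
      · rw [if_pos hj, if_pos hj, ← hν j hj, pow_add]
        field_simp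
      · rw [if_neg hj, if_neg hj, zero_div, zero_mul, mul_zero]
    rw [quot, ← hsum]
    have hneg : -(A * (v (inl 0) ^ ν 0 * v (inr 0))) =
      (A : ℝ) * -(v (inl 0) ^ ν 0 * v (inr 0)) := by ring
    rw [hneg]
    linear_combination v _ ^ e * (hf1 + hf2)

lemma quot_of_eq_zero (ha : ∀ i, 1 ≤ a i)
    {R : ℝⁿ → ℝ} (hA : A = 0 ∨ 0 < Γ.ex a 0) {v : ℝⁿ} (hv : v (inl 0) = 0) :
    F.quot σ A (Γ.ex a) R 0 v =
      (∑ j, if Γ.lev j ≤ k then v (inr j) *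
        σ ((Γ p).inv (lft v)) (atVal ((Γ p).inv (lft v)) (F.X j)) else 0) +
      R (elim (lft v) (snds Γ.lev k (Γ.ex a) v)) := by
  have hpos : ∀ j, j ≠ 0 → Γ.lev j ≤ k → 0 < Γ.ex a j := fun j hj hl => by
    rw [Γ.ex_of_ne hj]; exact Γ.one_le_wt ha hl
  have hsec : ∀ j, Γ.lev j ≤ k → snds Γ.lev k _ v j = v (inl j) := fun j hj => by
    by_cases h : j = 0
    · subst h; rw [snds_zero, hv, zero_mul]
    · rw [snds_of_le h hj, hv, zero_pow (hpos j h hj).ne', zero_mul, sub_zero]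
  have hpath : ∀ t, path (Γ.baseMove (Γ.ex a) v) t = lft v := fun t => by
    funext j
    by_cases h : j = 0
    · subst h
      simp [path, baseMove, lft, hv]
    · by_cases hj : Γ.lev j ≤ k
      · simp [path, baseMove, h, hj, hsec j hj, lft]
      · simp [path, baseMove, h, hj, lft]
  have hk : Γ.ex a 0 = 0 → k = 0 := fun h => by
    by_contra hne
    have := tailSum_pos a ha (i := 1) (by omega)
    rw [ex_zero] at h
    omega
  have hfac : ∀ j, Γ.lev j ≤ k → (v _ ^ Γ.ex a 0 * v (inr 0) = 0 ∨
      ((Γ.ex a j : ℝ) - A = 0 ∧ A = 0)) := fun j hj => by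
    rcases Nat.eq_zero_or_pos (Γ.ex a 0) with h0 | h0
    · have hA0 : A = 0 := hA.resolve_right (by omega)
      exact Or.inr ⟨by rw [((Γ.lev_eq_zero j).1 (by have := hk h0; omega)), h0, hA0]; simp, hA0⟩
    · exact Or.inl (by rw [hv, zero_pow h0.ne', zero_mul])
  have havg : ∀ j, Γ.lev j ≤ k → F.avg σ A j (Γ.baseMove (Γ.ex a) v) =
      σ ((Γ p).inv (lft v)) (atVal _ (F.X j)) := fun j hj => by
    have hm : Γ.baseMove (Γ.ex a) v (inr 0) = v (inl 0) ^ Γ.ex a 0 * v (inr 0) := by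
      simp [baseMove]
    have hc : ∀ t, σ ((Γ p).inv (path (Γ.baseMove (Γ.ex a) v) t))
        (atVal ((Γ p).inv (path (Γ.baseMove _ v) t)) (F.X j)) =
        σ _ (atVal _ (F.X j)) := fun t => by rw [hpath t]
    simp only [avg, hc, hm]
    have : ∀ t : ℝ, (1 - t) * (v _ ^ Γ.ex a 0 * v (inr 0)) *
        ((Γ.ex a j) - A) = 0 := fun t => by
      rcases hfac j hj with h | h
      · rw [h]; ring
      · rw [h.1, mul_zero]
    simp [this]
  have hstart : pstart (Γ.baseMove (Γ.ex a) v) = lft v := by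
    rw [← path_zero, hpath]
  have hexp : (A : ℝ) * (v (inl 0) ^ Γ.ex a 0 * v (inr 0)) = 0 := by
    rcases hfac 0 Γ.lev_zero_le with h | h
    · rw [h, mul_zero]
    · rw [h.2]; simp
  rw [quot, hstart, hexp]
  simp only [neg_zero, Real.exp_zero, one_mul, pow_zero]
  congr 1
  refine sum_congr rfl fun j _ => ?_
  split_ifs with hj
  · rw [havg j hj]
  · rfl

end Frame

end Tower.Charts

/-! ### Boundary defining functions of towers -/

variable (T) in
lemma Tower.exists_quotient {U : Set M} (hU : IsOpen U)
    (hUs : U ⊆ 𝕌) {f : M → ℝ} (hf : CM∞ f U)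
    (h0 : ∀ q ∈ U, q ∈ ∂M → f q = 0) :
    ∃ g : M → ℝ, CM∞ g U ∧ ∀ q ∈ U, f q = T.x q * g q := by
  classical
  obtain ⟨Γ⟩ := T.exists_charts
  have hloc : ∀ q : U, ∃ (g : M → ℝ) (N : Set M), IsOpen N ∧ q.1 ∈ N ∧ N ⊆ U ∧
      CM∞ g N ∧ ∀ q' ∈ N, f q' = T.x q' * g q' := by
    rintro ⟨q, hq⟩
    have hqs := hUs hq
    set C := Γ q
    have hx0 := Γ.c_zero q hqs
    by_cases hq0 : T.x q = 0
    · have hc := C.c_mem C.mem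
      obtain ⟨ρ, hρ, hρU⟩ := Metric.mem_nhdsWithin_iff.1 ((C.smooth_inv.continuousOn _ hc).eventually (hU.mem_nhds (by rwa [C.inv_c C.mem])))
      set r := min ρ C.r
      have hrD : orth {0} ∩ ball (C.c q) r ⊆ C.D :=
        inter_subset_inter_right _ (ball_subset_ball (min_le_right _ _))
      have hrU : ∀ w ∈ orth {0} ∩ ball (C.c q) r, C.inv w ∈ U := fun w hw =>
        hρU ⟨ball_subset_ball (min_le_left _ _) hw.2, hrD hw⟩
      obtain ⟨G, hG, hfG⟩ := hadamard_single (by rw [hx0 q hqs, hq0])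
        (contMDiffOn_iff_contDiffOn.1 (hf.comp (C.smooth_inv.mono hrD) hrU))
        fun w hw hw0 => h0 _ (hrU w hw) ((C.inv_mem_boundary_iff (hrD hw)).2 hw0)
      refine ⟨_, _,
        (C.smooth.continuousOn.isOpen_inter_preimage C.isOpen isOpen_ball).inter hU,
        ⟨⟨C.mem, mem_ball_self (lt_min hρ C.r_pos)⟩, hq⟩, inter_subset_right,
        (contMDiffOn_iff_contDiffOn.2 hG).comp (C.smooth.mono fun q' h => h.1.1)
          fun q' h => ⟨(C.c_mem h.1.1).1, h.1.2⟩, fun q' h => ?_⟩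
      have := hfG (C.c q') ⟨(C.c_mem h.1.1).1, h.1.2⟩
      rwa [hx0 q' (hUs h.2), Function.comp_apply, C.inv_c h.1.1] at this
    · refine ⟨fun q' => f q' / T.x q', _,
        (T.contMDiffOn_x.continuousOn.mono hUs).isOpen_inter_preimage hU isOpen_compl_singleton,
        ⟨hq, hq0⟩, inter_subset_left, (hf.mono inter_subset_left).div₀
          (T.contMDiffOn_x.mono fun q' h => hUs h.1) fun q' h => h.2,
        fun q' h => (mul_div_cancel₀ _ h.2).symm⟩
  choose g N hN hqN hNU hg hfg using hloc
  refine ⟨fun q => if h : q ∈ U then g ⟨q, h⟩ q else 0, fun q hq => ?_, fun q hq => by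
    simpa [hq] using hfg ⟨q, hq⟩ q (hqN _)⟩
  refine ContMDiffAt.contMDiffWithinAt (((hg ⟨q, hq⟩).contMDiffAt
    ((hN ⟨q, hq⟩).mem_nhds (hqN ⟨q, hq⟩))).congr_of_eventuallyEq ?_)
  filter_upwards [(hN ⟨q, hq⟩).mem_nhds (hqN ⟨q, hq⟩)] with q' hq'
  have hq'U := hNU _ hq'
  simp [hq'U, dif_pos]
  refine eqOn_of_eqOn_interior (n := n) ((hN ⟨q', hq'U⟩).inter (hN ⟨q, hq⟩))
    ((hg ⟨q', hq'U⟩).continuousOn.mono inter_subset_left)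
    ((hg ⟨q, hq⟩).continuousOn.mono inter_subset_right) (fun y hy => ?_) q' ⟨hqN ⟨q', hq'U⟩, hq'⟩
  exact mul_left_cancel₀ (Tower.Charts.x_pos (T := T) ⟨hUs (hNU _ hy.1.2), hy.2⟩).ne' ((hfg _ _ hy.1.1).symm.trans (hfg _ _ hy.1.2))

variable (T) in
lemma Tower.exists_ratio (T₁ : Tower n M k) : ∃ φ : M → ℝ,
    CM∞ φ (𝕌 ∩ T₁.emb.source) ∧
    ∀ q ∈ 𝕌 ∩ T₁.emb.source, φ q ≠ 0 ∧ T₁.x q = T.x q * φ q := by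
  have hU := T.emb.open_source.inter T₁.emb.open_source
  obtain ⟨φ, hφ, h⟩ := T.exists_quotient hU inter_subset_left
    (T₁.contMDiffOn_x.mono inter_subset_right) fun q hq hb => (T₁.mem_boundary_iff hq.2).1 hb
  obtain ⟨ψ, hψ, h'⟩ := T₁.exists_quotient hU inter_subset_right
    (T.contMDiffOn_x.mono inter_subset_left) fun q hq hb => (T.mem_boundary_iff hq.1).1 hb
  refine ⟨φ, hφ, fun q hq => ⟨?_, h q hq⟩⟩
  have := eqOn_of_eqOn_interior (n := n) hU (hφ.mul hψ).continuousOn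
    (continuousOn_const (c := 1)) (fun q hq => ?_) q hq
  · exact left_ne_zero_of_mul (this.trans_ne one_ne_zero)
  · have h1 := h' q hq.1
    rw [h q hq.1, mul_assoc] at h1
    exact mul_left_cancel₀ (Tower.Charts.x_pos (T := T) ⟨hq.1.1, hq.2⟩).ne' (h1.symm.trans (mul_one _).symm)

/-! ### Functions whose symbols are conormal with respect to a refinement -/

variable (T) in
/-- A function near the boundary whose symbol vanishes on the vector fields of the refinement. -/
structure Symb (a : Fin (k + 1) → ℕ) (𝒱 ℛ : Submodule ℝ (VField n M))
    where
  f : M → ℝ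
  A : ℕ
  σ : ACoField 𝒱
  U : Set M
  isOpen : IsOpen U
  subset : ∂M ⊆ U
  symbol : IsSymbol T.x U f A σ
  order : A = 0 ∨ 0 < tailSum a 1
  conormal : ∀ p ∈ ∂M, ∀ W : 𝒱, W.1 ∈ ℛ → σ p (atVal p W) = 0

section Refinement

variable {T₁ : Tower n M k} {φ : M → ℝ}

lemma exists_conormalSymbol
    (hφ : CM∞ φ (𝕌 ∩ T₁.emb.source))
    (hx : ∀ q ∈ 𝕌 ∩ T₁.emb.source, φ q ≠ 0 ∧ T₁.x q = T.x q * φ q) {f : M → ℝ} {A : ℕ}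
    (hA : A = 0 ∨ 0 < tailSum a 1)
    (hf : CM∞ f (T₁.emb.source ∩ M°))
    (h : ∀ V : 𝒱, ∃ w : M → ℝ, CM∞ w T₁.emb.source ∧
      ∀ q ∈ T₁.emb.source ∩ M°, dirDeriv V.1 f q = T₁.x q ^ A * w q)
    (hc : ∀ W ∈ ℛ, ∃ w : M → ℝ, CM∞ w T₁.emb.source ∧
      ∀ q ∈ T₁.emb.source ∩ M°, dirDeriv W f q = T₁.x q ^ (A + 1) * w q) :
    ∃ s : Symb T a 𝒱 ℛ, s.f = f ∧ s.A = A ∧ ∀ (V : 𝒱) (w : M → ℝ),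
      CM∞ w T₁.emb.source →
      (∀ q ∈ T₁.emb.source ∩ M°, dirDeriv V.1 f q = T₁.x q ^ A * w q) →
      ∀ q ∈ 𝕌 ∩ T₁.emb.source, s.σ q (atVal q V) = φ q ^ A * w q := by
  set U := 𝕌 ∩ T₁.emb.source with hU
  have hUo := T.emb.open_source.inter T₁.emb.open_source
  have hconv : ∀ q ∈ U, ∀ w : ℝ, T₁.x q ^ A * w = T.x q ^ A * (φ q ^ A * w) := fun q hq w => by
    rw [(hx q hq).2, mul_pow, mul_assoc]
  obtain ⟨σ, hσ⟩ := exists_symbol hUo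
    (fun q hq => (Tower.Charts.x_pos ⟨hq.1.1, hq.2⟩).ne')
    (hf.mono (inter_subset_inter_left _ inter_subset_right)) fun V => by
      obtain ⟨w, hw, hfw⟩ := h V
      exact ⟨fun q => φ q ^ A * w q, (hφ.pow A).mul (hw.mono inter_subset_right), fun q hq => by
        rw [hfw q ⟨hq.1.2, hq.2⟩, hconv q hq.1]⟩
  have huniq : ∀ (V : 𝒱) (w : M → ℝ), ContMDiffOn _ _ ∞ w _ →
      (∀ q ∈ T₁.emb.source ∩ M°, dirDeriv V.1 f q = T₁.x q ^ A * w q) →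
      ∀ q ∈ U, σ q _ = φ q ^ A * w q := fun V w hw hfw =>
    eqOn_of_eqOn_interior hUo (hσ.smooth_val V).continuousOn
      ((hφ.pow A).mul (hw.mono inter_subset_right)).continuousOn fun q hq => by
        refine mul_left_cancel₀ (pow_pos (Tower.Charts.x_pos ⟨hq.1.1, hq.2⟩) A).ne' ?_
        rw [← hσ.eq V q hq, hfw q ⟨hq.1.2, hq.2⟩, hconv q hq.1]
  refine ⟨⟨f, A, σ, U, hUo, fun p hp => ⟨T.boundary_subset hp, T₁.boundary_subset hp⟩, hσ, hA,
    fun p hp W hW => ?_⟩, rfl, rfl, huniq⟩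
  obtain ⟨w, hw, hfw⟩ := hc W.1 hW
  rw [huniq W (fun q => T₁.x q * w q) (T₁.contMDiffOn_x.mul hw)
    (fun q hq => by rw [hfw q hq, pow_succ, mul_assoc]) p
    ⟨T.boundary_subset hp, T₁.boundary_subset hp⟩,
    (T₁.mem_boundary_iff (T₁.boundary_subset hp)).1 hp, zero_mul, mul_zero]

lemma dirDeriv_log {V : VField n M} {q : M} (hq : q ∈ T₁.emb.source ∩ M°) {A : ℕ}
    {w : ℝ} (h : dirDeriv V T₁.x q = T₁.x q ^ (A + 1) * w) :
    dirDeriv V (fun q => Real.log (T₁.x q)) q = T₁.x q ^ A * w := by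
  have hx := Tower.Charts.x_pos hq
  rw [dirDeriv_comp (Real.hasDerivAt_log hx.ne') (((T₁.contMDiffOn_x q hq.1).contMDiffAt
    (T₁.emb.open_source.mem_nhds hq.1)).mdifferentiableAt (by simp)), h, pow_succ]
  field_simp

lemma exists_conormalSymbol_log (ha₀ : a 0 = 1) (h𝒱 : T₁.fields a = 𝒱)
    (hℛ : T₁.fields (refineOrder a) = ℛ)
    (hφ : CM∞ φ (𝕌 ∩ T₁.emb.source))
    (hx : ∀ q ∈ 𝕌 ∩ T₁.emb.source, φ q ≠ 0 ∧ T₁.x q = T.x q * φ q) :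
    ∃ s : Symb T a 𝒱 ℛ, s.f = (fun q => Real.log (T₁.x q)) ∧ s.A = tailSum a 1 ∧
      ∀ (V : 𝒱) (w : M → ℝ),
        IsQuotientOn (n := n) T₁.emb.source T₁.x (dirDeriv V.1 T₁.x) (tailSum a 0) w →
        ∀ q ∈ 𝕌 ∩ T₁.emb.source, s.σ q (atVal q V) = φ q ^ tailSum a 1 * w q := by
  have h01 : tailSum a 0 = tailSum a 1 + 1 := by
    have := tailSum_succ a 0
    simp at this
    omega
  obtain ⟨s, hf, hA, hs⟩ := exists_conormalSymbol (𝒱 := 𝒱) (ℛ := ℛ) hφ hx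
    (Nat.eq_zero_or_pos _)
    (fun q hq => (Real.contDiffAt_log.2 (Tower.Charts.x_pos hq).ne').contMDiffAt.comp_contMDiffWithinAt
      q (T₁.contMDiffOn_x.mono inter_subset_left q hq))
    (fun V => by
      obtain ⟨w, hw, hw'⟩ := (h𝒱 ▸ V.2 : V.1 ∈ T₁.fields a).2.1 id contDiff_id
      exact ⟨w, hw, fun q hq => dirDeriv_log hq (by rw [← h01]; exact hw' q hq.1)⟩)
    fun W hW => by
      obtain ⟨w, hw, hw'⟩ := (hℛ ▸ hW).2.1 id contDiff_id
      refine ⟨w, hw, fun q hq => dirDeriv_log hq ?_⟩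
      rw [← h01, ← tailSum_refineOrder a (Nat.zero_le _)]
      exact hw' q hq.1
  refine ⟨s, hf, hA, fun V w hw => hs V w hw.1 fun q hq => dirDeriv_log hq ?_⟩
  rw [← h01]; exact hw.2 q hq.1

lemma exists_conormalSymbol_proj (ha : ∀ i, 1 ≤ a i) (h𝒱 : T₁.fields a = 𝒱)
    (hℛ : T₁.fields (refineOrder a) = ℛ)
    (hφ : CM∞ φ (𝕌 ∩ T₁.emb.source))
    (hx : ∀ q ∈ 𝕌 ∩ T₁.emb.source, φ q ≠ 0 ∧ T₁.x q = T.x q * φ q) (i : Fin k)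
    {y : (T₁.B i.castSucc).carrier → ℝ} (hy : ContMDiff (T₁.B i.castSucc).model 𝓘(ℝ, ℝ) ∞ y) :
    ∃ s : Symb T a 𝒱 ℛ, s.f = (fun q => y (T₁.proj i.castSucc q)) ∧
      s.A = tailSum a (i + 1) ∧ ∀ (V : 𝒱) (w : M → ℝ),
        IsQuotientOn (n := n) T₁.emb.source T₁.x
          (dirDeriv V.1 fun q => y (T₁.proj i.castSucc q)) (tailSum a (i + 1)) w →
        ∀ q ∈ 𝕌 ∩ T₁.emb.source,
          s.σ q (atVal q V) = φ q ^ tailSum a (i + 1) * w q := by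
  obtain ⟨s, hf, hA, hs⟩ := exists_conormalSymbol (a := a) (𝒱 := 𝒱) (ℛ := ℛ) hφ hx
    (Or.inr (tailSum_pos a ha (by have := i.2; omega)))
    ((hy.comp_contMDiffOn (T₁.contMDiffOn_proj _)).mono inter_subset_left)
    (fun V => by
      obtain ⟨w, hw, hw'⟩ := (h𝒱 ▸ V.2 : V.1 ∈ T₁.fields a).2.2 i y hy
      exact ⟨w, hw, fun q hq => hw' q hq.1⟩)
    fun W hW => by
      obtain ⟨w, hw, hw'⟩ := (hℛ ▸ hW).2.2 i y hy
      exact ⟨w, hw, fun q hq => by rw [← tailSum_refineOrder a i.2]; exact hw' q hq.1⟩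
  exact ⟨s, hf, hA, fun V w hw => hs V w hw.1 fun q hq => hw.2 q hq.1⟩

variable (T) in
lemma exists_conormal_coframe (ha₀ : a 0 = 1) (ha : ∀ i, 1 ≤ a i)
    (h : IsRefinement a 𝒱 ℛ)
    {p : M} (hp : p ∈ ∂M) : ∃ (s : Fin n → Symb T a 𝒱 ℛ)
      (κ : Fin n → M → ℝ) (X : Fin n → 𝒱) (N : Set M), IsOpen N ∧ p ∈ N ∧
      (∀ l, CM∞ (κ l) N) ∧ ∀ q ∈ N, q ∈ ∂M →
        (∀ l, κ l q • atVal q (X l) ∈ ANormal 𝒱 q) ∧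
        ∀ η ∈ ANormal 𝒱 q, η = ∑ l, (κ l q * (s l).σ q η) • atVal q (X l) := by
  obtain ⟨T₁, hℛ, h𝒱⟩ := h
  obtain ⟨φ, hφ, hx⟩ := T.exists_ratio T₁
  obtain ⟨Γ⟩ := T₁.exists_charts
  have hp₁ := T₁.boundary_subset hp
  obtain ⟨F⟩ := Γ.exists_frame h𝒱 hp₁
  have hmod := h𝒱 ▸ Tower.isModule_fields
  have key : ∀ (l : Fin n) (s : Symb T a 𝒱 ℛ) (A : ℕ),
      (∀ V : 𝒱, ∀ q ∈ 𝕌 ∩ T₁.emb.source,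
        s.σ q _ = φ q ^ A * F.β l q _) →
      ∃ (s : Symb T a 𝒱 ℛ) (κ : M → ℝ),
        ContMDiffOn _ _ ∞ κ _ ∧
        ∀ q ∈ 𝕌 ∩ T₁.emb.source, ∀ α, F.β l q α = κ q * s.σ q α := fun l s A hs => by
    refine ⟨s, fun q => (φ q ^ A)⁻¹, (hφ.pow A).inv₀ fun q hq => pow_ne_zero _ (hx q hq).1,
      fun q hq α => ?_⟩
    obtain ⟨V, rfl⟩ := Submodule.Quotient.mk_surjective _ α
    exact (eq_inv_mul_iff_mul_eq₀ (pow_ne_zero _ (hx q hq).1)).2 (hs V q hq).symm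
  obtain ⟨s₀, -, -, hs₀⟩ := exists_conormalSymbol_log ha₀ h𝒱 hℛ hφ hx
  have hl : ∀ l, ∃ (s : Symb T a 𝒱 ℛ) (κ : M → ℝ),
      ContMDiffOn _ _ ∞ κ _ ∧
      ∀ q ∈ 𝕌 ∩ T₁.emb.source, ∀ α,
        (Γ.lev l ≤ k → F.β l q α = κ q * s.σ q α) ∧ (k < Γ.lev l → κ q = 0) := fun l => by
    rcases le_or_gt (Γ.lev l) k with hlk | hlk
    · simp only [hlk, hlk.not_gt, forall_const, false_imp_iff, and_true]
      have hq : ∀ V : 𝒱, IsQuotientOn _ T₁.x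
          _ _ fun q => F.β l q _ :=
        fun V => ⟨F.smooth_β l V, F.β_eq l V⟩
      have hcong : ∀ f : M → ℝ, (∀ q ∈ T₁.emb.source, (Γ p).c q l = f q) → ∀ V : 𝒱,
          IsQuotientOn _ T₁.x (dirDeriv V.1 f) _
            fun q => F.β l q _ := fun f hf V => ⟨(hq V).1, fun q hqs => by
        rw [← (hq V).2 q hqs]
        exact (dirDeriv_congr (eventually_of_mem (T₁.emb.open_source.mem_nhds hqs) hf)).symm⟩
      rcases hll : Γ.lev l with _ | i
      · refine key l s₀ _ fun V => hs₀ V _ ?_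
        have := hcong T₁.x (fun q hq => by rw [(Γ.lev_eq_zero l).1 hll]; exact Γ.c_zero p hp₁ q hq) V
        rwa [Tower.Charts.wt, hll] at this
      · obtain ⟨u, hu, hcu⟩ := Γ.pull ⟨i, by omega⟩ p l hp₁ hll.le
        obtain ⟨s, -, -, hs⟩ := exists_conormalSymbol_proj ha h𝒱 hℛ hφ hx ⟨i, by omega⟩ hu
        refine key l s _ fun V => hs V _ ?_
        have := hcong _ hcu V
        rwa [Tower.Charts.wt, hll] at this
    · exact ⟨s₀, fun _ => 0, contMDiffOn_const, fun q _ α => ⟨fun h => by omega, fun _ => rfl⟩⟩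
  choose s κ hκ hβ using hl
  refine ⟨s, κ, F.X, _, F.isOpen.inter (T.emb.open_source.inter T₁.emb.open_source),
    ⟨F.mem, T.boundary_subset hp, hp₁⟩, fun l => (hκ l).mono inter_subset_right, fun q hq hb => ?_⟩
  have hmem := F.mem_ANormal_iff hmod ha hp₁ hq.1 ((T₁.mem_boundary_iff hq.2.2).1 hb)
  refine ⟨fun l => ?_, fun η hη => ?_⟩
  · rcases le_or_gt (Γ.lev l) k with hlk | hlk
    · refine Submodule.smul_mem _ _ ((hmem _).2 fun j hj => ?_)
      rw [F.β_X hp₁ j l hq.1, if_neg fun h => by rw [h] at hj; omega]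
    · rw [(hβ l q hq.2 0).2 hlk, zero_smul]; exact Submodule.zero_mem _
  · conv_lhs => rw [F.eq_sum hmod hp₁ hq.1 η]
    refine sum_congr rfl fun l _ => ?_
    rcases le_or_gt _ k with hlk | hlk
    · rw [(hβ l q hq.2 η).1 hlk]
    · rw [(hmem η).1 hη l hlk, (hβ l q hq.2 0).2 hlk, zero_mul]

lemma exists_anchor_eq (h : IsRefinement a 𝒱 ℛ) (ha : ∀ i, 1 ≤ a i) {p : M}
    (hp : p ∈ ∂M) (V : 𝒱) :
    ∃ W : 𝒱, W.1 ∈ ℛ ∧ atVal p V - atVal p W ∈ ANormal 𝒱 p := by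
  obtain ⟨T₁, hℛ, h𝒱⟩ := h
  obtain ⟨Γ⟩ := T₁.exists_charts
  have hp₁ := T₁.boundary_subset hp
  obtain ⟨F⟩ := Γ.exists_frame h𝒱 hp₁
  refine ⟨∑ l, (if k < Γ.lev l then F.β l p (atVal p V) else 0) • F.X l, ?_, ?_⟩
  · rw [Submodule.coe_sum]
    refine Submodule.sum_mem _ fun l _ => ?_
    split_ifs with hl
    · exact Submodule.smul_mem _ _ (hℛ ▸ F.X_mem l hl _)
    · rw [zero_smul]; exact Submodule.zero_mem _
  · refine (F.mem_ANormal_iff (h𝒱 ▸ Tower.isModule_fields) ha hp₁ F.mem ((T₁.mem_boundary_iff hp₁).1 hp) _).2 fun j hj => ?_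
    have hsm : ∀ (c : ℝ) (X : 𝒱), atVal p _ = c • atVal p X := fun c X => rfl
    rw [map_sub, atVal_sum, map_sum, Finset.sum_eq_single j]
    · rw [hsm, map_smul, F.β_X hp₁ j j F.mem, if_pos rfl, if_pos hj, smul_eq_mul, mul_one, sub_self]
    · intro l _ hl
      rw [hsm, map_smul, F.β_X hp₁ j l F.mem, if_neg hl.symm, smul_zero]
    · simp

variable (T) in
lemma mem_refinement (ha₀ : a 0 = 1) (ha : ∀ i, 1 ≤ a i)
    (h : IsRefinement a 𝒱 ℛ) (V : 𝒱)
    (hV : ∀ (s : Symb T a 𝒱 ℛ), ∀ p ∈ ∂M, s.σ p (atVal p V) = 0) :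
    V.1 ∈ ℛ := by
  obtain ⟨T₁, hℛ, h𝒱⟩ := h
  obtain ⟨φ, hφ, hx⟩ := T.exists_ratio T₁
  have hV₁ : V.1 ∈ T₁.fields a := h𝒱 ▸ V.2
  have key : ∀ (s : Symb T a 𝒱 ℛ) (A B : ℕ) (f w : M → ℝ), IsQuotientOn
      _ T₁.x f A w → (∀ q ∈ 𝕌 ∩ T₁.emb.source,
        s.σ q _ = φ q ^ B * w q) → BigO _ T₁.x f (A + 1) :=
    fun s A B f w hw hs => by
      obtain ⟨g, hg, hwg⟩ := T₁.exists_quotient T₁.emb.open_source subset_rfl hw.1 fun q _ hb => by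
        have hq : q ∈ 𝕌 ∩ T₁.emb.source := ⟨T.boundary_subset hb, T₁.boundary_subset hb⟩
        have h1 := hs q hq
        rw [hV s q hb] at h1
        exact (mul_eq_zero.1 h1.symm).resolve_left (pow_ne_zero _ (hx q hq).1)
      exact ⟨g, hg, fun q hq => by rw [hw.2 q hq, hwg q hq, pow_succ, mul_assoc]⟩
  rw [← hℛ]
  refine ⟨hV₁.1, fun u hu => ?_, fun i y hy => ?_⟩
  · rw [tailSum_refineOrder a (Nat.zero_le _)]
    obtain ⟨s, -, -, hs⟩ := exists_conormalSymbol_log ha₀ h𝒱 hℛ hφ hx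
    obtain ⟨w₀, hw₀⟩ := hV₁.2.1 id contDiff_id
    obtain ⟨g, hg, hg'⟩ := key s _ _ (dirDeriv V.1 T₁.x) w₀ hw₀ (hs V w₀ hw₀)
    refine ⟨fun q => deriv u (T₁.x q) * g q, ?_, fun q hq => ?_⟩
    · exact ((contDiff_infty_iff_deriv.1 hu).2.contMDiff.comp_contMDiffOn T₁.contMDiffOn_x).mul hg
    · rw [dirDeriv_comp (hu.differentiable (by simp) _).hasDerivAt (((T₁.contMDiffOn_x q hq).contMDiffAt
        (T₁.emb.open_source.mem_nhds hq)).mdifferentiableAt (by simp)), hg' q hq]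
      ring
  · rw [tailSum_refineOrder a i.2]
    obtain ⟨s, -, -, hs⟩ := exists_conormalSymbol_proj ha h𝒱 hℛ hφ hx i hy
    obtain ⟨w, hw⟩ := hV₁.2.2 i y hy
    exact key s _ _ _ w hw (hs V w hw)

end Refinement

namespace Tower.Charts

variable (Γ : T.Charts)

/-- The point with coordinates `c p + t e_0`. -/
def push (p : M) (t : ℝ) : 𝔼 := (Γ p).c p + Pi.single 0 t

/-- The limit of the difference quotients of order `A` of `f` at `p` and `p'`. -/
def fibreDiff (f : M → ℝ) (A : ℕ) (p p' : M) : ℝ := limUnder (𝓝[>] 0) fun t =>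
  (f ((Γ p).inv (Γ.push p t)) - f ((Γ p').inv (Γ.push p' t))) / t ^ A

variable {Γ} {f : M → ℝ} {A : ℕ} {O : Set (Idx n → ℝ)} {R : (Idx n → ℝ) → ℝ} {U : Set M} {σ :
  ACoField 𝒱}

lemma c_self (hp : p ∈ ∂M) : (Γ p).c p 0 = 0 :=
  ((Γ p).mem_boundary_iff (Γ p).mem).1 hp

lemma continuous_push (p : M) : Continuous (Γ.push p) :=
  continuous_const.add (continuous_pi fun j => by
    by_cases h : j = 0
    · subst h; simpa using continuous_id'
    · simpa [h] using continuous_const)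

lemma push_zero (p : M) : Γ.push p 0 = (Γ p).c p := by simp [push]

lemma push_apply_zero (hp : p ∈ ∂M) (t : ℝ) : Γ.push p t 0 = t := by
  simp [push, c_self hp]

lemma continuous_elim_push (p p' : M) :
    Continuous fun t => (elim (Γ.push p t) (Γ.push p' t) : ℝⁿ) := by
  refine continuous_pi fun j => ?_
  rcases j with j | j
  · exact (continuous_apply j).comp (continuous_push p)
  · exact (continuous_apply j).comp (continuous_push p')

namespace IsQuot

lemma eventually_mem (h : Γ.IsQuot f A p p' O R) (hp : p ∈ ∂M)
    (hp' : p' ∈ ∂M) : ∀ᶠ t in 𝓝[>] (0 : ℝ), 0 < t ∧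
    (elim (Γ.push p t) (Γ.push p' t) : ℝⁿ) ∈ orthInt (faces n) ∩ O := by
  filter_upwards [nhdsWithin_le_nhds ((continuous_elim_push p p').continuousAt.eventually (h.isOpen.mem_nhds (by
      simp only [push_zero]; exact h.mem))), self_mem_nhdsWithin] with t ht ht0
  refine ⟨ht0, fun j hj => ?_, ht⟩
  simp [faces, Finset.mem_insert, Finset.mem_singleton] at hj
  rcases hj with rfl | rfl
  · exact lt_of_lt_of_eq ht0 (push_apply_zero hp t).symm
  · exact lt_of_lt_of_eq ht0 (push_apply_zero hp' t).symm

lemma tendsto_comp (h : Γ.IsQuot f A p p' O R) (hp : p ∈ ∂M)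
    (hp' : p' ∈ ∂M) {E : Type*} [TopologicalSpace E] {G : ℝⁿ → E}
    (hG : ContinuousOn G (orth (faces n) ∩ O)) :
    Tendsto (fun t => G (elim (Γ.push p t) (Γ.push p' t))) (𝓝[>] 0)
      (𝓝 (G (elim ((Γ p).c p) ((Γ p').c p')))) := by
  refine (hG _ (⟨mem_orth_faces.2 ⟨(c_self hp).ge, (c_self hp').ge⟩, h.mem⟩)).tendsto.comp (tendsto_nhdsWithin_iff.2 ⟨?_, ?_⟩)
  · have := (continuous_elim_push (Γ := Γ) p p').tendsto 0
    rw [push_zero, push_zero] at this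
    exact this.mono_left nhdsWithin_le_nhds
  · filter_upwards [h.eventually_mem hp hp'] with t ht
    exact ⟨fun j hj => (ht.2.1 j hj).le, ht.2.2⟩

lemma tendsto (h : Γ.IsQuot f A p p' O R) (hp : p ∈ ∂M)
    (hp' : p' ∈ ∂M)
    (hb : ∀ j, Γ.lev j ≤ k → (Γ p).c p j = (Γ p').c p' j) : Tendsto (fun t => (f ((Γ p).inv (Γ.push p t)) -
    f ((Γ p').inv (Γ.push p' t))) / t ^ A) (𝓝[>] 0)
      (𝓝 (R (elim ((Γ p).c p) ((Γ p').c p')))) := by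
  refine (h.tendsto_comp hp hp' h.smooth.continuousOn).congr' ?_
  filter_upwards [h.eventually_mem hp hp'] with t ht
  rw [(h.eq _ _ ht.2.2 (fun j hj => by simp [push, hb j hj])
    (by rw [push_apply_zero hp]; exact ht.1)).2.2, push_apply_zero hp,
    mul_div_cancel_left₀ _ (pow_pos ht.1 A).ne']

lemma fibreDiff_eq (h : Γ.IsQuot f A p p' O R) (hp : p ∈ ∂M)
    (hp' : p' ∈ ∂M)
    (hb : ∀ j, Γ.lev j ≤ k → (Γ p).c p j = (Γ p').c p' j) : Γ.fibreDiff f A p p' = R (elim ((Γ p).c p) ((Γ p').c p')) :=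
  (h.tendsto hp hp' hb).limUnder_eq

end IsQuot

lemma Frame.hasFDerivAt_symbol (F : Γ.Frame (𝒱 := 𝒱) a p) (hp : p ∈ 𝕌) (hU : IsOpen U)
    (hσ : IsSymbol T.x U f A σ) {w : 𝔼} (hw : w ∈ (Γ p).D) (h0 : 0 < w 0)
    (hwN : (Γ p).inv w ∈ F.N ∩ U) : ∃ G : 𝔼 →L[ℝ] ℝ,
      HasFDerivAt (fun w => f ((Γ p).inv w)) G w ∧ ∀ j, w 0 ^ Γ.wt a j * G (Pi.single j 1) =
        w 0 ^ A * σ ((Γ p).inv w) (atVal ((Γ p).inv w) (F.X j)) := by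
  set C := Γ p
  have hi : C.inv w ∈ U ∩ M° := ⟨hwN.2, (C.inv_mem_interior_iff hw).2 h0⟩
  have hsm := (hσ.smooth _ hi).contMDiffAt ((hU.inter (ModelWithCorners.isOpen_interior (n := ∞) (by simp))).mem_nhds hi)
  have hD : C.D ∈ 𝓝 w := by
    filter_upwards [(isOpen_lt continuous_const (continuous_apply 0)).mem_nhds h0,
      isOpen_ball.mem_nhds hw.2] with y hy hy'
    exact ⟨fun j hj => by rw [Finset.mem_singleton] at hj; rw [hj]; exact le_of_lt hy, hy'⟩
  have hd : HasFDerivAt (f ∘ C.inv) (fderivWithin ℝ (f ∘ C.inv) C.D w) w := by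
    rw [fderivWithin_of_mem_nhds hD]
    exact ((hsm.comp w (C.smooth_inv.contMDiffAt hD)).contDiffAt.differentiableAt
      (by simp)).hasFDerivAt
  refine ⟨_, hd, fun j => ?_⟩
  have h1 := hσ.eq (F.X j) _ hi
  rw [F.dirDeriv_X j hwN.1 (hsm.mdifferentiableAt (by simp)), C.right w hw,
    ← Γ.c_zero p hp _ (F.mem_source hp hwN.1), C.right w hw] at h1
  exact h1

lemma IsQuot.symbol_eq (ha₀ : a 0 = 1) (ha : ∀ i, 1 ≤ a i)
    (h : Γ.IsQuot f A p p' O R)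
    (hp : p ∈ ∂M) (hp' : p' ∈ ∂M)
    (hb : ∀ j, Γ.lev j ≤ k → (Γ p).c p j = (Γ p').c p' j)
    (hA : A = 0 ∨ 0 < tailSum a 1) (hU : IsOpen U) (hbU : ∂M ⊆ U)
    (hσ : IsSymbol T.x U f A σ) (F : Γ.Frame (𝒱 := 𝒱) a p) (F' : Γ.Frame (𝒱 := 𝒱) a p') {j : Fin n}
    (hj : Γ.lev j ≤ k) : σ p (atVal p (F.X j)) = σ p' (atVal p' (F'.X j)) := by
  have hsym : ∀ {y : M} (hy : y ∈ ∂M) (G : Γ.Frame a y),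
      Tendsto (fun t => σ ((Γ y).inv (Γ.push y t)) _)
        _ _ ∧
      ∀ᶠ t in 𝓝[>] 0, Γ.push y t ∈ (Γ y).D ∧
        (Γ y).inv _ ∈ G.N ∩ U := fun {y} hy G => by
    have hc := (Γ y).c_mem (Γ y).mem
    have hD : Tendsto (Γ.push y) (𝓝[>] 0) (𝓝[(Γ y).D] ((Γ y).c y)) := by
      refine tendsto_nhdsWithin_iff.2 ⟨?_, ?_⟩
      · rw [← push_zero]; exact ((continuous_push y).tendsto 0).mono_left nhdsWithin_le_nhds
      · have h1 : ∀ᶠ t in 𝓝 _, Γ.push y t ∈ ball ((Γ y).c y) _ :=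
          (continuous_push y).continuousAt.eventually (isOpen_ball.mem_nhds
            (by rw [push_zero]; exact hc.2))
        filter_upwards [nhdsWithin_le_nhds h1, self_mem_nhdsWithin] with t ht ht0
        refine ⟨fun l hl => ?_, ht⟩
        rw [Finset.mem_singleton] at hl
        rw [hl, push_apply_zero hy]; exact le_of_lt ht0
    have hinv : Tendsto (fun t => (Γ y).inv (Γ.push y t)) (𝓝[>] 0) (𝓝 y) := by
      have := ((Γ y).smooth_inv.continuousOn _ hc).tendsto.comp hD
      rwa [(Γ y).inv_c (Γ y).mem] at this
    exact ⟨(((hσ.smooth_val (G.X j)).continuousOn.continuousAt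
      (hU.mem_nhds (hbU hy))).tendsto).comp hinv,
      (tendsto_nhdsWithin_iff.1 hD).2.and
        (hinv.eventually ((G.isOpen.inter hU).mem_nhds ⟨G.mem, hbU hy⟩))⟩
  obtain ⟨l1, e1⟩ := hsym hp F
  obtain ⟨l2, e2⟩ := hsym hp' F'
  set K := orth (faces n) ∩ O
  set d : ℝⁿ := elim (Pi.single j 1) (Pi.single j 1)
  have lD := h.tendsto_comp hp hp' (G := fun v => fderivWithin ℝ R K v d)
    (((h.smooth.continuousOn_fderivWithin (uniqueDiffOn_orth_inter _ h.isOpen) (by simp)).clm_apply continuousOn_const))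
  have lR := h.tendsto_comp hp hp' h.smooth.continuousOn
  have hz : Tendsto (fun t : ℝ => t ^ Γ.wt a j * fderivWithin ℝ R K
      (elim (Γ.push p t) (Γ.push p' t)) d + (if j = 0 then A * t ^ Γ.ex a 0 else 0) *
        R (elim (Γ.push p t) (Γ.push p' t))) (𝓝[>] 0) (𝓝 0) := by
    have hpow : ∀ N : ℕ, Tendsto (fun t : ℝ => t ^ N) (𝓝[>] 0) _ := fun N =>
      ((continuous_pow N).tendsto 0).mono_left nhdsWithin_le_nhds
    have t1 := (hpow (Γ.wt a j)).mul lD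
    rw [zero_pow (by have := Γ.one_le_wt ha hj; omega), zero_mul] at t1
    have t2 : Tendsto (fun t : ℝ => if j = 0 then A * t ^ Γ.ex a 0 else 0) (𝓝[>] 0) (𝓝 0) := by
      split_ifs
      · rcases hA with hA | hA
        · simp [hA]
        · have := (hpow (Γ.ex a 0)).const_mul (A : ℝ)
          rwa [zero_pow (by rw [ex_zero]; omega), mul_zero] at this
      · exact tendsto_const_nhds
    simpa using t1.add (t2.mul lR)
  refine sub_eq_zero.1 (tendsto_nhds_unique (l1.sub l2) (hz.congr' ?_))
  filter_upwards [e1, e2, h.eventually_mem hp hp'] with t h1 h2 h3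
  obtain ⟨G₁, d1, g1⟩ := F.hasFDerivAt_symbol (T.boundary_subset hp) hU hσ h1.1
    (by rw [push_apply_zero hp]; exact h3.1) h1.2
  obtain ⟨G₂, d2, g2⟩ := F'.hasFDerivAt_symbol (T.boundary_subset hp') hU hσ h2.1
    (by rw [push_apply_zero hp']; exact h3.1) h2.2
  have g1 := g1 j
  have g2 := g2 j
  rw [push_apply_zero hp] at g1
  rw [push_apply_zero hp'] at g2
  have hKn := ((isOpen_orthInt _).inter h.isOpen).mem_nhds h3.2
  have hel : ∀ s : ℝ, (elim (Γ.push p t) (Γ.push p' t) : ℝⁿ) + s • d =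
      elim (Γ.push p t + s • Pi.single j 1) (Γ.push p' t + s • Pi.single j 1) := fun s => by
    funext l; rcases l with l | l <;> rfl
  have d3 := ((h.smooth.differentiableOn (by simp) _ (inter_subset_inter_left _ (orthInt_subset _)
    h3.2)).hasFDerivWithinAt.hasFDerivAt
      (mem_of_superset hKn (inter_subset_inter_left _ (orthInt_subset _)))).hasLineDerivAt d
  have hx : HasDerivAt (fun s : ℝ => (t + if j = 0 then s else 0) ^ A)
      (A * t ^ (A - 1) * if j = 0 then 1 else 0) 0 := by
    have : HasDerivAt (fun s : ℝ => t + if j = 0 then s else 0) (if j = 0 then 1 else 0) 0 := by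
      split_ifs
      · exact (hasDerivAt_id _).const_add t
      · exact hasDerivAt_const _ _
    exact (this.pow A).congr_deriv (by simp)
  have d4 := (hx.mul d3).congr_of_eventuallyEq (f₁ := fun s : ℝ =>
    f _ -
      f _) (by
    filter_upwards [(show Continuous fun s : ℝ => (elim (Γ.push p t) (Γ.push p' t) : ℝⁿ) +
      s • d by fun_prop).tendsto' 0 _ (by simp) |>.eventually hKn] with s hs
    have hs0 : 0 < (Γ.push p t + s • Pi.single j 1 : 𝔼) 0 := by
      have := hs.1 (inl 0) (by simp [faces])
      rwa [hel] at this
    rw [hel] at hs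
    rw [((h.eq _ _ hs.2 (fun l hl => by simp [push, hb l hl]) hs0).2.2)]
    simp only [hel]
    congr 2
    rw [Pi.add_apply, push_apply_zero hp]
    by_cases hj0 : j = 0
    · simp [hj0]
    · simp [hj0])
  have hu := ((d1.hasLineDerivAt (Pi.single j 1)).sub (d2.hasLineDerivAt _)).unique d4
  have ht := h3.1
  simp at hu
  refine mul_left_cancel₀ (pow_pos ht A).ne' ?_
  rw [mul_sub, ← g1, ← g2, ← mul_sub, hu]
  by_cases hj0 : j = 0
  · subst hj0
    rw [Γ.wt_zero_eq ha₀]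
    rcases A with _ | A
    · simp [K, mul_comm]
    · simp; ring
  · simp [hj0, if_false]; ring

end Tower.Charts

namespace Tower.Charts

variable (Γ : T.Charts) (ha₀ : a 0 = 1) (ha : ∀ i, 1 ≤ a i) (h𝒱 : T.fields a = 𝒱) (hconn : ∀ p ∈
  (𝓡∂ n).boundary M, IsPreconnected {p' | p' ∈ (𝓡∂ n).boundary M ∧ p ∼ p'})

lemma sameFibre_symm_trans {m : Fin (k + 1)} (h : T.SameFibre m p p') (h' : T.SameFibre m p p'') :
    T.SameFibre m p' p'' :=
  ⟨h.1.symm.trans h'.1, fun j hj => (h.2 j hj).symm.trans (h'.2 j hj)⟩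

lemma exists_fibreQuotient (ha₀ : a 0 = 1) (h𝒱 : T.fields a = 𝒱)
    (hconn : ∀ p ∈ ∂M,
      IsPreconnected {p' | p' ∈ ∂M ∧ p ∼ p'})
    (s : Symb T a 𝒱 ℛ)
    (hp : p ∈ ∂M) (hp' : p' ∈ ∂M)
    (hs : p ∼ p') : ∃ O R, Γ.IsQuot s.f s.A p p' O R ∧
      R (elim ((Γ p).c p) ((Γ p').c p')) = Γ.fibreDiff s.f s.A p p' := by
  obtain ⟨O, R, h⟩ := Γ.exists_isFibreQuotient ha₀ h𝒱 s.isOpen s.subset s.symbol hp hp' hs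
    (hconn p hp)
  exact ⟨O, R, h, (h.fibreDiff_eq hp hp'
    (Γ.base_eq (T.boundary_subset hp) (T.boundary_subset hp') hs)).symm⟩

lemma fibreDiff_add (ha₀ : a 0 = 1) (h𝒱 : T.fields a = 𝒱)
    (hconn : ∀ p ∈ ∂M,
      IsPreconnected {p' | p' ∈ ∂M ∧ p ∼ p'})
    (s : Symb T a 𝒱 ℛ) (hp : p ∈ ∂M)
    (hp' : p' ∈ ∂M) (hp'' : p'' ∈ ∂M)
    (hs : p ∼ p') (hs' : p ∼ p'') :
    Γ.fibreDiff s.f s.A p p' + Γ.fibreDiff s.f s.A p' p'' = Γ.fibreDiff s.f s.A p p'' := by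
  have key : ∀ {x y : M}, x ∈ ∂M → y ∈ ∂M →
      T.SameFibre _ x y → Tendsto (fun t => (s.f _ -
        s.f _) / t ^ s.A) _ _ :=
    fun hx hy h => by
      obtain ⟨O, R, hR, he⟩ := Γ.exists_fibreQuotient ha₀ h𝒱 hconn s hx hy h
      exact he ▸ hR.tendsto hx hy (Γ.base_eq (T.boundary_subset hx) (T.boundary_subset hy) h)
  refine tendsto_nhds_unique (((key hp hp' hs).add (key hp' hp'' (sameFibre_symm_trans hs hs'))).congr
    fun t => ?_) (key hp hp'' hs')
  rw [← add_div, sub_add_sub_cancel]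

section Family

variable {ι : Type*} [Fintype ι] (s : ι → Symb T a 𝒱 ℛ) (γ : ℝ^ι)

lemma sum_symbol_eq_zero (Γ : T.Charts) (s : ι → Symb T a 𝒱 ℛ) (γ : ℝ^ι) (ha₀ : a 0 = 1) (ha : ∀ i, 1 ≤ a i) (h𝒱 : T.fields a = 𝒱)
    (hconn : ∀ p ∈ ∂M,
      IsPreconnected {p' | p' ∈ ∂M ∧ p ∼ p'})
    (h : IsRefinement a 𝒱 ℛ) (hp : p ∈ ∂M)
    (hp' : p' ∈ ∂M) (hs : p ∼ p')
    (h0 : ∀ η ∈ ANormal 𝒱 p, ∑ i, γ i * (s i).σ p η = 0) (α : AT 𝒱 p') :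
    ∑ i, γ i * (s i).σ p' α = 0 := by
  have hmod : IsModule 𝒱 := h𝒱 ▸ isModule_fields
  have hps := T.boundary_subset hp
  have hps' := T.boundary_subset hp'
  obtain ⟨F⟩ := Γ.exists_frame h𝒱 hps
  obtain ⟨F'⟩ := Γ.exists_frame h𝒱 hps'
  have hn : ∀ η ∈ ANormal 𝒱 p', ∑ i, γ i * (s i).σ p' η = 0 := fun η hη => by
    have hexp : ∀ i, γ i * (s i).σ p' η =
        ∑ j, F'.β j p' η * (γ i * (s i).σ p' (atVal p' (F'.X j))) := fun i => by
      conv_lhs => rw [F'.eq_sum hmod hps' F'.mem η]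
      rw [map_sum, mul_sum]
      exact sum_congr rfl fun j _ => by rw [map_smul, smul_eq_mul]; ring
    rw [sum_congr rfl fun i _ => hexp i, Finset.sum_comm]
    refine sum_eq_zero fun j _ => ?_
    rw [← mul_sum]
    rcases lt_or_ge k _ with hj | hj
    · rw [(F'.mem_ANormal_iff hmod ha hps' F'.mem ((T.mem_boundary_iff hps').1 hp') η).1 hη j hj,
        zero_mul]
    · refine (congrArg _ (Eq.trans ?_ (h0 (atVal p (F.X j)) ((F.mem_ANormal_iff hmod ha hps F.mem
        ((T.mem_boundary_iff hps).1 hp) _).2 fun l hl => by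
          rw [F.β_X hps l j F.mem, if_neg fun h => by rw [h] at hl; omega])))).trans (mul_zero _)
      refine sum_congr rfl fun i _ => ?_
      obtain ⟨O, R, hR, -⟩ := Γ.exists_fibreQuotient ha₀ h𝒱 hconn (s i) hp hp' hs
      rw [hR.symbol_eq ha₀ ha hp hp' (Γ.base_eq hps hps' hs) (s i).order (s i).isOpen (s i).subset
        (s i).symbol F F' hj]
  obtain ⟨V, rfl⟩ := Submodule.Quotient.mk_surjective _ α
  obtain ⟨W, hW, hWn⟩ := exists_anchor_eq h ha hp' V
  rw [← hn _ hWn]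
  refine sum_congr rfl fun i _ => ?_
  rw [map_sub, (s i).conormal p' hp' W hW, sub_zero]
  rfl

lemma path_boundary (hp : p ∈ ∂M) {ρ : ℝ} (hρ : ρ ≤ (Γ p).r)
    (hp' : p' ∈ ∂M)
    (hs : p ∼ p') (hpρ : (Γ p).c p' ∈ ball ((Γ p).c p) ρ)
    (hpU : p' ∈ (Γ p).U) {t : ℝ} (ht : t ∈ Icc (0 : ℝ) 1) :
    let v : ℝⁿ := elim ((Γ p).c p) fun j => if j = 0 then 0 else (Γ p).c p' j
    path v t ∈ orth {0} ∩ ball ((Γ p).c p) ρ ∧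
      (Γ p).inv (path v t) ∈ ∂M ∧
      T.SameFibre (Fin.last k) p ((Γ p).inv (path v t)) := by
  intro v
  have hps := T.boundary_subset hp
  have hc0 : (Γ p).c p 0 = 0 := c_self hp
  have hl : lft v = (Γ p).c p := rfl
  have hst : pstart v = (Γ p).c p' := by
    funext j
    by_cases hj : j = 0
    · subst hj
      simp [pstart, v, hc0, ((Γ p).mem_boundary_iff hpU).1 hp']
    · simp [pstart, v, hj]
  have hm := path_mem (v := v)
    ⟨fun j hj => by rw [Finset.mem_singleton] at hj; rw [hj]; exact hc0.ge,
      by rw [hl]; exact mem_ball_self (dist_nonneg.trans_lt (mem_ball.1 hpρ)),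
      by rw [hst]; exact hpρ⟩ ht
  have hD : path v t ∈ (Γ p).D := ⟨hm.1, ball_subset_ball hρ hm.2⟩
  refine ⟨hm, ((Γ p).inv_mem_boundary_iff hD).2 (by simp [path, v, hc0]), ?_⟩
  rw [Γ.same _ p p hps hps ⟨rfl, fun _ _ => rfl⟩ p (Γ p).mem _
    ((Γ p).inv_mem _ hD), (Γ p).right _ hD]
  intro j hj
  by_cases hj0 : j = 0
  · simp [path, v, hc0, hj0]
  · simp [path, v, hj0, ((Γ.same (Fin.last k) p p hps hps ⟨rfl, fun _ _ => rfl⟩ p (Γ p).mem p' hpU).1 hs) j hj]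

lemma sum_fibreDiff_eq_zero (ha₀ : a 0 = 1) (ha : ∀ i, 1 ≤ a i) (h𝒱 : T.fields a = 𝒱)
    (hconn : ∀ p ∈ ∂M,
      IsPreconnected {p' | p' ∈ ∂M ∧ p ∼ p'})
    (h : IsRefinement a 𝒱 ℛ) (hp : p ∈ ∂M)
    (hp' : p' ∈ ∂M) (hs : p ∼ p')
    (h0 : ∀ η ∈ ANormal 𝒱 p, ∑ i, γ i * (s i).σ p η = 0) :
    ∑ i, γ i * Γ.fibreDiff (s i).f (s i).A p p' = 0 := by
  have hself : p ∼ p := ⟨rfl, fun _ _ => rfl⟩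
  refine (hconn p hp).induction₂
    (fun x y => ∑ i, γ i * Γ.fibreDiff (s i).f (s i).A x y = 0) (fun x hx => ?_)
    (fun x y z hx hy hz h1 h2 => ?_) (fun x y hx hy h1 => ?_) ⟨hp, hself⟩ ⟨hp', hs⟩
  · have hxs := T.boundary_subset hx.1
    obtain ⟨F⟩ := Γ.exists_frame h𝒱 hxs
    obtain ⟨ρ, hρ0, hρr, hρ⟩ := Γ.exists_radius F
      (isOpen_iInter_of_finite fun i => (s i).isOpen) (mem_iInter.2 fun i => (s i).subset hx.1)
    have hρi : ∀ i, ∀ w ∈ orth {0} ∩ ball _ ρ,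
        (Γ x).inv w ∈ F.N ∩ (s i).U := fun i w hw => ⟨(hρ w hw).1, mem_iInter.1 (hρ w hw).2 i⟩
    filter_upwards [nhdsWithin_le_nhds (Filter.Eventually.and ((Γ x).isOpen.mem_nhds (Γ x).mem)
        (((Γ x).smooth.continuousOn.continuousAt
          ((Γ x).isOpen.mem_nhds (Γ x).mem)).eventually (ball_mem_nhds _ hρ0))), nhdsWithin_le_nhds (eventually_all.2 fun i => Γ.eventually_isFibreQuotient ha₀ (s i).isOpen (s i).symbol
      hxs ((s i).subset hx.1) F), self_mem_nhdsWithin]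
      with y hy hq hyC
    have hxy := sameFibre_symm_trans hx.2 hyC.2
    have hys := T.boundary_subset hyC.1
    have hpath := fun t ht => Γ.path_boundary hx.1 hρr hyC.1 hxy hy.2 hy.1 (t := t) ht
    set v : ℝⁿ := elim _ fun j => if j = 0 then 0 else (Γ x).c y j
    have hL : ∀ i, Γ.fibreDiff (s i).f (s i).A x y = ∑ j, (if Γ.lev j ≤ k then 0 else
        (Γ x).c x j - (Γ x).c y j) * F.avg (s i).σ (s i).A j v := fun i => by
      obtain ⟨O, R, hR, he⟩ := hq i hys hxy
      exact (hR.fibreDiff_eq hx.1 hyC.1 (Γ.base_eq hxs hys hxy)).trans he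
    have havg : ∀ i j, F.avg (s i).σ (s i).A j v = ∫ t in 0..1,
        (s i).σ ((Γ x).inv (path v t)) (atVal _ (F.X j)) := fun i j => by
      simp [Frame.avg, v]
    have hsum : ∀ j, ∑ i, γ i * F.avg (s i).σ (s i).A j v = 0 := fun j => by
      simp [havg, ← intervalIntegral.integral_const_mul]
      rw [← intervalIntegral.integral_finsetSum]
      · rw [intervalIntegral.integral_congr, intervalIntegral.integral_zero]
        intro t ht
        rw [uIcc_of_le zero_le_one] at ht
        exact Γ.sum_symbol_eq_zero s γ ha₀ ha h𝒱 hconn h hp (hpath t ht).2.1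
          (sameFibre_symm_trans (sameFibre_symm_trans hx.2 hself) (hpath t ht).2.2) h0 _
      · intro i _
        refine ContinuousOn.intervalIntegrable ?_
        rw [uIcc_of_le zero_le_one]
        exact continuousOn_const.mul ((F.contDiffOn_symbol (s i).symbol hρr (hρi i) j).continuousOn.comp
          ((contDiff_path).continuous.comp (Continuous.prodMk_right v)).continuousOn
          fun t ht => (hpath t ht).1)
    simp only [hL, mul_sum]
    rw [Finset.sum_comm]
    refine sum_eq_zero fun j _ => ?_
    have : ∀ c : ℝ, ∑ i, γ i * (c * F.avg (s i).σ (s i).A j v) = 0 := fun c => by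
      rw [sum_congr rfl fun i _ => mul_left_comm (γ i) c _, ← mul_sum, hsum j, mul_zero]
    exact this _
  · rw [← add_zero 0]
    nth_rw 1 [← h1]
    rw [← h2, ← Finset.sum_add_distrib]
    refine sum_congr rfl fun i _ => ?_
    rw [← mul_add, Γ.fibreDiff_add ha₀ h𝒱 hconn (s i) hx.1 hy.1 hz.1
      (sameFibre_symm_trans hx.2 hy.2) (sameFibre_symm_trans hx.2 hz.2)]
  · have hxx : x ∼ x := ⟨rfl, fun _ _ => rfl⟩
    rw [← neg_eq_zero, ← h1, ← sum_neg_distrib]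
    refine sum_congr rfl fun i _ => ?_
    have a1 := Γ.fibreDiff_add ha₀ h𝒱 hconn (s i) hx.1 hy.1 hx.1 (sameFibre_symm_trans hx.2 hy.2) hxx
    have a2 := Γ.fibreDiff_add ha₀ h𝒱 hconn (s i) hx.1 hx.1 hx.1 hxx hxx
    have : Γ.fibreDiff (s i).f (s i).A y x = -Γ.fibreDiff (s i).f (s i).A x y := by linarith
    rw [this]; ring

end Family

end Tower.Charts

lemma Patch.mem_closure_int {ι : Type} [Fintype ι] [DecidableEq ι] {W : Type*} {P : Patch ι W}
    {u : ℝ^ι} (hu : u ∈ P.dom) : u ∈ closure P.int := by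
  rw [P.int_eq]
  exact mem_closure_orthInt_inter P.isOpen ⟨hu.2, hu.1⟩

lemma Patch.SamePoint.tendsto_comp {ι : Type} [Fintype ι] [DecidableEq ι] {W E : Type*}
    {P Q : Patch ι W} {u v : ℝ^ι} (hz : SamePoint (P, u) (Q, v)) (hu : u ∈ P.dom) {G : W → E}
    {l : Filter E} (hG : Tendsto (fun w => G (Q.toFun w)) (𝓝[Q.int] v) l) :
    Tendsto (fun w => G (P.toFun w)) (𝓝[P.int] u) l := by
  obtain ⟨O, hO, O', hO', h, h', H, huO, hvO', hv, rfl, he⟩ := hz.exists_locDiffeo hu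
  have hev : ∀ᶠ w in 𝓝[P.int] u, w ∈ orth P.corners ∩ O ∧ w ∈ P.int := by
    filter_upwards [nhdsWithin_le_nhds (H.isOpen.mem_nhds huO), self_mem_nhdsWithin] with w h1 h2
    exact ⟨⟨(P.int_subset_dom h2).2, h1⟩, h2⟩
  have ht : Tendsto h (𝓝[P.int] u) (𝓝[Q.int] (h u)) := by
    refine tendsto_nhdsWithin_iff.2 ⟨?_, ?_⟩
    · refine ((H.smooth.continuousOn u ⟨hu.2, huO⟩).tendsto).mono_left (nhdsWithin_le_iff.2 ?_)
      filter_upwards [hev] with w hw using hw.1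
    · filter_upwards [hev] with w hw
      exact ⟨hO' (H.maps hw.1).2, (H.mem_orthInt_iff hw.1).2 hw.2.2⟩
  refine (hG.comp ht).congr' ?_
  filter_upwards [hev] with w hw
  exact (congrArg G (he w hw.1)).symm

namespace Tower

lemma HasCoords.mem_dom {ξ : T.DoubleSpace a} {P : 𝒫} {u : ℝⁿ}
    (h : T.HasCoords a ξ P u) : u ∈ P.dom := h.choose.2

lemma HasCoords.samePoint {ξ : T.DoubleSpace a} {P P' : 𝒫}
    {u u' : ℝⁿ} (h : T.HasCoords a ξ P u) (h' : T.HasCoords a ξ P' u') :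
    Patch.SamePoint (P, u) (P', u') := by
  obtain ⟨h1, rfl⟩ := h
  obtain ⟨h2, e⟩ := h'
  have key : ∀ z z' : T.PatchPoint a,
      Relation.EqvGen (fun z z' : T.PatchPoint a => Patch.SamePoint z.1 z'.1) z z' →
      Patch.SamePoint z.1 z'.1 := fun z z' h => by
    induction h with
    | rel _ _ h => exact h
    | refl => exact Patch.SamePoint.refl _
    | symm x _ _ ih => exact ih.symm x.2.2
    | trans x _ _ _ _ ih ih' => exact ih.trans x.2.2 ih'
  exact key _ _ (Quot.eqvGen_exact e)

lemma HasCoords.blowDown_eq {ξ : T.DoubleSpace a} {P : 𝒫} {u : ℝⁿ}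
    (h : T.HasCoords a ξ P u) : T.blowDown a ξ = P.toFun u := by
  obtain ⟨h1, rfl⟩ := h
  rfl

variable (T) in
/-- The standing assumptions: `T` represents `𝒱` to order `a` and has connected fibres. -/
structure Represents (a : Fin (k + 1) → ℕ)
    (𝒱 : Submodule ℝ (VField n M)) : Prop where
  zero : a 0 = 1
  one_le : ∀ i, 1 ≤ a i
  fields : T.fields a = 𝒱
  conn : ∀ p ∈ ∂M,
    IsPreconnected {p' | p' ∈ ∂M ∧ p ∼ p'}

namespace Charts

variable (Γ : T.Charts)

lemma nu_eq_ex : nu a Γ.lev k = Γ.ex a := by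
  funext j
  rw [nu_last]
  by_cases hj : j = 0
  · subst hj; rw [ex_zero, Γ.lev_zero]; rfl
  · rw [Γ.ex_of_ne hj, wt, max_eq_right (Nat.one_le_iff_ne_zero.2 fun h => hj ((Γ.lev_eq_zero j).1 h))]

/-- The point `ξ` has coordinates `v` in the model patch at `(p, p')`. -/
def Rep (ξ : T.DoubleSpace a) (p p' : M) (v : ℝⁿ) : Prop :=
  ∃ P u, T.HasCoords a ξ P u ∧ Patch.SamePoint (P, u) (Γ.stage a k p p', v)

variable {Γ} {ξ ξ' : T.DoubleSpace a} {v v' : Idx n → ℝ}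

namespace Rep

lemma samePoint (h : Γ.Rep ξ p p' v) {P : 𝒫} {u : ℝⁿ}
    (hu : T.HasCoords a ξ P u) : Patch.SamePoint (P, u) (Γ.stage a k p p', v) := by
  obtain ⟨P', u', hu', hz⟩ := h
  exact (hu.samePoint hu').trans hu.mem_dom hz

lemma mem_dom (h : Γ.Rep ξ p p' v) : v ∈ (Γ.stage a k p p').dom := by
  obtain ⟨P', u', hu', hz⟩ := h
  exact hz.mem_dom hu'.mem_dom

lemma blowDown_eq (h : Γ.Rep ξ p p' v) : T.blowDown a ξ = (Γ.stage a k p p').toFun v := by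
  obtain ⟨P', u', hu', hz⟩ := h
  exact hu'.blowDown_eq.trans (hz.apply_eq hu'.mem_dom)

lemma unique (h : Γ.Rep ξ p p' v) (h' : Γ.Rep ξ' p p' v) : ξ = ξ' := by
  obtain ⟨P, u, ⟨hu, rfl⟩, hz⟩ := h
  obtain ⟨P', u', ⟨hu', rfl⟩, hz'⟩ := h'
  exact Quot.sound (hz.trans hu.2 (hz'.symm hu'.2))

lemma fst_eq (h : Γ.Rep ξ p p' v) : (T.blowDown a ξ).1 = (Γ p).inv (lft v) := by
  rw [h.blowDown_eq]; rfl

lemma snd_eq (h : Γ.Rep ξ p p' v) :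
    (T.blowDown a ξ).2 = (Γ p').inv (snds Γ.lev k (Γ.ex a) v) := by
  rw [h.blowDown_eq, ← nu_eq_ex]; rfl

lemma lft_eq (h : Γ.Rep ξ p p' v) : lft v = (Γ p).c (T.blowDown a ξ).1 := by
  rw [h.fst_eq, (Γ p).right _ (mem_dom_model.1 h.mem_dom).1]

lemma snds_eq (h : Γ.Rep ξ p p' v) :
    snds Γ.lev k (Γ.ex a) v = (Γ p').c (T.blowDown a ξ).2 := by
  have := (mem_dom_model.1 h.mem_dom).2
  rw [nu_eq_ex] at this
  rw [h.snd_eq, (Γ p').right _ this]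

lemma fst_mem (h : Γ.Rep ξ p p' v) : (T.blowDown a ξ).1 ∈ (Γ p).U := by
  rw [h.fst_eq]; exact (Γ p).inv_mem _ (mem_dom_model.1 h.mem_dom).1

lemma tendsto (h : Γ.Rep ξ p p' v) {E : Type*} {l : Filter E} {G : M × M → E}
    (hG : Tendsto (fun w => G ((Γ.stage a k p p').toFun w)) (𝓝[(Γ.stage a k p p').int] v) l)
    {P : 𝒫} {u : ℝⁿ} (hu : T.HasCoords a ξ P u) :
    Tendsto (fun w => G (P.toFun w)) (𝓝[P.int] u) l :=
  (h.samePoint hu).tendsto_comp hu.mem_dom hG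

end Rep

variable (Γ)

lemma exists_rep (ha : ∀ i, 1 ≤ a i) (hξ : ξ ∈ T.frontInterior a) :
    (T.blowDown a ξ).1 ∈ ∂M ∧ (T.blowDown a ξ).2 ∈ ∂M ∧
      T.SameFibre (Fin.last k) (T.blowDown a ξ).1 (T.blowDown a ξ).2 ∧
      ∃ v, Γ.Rep ξ (T.blowDown a ξ).1 (T.blowDown a ξ).2 v ∧ v (inl 0) = 0 := by
  obtain ⟨i, P, u, hP, hu, hu0, hoff⟩ := hξ
  have hF := Γ.atlasFacts (fun i => (Nat.one_le_iff_ne_zero.1 (ha i))) _ _ _ hP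
  obtain ⟨hb, hs, w, hz⟩ := hF.loc i rfl u hu.mem_dom hu0 hoff
  obtain ⟨j, hj, hj0⟩ := hz.exists_zero hu.mem_dom ⟨i, hF.front_mem i rfl, hu0⟩
  rw [corners_model, Finset.mem_singleton] at hj
  rw [hu.blowDown_eq]
  exact ⟨hb.1, hb.2, hs, w, ⟨P, u, hu, hz⟩, hj ▸ hj0⟩

lemma exists_front (hp : p ∈ ∂M) (hp' : p' ∈ ∂M)
    (h : p ∼ p') {v : ℝⁿ} (hv : v ∈ (Γ.stage a k p p').dom)
    (hv0 : v (inl 0) = 0) : ∃ ξ ∈ T.frontInterior a, Γ.Rep ξ p p' v := by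
  obtain ⟨i, P, w, hP, hz, hw, hoff⟩ := Γ.exists_front_of_stage _ (T.boundary_subset hp)
    (T.boundary_subset hp') h hv hv0
  have hc : T.HasCoords a (Quot.mk _ ⟨(P, w), ⟨⟨some i, hP⟩, hz.mem_dom hv⟩⟩) P w := ⟨_, rfl⟩
  exact ⟨_, ⟨i, P, w, hP, hc, hw, hoff⟩, P, w, hc, hz.symm hv⟩

lemma exists_quot (H : T.Represents a 𝒱) (s : Symb T a 𝒱 ℛ)
    (hp : p ∈ ∂M) (hp' : p' ∈ ∂M)
    (hs : p ∼ p') (F : Γ.Frame (𝒱 := 𝒱) a p) :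
    ∃ (O : Set ℝⁿ) (R : ℝⁿ → ℝ), Γ.IsQuot s.f s.A p p' O R ∧
      R (elim ((Γ p).c p) ((Γ p').c p')) = Γ.fibreDiff s.f s.A p p' ∧
      ∀ v₀ : ℝⁿ, lft v₀ = (Γ p).c p →
      snds Γ.lev k (Γ.ex a) v₀ = (Γ p').c p' →
      ∃ (B : Set ℝⁿ) (Q : ℝⁿ → ℝ), IsOpen B ∧ v₀ ∈ B ∧ C∞ Q (orth {inl 0} ∩ B) ∧
      (∀ v ∈ orth {inl 0} ∩ B, v (inl 0) = 0 → Q v =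
        (∑ j, if Γ.lev j ≤ k then v (inr j) *
          s.σ ((Γ p).inv (lft v)) (atVal ((Γ p).inv (lft v)) (F.X j)) else 0) +
        R (elim (lft v) (snds Γ.lev k (Γ.ex a) v))) ∧
      (∀ v ∈ (Γ.stage a k p p').int ∩ B, s.f ((Γ.stage a k p p').toFun v).1 -
        s.f ((Γ.stage a k p p').toFun v).2 = T.x ((Γ.stage a k p p').toFun v).1 ^ s.A * Q v) ∧
      ∀ {P : 𝒫} {u v : ℝⁿ}, u ∈ P.dom → v ∈ B →
        Patch.SamePoint (P, u) (Γ.stage a k p p', v) →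
        Tendsto (fun w => (s.f (P.toFun w).1 - s.f (P.toFun w).2) / T.x (P.toFun w).1 ^ s.A)
          (𝓝[P.int] u) (𝓝 (Q v)) := by
  have hps := T.boundary_subset hp
  obtain ⟨O, R, hR, hRe⟩ := Γ.exists_fibreQuotient H.zero H.fields H.conn s hp hp' hs
  refine ⟨O, R, hR, hRe, fun v₀ h1 h2 => ?_⟩
  obtain ⟨B, hB, hvB, hQ, hQe⟩ := F.exists_contDiffOn_quot H.zero hps s.isOpen (s.subset hp) s.symbol
    hR (ν := Γ.ex a) (e := 0) (fun j _ => rfl) h1 h2 (Γ.base_eq hps (T.boundary_subset hp') hs)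
  have heq : ∀ v ∈ (Γ.stage a k p p').int ∩ B, 0 < T.x _ ∧
      s.f ((Γ.stage a k p p').toFun v).1 - s.f ((Γ.stage a k p p').toFun v).2 =
      T.x _ ^ s.A * F.quot s.σ s.A (Γ.ex a) R 0 v := fun v hv => by
    obtain ⟨hd, h0⟩ := mem_int_model.1 hv.1
    have hD := (mem_dom_model.1 hd).1
    have hx : T.x ((Γ.stage a k p p').toFun v).1 = v (inl 0) := by
      change T.x ((Γ p).inv (lft v)) = _
      rw [← Γ.c_zero p hps _ (Γ.subset p hps ((Γ p).inv_mem _ hD)), (Γ p).right _ hD]; rfl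
    have := hQe v ⟨fun j hj => by rw [Finset.mem_singleton] at hj; rw [hj]; exact h0.le, hv.2⟩ h0
    rw [pow_zero, one_mul, ← nu_eq_ex] at this
    rw [hx, ← nu_eq_ex]
    exact ⟨h0, this⟩
  refine ⟨B, _, hB, hvB, hQ, fun v hv hv0 => F.quot_of_eq_zero H.one_le (by rw [ex_zero]; exact s.order) hv0,
    fun v hv => (heq v hv).2, fun {P u v} hu hv hz => ?_⟩
  refine hz.tendsto_comp hu (G := fun q => (s.f q.1 - s.f q.2) / T.x q.1 ^ s.A) ?_
  have hc : Tendsto (F.quot s.σ s.A (Γ.ex a) R 0) (𝓝[(Γ.stage a k p p').int] v)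
      (𝓝 (F.quot s.σ s.A (Γ.ex a) R 0 v)) := by
    refine (hQ.continuousOn v ⟨(hz.mem_dom hu).2, hv⟩).tendsto.mono_left (nhdsWithin_le_iff.2 ?_)
    filter_upwards [self_mem_nhdsWithin, nhdsWithin_le_nhds (hB.mem_nhds hv)] with w h1 h2
    exact ⟨(Patch.int_subset_dom _ h1).2, h2⟩
  refine hc.congr' ?_
  filter_upwards [self_mem_nhdsWithin, nhdsWithin_le_nhds (hB.mem_nhds hv)] with w h1 h2
  obtain ⟨h3, h4⟩ := heq w ⟨h1, h2⟩
  rw [h4, mul_div_cancel_left₀ _ (pow_pos h3 _).ne']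

end Charts

end Tower

namespace Tower

variable {ξ ξ' : T.DoubleSpace a}

lemma Represents.isModule (H : T.Represents a 𝒱) : IsModule 𝒱 := H.fields ▸ isModule_fields

lemma eq_of_conormalSymbol (H : T.Represents a 𝒱) (h : IsRefinement a 𝒱 ℛ)
    (hp : p ∈ ∂M) {η η' : AT 𝒱 p} (hη : η ∈ ANormal 𝒱 p) (hη' : η' ∈ ANormal 𝒱 p)
    (he : ∀ s : Symb T a 𝒱 ℛ, s.σ p η = s.σ p η') : η = η' := by
  obtain ⟨s, κ, X, N, -, hpN, -, hc⟩ := exists_conormal_coframe T H.zero H.one_le h hp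
  rw [(hc p hpN hp).2 η hη, (hc p hpN hp).2 η' hη']
  simp [he]

namespace NormalProduct

lemma ext' {N N' : T.NormalProduct 𝒱} (h : N.p = N'.p) (h' : N.p' = N'.p')
    (hv : HEq N.v N'.v) : N = N' := by
  cases N; cases N'
  subst h h'
  subst hv
  rfl

end NormalProduct

variable (ℛ) in
/-- The normal vector `N` is given by the limits, at `ξ`, of the difference quotients of the functions
with conormal symbols. -/
def IsLimitAt (ξ : T.DoubleSpace a) (N : T.NormalProduct 𝒱) : Prop :=
  T.blowDown a ξ = (N.p, N.p') ∧ ∀ (s : Symb T a 𝒱 ℛ) P u, T.HasCoords a ξ P u →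
    Tendsto (fun w => (s.f (P.toFun w).1 - s.f (P.toFun w).2) / T.x (P.toFun w).1 ^ s.A)
      (𝓝[P.int] u) (𝓝 (s.σ N.p N.v))

lemma IsLimitAt.unique (H : T.Represents a 𝒱) (h : IsRefinement a 𝒱 ℛ)
    {N N' : T.NormalProduct 𝒱} (h1 : IsLimitAt ℛ ξ N) (h2 : IsLimitAt ℛ ξ N') : N = N' := by
  obtain ⟨p, p', hp, hp', hs, v⟩ := N
  obtain ⟨q, q', hq, hq', hs', v'⟩ := N'
  have e := h1.1.symm.trans h2.1
  obtain ⟨rfl, rfl⟩ := e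
  have := Subtype.ext (eq_of_conormalSymbol H h hp v.2 v'.2 fun s => by
    obtain ⟨⟨P, u⟩, hz⟩ := Quot.exists_rep ξ
    have hc : T.HasCoords a ξ P.1 P.2 := ⟨u, hz.symm⟩
    haveI :=
      mem_closure_iff_nhdsWithin_neBot.1 (Patch.mem_closure_int hc.mem_dom)
    exact tendsto_nhds_unique (h1.2 s _ _ hc) (h2.2 s _ _ hc))
  rw [this]

namespace Charts

variable (Γ : T.Charts)

lemma exists_shift (H : T.Represents a 𝒱) (h : IsRefinement a 𝒱 ℛ)
    (hp : p ∈ ∂M) (hp' : p' ∈ ∂M)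
    (hs : p ∼ p') : ∃ r ∈ ANormal 𝒱 p,
      ∀ s : Symb T a 𝒱 ℛ, s.σ p r = Γ.fibreDiff s.f s.A p p' := by
  obtain ⟨s, κ, X, N, -, hpN, -, hc⟩ := exists_conormal_coframe T H.zero H.one_le h hp
  obtain ⟨h1, h2⟩ := hc p hpN hp
  refine ⟨∑ l, Γ.fibreDiff (s l).f (s l).A p p' • κ l p • atVal p (X l),
    Submodule.sum_mem _ fun l _ => Submodule.smul_mem _ _ (h1 l), fun s₀ => ?_⟩
  have key := Γ.sum_fibreDiff_eq_zero (ι := Option (Fin n)) (fun o => o.elim s₀ s)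
    (fun o => o.elim 1 fun l => -(κ l p * s₀.σ p (atVal p (X l)))) H.zero H.one_le H.fields H.conn h
    hp hp' hs fun η hη => by
      rw [Fintype.sum_option]
      simp only [Option.elim]
      conv_lhs => enter [1, 2]; rw [h2 η hη]
      simp only [map_sum, map_smul]
      rw [one_mul, ← Finset.sum_add_distrib]
      exact sum_eq_zero fun l _ => by ring
  rw [Fintype.sum_option] at key
  simp only [Option.elim, one_mul] at key
  simp
  rw [← sub_eq_zero, ← neg_eq_zero, ← key, neg_sub, sub_eq_add_neg, ← sum_neg_distrib]
  exact congrArg _ (sum_congr rfl fun l _ => by ring)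

/-- The coordinates of a point of the front face over `(q, q')` in the model patch at `(p, p')`. -/
def stagePt (p p' q q' : M) (b : 𝔼) : ℝⁿ :=
  elim ((Γ p).c q) fun j => if Γ.lev j ≤ k then b j else (Γ p').c q' j

variable {Γ} in
lemma snds_of_eq_zero (ha : ∀ i, 1 ≤ a i) {v : ℝⁿ} (hv : v (inl 0) = 0)
    (j : Fin n) : snds Γ.lev k (Γ.ex a) v j =
      if Γ.lev j ≤ k then v (inl j) else v (inr j) := by
  split_ifs with hj
  · by_cases h : j = 0
    · subst h; rw [snds_zero, hv, zero_mul]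
    · rw [snds_of_le h hj, hv, Γ.ex_of_ne h, zero_pow (by
        have := Γ.one_le_wt ha hj; omega), zero_mul, sub_zero]
  · rw [snds_of_lt (fun h => hj (by rw [h]; exact Γ.lev_zero_le)) (not_le.1 hj)]

lemma snds_stagePt (ha : ∀ i, 1 ≤ a i) (hp : p ∈ ∂M)
    (hp' : p' ∈ ∂M) (hs : p ∼ p')
    (hq : q ∈ ∂M) (hqU : q ∈ (Γ p).U) (hqU' : q' ∈ (Γ p').U)
    (hs' : q ∼ q') (b : 𝔼) :
    snds Γ.lev k (Γ.ex a) (Γ.stagePt p p' q q' b) = (Γ p').c q' := by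
  funext j
  rw [snds_of_eq_zero ha (((Γ p).mem_boundary_iff hqU).1 hq)]
  split_ifs with hj
  · exact (Γ.same _ p p' (T.boundary_subset hp) (T.boundary_subset hp') hs q hqU q'
      hqU').1 hs' j hj
  · simp [stagePt, hj]

lemma stagePt_mem (ha : ∀ i, 1 ≤ a i) (hp : p ∈ ∂M)
    (hp' : p' ∈ ∂M) (hs : p ∼ p')
    (hq : q ∈ ∂M) (hqU : q ∈ (Γ p).U) (hqU' : q' ∈ (Γ p').U)
    (hs' : q ∼ q') (b : 𝔼) :
    Γ.stagePt p p' q q' b ∈ (Γ.stage a k p p').dom := by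
  rw [mem_dom_model, nu_eq_ex, Γ.snds_stagePt ha hp hp' hs hq hqU hqU' hs']
  exact ⟨(Γ p).c_mem hqU, (Γ p').c_mem hqU'⟩

lemma exists_front_stagePt (ha : ∀ i, 1 ≤ a i) (hp : p ∈ ∂M)
    (hp' : p' ∈ ∂M) (hs : p ∼ p')
    (hq : q ∈ ∂M) (hqU : q ∈ (Γ p).U) (hqU' : q' ∈ (Γ p').U)
    (hs' : q ∼ q') (b : 𝔼) :
    ∃ ξ ∈ T.frontInterior a, Γ.Rep ξ p p' (Γ.stagePt p p' q q' b) ∧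
      T.blowDown a ξ = (q, q') := by
  obtain ⟨ξ, hξ, h⟩ := Γ.exists_front hp hp' hs
    (Γ.stagePt_mem ha hp hp' hs hq hqU hqU' hs' b) (((Γ p).mem_boundary_iff hqU).1 hq)
  refine ⟨ξ, hξ, h, Prod.ext ?_ ?_⟩
  · rw [h.fst_eq]; exact (Γ p).inv_c hqU
  · rw [h.snd_eq, Γ.snds_stagePt ha hp hp' hs hq hqU hqU' hs', (Γ p').inv_c hqU']

variable {Γ} in
lemma Rep.eq_stagePt (ha : ∀ i, 1 ≤ a i) {v : ℝⁿ} (h : Γ.Rep ξ p p' v)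
    (hv : v (inl 0) = 0) (hb : T.blowDown a ξ = (q, q')) :
    v = Γ.stagePt p p' q q' fun j => v (inr j) := by
  funext j
  rcases j with j | j
  · have := congrFun h.lft_eq j
    rw [hb] at this
    exact this
  · have := congrFun h.snds_eq j
    rw [hb, snds_of_eq_zero ha hv] at this
    by_cases hj : Γ.lev j ≤ k
    · simp [stagePt, hj]
    · simpa [stagePt, hj] using this

variable {Γ} (F : Γ.Frame (𝒱 := 𝒱) a p)

/-- The normal vector with the given coordinates. -/
def Frame.vec (F : Γ.Frame (𝒱 := 𝒱) a p) (q : M) (v : ℝⁿ) : AT 𝒱 q :=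
  ∑ j, (if Γ.lev j ≤ k then v (inr j) else 0) • atVal q (F.X j)

lemma Frame.β_vec (hp : p ∈ 𝕌) (hq : q ∈ F.N) (v : ℝⁿ) (l : Fin n) :
    F.β l q (F.vec q v) = if Γ.lev l ≤ k then v (inr l) else 0 := by
  simp only [vec, map_sum, map_smul, F.β_X hp l _ hq]
  simp

lemma Frame.vec_mem (H : T.Represents a 𝒱) (hp : p ∈ 𝕌) (hq : q ∈ F.N)
    (hqb : q ∈ ∂M) (v : ℝⁿ) : F.vec q v ∈ ANormal 𝒱 q :=
  (F.mem_ANormal_iff H.isModule H.one_le hp hq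
    ((T.mem_boundary_iff (T.boundary_subset hqb)).1 hqb) _).2 fun j hj => by
      rw [F.β_vec hp hq, if_neg (not_le.2 hj)]

lemma Frame.vec_β (H : T.Represents a 𝒱) (hp : p ∈ 𝕌) (hq : q ∈ F.N)
    (hqb : q ∈ ∂M) {η : AT 𝒱 q} (hη : η ∈ ANormal 𝒱 q) {v : ℝⁿ}
    (hv : ∀ j, Γ.lev j ≤ k → v (inr j) = F.β j q η) : F.vec q v = η := by
  rw [F.eq_sum H.isModule hp hq η, vec]
  refine sum_congr rfl fun j _ => ?_
  split_ifs with hj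
  · rw [hv j hj]
  · rw [(F.mem_ANormal_iff H.isModule H.one_le hp hq
      ((T.mem_boundary_iff (T.boundary_subset hqb)).1 hqb) _).1 hη j (not_le.1 hj)]

lemma Frame.σ_vec (σ : ACoField 𝒱) (q : M) (v : ℝⁿ) : σ q (F.vec q v) =
    ∑ j, if Γ.lev j ≤ k then v (inr j) * σ q (atVal q (F.X j)) else 0 := by
  simp only [vec, map_sum, map_smul, smul_eq_mul, ite_mul, zero_mul]

lemma Rep.isLimitAt (H : T.Represents a 𝒱) {v : ℝⁿ} (h : Γ.Rep ξ p p' v)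
    (hv : v (inl 0) = 0) (hp : p ∈ ∂M) (hp' : p' ∈ ∂M)
    (hs : p ∼ p') (hb : T.blowDown a ξ = (p, p')) {r : AT 𝒱 p}
    (hr : r ∈ ANormal 𝒱 p)
    (hr' : ∀ s : Symb T a 𝒱 ℛ, s.σ p r = Γ.fibreDiff s.f s.A p p') :
    IsLimitAt ℛ ξ ⟨p, p', hp, hp', hs, ⟨F.vec p v + r,
      Submodule.add_mem _ (F.vec_mem H (T.boundary_subset hp) F.mem hp v) hr⟩⟩ := by
  refine ⟨hb, fun s P u hu => ?_⟩
  have h1 : lft v = (Γ p).c p := by rw [h.lft_eq, hb]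
  have h2 : snds Γ.lev k (Γ.ex a) v = (Γ p').c p' := by rw [h.snds_eq, hb]
  obtain ⟨O, R, hR, hRe, hex⟩ := Γ.exists_quot H s hp hp' hs F
  obtain ⟨B, Q, hB, hvB, hQ, hQ0, -, hlim⟩ := hex v h1 h2
  have := hlim hu.mem_dom hvB (h.samePoint hu)
  rw [hQ0 v ⟨h.mem_dom.2, hvB⟩ hv, h1, h2, hRe, ← F.σ_vec s.σ, (Γ p).inv_c (Γ p).mem,
    ← hr' s, ← map_add] at this
  exact this

end Charts

variable (T) in
lemma existsUnique_isLimitAt (H : T.Represents a 𝒱) (h : IsRefinement a 𝒱 ℛ) :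
    (∀ ξ ∈ T.frontInterior a, ∃! N : T.NormalProduct 𝒱, IsLimitAt ℛ ξ N) ∧
      ∀ N : T.NormalProduct 𝒱, ∃! ξ, ξ ∈ T.frontInterior a ∧ IsLimitAt ℛ ξ N := by
  obtain ⟨Γ⟩ := T.exists_charts
  refine ⟨fun ξ hξ => ?_, fun N => ?_⟩
  · obtain ⟨hp, hp', hs, v, hv, hv0⟩ := Γ.exists_rep H.one_le hξ
    obtain ⟨r, hr, hr'⟩ := Γ.exists_shift H h hp hp' hs
    obtain ⟨F⟩ := Γ.exists_frame H.fields (T.boundary_subset hp)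
    have := hv.isLimitAt F H hv0 hp hp' hs rfl hr hr'
    exact ⟨_, this, fun N hN => hN.unique H h this⟩
  · obtain ⟨p, p', hp, hp', hs, ⟨η, hη⟩⟩ := N
    have hps := T.boundary_subset hp
    obtain ⟨r, hr, hr'⟩ := Γ.exists_shift H h hp hp' hs
    obtain ⟨F⟩ := Γ.exists_frame H.fields hps
    have key : ∀ v : ℝⁿ, (∀ j, Γ.lev j ≤ k → v (inr j) = F.β j p (η - r)) →
        F.vec p v + r = η := fun v hv => by
      rw [F.vec_β H hps F.mem hp (Submodule.sub_mem _ hη hr) hv, sub_add_cancel]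
    obtain ⟨ξ, hξ, hrep, hb⟩ := Γ.exists_front_stagePt H.one_le hp hp' hs hp (Γ p).mem
      (Γ p').mem hs fun j => F.β j p (η - r)
    have h0 : Γ.stagePt p p' p p' (fun j => F.β j p (η - r)) (inl 0) = 0 := Charts.c_self hp
    have := hrep.isLimitAt F H h0 hp hp' hs hb hr hr'
    refine ⟨ξ, ⟨hξ, ?_⟩, fun ξ' ⟨hξ', hN'⟩ => ?_⟩
    · convert this using 3
      exact (key _ fun j hj => by simp [Charts.stagePt, hj]).symm
    · obtain ⟨-, -, -, v', hv', hv0'⟩ := Γ.exists_rep H.one_le hξ'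
      rw [hN'.1] at hv'
      have h2 := (hv'.isLimitAt F H hv0' hp hp' hs hN'.1 hr hr').unique H h hN'
      simp only [NormalProduct.mk.injEq, heq_eq_eq, true_and, Subtype.mk.injEq] at h2
      have h3 : ∀ j, Γ.lev j ≤ k → v' (inr j) = F.β j p (η - r) := fun j hj => by
        rw [← h2, add_sub_cancel_right, F.β_vec hps F.mem, if_pos hj]
      have h4 : v' = Γ.stagePt p p' p p' fun j => F.β j p (η - r) := by
        rw [hv'.eq_stagePt H.one_le hv0' hN'.1]
        funext j
        rcases j with j | j
        · rfl
        · by_cases hj : Γ.lev j ≤ k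
          · simp [Charts.stagePt, hj, h3 j hj]
          · simp [Charts.stagePt, hj]
      rw [h4] at hv'
      exact hv'.unique hrep

end Tower

namespace Tower

variable {ξ ξ' : T.DoubleSpace a}

lemma IsLimitAt.quot_eq {Γ : T.Charts} {N : T.NormalProduct 𝒱} (hN : IsLimitAt ℛ ξ N)
    {s : Symb T a 𝒱 ℛ} {v : ℝⁿ} (hr : Γ.Rep ξ p p' v) {l : ℝ}
    (hl : ∀ {P : 𝒫} {u : ℝⁿ}, u ∈ P.dom →
      Patch.SamePoint (P, u) (Γ.stage a k p p', v) →
      Tendsto (fun w => (s.f (P.toFun w).1 - s.f (P.toFun w).2) / T.x (P.toFun w).1 ^ s.A)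
        (𝓝[P.int] u) (𝓝 l)) : l = s.σ N.p N.v := by
  obtain ⟨P, u, hu, hz⟩ := hr
  haveI :=
    mem_closure_iff_nhdsWithin_neBot.1 (Patch.mem_closure_int hu.mem_dom)
  exact tendsto_nhds_unique (hl hu.mem_dom hz) (hN.2 s P u hu)

lemma IsLimitAt.fst_eq {Γ : T.Charts} {N : T.NormalProduct 𝒱} (hN : IsLimitAt ℛ ξ N)
    {v : ℝⁿ} (hr : Γ.Rep ξ p p' v) : N.p = (Γ p).inv (lft v) := by
  rw [← hr.fst_eq, hN.1]

lemma IsLimitAt.snd_eq {Γ : T.Charts} {N : T.NormalProduct 𝒱} (hN : IsLimitAt ℛ ξ N)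
    {v : ℝⁿ} (hr : Γ.Rep ξ p p' v) :
    N.p' = (Γ p').inv (snds Γ.lev k (Γ.ex a) v) := by
  rw [← hr.snd_eq, hN.1]

lemma IsLimitAt.inl_eq {Γ : T.Charts} {N : T.NormalProduct 𝒱} (hN : IsLimitAt ℛ ξ N)
    {v : ℝⁿ} (hr : Γ.Rep ξ p p' v) : v (inl 0) = 0 :=
  ((Γ p).inv_mem_boundary_iff (mem_dom_model.1 hr.mem_dom).1).1 (hN.fst_eq hr ▸ N.hp)

namespace Charts

variable (Γ : T.Charts)

lemma exists_rep_smooth (H : T.Represents a 𝒱) {d : ℕ} {Ω : Set (Fin d → ℝ)} (hΩ : IsOpen Ω)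
    {c : (Fin d → ℝ) → T.frontInterior a} (hc : T.SmoothToFront a c Ω) {t : Fin d → ℝ} (ht : t ∈ Ω)
    (hb : T.blowDown a (c t).1 = (p, p')) :
    ∃ (V : Set (Fin d → ℝ)) (v : (Fin d → ℝ) → ℝⁿ), IsOpen V ∧ t ∈ V ∧ V ⊆ Ω ∧
      C∞ v V ∧ ∀ s ∈ V, Γ.Rep (c s).1 p p' (v s) := by
  obtain ⟨P, γ, O, hO, htO, hγ, hco⟩ := hc t ht
  obtain ⟨-, -, -, v, hv, -⟩ := Γ.exists_rep H.one_le (c t).2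
  rw [hb] at hv
  obtain ⟨A, hA, A', hA', h, h', L, hγA, -, -, -, he⟩ :=
    (hv.samePoint (hco t ⟨ht, htO⟩)).exists_locDiffeo ((hco t ⟨ht, htO⟩).mem_dom)
  have hm : ∀ s ∈ Ω ∩ O ∩ γ ⁻¹' A, γ s ∈ orth _ ∩ A := fun s hs =>
    ⟨(hco s hs.1).mem_dom.2, hs.2⟩
  exact ⟨_, _, hγ.continuousOn.isOpen_inter_preimage (hΩ.inter hO) L.isOpen, ⟨⟨ht, htO⟩, hγA⟩, fun s hs => hs.1.1,
    L.smooth.comp (hγ.mono inter_subset_left) hm, fun s hs => ⟨P, γ s, hco s hs.1,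
      Patch.samePoint_of_locDiffeo L hA hA' hs.2 (L.maps (hm s hs)).2 rfl he⟩⟩

lemma exists_hasCoords (hp : p ∈ ∂M) (hp' : p' ∈ ∂M)
    (hs : p ∼ p') {v₀ : ℝⁿ} (hv : v₀ ∈ (Γ.stage a k p p').dom)
    (hv0 : v₀ (inl 0) = 0) : ∃ (P : 𝒫) (h : ℝⁿ → ℝⁿ)
      (A : Set ℝⁿ), IsOpen A ∧ v₀ ∈ A ∧ C∞ h ((Γ.stage a k p p').dom ∩ A) ∧
      ∀ v ∈ (Γ.stage a k p p').dom ∩ A, ∀ ξ, Γ.Rep ξ p p' v → T.HasCoords a ξ P (h v) := by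
  obtain ⟨i, P, w, hP, hz, hw, hoff⟩ := Γ.exists_front_of_stage _ (T.boundary_subset hp)
    (T.boundary_subset hp') hs hv hv0
  obtain ⟨A, hA, A', hA', h, h', L, hvA, -, -, -, he⟩ := hz.exists_locDiffeo hv
  refine ⟨P, h, A, L.isOpen, hvA, L.smooth.mono fun v hv => ⟨hv.1.2, hv.2⟩, fun v hv ξ hξ => ?_⟩
  have hm := L.maps ⟨hv.1.2, hv.2⟩
  have hd : h v ∈ P.dom := ⟨hA' hm.2, hm.1⟩
  have hc : T.HasCoords a (Quot.mk _ ⟨_, ⟨⟨some i, hP⟩, hd⟩⟩) P (h v) := ⟨_, rfl⟩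
  rwa [hξ.unique (⟨P, h v, hc,
    (Patch.samePoint_of_locDiffeo L hA hA' hv.2 hm.2 rfl he).symm hv.1⟩)]

end Charts

lemma smoothToNormal_of_smoothToFront (H : T.Represents a 𝒱) (h : IsRefinement a 𝒱 ℛ) {d : ℕ}
    {Ω : Set (Fin d → ℝ)} (hΩ : IsOpen Ω) {c : (Fin d → ℝ) → T.frontInterior a}
    (hc : T.SmoothToFront a c Ω) {N : (Fin d → ℝ) → T.NormalProduct 𝒱}
    (hN : ∀ s, IsLimitAt ℛ (c s).1 (N s)) : SmoothToNormal N Ω := by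
  obtain ⟨Γ⟩ := T.exists_charts
  have hloc := fun t ht => Γ.exists_rep_smooth H hΩ hc ht (hN t).1
  refine ⟨fun t ht => ?_, fun t ht => ?_, fun t ht => ?_⟩
  · obtain ⟨V, v, hV, htV, hVΩ, hv, hr⟩ := hloc t ht
    refine ContMDiffAt.contMDiffWithinAt (ContMDiffOn.contMDiffAt ?_ (hV.mem_nhds htV))
    refine ((Γ (N t).p).smooth_inv.comp (contMDiffOn_iff_contDiffOn.2
      (contDiff_lft.comp_contDiffOn hv)) fun s hs => (mem_dom_model.1 (hr s hs).mem_dom).1).congr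
      fun s hs => (hN s).fst_eq (hr s hs)
  · obtain ⟨V, v, hV, htV, hVΩ, hv, hr⟩ := hloc t ht
    refine ContMDiffAt.contMDiffWithinAt (ContMDiffOn.contMDiffAt ?_ (hV.mem_nhds htV))
    refine ((Γ (N t).p').smooth_inv.comp (contMDiffOn_iff_contDiffOn.2
      ((contDiff_snds Γ.lev k _).comp_contDiffOn hv)) fun s hs => ?_).congr
      fun s hs => (hN s).snd_eq (hr s hs)
    have := (mem_dom_model.1 (hr s hs).mem_dom).2
    rwa [Charts.nu_eq_ex] at this
  · obtain ⟨V, v, hV, htV, hVΩ, hv, hr⟩ := hloc t ht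
    set p := (N t).p
    set p' := (N t).p'
    obtain ⟨s, κ, X, W, hW, hpW, hκ, hcof⟩ := exists_conormal_coframe T H.zero H.one_le h (N t).hp
    obtain ⟨F⟩ := Γ.exists_frame H.fields (T.boundary_subset (N t).hp)
    choose O R hR hRe hex using (fun l => Γ.exists_quot H (s l) (N t).hp (N t).hp' (N t).same F)
    choose B Q hB hvB hQ hQ0 hQe hlim using fun l => hex l (v t) (by rw [(hr t htV).lft_eq, (hN t).1]) (by
      rw [(hr t htV).snds_eq, (hN t).1])
    have hpc : ContinuousOn (fun s => (Γ p).inv (lft (v s))) V :=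
      (Γ p).smooth_inv.continuousOn.comp (contDiff_lft (m := ∞).continuous.comp_continuousOn
        hv.continuousOn) fun s hs => (mem_dom_model.1 (hr s hs).mem_dom).1
    have hsp := fun s hs => (hN s).fst_eq (hr s hs)
    have hsB : ∀ s' ∈ V ∩ v ⁻¹' ⋂ l, B l, ∀ l, v s' ∈ orth _ ∩ B l := fun s' hs' l =>
      ⟨(hr s' hs'.1).mem_dom.2, mem_iInter.1 hs'.2 l⟩
    refine ⟨_, n, X, fun l s' => κ l ((Γ p).inv (lft (v s'))) * Q l (v s'), (hpc.isOpen_inter_preimage hV hW).inter (hv.continuousOn.isOpen_inter_preimage hV (isOpen_iInter_of_finite hB)),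
      ⟨⟨htV, by rwa [mem_preimage, (((hN t).fst_eq (hr t htV)).symm)]⟩, htV, mem_iInter.2 hvB⟩, fun l => ?_, fun s' hs' => ?_⟩
    · refine (ContDiffOn.mul ?_ ((hQ l).comp (hv.mono fun s' hs' => hs'.1.1)
        fun s' hs' => hsB s' hs'.2 l)).mono inter_subset_right
      refine contMDiffOn_iff_contDiffOn.1 ((hκ l).comp ((Γ p).smooth_inv.comp
        (contMDiffOn_iff_contDiffOn.2 (contDiff_lft.comp_contDiffOn (hv.mono fun s' hs' => hs'.1.1)))
        fun s' hs' => (mem_dom_model.1 (hr s' hs'.1.1).mem_dom).1) fun s' hs' => hs'.1.2)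
    · rw [(hcof _ (by rw [hsp s' hs'.2.1.1]; exact hs'.2.1.2) (N s').hp).2 _ (N s').v.2]
      refine sum_congr rfl fun l _ => ?_
      rw [← (hN s').quot_eq (hr s' hs'.2.1.1) fun hu hz => hlim l hu (hsB s' hs'.2.2 l).2 hz,
        hsp s' hs'.2.1.1]

end Tower

namespace Tower

variable {ξ ξ' : T.DoubleSpace a}

lemma Charts.exists_limit_stagePt {Γ : T.Charts} (H : T.Represents a 𝒱)
    (h : IsRefinement a 𝒱 ℛ)
    (hp : p ∈ ∂M) (hp' : p' ∈ ∂M)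
    (hs : p ∼ p') (F : Γ.Frame (𝒱 := 𝒱) a p) {ι : Type*}
    {s : ι → Symb T a 𝒱 ℛ} {B : ι → Set ℝⁿ} {R Q : ι → ℝⁿ → ℝ}
    (hQ0 : ∀ l, ∀ v ∈ orth {inl 0} ∩ B l, v (inl 0) = 0 → Q l v =
      (∑ j, if Γ.lev j ≤ k then v (inr j) *
        (s l).σ ((Γ p).inv (lft v)) (atVal ((Γ p).inv (lft v)) (F.X j)) else 0) +
      R l (elim (lft v) (snds Γ.lev k (Γ.ex a) v)))
    (hlim : ∀ l, ∀ {P : 𝒫} {u v : ℝⁿ}, u ∈ P.dom → v ∈ B l →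
        Patch.SamePoint (P, u) (Γ.stage a k p p', v) →
        Tendsto (fun w => ((s l).f (P.toFun w).1 - (s l).f (P.toFun w).2) /
          T.x (P.toFun w).1 ^ (s l).A) (𝓝[P.int] u) (𝓝 (Q l v)))
    (hq : q ∈ ∂M) (hq' : q' ∈ ∂M)
    (hqU : q ∈ (Γ p).U) (hqU' : q' ∈ (Γ p').U)
    (hs' : q ∼ q') {b : 𝔼}
    (hb : ∀ l, Γ.stagePt p p' q q' b ∈ B l) :
    ∃ (ξ : T.DoubleSpace a) (η : ANormal 𝒱 q), ξ ∈ T.frontInterior a ∧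
      Γ.Rep ξ p p' (Γ.stagePt p p' q q' b) ∧ IsLimitAt ℛ ξ ⟨q, q', hq, hq', hs', η⟩ ∧
      ∀ l, (s l).σ q η = (s l).σ q (F.vec q (Γ.stagePt p p' q q' b)) +
        R l (elim ((Γ p).c q) ((Γ p').c q')) := by
  obtain ⟨ξ, hξ, hr, hbd⟩ := Γ.exists_front_stagePt H.one_le hp hp' hs hq hqU hqU' hs' b
  obtain ⟨⟨q₁, q₁', h1, h2, h3, η⟩, hN, -⟩ := (T.existsUnique_isLimitAt H h).1 ξ hξ
  have e := hbd.symm.trans hN.1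
  simp only [Prod.mk.injEq] at e
  obtain ⟨rfl, rfl⟩ := e
  refine ⟨ξ, η, hξ, hr, hN, fun l => ?_⟩
  rw [← hN.quot_eq hr fun hu hz => hlim l hu (hb l) hz,
    hQ0 l _ ⟨hr.mem_dom.2, hb l⟩ (hN.inl_eq hr), F.σ_vec,
    Γ.snds_stagePt H.one_le hp hp' hs hq hqU hqU' hs']
  have hl : lft (Γ.stagePt p p' q q' b) = (Γ p).c q := rfl
  rw [hl, (Γ p).inv_c hqU]

lemma smoothToFront_of_smoothToNormal (H : T.Represents a 𝒱) (h : IsRefinement a 𝒱 ℛ) {d : ℕ}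
    {Ω : Set (Fin d → ℝ)} (hΩ : IsOpen Ω) {c : (Fin d → ℝ) → T.frontInterior a}
    {N : (Fin d → ℝ) → T.NormalProduct 𝒱} (hNs : SmoothToNormal N Ω)
    (hN : ∀ s, IsLimitAt ℛ (c s).1 (N s)) : T.SmoothToFront a c Ω := by
  obtain ⟨Γ⟩ := T.exists_charts
  intro t ht
  obtain ⟨hq, hq', hη⟩ := hNs
  obtain ⟨O, m, Vf, f, hO, htO, hf, hfe⟩ := hη t ht
  have hp := (N t).hp
  have hp' := (N t).hp'
  have hs := (N t).same
  set p := (N t).p with hpt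
  set p' := (N t).p' with hpt'
  have hps := T.boundary_subset hp
  obtain ⟨s, κ, X, W, hW, hpW, hκ, hcof⟩ := exists_conormal_coframe T H.zero H.one_le h hp
  obtain ⟨F⟩ := Γ.exists_frame H.fields hps
  choose OR R hR hRe hex using fun l => Γ.exists_quot H (s l) hp hp' hs F
  -- the neighbourhood of `t` where everything is defined
  set G := fun s' => (elim ((Γ p).c (N s').p) ((Γ p').c (N s').p') : ℝⁿ) with hG
  have hV1 := ((hq.continuousOn.isOpen_inter_preimage hΩ ((F.isOpen.inter hW))).inter
    (hq'.continuousOn.isOpen_inter_preimage hΩ (Γ p').isOpen)).inter hO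
  set V₁ := ((Ω ∩ (fun s => (N s).p) ⁻¹' (F.N ∩ W)) ∩ (Ω ∩ (fun s => (N s).p') ⁻¹' (Γ p').U)) ∩ O
    with hV₁
  have hqU : ∀ s' ∈ V₁, (N s').p ∈ (Γ p).U := fun s' hs' => F.subset hs'.1.1.2.1
  have hc1 : C∞ (fun s' => (Γ p).c (N s').p) V₁ := contMDiffOn_iff_contDiffOn.1
    ((Γ p).smooth.comp (hq.mono fun s' hs' => hs'.1.1.1) hqU)
  have hc2 : C∞ (fun s' => (Γ p').c (N s').p') V₁ := contMDiffOn_iff_contDiffOn.1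
    ((Γ p').smooth.comp (hq'.mono fun s' hs' => hs'.1.1.1) fun s' hs' => hs'.1.2.2)
  have hGs : C∞ G V₁ := contDiff_sumElim hc1 hc2
  have hV2 := hGs.continuousOn.isOpen_inter_preimage hV1 (isOpen_iInter_of_finite fun l =>
    (hR l).isOpen)
  set V₂ := V₁ ∩ G ⁻¹' ⋂ l, OR l with hV₂
  have htV₂ : t ∈ V₂ := ⟨⟨⟨⟨ht, F.mem, hpW⟩, ht, (Γ p').mem⟩, htO⟩, mem_iInter.2 fun l => (hR l).mem⟩
  -- smooth functions of the parameter
  have hGo : ∀ s' ∈ V₂, G s' ∈ orth (faces n) := fun s' hs' => mem_orth_faces.2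
    ⟨(((Γ p).mem_boundary_iff (hqU s' hs'.1)).1 (N s').hp).ge,
      (((Γ p').mem_boundary_iff hs'.1.1.2.2).1 (N s').hp').ge⟩
  have hRs : ∀ l, C∞ (fun s' => R l (G s')) V₂ := fun l =>
    (hR l).smooth.comp (hGs.mono inter_subset_left) fun s' hs' => ⟨hGo s' hs', mem_iInter.1 hs'.2 l⟩
  have hfun : ∀ {g : M → ℝ} {E : Set M}, CM∞ g E →
      (∀ s' ∈ V₂, (N s').p ∈ E) → C∞ (fun s' => g (N s').p) V₂ := fun hg hE =>
    contMDiffOn_iff_contDiffOn.1 (hg.comp (hq.mono fun s' hs' => hs'.1.1.1.1) hE)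
  have hκs : ∀ l, C∞ (fun s' => κ l (N s').p) V₂ := fun l =>
    hfun (hκ l) fun s' hs' => hs'.1.1.1.2.2
  have hβs : ∀ j (Y : 𝒱), C∞ (fun s' => F.β j (N s').p (atVal (N s').p Y)) V₂ :=
    fun j Y => hfun (F.smooth_β j Y) fun s' _ => T.boundary_subset (N s').hp
  set r := fun s' => ∑ l, R l (G s') • κ l (N s').p • atVal (N s').p (X l) with hr
  have hrn : ∀ s' ∈ V₂, r s' ∈ ANormal 𝒱 (N s').p := fun s' hs' => Submodule.sum_mem _ fun l _ =>
    Submodule.smul_mem _ _ ((hcof _ hs'.1.1.1.2.2 (N s').hp).1 l)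
  set b := fun s' j => (∑ i, f i s' * F.β j (N s').p (atVal (N s').p (Vf i))) -
    ∑ l, R l (G s') * (κ l (N s').p * F.β j (N s').p (atVal (N s').p (X l))) with hbdef
  have hbs : C∞ b V₂ := contDiffOn_pi.2 fun j =>
    (ContDiffOn.sum fun i _ => ((hf i).mono fun s' hs' => ⟨hs'.1.1.1.1, hs'.1.2⟩).mul
      (hβs j _)).sub (ContDiffOn.sum fun l _ => (hRs l).mul ((hκs l).mul (hβs j _)))
  have hb : ∀ s' ∈ V₂, ∀ j, b s' j = F.β j (N s').p ((N s').v - r s') := fun s' hs' j => by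
    rw [map_sub, hfe s' ⟨hs'.1.1.1.1, hs'.1.2⟩]
    simp only [hr, map_sum, map_smul, smul_eq_mul, hbdef]
  have hst : ∀ {b : (Fin d → ℝ) → 𝔼}, C∞ b V₂ →
      C∞ (fun s' => Γ.stagePt p p' (N s').p (N s').p' (b s')) V₂ := fun hb =>
    contDiff_sumElim (hc1.mono inter_subset_left) (contDiffOn_pi.2 fun j => by
      by_cases hj : Γ.lev j ≤ k
      · simpa [hj] using contDiffOn_pi.1 hb j
      · simpa [hj] using contDiffOn_pi.1 (hc2.mono inter_subset_left) j)
  have hcoord : ∀ b, lft (Γ.stagePt p p' p p' b) = (Γ p).c p ∧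
      snds Γ.lev k (Γ.ex a) (Γ.stagePt p p' p p' b) = (Γ p').c p' := fun b =>
    ⟨rfl, Γ.snds_stagePt H.one_le hp hp' hs hp (Γ p).mem (Γ p').mem hs b⟩
  choose B Q hB hvB hQ hQ0 hQe hlim using fun l => hex l _ (hcoord (b t)).1 (hcoord (b t)).2
  choose B₀ Q₀ hB₀ hvB₀ hQ₀ hQ₀0 hQ₀e hlim₀ using fun l => hex l _ (hcoord 0).1 (hcoord 0).2
  obtain ⟨P, g, A, hA, htA, hg, hgc⟩ := Γ.exists_hasCoords (a := a) hp hp' hs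
    (Γ.stagePt_mem H.one_le hp hp' hs hp (Γ p).mem (Γ p').mem hs (b t)) (Charts.c_self hp)
  have hV3 := ((hst hbs).continuousOn.isOpen_inter_preimage hV2 ((isOpen_iInter_of_finite hB).inter
    hA)).inter ((hst (b := fun _ => 0) contDiffOn_const).continuousOn.isOpen_inter_preimage hV2
      (isOpen_iInter_of_finite hB₀))
  have hmem : ∀ s' ∈ V₂, Γ.stagePt p p' (N s').p (N s').p' (b s') ∈ (Γ.stage a k p p').dom :=
    fun s' hs' => Γ.stagePt_mem H.one_le hp hp' hs (N s').hp (hqU s' hs'.1) hs'.1.1.2.2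
      (N s').same _
  refine ⟨P, fun s' => g (Γ.stagePt p p' (N s').p (N s').p' (b s')), _, hV3,
    ⟨⟨htV₂, mem_iInter.2 hvB, htA⟩, htV₂, mem_iInter.2 hvB₀⟩,
    hg.comp ((hst hbs).mono fun s' hs' => hs'.2.1.1) fun s' hs' => ⟨hmem s' hs'.2.1.1, hs'.2.1.2.2⟩,
    fun s' hs' => ?_⟩
  have hs2 := hs'.2.1.1
  refine hgc _ ⟨hmem s' hs2, hs'.2.1.2.2⟩ _ ?_
  have hcq := hcof _ hs2.1.1.1.2.2 (N s').hp
  obtain ⟨ξ, η, hξ, hrep, hlimit, hval⟩ := Charts.exists_limit_stagePt H h hp hp' hs F hQ0 hlim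
    (N s').hp (N s').hp' (hqU s' hs2.1) hs2.1.1.2.2 (N s').same (b := b s')
    (mem_iInter.1 hs'.2.1.2.1)
  obtain ⟨ξ₀, η₀, -, -, -, hval₀⟩ := Charts.exists_limit_stagePt H h hp hp' hs F hQ₀0 hlim₀
    (N s').hp (N s').hp' (hqU s' hs2.1) hs2.1.1.2.2 (N s').same (b := 0) (mem_iInter.1 hs'.2.2.2)
  have hbd := (T.mem_boundary_iff (T.boundary_subset (N s').hp)).1 (N s').hp
  have hvec := F.vec_β H hps hs2.1.1.1.2.1 (N s').hp (Submodule.sub_mem _ (N s').v.2 (hrn s' hs2))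
    (v := Γ.stagePt p p' (N s').p (N s').p' (b s')) fun j hj => by
      rw [← hb s' hs2]; simp [Charts.stagePt, hj]
  have hvec₀ := F.vec_β H hps hs2.1.1.1.2.1 (N s').hp (Submodule.zero_mem _)
    (v := Γ.stagePt p p' (N s').p (N s').p' 0) fun j hj => by simp [Charts.stagePt, hj]
  rw [hvec] at hval
  simp only [hvec₀, map_zero, zero_add] at hval₀
  have hη₀ : (η₀ : AT 𝒱 (N s').p) = r s' := by
    rw [hcq.2 _ η₀.2]
    exact sum_congr rfl fun l _ => by rw [hval₀ l, mul_comm, mul_smul]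
  have hηe : η = (N s').v := Subtype.ext (by
    rw [hcq.2 _ η.2, hcq.2 _ (N s').v.2]
    refine sum_congr rfl fun l _ => ?_
    rw [hval l, map_sub, ← hη₀, hval₀ l, sub_add_cancel])
  rw [hηe] at hlimit
  have := ((T.existsUnique_isLimitAt H h).2 (N s')).unique ⟨hξ, hlimit⟩ ⟨(c s').2, hN s'⟩
  rwa [← this]

/-- The identification of the interior of the front face determined by a refinement. -/
def frontEquiv (H : T.Represents a 𝒱) (h : IsRefinement a 𝒱 ℛ) :
    T.frontInterior a ≃ T.NormalProduct 𝒱 :=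
  Equiv.ofBijective (fun ξ => ((T.existsUnique_isLimitAt H h).1 ξ.1 ξ.2).choose) (by
    have spec := fun ξ : T.frontInterior a => ((T.existsUnique_isLimitAt H h).1 ξ.1 ξ.2).choose_spec.1
    refine ⟨fun ξ ξ' he => Subtype.ext ?_, fun N => ?_⟩
    · exact ((T.existsUnique_isLimitAt H h).2 _).unique ⟨ξ.2, spec ξ⟩ ⟨ξ'.2, (congrArg (IsLimitAt ℛ ξ'.1) he).mpr (spec ξ')⟩
    · obtain ⟨ξ, ⟨hξ, hN⟩, -⟩ := (T.existsUnique_isLimitAt H h).2 N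
      exact ⟨⟨ξ, hξ⟩, (spec ⟨ξ, hξ⟩).unique H h hN⟩)

lemma isLimitAt_frontEquiv (H : T.Represents a 𝒱) (h : IsRefinement a 𝒱 ℛ)
    (ξ : T.frontInterior a) : IsLimitAt ℛ ξ.1 (frontEquiv H h ξ) :=
  ((T.existsUnique_isLimitAt H h).1 ξ.1 ξ.2).choose_spec.1

lemma isDiffeo_frontEquiv (H : T.Represents a 𝒱) (h : IsRefinement a 𝒱 ℛ) :
    IsDiffeo (frontEquiv H h) := fun _ _ hΩ c =>
  ⟨fun hc => smoothToNormal_of_smoothToFront H h hΩ hc fun s => isLimitAt_frontEquiv H h (c s),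
    fun hc => smoothToFront_of_smoothToNormal H h hΩ hc fun s => isLimitAt_frontEquiv H h (c s)⟩

end Tower

section

variable {ℛ' : Submodule ℝ (VField n M)}

lemma BigO.of_succ {U : Set M} {x f : M → ℝ} {A : ℕ} (hx : CM∞ x U)
    (h : BigO (n := n) U x f (A + 1)) : BigO (n := n) U x f A := by
  obtain ⟨w, hw, hw'⟩ := h
  exact ⟨fun p => x p * w p, hx.mul hw, fun p hp => by rw [hw' p hp]; ring⟩

lemma IsRefinement.le (h : IsRefinement a 𝒱 ℛ) : ℛ ≤ 𝒱 := by
  obtain ⟨T, rfl, rfl⟩ := h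
  refine fun V hV => ⟨hV.1, fun u hu => ?_, fun i u hu => ?_⟩
  · exact .of_succ T.contMDiffOn_x (tailSum_refineOrder a (Nat.zero_le _) ▸ hV.2.1 u hu)
  · exact .of_succ T.contMDiffOn_x (tailSum_refineOrder a i.2 ▸ hV.2.2 i u hu)

variable {ξ : T.DoubleSpace a}

lemma exists_conormalSymbol_of_coField (h : IsRefinement a 𝒱 ℛ) {g : M → ℝ} {θ : ACoField 𝒱}
    (hg : CM∞ g M°) (hθ : SmoothCoField θ)
    (hgθ : ExtendsDifferential g θ) (hc : ∀ p ∈ ∂M, θ p ∈ conormal 𝒱 ℛ p) :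
    ∃ s : Symb T a 𝒱 ℛ, s.f = g ∧ s.A = 0 ∧ s.σ = θ := by
  refine ⟨⟨g, 0, θ, univ, isOpen_univ, subset_univ _, ⟨by rwa [univ_inter], fun V =>
    (hθ V).contMDiffOn, fun V q hq => by rw [pow_zero, one_mul, hgθ q hq.2 V]⟩, Or.inl rfl,
    fun p hp W hW => ?_⟩, rfl, rfl, rfl⟩
  obtain ⟨ρ, α, hρ, -, hα⟩ := hc p hp
  have hm : fmul ρ W.1 ∈ ℛ := by
    obtain ⟨T', rfl, -⟩ := h
    exact Tower.fmul_mem_fields hρ.1 hW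
  rw [hα W ⟨_, hm⟩ fun q => rfl]
  have : atVal p (⟨_, hm⟩) = 0 := (Submodule.Quotient.mk_eq_zero _).2 (Submodule.subset_span
    ⟨ρ, hρ.1, (hρ.2.2.1 p).2 hp, ⟨W.1, hW⟩, fun q => rfl⟩)
  rw [this, map_zero]

namespace Tower

lemma HasCoords.tendsto_toFun (ha : ∀ i, 1 ≤ a i) {P : 𝒫} {u : ℝⁿ}
    (hu : T.HasCoords a ξ P u) : (∀ w ∈ P.int, P.toFun w ∈ intPairs n M) ∧
      Tendsto P.toFun (𝓝[P.int] u) (𝓝 (T.blowDown a ξ)) := by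
  obtain ⟨Γ⟩ := T.exists_charts
  obtain ⟨o, hP⟩ := hu.choose.1
  have hF := Γ.atlasFacts (fun i => (Nat.one_le_iff_ne_zero.1 (ha i))) _ _ _ hP
  refine ⟨fun w hw => (hF.good.int_iff w (P.int_subset_dom hw)).2 hw, ?_⟩
  rw [hu.blowDown_eq]
  exact (hF.smooth.continuousOn u hu.mem_dom).tendsto.mono_left (nhdsWithin_mono _ P.int_subset_dom)

lemma isGivenByCoordinates_frontEquiv (H : T.Represents a 𝒱) (h : IsRefinement a 𝒱 ℛ)
    {T' : Tower n M k} (hℛ : T'.fields (refineOrder a) = ℛ) (h𝒱 : T'.fields a = 𝒱) :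
    IsGivenByCoordinates (frontEquiv H h) T' := by
  intro ξ P u hu V hV
  obtain ⟨hb, hlim⟩ := isLimitAt_frontEquiv H h ξ
  set N := frontEquiv H h ξ
  obtain ⟨φ, hφ, hx⟩ := T.exists_ratio T'
  have hU := T.emb.open_source.inter T'.emb.open_source
  have hpU : N.p ∈ 𝕌 ∩ T'.emb.source := ⟨T.boundary_subset N.hp, T'.boundary_subset N.hp⟩
  obtain ⟨hint, htend⟩ := hu.tendsto_toFun H.one_le
  rw [hb] at htend
  have h1 :=
    (continuous_fst.tendsto _).comp htend
  have hmem : ∀ᶠ w in 𝓝[P.int] u, (P.toFun w).1 ∈ 𝕌 ∩ T'.emb.source ∧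
      0 < T'.x (P.toFun w).1 ∧ 0 < T'.x (P.toFun w).2 := by
    filter_upwards [h1.eventually (hU.mem_nhds hpU), ((continuous_snd.tendsto _).comp htend).eventually (T'.emb.open_source.mem_nhds
      (T'.boundary_subset N.hp')), self_mem_nhdsWithin] with w hw1 hw2 hw
    exact ⟨hw1, Charts.x_pos ⟨hw1.2, (hint w hw).1⟩, Charts.x_pos ⟨hw2, (hint w hw).2⟩⟩
  have key : ∀ (s : Symb T a 𝒱 ℛ) (y : ℝ), s.σ N.p N.v = φ N.p ^ s.A * y →
      Tendsto (fun w => (s.f _ - s.f _) / T'.x _ ^ s.A)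
        _ (𝓝 y) := fun s y hy => by
    have h4 := (hlim s P u hu).div (((hφ.continuousOn.continuousAt (hU.mem_nhds hpU)).tendsto.comp h1).pow s.A) (pow_ne_zero _ (hx _ hpU).1)
    rw [hy, mul_div_cancel_left₀ _ (pow_ne_zero _ (hx _ hpU).1)] at h4
    refine h4.congr' ?_
    filter_upwards [hmem] with w hw
    rw [(hx _ hw.1).2, mul_pow]
    exact div_div _ _ _
  refine ⟨fun w hw => ?_, fun i y w hy hw => ?_⟩
  · obtain ⟨s, hf, hA, hs⟩ := exists_conormalSymbol_log H.zero h𝒱 hℛ hφ hx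
    have := key s (w N.p) (by rw [hV, hs V w hw _ hpU, hA])
    rw [hf, hA] at this
    refine this.congr' ?_
    filter_upwards [hmem] with w' hw'
    rw [Real.log_div hw'.2.1.ne' hw'.2.2.ne']
  · obtain ⟨s, hf, hA, hs⟩ := exists_conormalSymbol_proj H.one_le h𝒱 hℛ hφ hx i hy
    have := key s (w N.p) (by rw [hV, hs V w hw _ hpU, hA])
    rwa [hf, hA] at this

open Classical in
lemma extendsToFront_frontEquiv (H : T.Represents a 𝒱) (h : IsRefinement a 𝒱 ℛ) {g : M → ℝ}
    {θ : ACoField 𝒱} (hg : CM∞ g M°)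
    (hθ : SmoothCoField θ) (hgθ : ExtendsDifferential g θ)
    (hc : ∀ p ∈ ∂M, θ p ∈ conormal 𝒱 ℛ p) :
    ExtendsToFront (frontEquiv H h) g θ := by
  intro i P hP
  obtain ⟨s, hsf, hsA, hsσ⟩ := exists_conormalSymbol_of_coField (T := T) h hg hθ hgθ hc
  obtain ⟨Γ⟩ := T.exists_charts
  have hF := Γ.atlasFacts (fun i => (Nat.one_le_iff_ne_zero.1 (H.one_le i))) _ _ _ hP
  have hne : ∀ w ∈ P.dom, (𝓝[P.int] w).NeBot := fun w hw =>
    mem_closure_iff_nhdsWithin_neBot.1 (Patch.mem_closure_int hw)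
  refine ⟨fun u => if u ∈ P.int then g (P.toFun u).1 - g (P.toFun u).2 else
    limUnder (𝓝[P.int] u) fun w => g (P.toFun w).1 - g (P.toFun w).2, fun u hu => ?_,
    fun u hu => if_pos hu, fun u hu0 hoff ξ hξ => ?_⟩
  · by_cases hint : u ∈ P.int
    · have ho : IsOpen P.int := by
        rw [P.int_eq]; exact (isOpen_orthInt _).inter P.isOpen
      have hm : ∀ w ∈ P.int, P.toFun w ∈ intPairs n M := fun w hw =>
        (hF.good.int_iff w (P.int_subset_dom hw)).2 hw
      have hsm := hF.smooth.mono P.int_subset_dom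
      have h1 := contMDiffOn_iff_contDiffOn.1 ((hg.comp (contMDiff_fst.comp_contMDiffOn hsm)
        fun w hw => (hm w hw).1).sub (hg.comp (contMDiff_snd.comp_contMDiffOn hsm)
        fun w hw => (hm w hw).2))
      refine ((h1.contDiffAt (ho.mem_nhds hint)).congr_of_eventuallyEq ?_).contDiffWithinAt
      filter_upwards [ho.mem_nhds hint] with w hw
      exact if_pos hw
    · have hu0 : u i = 0 := by
        by_contra hne0
        refine hint ⟨hu.1.1, fun j hj => ?_⟩
        by_cases hji : j = i
        · exact hji ▸ lt_of_le_of_ne (hu.1.2 i (hji ▸ hj)) (Ne.symm hne0)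
        · exact hu.2 j hj hji
      obtain ⟨hb, hs, v, hz⟩ := hF.loc i rfl u hu.1 hu0 hu.2
      change Patch.SamePoint (P, u) (Γ.stage a k (P.toFun u).1 (P.toFun u).2, v) at hz
      obtain ⟨F⟩ := Γ.exists_frame H.fields (T.boundary_subset hb.1)
      obtain ⟨_, _, -, -, hex⟩ := Γ.exists_quot H s hb.1 hb.2 hs F
      have hvd := mem_dom_model.1 (hz.mem_dom hu.1)
      have hpt := hz.apply_eq hu.1
      obtain ⟨B, Q, hB, hvB, hQ, -, hQe, hlim⟩ := hex v
        (by rw [← (Γ _).right _ hvd.1]; exact congrArg _ (congrArg Prod.fst hpt).symm)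
        (by
          rw [← Charts.nu_eq_ex, ← (Γ _).right _ hvd.2]
          exact congrArg _ (congrArg Prod.snd hpt).symm)
      obtain ⟨A, hA, A', hA', L, L', hL, huA, -, -, rfl, he⟩ := hz.exists_locDiffeo hu.1
      have hop : ∀ᶠ w in 𝓝[P.dom] u, w ∈ orth P.corners ∩ A ∧ L w ∈ B ∧ w ∈ P.dom := by
        have hc := (hL.smooth.continuousOn u ⟨hu.1.2, huA⟩).tendsto.eventually (hB.mem_nhds hvB)
        filter_upwards [self_mem_nhdsWithin, nhdsWithin_le_nhds (hL.isOpen.mem_nhds huA),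
          nhdsWithin_le_iff.2 (by
            filter_upwards [self_mem_nhdsWithin, nhdsWithin_le_nhds (hL.isOpen.mem_nhds huA)] with
              w h1 h2 using ⟨h1.2, h2⟩) hc] with w h1 h2 h3
        exact ⟨⟨h1.2, h2⟩, h3, h1⟩
      have hQL : ContDiffWithinAt ℝ ∞ (Q ∘ L) P.dom u := by
        refine ((hQ (L u) ⟨(hL.maps ⟨hu.1.2, huA⟩).1, hvB⟩).comp u
          (hL.smooth u ⟨hu.1.2, huA⟩ |>.mono inter_subset_left) fun w hw =>
            ⟨(hL.maps hw.1).1, hw.2⟩).mono_of_mem_nhdsWithin (t := P.dom) ?_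
        filter_upwards [hop] with w hw using ⟨hw.1, hw.2.1⟩
      refine (hQL.congr_of_eventuallyEq_of_mem ?_ hu.1).mono fun w hw => hw.1
      filter_upwards [hop] with w hw
      have hm := hL.maps hw.1
      split_ifs with hwi
      · have := hQe (L w) ⟨⟨hA' hm.2, (hL.mem_orthInt_iff hw.1).2 hwi.2⟩, hw.2.1⟩
        rwa [← he w hw.1, hsf, hsA, pow_zero, one_mul] at this
      · have hl := hlim hw.2.2 hw.2.1 (Patch.samePoint_of_locDiffeo hL hA hA' hw.1.2 hm.2 rfl he)
        simp only [hsf, hsA, pow_zero, div_one] at hl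
        have := hne w hw.2.2
        exact hl.limUnder_eq
  · have hd := hξ.mem_dom
    have := hne u hd
    have hni : u ∉ P.int := fun hui => (hui.2 i (hF.front_mem i rfl)).ne' hu0
    have hl := (isLimitAt_frontEquiv H h ξ).2 s P u hξ
    simp only [hsf, hsA, hsσ, pow_zero, div_one] at hl
    exact (if_neg hni).trans hl.limUnder_eq

end Tower

end

namespace Tower

variable {ℛ' : Submodule ℝ (VField n M)}

lemma Charts.tendsto_fibreDiff {Γ : T.Charts} (H : T.Represents a 𝒱)
    (hp : p ∈ ∂M) (F : Γ.Frame (𝒱 := 𝒱) a p) {z : Fin n} (hz : k < Γ.lev z) :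
    ∃ c : ℝ → M, (∀ᶠ τ in 𝓝[>] (0 : ℝ), c τ ∈ ∂M ∧
      T.SameFibre (Fin.last k) p (c τ)) ∧ ∀ {ℛ : Submodule ℝ (VField n M)}
      (s : Symb T a 𝒱 ℛ), Tendsto (fun τ => Γ.fibreDiff s.f s.A p (c τ) / τ) (𝓝[>] 0)
        (𝓝 (-s.σ p (atVal p (F.X z)))) := by
  set C := Γ p
  have hps := T.boundary_subset hp
  have hz0 : z ≠ 0 := fun h => by rw [h, Γ.lev_zero] at hz; omega
  have hc0 : C.c p 0 = 0 := c_self hp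
  set w := fun τ : ℝ => C.c p + Pi.single z τ with hw
  have hwc : Continuous w := continuous_const.add (continuous_pi fun j => by
    by_cases h : j = z
    · subst h; simpa using continuous_id'
    · simpa [h] using continuous_const)
  have hw0 : w 0 = C.c p := by simp [hw]
  have hw00 : ∀ τ, w τ 0 = 0 := fun τ => by simp [hw, hc0, hz0.symm]
  have hort : ∀ τ, w τ ∈ orth {0} := fun τ j hj => by
    rw [Finset.mem_singleton] at hj; rw [hj, hw00]
  have hball : ∀ ρ > 0, ∀ᶠ τ in 𝓝[>] 0, w τ ∈ ball (C.c p) ρ := fun ρ hρ =>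
    nhdsWithin_le_nhds (hwc.continuousAt.eventually (by
      rw [hw0]; exact ball_mem_nhds _ hρ))
  have hD : ∀ᶠ τ in 𝓝[>] 0, w τ ∈ C.D := (hball _ C.r_pos).mono fun τ h => ⟨hort τ, h⟩
  have hto : Tendsto (fun τ => C.inv (w τ)) (𝓝[>] 0) (𝓝 p) := by
    have h1 := (C.smooth_inv.continuousOn (C.c p) (C.c_mem C.mem)).tendsto
    rw [C.inv_c C.mem] at h1
    refine h1.comp (tendsto_nhdsWithin_iff.2 ⟨?_, hD⟩)
    exact hw0 ▸ hwc.continuousAt.mono_left nhdsWithin_le_nhds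
  have hgood : ∀ᶠ τ in 𝓝[>] 0, C.inv (w τ) ∈ ∂M ∧
      T.SameFibre (Fin.last k) p (C.inv (w τ)) := by
    filter_upwards [hD] with τ hτ
    refine ⟨(C.inv_mem_boundary_iff hτ).2 (hw00 τ), ?_⟩
    rw [Γ.same _ p p hps hps ⟨rfl, fun _ _ => rfl⟩ p C.mem _ (C.inv_mem _ hτ),
      C.right _ hτ]
    intro j hj
    have hjz : j ≠ z := fun h => by rw [h] at hj; exact absurd hj (not_le.2 hz)
    simp [hw, hjz, C]
  refine ⟨fun τ => C.inv (w τ), hgood, fun {ℛ} s => ?_⟩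
  obtain ⟨ρ, hρ0, hρr, hρ⟩ := Γ.exists_radius F s.isOpen (s.subset hp)
  set v := fun τ : ℝ => (elim (C.c p) fun j => if j = 0 then 0 else w τ j) with hv
  have hst : ∀ τ, pstart (v τ) = w τ := fun τ => by
    funext j
    by_cases hj : j = 0
    · subst hj; simp [pstart, hv, hc0, hw00]
    · simp [pstart, hv, hj]
  have hvm : ∀ τ, w τ ∈ ball (C.c p) ρ →
      v τ ∈ orth {inl 0} ∩ pathDom (C.c p) ρ := fun τ h =>
    ⟨fun j hj => by rw [Finset.mem_singleton] at hj; rw [hj]; exact hc0.ge,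
      mem_ball_self hρ0, by rw [hst]; exact h⟩
  have h0 : F.avg s.σ s.A z (v 0) = s.σ p (atVal p (F.X z)) := by
    have hpath : ∀ t, path (v 0) t = C.c p := fun t => by
      funext j
      by_cases hj : j = 0
      · subst hj; simp [path, hv, hc0]
      · simp [path, hv, hj, hw0]
    have hc : ∀ t, s.σ _ (atVal ((Γ p).inv (path (v 0) t)) (F.X z)) =
        s.σ p _ := fun t => by
      rw [hpath t, (C.inv_c C.mem)]
    simp [Frame.avg, hc]
    simp [hv]
  have havg : Tendsto (fun τ => F.avg s.σ s.A z (v τ)) (𝓝[>] 0)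
      (𝓝 (s.σ p (atVal p (F.X z)))) := by
    rw [← h0]
    refine ((F.contDiffOn_avg s.symbol hρr hρ z).continuousOn (v 0) (hvm 0 (by
      rw [hw0]; exact mem_ball_self hρ0))).tendsto.comp (tendsto_nhdsWithin_iff.2 ⟨?_, ?_⟩)
    · exact (continuous_pi fun j => by
    rcases j with j | j
    · exact continuous_const
    · by_cases hj : j = 0
      · simpa [hv, hj] using continuous_const
      · simpa [hv, hj] using (continuous_apply j).comp' hwc).continuousAt.mono_left nhdsWithin_le_nhds
    · exact (hball ρ hρ0).mono hvm
  refine havg.neg.congr' ?_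
  filter_upwards [hD, hgood, hto.eventually (Γ.eventually_isFibreQuotient H.zero s.isOpen s.symbol
    hps (s.subset hp) F), self_mem_nhdsWithin] with τ hτ hg hq hτ0
  obtain ⟨O, R, hR, he⟩ := hq (T.boundary_subset hg.1) hg.2
  rw [hR.fibreDiff_eq hp hg.1 (Γ.base_eq hps (T.boundary_subset hg.1) hg.2), he,
    Finset.sum_eq_single z]
  · rw [if_neg (not_le.2 hz), C.right _ hτ]
    have : (Γ p).c p z - w τ z = -τ := by simp [hw, C]
    rw [this, neg_mul, neg_div, mul_div_cancel_left₀ _ hτ0.ne']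
  · intro j _ hj
    rw [C.right _ hτ]
    have : (Γ p).c p j - w τ j = 0 := by simp [hw, C, hj]
    rw [this, ite_self, zero_mul]
  · simp

lemma exists_common_shift (Γ : T.Charts) (H : T.Represents a 𝒱) (h : IsRefinement a 𝒱 ℛ)
    (h' : IsRefinement a 𝒱 ℛ') (he : frontEquiv H h = frontEquiv H h')
    (hp : p ∈ ∂M) (hp' : p' ∈ ∂M)
    (hs : p ∼ p') : ∃ r ∈ ANormal 𝒱 p,
      (∀ s : Symb T a 𝒱 ℛ, s.σ p r = Γ.fibreDiff s.f s.A p p') ∧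
      ∀ s : Symb T a 𝒱 ℛ', s.σ p r = Γ.fibreDiff s.f s.A p p' := by
  obtain ⟨r, hr, hr'⟩ := Γ.exists_shift H h hp hp' hs
  obtain ⟨r₁, hr₁, hr₁'⟩ := Γ.exists_shift H h' hp hp' hs
  obtain ⟨F⟩ := Γ.exists_frame H.fields (T.boundary_subset hp)
  obtain ⟨ξ, hξ, hrep, hb⟩ := Γ.exists_front_stagePt H.one_le hp hp' hs hp (Γ p).mem
    (Γ p').mem hs 0
  have h0 : Γ.stagePt p p' p p' 0 (inl 0) = 0 := Charts.c_self hp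
  have := ((hrep.isLimitAt F H h0 hp hp' hs hb hr hr').unique H h
    (isLimitAt_frontEquiv H h ⟨ξ, hξ⟩)).trans ((congrFun (congrArg _ he) _).trans ((hrep.isLimitAt F H h0 hp hp' hs hb hr₁ hr₁').unique H h'
    (isLimitAt_frontEquiv H h' ⟨ξ, hξ⟩)).symm)
  simp at this
  exact ⟨r, hr, hr', this ▸ hr₁'⟩

lemma refinement_le (H : T.Represents a 𝒱) (h : IsRefinement a 𝒱 ℛ) (h' : IsRefinement a 𝒱 ℛ')
    (he : frontEquiv H h = frontEquiv H h') : ℛ ≤ ℛ' := by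
  intro V hV
  refine mem_refinement T H.zero H.one_le h' ⟨V, h.le hV⟩ fun s' p hp => ?_
  obtain ⟨Γ⟩ := T.exists_charts
  have hps := T.boundary_subset hp
  obtain ⟨F⟩ := Γ.exists_frame H.fields hps
  obtain ⟨s, κ, X, N, -, hpN, -, hcof⟩ := exists_conormal_coframe T H.zero H.one_le h hp
  obtain ⟨hc1, hc2⟩ := hcof p hpN hp
  have key : ∀ j, ∃ η ∈ ANormal 𝒱 p, (∀ s : Symb T a 𝒱 ℛ, s.σ p η =
      s.σ p _) ∧ ∀ s : Symb T a 𝒱 ℛ', s.σ p η =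
      s.σ p (atVal p (F.X j)) := fun j => by
    rcases le_or_gt (Γ.lev j) k with hj | hj
    · refine ⟨_, (F.mem_ANormal_iff H.isModule H.one_le hps F.mem ((T.mem_boundary_iff hps).1 hp) _).2 fun l hl => ?_,
        fun _ => rfl, fun _ => rfl⟩
      rw [F.β_X hps l j F.mem, if_neg fun h => by rw [h] at hl; omega]
    · obtain ⟨c, hcev, hlim⟩ := Charts.tendsto_fibreDiff H hp F hj
      have hr : ∀ᶠ τ in 𝓝[>] 0, ∃ r ∈ ANormal 𝒱 p,
          (∀ s : Symb T a 𝒱 ℛ, s.σ p r = Γ.fibreDiff s.f s.A p (c τ)) ∧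
          ∀ s : Symb T a 𝒱 ℛ', s.σ p r = Γ.fibreDiff s.f s.A p (c τ) := by
        filter_upwards [hcev] with τ hτ
        exact exists_common_shift Γ H h h' he hp hτ.1 hτ.2
      have hval : ∀ {ℛ₁ : Submodule ℝ _} (s₁ : Symb T a 𝒱 ℛ₁),
          (∀ᶠ τ in 𝓝[>] 0, Γ.fibreDiff s₁.f s₁.A p (c τ) = ∑ l, κ l p *
            Γ.fibreDiff (s l).f (s l).A p (c τ) * s₁.σ p _) →
          s₁.σ p (∑ l, (κ l p * (s l).σ p _) • atVal p (X l)) =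
            s₁.σ p _ := fun s₁ hs₁ => by
        have h1 := (tendsto_finsetSum _ fun l _ => ((hlim (s l)).const_mul (κ l p)).mul_const
          (s₁.σ p (atVal p (X l)))).congr' (f₂ := fun τ => Γ.fibreDiff s₁.f s₁.A p (c τ) / τ) (by
            filter_upwards [hs₁] with τ hτ
            rw [hτ, Finset.sum_div]
            exact sum_congr rfl fun l _ => by ring)
        rw [← neg_inj, ← tendsto_nhds_unique h1 (hlim s₁)]
        simp [map_sum, map_smul, ← sum_neg_distrib]
        exact sum_congr rfl fun l _ => by ring
      have hsum : ∀ {ℛ₁ : Submodule ℝ _} (s₁ : Symb T a 𝒱 ℛ₁) {r : AT 𝒱 p} {τ : ℝ},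
          r ∈ ANormal 𝒱 p → (∀ s : Symb T a 𝒱 ℛ, s.σ p r = Γ.fibreDiff s.f s.A p (c τ)) →
          s₁.σ p r = Γ.fibreDiff s₁.f s₁.A p (c τ) → Γ.fibreDiff s₁.f s₁.A p (c τ) =
            ∑ l, κ l p * Γ.fibreDiff (s l).f (s l).A p (c τ) * s₁.σ p (atVal p (X l)) :=
        fun s₁ r τ h1 h2 h3 => by
          rw [← h3, hc2 r h1]
          simp [map_sum, map_smul, smul_eq_mul, h2]
      refine ⟨_,
        Submodule.sum_mem _ fun l _ => ?_, fun s₁ => hval s₁ ?_, fun s₁ => hval s₁ ?_⟩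
      · rw [mul_comm, mul_smul]; exact Submodule.smul_mem _ _ (hc1 l)
      · filter_upwards [hr] with τ ⟨r, h1, h2, h3⟩ using hsum s₁ h1 h2 (h2 s₁)
      · filter_upwards [hr] with τ ⟨r, h1, h2, h3⟩ using hsum s₁ h1 h2 (h3 s₁)
  choose η hη h1 h2 using key
  set α := atVal p (⟨V, h.le hV⟩)
  have h3 : ∀ {ℛ₁ : Submodule ℝ _} (s₁ : Symb T a 𝒱 ℛ₁),
      (∀ j, s₁.σ p (η j) = s₁.σ p (atVal p (F.X j))) →
      s₁.σ p (∑ j, F.β j p α • η j) = s₁.σ p α := fun s₁ hs₁ => by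
    conv_rhs => rw [F.eq_sum H.isModule hps F.mem α]
    simp [map_sum, map_smul, hs₁]
  rw [← h3 s' fun j => h2 j s', eq_of_conormalSymbol H h hp
    (Submodule.sum_mem _ fun j _ => Submodule.smul_mem _ _ (hη j)) (Submodule.zero_mem _) fun s₁ => by
      rw [h3 s₁ fun j => h1 j s₁, map_zero]
      exact s₁.conormal p hp _ hV, map_zero]

lemma frontEquiv_injective (H : T.Represents a 𝒱) :
    Function.Injective fun ℛ : {ℛ : Submodule ℝ (VField n M) // IsRefinement a 𝒱 ℛ} =>
      frontEquiv H ℛ.2 := fun ℛ ℛ' he =>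
  Subtype.ext (le_antisymm (refinement_le H ℛ.2 ℛ'.2 he) (refinement_le H ℛ'.2 ℛ.2 he.symm))

end Tower

section Mono

variable {ι ι' : Type} [Fintype ι] [DecidableEq ι] [Fintype ι'] [DecidableEq ι'] {C J : Finset ι}
  {C' : Finset ι'} {f g : ℝ^ι → ℝ} {u₀ : ℝ^ι} {i : ι} {r : ℝ}

/-- Near `u₀`, `f` is smooth on the orthant. -/
def SmoothNear (C : Finset ι) (u₀ : ℝ^ι) (f : ℝ^ι → ℝ) : Prop :=
  ∀ᶠ u in 𝓝[orth C] u₀, ContDiffWithinAt ℝ ∞ f (orth C) u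

/-- Near `u₀`, `f` is the product of a positive smooth function and a monomial. -/
def MonoAt (C : Finset ι) (u₀ : ℝ^ι) (f : ℝ^ι → ℝ) : Prop :=
  ∃ (κ : ι → ℕ) (c : ℝ^ι → ℝ), SmoothNear C u₀ c ∧
    ∀ᶠ u in 𝓝[orth C] u₀, 0 < c u ∧ f u = c u * ∏ j ∈ C, u j ^ κ j

/-- Near `u₀`, the partial derivatives of `f` are smooth functions divided by a monomial in the
coordinates with index in `J`. -/
def GradAt (C J : Finset ι) (u₀ : ℝ^ι) (f : ℝ^ι → ℝ) : Prop :=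
  ∃ (K : ℕ) (B : ι → ℝ^ι → ℝ), (∀ l, SmoothNear C u₀ (B l)) ∧
    ∀ᶠ u in 𝓝[orth C] u₀, u ∈ orthInt C → ∃ f' : ℝ^ι →L[ℝ] ℝ, HasFDerivAt f f' u ∧
      ∀ l, (∏ j ∈ J, u j) ^ K * f' (Pi.single l 1) = B l u

lemma nhdsWithin_orth {O : Set ℝ^ι} (hO : IsOpen O) {u : ℝ^ι} (hu : u ∈ O) :
    𝓝[orth C ∩ O] u = 𝓝[orth C] u :=
  nhdsWithin_inter_of_mem' (mem_nhdsWithin_of_mem_nhds (hO.mem_nhds hu))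

lemma eventually_orth {O : Set ℝ^ι} (hO : IsOpen O) (hu : u₀ ∈ O) {p : ℝ^ι → Prop}
    (h : ∀ u ∈ orth C ∩ O, p u) : ∀ᶠ u in 𝓝[orth C] u₀, p u := by
  rw [← nhdsWithin_orth hO hu]
  exact eventually_nhdsWithin_of_forall h

lemma SmoothNear.of_contDiffOn {O : Set ℝ^ι} (hO : IsOpen O) (hu : u₀ ∈ O)
    (h : C∞ f (orth C ∩ O)) : SmoothNear C u₀ f :=
  eventually_orth hO hu fun u hu => (h u hu).mono_of_mem_nhdsWithin
    (inter_mem self_mem_nhdsWithin (mem_nhdsWithin_of_mem_nhds (hO.mem_nhds hu.2)))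

lemma SmoothNear.of_contDiff (h : ContDiff ℝ ∞ f) : SmoothNear C u₀ f :=
  Eventually.of_forall fun _ => h.contDiffWithinAt

lemma SmoothNear.add (hf : SmoothNear C u₀ f) (hg : SmoothNear C u₀ g) :
    SmoothNear C u₀ fun u => f u + g u := by
  filter_upwards [hf, hg] with u h1 h2 using h1.add h2

lemma SmoothNear.mul (hf : SmoothNear C u₀ f) (hg : SmoothNear C u₀ g) :
    SmoothNear C u₀ fun u => f u * g u := by
  filter_upwards [hf, hg] with u h1 h2 using h1.mul h2

lemma SmoothNear.inv (hf : SmoothNear C u₀ f) (h : ∀ᶠ u in 𝓝[orth C] u₀, 0 < f u) :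
    SmoothNear C u₀ fun u => (f u)⁻¹ := by
  filter_upwards [hf, h] with u h1 h2 using h1.inv h2.ne'

lemma SmoothNear.pow (hf : SmoothNear C u₀ f) (m : ℕ) : SmoothNear C u₀ fun u => f u ^ m := by
  filter_upwards [hf] with u h1 using h1.pow m

lemma SmoothNear.comp {η : ℝ^ι → ℝ^ι'} {O : Set ℝ^ι} (hO : IsOpen O)
    (hu : u₀ ∈ orth C ∩ O) (hη : C∞ η (orth C ∩ O)) (hm : MapsTo η (orth C ∩ O) (orth C'))
    {f : ℝ^ι' → ℝ} (hf : SmoothNear C' (η u₀) f) : SmoothNear C u₀ fun u => f (η u) := by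
  have ht : Tendsto η (𝓝[orth C] u₀) (𝓝[orth C'] (η u₀)) := by
    rw [← nhdsWithin_orth hO hu.2]
    exact tendsto_nhdsWithin_of_tendsto_nhds_of_eventually_within _ (hη.continuousOn u₀ hu)
      (eventually_nhdsWithin_of_forall hm)
  filter_upwards [ht.eventually hf, eventually_orth hO hu.2 fun u hu => hu] with u h1 hu
  exact (h1.comp u (hη u hu) hm).mono_of_mem_nhdsWithin
    (inter_mem self_mem_nhdsWithin (mem_nhdsWithin_of_mem_nhds (hO.mem_nhds hu.2)))

lemma SmoothNear.exists_ball {B : ι → ℝ^ι → ℝ} (hB : ∀ l, SmoothNear C u₀ (B l))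
    {p : ℝ^ι → Prop} (hp : ∀ᶠ u in 𝓝[orth C] u₀, p u) : ∃ r > 0,
      (∀ l, C∞ (B l) (orth C ∩ ball u₀ r)) ∧
      ∀ u ∈ orth C ∩ ball u₀ r, p u := by
  obtain ⟨r, hr, h⟩ := Metric.mem_nhdsWithin_iff.1 ((eventually_all.2 hB).and hp)
  exact ⟨r, hr, fun l u hu => ((h hu.symm).1 l).mono inter_subset_left, fun u hu => (h hu.symm).2⟩

lemma MonoAt.of_pos (hu : u₀ ∈ orth C) (hf : SmoothNear C u₀ f) (h : 0 < f u₀) : MonoAt C u₀ f :=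
  ⟨0, f, hf, by
    filter_upwards [((hf.self_of_nhdsWithin hu).continuousWithinAt.eventually
      (isOpen_Ioi.mem_nhds h))] with u hu using ⟨hu, by simp⟩⟩

lemma MonoAt.coord {j : ι} (hj : j ∈ C) : MonoAt C u₀ fun u => u j :=
  ⟨Pi.single j 1, fun _ => 1, .of_contDiff contDiff_const, Eventually.of_forall fun u => ⟨one_pos, by
    rw [one_mul, Finset.prod_eq_single_of_mem j hj fun i _ hi => by simp [hi]]; simp⟩⟩

lemma MonoAt.mul (hf : MonoAt C u₀ f) (hg : MonoAt C u₀ g) : MonoAt C u₀ fun u => f u * g u := by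
  obtain ⟨κ, c, hc, h⟩ := hf
  obtain ⟨κ', c', hc', h'⟩ := hg
  refine ⟨κ + κ', fun u => c u * c' u, hc.mul hc', ?_⟩
  filter_upwards [h, h'] with u h1 h2
  refine ⟨mul_pos h1.1 h2.1, ?_⟩
  simp [h1.2, h2.2, Pi.add_apply, pow_add, Finset.prod_mul_distrib]
  ring

lemma MonoAt.congr (hf : MonoAt C u₀ f) (h : ∀ᶠ u in 𝓝[orth C] u₀, g u = f u) :
    MonoAt C u₀ g := by
  obtain ⟨κ, c, hc, h'⟩ := hf
  refine ⟨κ, c, hc, ?_⟩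
  filter_upwards [h, h'] with u h1 h2 using ⟨h2.1, h1.trans h2.2⟩

lemma monoAt_one : MonoAt C u₀ fun _ => 1 :=
  ⟨0, fun _ => 1, .of_contDiff contDiff_const, Eventually.of_forall fun u => by simp⟩

lemma MonoAt.pow (hf : MonoAt C u₀ f) (m : ℕ) : MonoAt C u₀ fun u => f u ^ m := by
  induction m with
  | zero => simpa using monoAt_one
  | succ m ih => simpa only [pow_succ] using ih.mul hf

lemma MonoAt.prod {α : Type*} [DecidableEq α] {s : Finset α} {f : α → ℝ^ι → ℝ}
    (h : ∀ j ∈ s, MonoAt C u₀ (f j)) : MonoAt C u₀ fun u => ∏ j ∈ s, f j u := by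
  induction s using Finset.induction_on with
  | empty => simpa using monoAt_one
  | insert i s hi ih =>
    simp [Finset.prod_insert hi]
    exact (h i (mem_insert_self _ _)).mul (ih fun j hj => h j (Finset.mem_insert_of_mem hj))

lemma MonoAt.comp {η : ℝ^ι → ℝ^ι'} {O : Set ℝ^ι} (hO : IsOpen O)
    (hu : u₀ ∈ orth C ∩ O) (hη : C∞ η (orth C ∩ O)) (hm : MapsTo η (orth C ∩ O) (orth C'))
    (hc : ∀ j ∈ C', MonoAt C u₀ fun u => η u j) {f : ℝ^ι' → ℝ} (hf : MonoAt C' (η u₀) f) :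
    MonoAt C u₀ fun u => f (η u) := by
  obtain ⟨κ, c, hcs, h⟩ := hf
  have ht : Tendsto η (𝓝[orth C] u₀) (𝓝[orth C'] (η u₀)) := by
    rw [← nhdsWithin_orth hO hu.2]
    exact tendsto_nhdsWithin_of_tendsto_nhds_of_eventually_within _ (hη.continuousOn u₀ hu)
      (eventually_nhdsWithin_of_forall hm)
  refine ((MonoAt.of_pos hu.1 (hcs.comp hO hu hη hm) (h.self_of_nhdsWithin (hm hu)).1).mul
    (MonoAt.prod fun j hj => (hc j hj).pow (κ j))).congr ?_
  filter_upwards [ht.eventually h] with u h1 using h1.2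

lemma LocDiffeo.monoAt {O : Set ℝ^ι} {O' : Set ℝ^ι'} {h : ℝ^ι → ℝ^ι'}
    {h' : ℝ^ι' → ℝ^ι} (H : LocDiffeo C C' O O' h h') {v : ℝ^ι} (hv : v ∈ orth C ∩ O)
    {j : ι'} (hj : j ∈ C') : MonoAt C v fun u => h u j := by
  rcases ((H.maps hv).1 j hj).eq_or_lt with h0 | h0
  · obtain ⟨l, hl, -, r, hr, c, -, hc, hcl⟩ := H.corner_inv hv hj h0.symm
    have hvr := mem_ball_self (x := v) hr
    refine ((MonoAt.coord hl).mul (MonoAt.of_pos hv.1 (.of_contDiffOn isOpen_ball hvr hc)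
      (hcl v ⟨hv.1, hvr⟩).1)).congr ?_
    exact eventually_orth isOpen_ball hvr fun u hu => (hcl u hu).2
  · exact MonoAt.of_pos hv.1 (.of_contDiffOn H.isOpen hv.2 (contDiffOn_pi.1 H.smooth j)) h0

lemma smoothNear_prod (s : Finset ι) (κ : ι → ℕ) : SmoothNear C u₀ fun u => ∏ j ∈ s, u j ^ κ j :=
  .of_contDiff (contDiff_prod fun j _ => (contDiff_apply ℝ ℝ j).pow _)

lemma MonoAt.exists_mul_eq_pow {φ : ℝ^ι → ℝ} (hφ : MonoAt C u₀ φ) (N : ι' → ℕ) :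
    ∃ (L : ℕ) (e : ι' → ℝ^ι → ℝ), (∀ j, SmoothNear C u₀ (e j)) ∧
      ∀ᶠ u in 𝓝[orth C] u₀, ∀ j, (∏ i ∈ C, u i) ^ L = e j u * φ u ^ N j := by
  obtain ⟨κ, c, hc, h⟩ := hφ
  set L := (∑ j, N j) * ∑ i ∈ C, κ i
  refine ⟨L, fun j u => (c u ^ N j)⁻¹ * ∏ i ∈ C, u i ^ (L - κ i * N j), fun j =>
    ((hc.pow _).inv (h.mono fun u h => pow_pos h.1 _)).mul (smoothNear_prod _ _),
    h.mono fun u h j => ?_⟩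
  have h5 : (∏ i ∈ C, u i) ^ L = (∏ i ∈ C, u i ^ (L - κ i * N j)) * (∏ i ∈ C, u i ^ κ i) ^ N j := by
    rw [← Finset.prod_pow, ← Finset.prod_pow, ← Finset.prod_mul_distrib]
    exact Finset.prod_congr rfl fun i hi => by
      rw [← pow_mul, ← pow_add, Nat.sub_add_cancel]
      rw [mul_comm]
      exact Nat.mul_le_mul (single_le_sum (fun _ _ => zero_le) (Finset.mem_univ j))
        (single_le_sum (fun _ _ => zero_le) hi)
  have := (pow_pos h.1 (N j)).ne'
  rw [h5, h.2, mul_pow]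
  field_simp

lemma hasFDerivAt_of_orth {E : Type*} [NormedAddCommGroup E] [NormedSpace ℝ E] {f : ℝ^ι → E}
    {O : Set ℝ^ι} (hO : IsOpen O) (hf : C∞ f (orth C ∩ O)) {u : ℝ^ι}
    (hu : u ∈ orthInt C ∩ O) : HasFDerivAt f (fderivWithin ℝ f (orth C ∩ O) u) u :=
  have h := inter_subset_inter_left O (orthInt_subset C)
  (hf.differentiableOn (by simp) u (h hu)).hasFDerivWithinAt.hasFDerivAt
    (mem_of_superset (((isOpen_orthInt C).inter hO).mem_nhds hu) h)

lemma GradAt.of_smooth {O : Set ℝ^ι} (hO : IsOpen O) (hu : u₀ ∈ O)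
    (hf : C∞ f (orth C ∩ O)) : GradAt C J u₀ f :=
  ⟨0, pd _ f, fun l => .of_contDiffOn hO hu (contDiffOn_pd (uniqueDiffOn_orth_inter C hO) hf l),
    eventually_orth hO hu fun u hu hu' =>
      ⟨_, hasFDerivAt_of_orth hO hf ⟨hu', hu.2⟩, fun l => by simp [pd]⟩⟩

lemma GradAt.of_comp {O : Set ℝ^ι} (hO : IsOpen O) (hu : u₀ ∈ O) {w : ℝ^ι → ℝ^ι'}
    (hw : C∞ w (orth C ∩ O)) {φ : ℝ^ι → ℝ} (hφ : MonoAt C u₀ φ) {N : ι' → ℕ}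
    {h : ι' → ℝ^ι → ℝ} (hh : ∀ j, C∞ (h j) (orth C ∩ O)) {G : ℝ^ι' → ℝ}
    (hG : ∀ u ∈ orthInt C ∩ O, ∃ G' : ℝ^ι' →L[ℝ] ℝ, HasFDerivAt G G' (w u) ∧
      ∀ j, φ u ^ N j * G' (Pi.single j 1) = h j u) (hf : ∀ u ∈ orthInt C ∩ O, f u = G (w u)) :
    GradAt C C u₀ f := by
  obtain ⟨L, e, he, hL⟩ := hφ.exists_mul_eq_pow N
  have hw' : ∀ l j, SmoothNear C u₀ fun u => fderivWithin ℝ w (orth C ∩ O) u (Pi.single l 1) j :=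
    fun l j => .of_contDiffOn hO hu (contDiffOn_pi.1 (((contDiffOn_infty_iff_fderivWithin
      (uniqueDiffOn_orth_inter C hO)).1 hw).2.clm_apply contDiffOn_const) j)
  refine ⟨L, fun l u => ∑ j, fderivWithin ℝ w (orth C ∩ O) u (Pi.single l 1) j * (e j u * h j u),
    fun l => ?_, ?_⟩
  · filter_upwards [eventually_all.2 (hw' l), eventually_all.2 he,
      eventually_all.2 fun j => SmoothNear.of_contDiffOn hO hu (hh j)] with u h1 h2 h3
    exact ContDiffWithinAt.sum fun j _ => (h1 j).mul ((h2 j).mul (h3 j))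
  · filter_upwards [hL, eventually_orth hO hu fun u hu => hu.2] with u hL huO hu'
    obtain ⟨G', hG', hGh⟩ := hG u ⟨hu', huO⟩
    refine ⟨_, (hG'.comp u (hasFDerivAt_of_orth hO hw ⟨hu', huO⟩)).congr_of_eventuallyEq
      (eventually_of_mem (((isOpen_orthInt C).inter hO).mem_nhds ⟨hu', huO⟩) hf), fun l => ?_⟩
    rw [ContinuousLinearMap.comp_apply, clm_apply_eq_sum, mul_sum]
    refine sum_congr rfl fun j _ => ?_
    rw [← hGh, hL j]
    ring

lemma GradAt.sub (hf : GradAt C C u₀ f) (hg : GradAt C C u₀ g) :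
    GradAt C C u₀ fun u => f u - g u := by
  obtain ⟨K, B, hB, h⟩ := hf
  obtain ⟨K', B', hB', h'⟩ := hg
  have hM : ∀ c : ℝ, ∀ L, SmoothNear C u₀ fun u => c * (∏ j ∈ C, u j) ^ L := fun c L =>
    .of_contDiff (contDiff_const.mul ((contDiff_prod fun j _ => contDiff_apply ℝ ℝ j).pow _))
  refine ⟨K + K', fun l u => 1 * (∏ j ∈ C, u j) ^ K' * B l u + -1 * (∏ j ∈ C, u j) ^ K * B' l u,
    fun l => ((hM _ _).mul (hB l)).add ((hM _ _).mul (hB' l)), ?_⟩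
  filter_upwards [h, h'] with u h1 h2 hu
  obtain ⟨f', hf, h1⟩ := h1 hu
  obtain ⟨g', hg, h2⟩ := h2 hu
  refine ⟨_, hf.sub hg, fun l => ?_⟩
  rw [← h1, ← h2, sub_apply]
  ring

lemma GradAt.of_subset (hJ : J ⊆ C) (hp : ∀ j ∈ C \ J, 0 < u₀ j) (h : GradAt C C u₀ f) :
    GradAt C J u₀ f := by
  obtain ⟨K, B, hB, h⟩ := h
  have hpp : ∀ᶠ u in 𝓝[orth C] u₀, 0 < ∏ j ∈ C \ J, u j := by
    filter_upwards [(Finset.eventually_all _).2 fun j hj => mem_nhdsWithin_of_mem_nhds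
      ((isOpen_lt continuous_const (continuous_apply j)).mem_nhds (hp j hj))] with u hu
      using Finset.prod_pos hu
  refine ⟨K, fun l u => ((∏ j ∈ C \ J, u j) ^ K)⁻¹ * B l u, fun l => (SmoothNear.inv
    (.of_contDiff ((contDiff_prod fun j _ => contDiff_apply ℝ ℝ j).pow _))
    (hpp.mono fun u h => pow_pos h K)).mul (hB l), ?_⟩
  filter_upwards [h, hpp] with u h hpp hu
  obtain ⟨f', hf, h⟩ := h hu
  refine ⟨f', hf, fun l => ?_⟩
  have := (pow_pos hpp K).ne'
  rw [← h, ← Finset.prod_sdiff hJ, mul_pow]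
  field_simp

lemma isOpen_orthInt_inter_ball (C : Finset ι) : IsOpen (orthInt C ∩ ball u₀ r) :=
  (isOpen_orthInt C).inter isOpen_ball

lemma exists_eq_pow_mul (hi : i ∈ C) (h0 : u₀ i = 0) (K : ℕ) {A B : ℝ^ι → ℝ}
    (hA : C∞ A (orth C ∩ ball u₀ r))
    (hB : ContinuousOn B (orth {i} ∩ (orthInt (C.erase i) ∩ ball u₀ r)))
    (h : ∀ u ∈ orthInt C ∩ ball u₀ r, A u = u i ^ K * B u) :
    ∃ A', C∞ A' (orth C ∩ ball u₀ r) ∧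
      ∀ u ∈ orth C ∩ ball u₀ r, A u = u i ^ K * A' u := by
  induction K generalizing A with
  | zero => exact ⟨A, hA, fun u _ => by simp⟩
  | succ K ih =>
    have hs : orth {i} ∩ (orthInt _ ∩ ball u₀ r) ⊆ orth C ∩ ball u₀ r :=
      fun u hu => ⟨fun j hj => by
        by_cases hji : j = i
        · exact hu.1 j (by simp [hji])
        · exact (hu.2.1 j (mem_erase.2 ⟨hji, hj⟩)).le, hu.2.2⟩
    have h1 := eqOn_of_eqOn_orthInt (isOpen_orthInt_inter_ball (u₀ := u₀) (r := r) (C.erase i)) (hA.continuousOn.mono hs)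
      (((continuous_apply i).pow (K + 1)).continuousOn.mul hB) fun u hu => h u ⟨fun j hj => by
        by_cases hji : j = i
        · exact hu.1 j (by simp [hji])
        · exact hu.2.1 j (mem_erase.2 ⟨hji, hj⟩), hu.2.2⟩
    obtain ⟨A₁, hA₁, he⟩ := hadamard_single h0 hA fun u hu hui => by
      have ht := tendsto_push u (fun j => if j = i then 0 else 1)
      have hmem : ∀ᶠ t : ℝ in 𝓝[>] 0, u + t • (fun j => if j = i then 0 else 1) ∈
          orth {i} ∩ (orthInt (C.erase i) ∩ ball u₀ r) ∧
          (u + t • (fun j => if j = i then 0 else 1) : ℝ^ι) i = 0 := by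
        filter_upwards [ht.eventually (isOpen_ball.mem_nhds hu.2), self_mem_nhdsWithin]
          with t ht ht0
        have ht0' : 0 < t := ht0
        refine ⟨⟨fun j hj => ?_, fun j hj => ?_, ht⟩, by simp [hui]⟩
        · rw [Finset.mem_singleton.1 hj]; simp [hui]
        · have := hu.1 j (Finset.mem_of_mem_erase hj)
          simp [Pi.add_apply, Pi.smul_apply, smul_eq_mul, (mem_erase.1 hj).1]
          linarith
      refine tendsto_nhds_unique ((hA.continuousOn u hu).tendsto.comp
        (tendsto_nhdsWithin_of_tendsto_nhds_of_eventually_within _ ht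
          (hmem.mono fun t h => hs h.1))) (tendsto_const_nhds.congr' ?_)
      filter_upwards [hmem] with t ht
      exact ((h1 ht.1).trans ((congrArg (· ^ (K + 1) * B _) ht.2).trans (by simp))).symm
    obtain ⟨A', hA', he'⟩ := ih hA₁ fun u hu => by
      have := h u hu
      rw [he u ⟨orthInt_subset _ hu.1, hu.2⟩, pow_succ'] at this
      exact mul_left_cancel₀ (hu.1 i hi).ne' (this.trans (mul_assoc _ _ _))
    exact ⟨A', hA', fun u hu => by rw [he u hu, he' u hu, pow_succ']; ring⟩

lemma GradAt.erase (hi : i ∈ C) (h0 : u₀ i = 0) {G : ℝ^ι → ℝ} {O : Set ℝ^ι}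
    (hO : IsOpen O) (huO : u₀ ∈ O) (hG : C∞ G (orth {i} ∩ (orthInt (C.erase i) ∩ O)))
    (hfG : ∀ u ∈ orthInt C ∩ O, f u = G u) (h : GradAt C C u₀ f) : GradAt C (C.erase i) u₀ f := by
  obtain ⟨K, B, hB, h⟩ := h
  obtain ⟨r, hr, hB, h⟩ := SmoothNear.exists_ball hB
    (h.and (eventually_orth hO huO fun u hu => hu.2))
  have hE : orth {i} ∩ (orthInt (C.erase i) ∩ ball u₀ r) ⊆ orth C ∩ ball u₀ r :=
    fun u hu => ⟨fun j hj => by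
      by_cases hji : j = i
      · exact hu.1 j (by simp [hji])
      · exact (hu.2.1 j (mem_erase.2 ⟨hji, hj⟩)).le, hu.2.2⟩
  have hG := hG.mono fun u hu => ⟨hu.1, hu.2.1, (h u (hE hu)).2⟩
  have hb := isOpen_orthInt_inter_ball (u₀ := u₀) (r := r) (C.erase i)
  choose A hA hAe using fun l => exists_eq_pow_mul hi h0 K (hB l)
    (((contDiff_prod (t := C.erase i) fun j _ => contDiff_apply ℝ ℝ j).pow K).contDiffOn.mul
      (contDiffOn_pd (uniqueDiffOn_orth_inter _ hb) hG l)).continuousOn fun u hu => by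
    obtain ⟨f', hf, h1⟩ := (h u ⟨orthInt_subset _ hu.1, hu.2⟩).1 hu.1
    have hG' := hasFDerivAt_of_orth hb hG (u := u) ⟨fun j hj => by
      rw [Finset.mem_singleton.1 hj]; exact hu.1 i hi,
      fun j hj => hu.1 j (Finset.mem_of_mem_erase hj), hu.2⟩
    rw [← h1, ← Finset.mul_prod_erase C u hi, pd, ← hf.unique (hG'.congr_of_eventuallyEq
      (eventually_of_mem (((isOpen_orthInt C).inter hO).mem_nhds
        ⟨hu.1, (h u ⟨orthInt_subset _ hu.1, hu.2⟩).2⟩) hfG))]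
    ring
  refine ⟨K, A, fun l => .of_contDiffOn isOpen_ball (mem_ball_self hr) (hA l),
    eventually_orth isOpen_ball (mem_ball_self hr) fun u hu hu' => ?_⟩
  obtain ⟨f', hf, h1⟩ := (h u hu).1 hu'
  refine ⟨f', hf, fun l => mul_left_cancel₀ (pow_pos (hu' i hi) K).ne' ?_⟩
  rw [← hAe l u hu, ← h1, ← Finset.mul_prod_erase C u hi]
  ring

lemma GradAt.finiteOrder (hu₀ : u₀ ∈ orth C) (hJ : J ⊆ C) (h : GradAt C J u₀ f) (m : ℕ) :
    ∃ (N : ℕ) (O : Set ℝ^ι) (F : ℝ^ι → ℝ), IsOpen O ∧ u₀ ∈ O ∧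
      ContDiffOn ℝ m F (orth C ∩ O) ∧ ∀ u ∈ orthInt C ∩ O, F u = (∏ j ∈ J, u j) ^ N * f u := by
  obtain ⟨K, B, hB, h⟩ := h
  set π : ℝ^ι → ℝ := fun u => ∏ j ∈ J, u j
  have hπ : ContDiff ℝ ∞ π := contDiff_prod fun j _ => contDiff_apply ℝ ℝ j
  have hπ' : ContDiff ℝ ∞ (fderiv ℝ π) := hπ.fderiv_right (by simp)
  set b : ℝ^ι → ℝ^ι →L[ℝ] ℝ := fun u =>
    ∑ l, B l u • ContinuousLinearMap.proj (R := ℝ) (φ := fun _ : ι => ℝ) l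
  set q := fun u => ‖b u‖ + ‖fderiv ℝ π u‖ + |π u|
  have hq : ContinuousWithinAt q (orth C) u₀ := by
    have h1 := hπ.continuous.continuousWithinAt (s := orth C) (x := u₀)
    have : ContinuousWithinAt b (orth C) u₀ := tendsto_finsetSum _ fun l _ =>
      ((hB l).self_of_nhdsWithin hu₀).continuousWithinAt.smul continuousWithinAt_const
    exact (this.norm.add hπ'.continuous.continuousWithinAt.norm).add h1.abs
  obtain ⟨r, hr, hB, h⟩ := SmoothNear.exists_ball hB
    (h.and (hq.eventually_lt_const (lt_add_one (q u₀))))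
  set c := q u₀ + 1
  have hb : C∞ b (orth C ∩ ball u₀ r) :=
    ContDiffOn.sum fun l _ => (hB l).smul contDiffOn_const
  have hlt : ∀ u ∈ orthInt C ∩ ball u₀ r, ‖b u‖ ≤ c ∧ ‖fderiv ℝ π u‖ ≤ c ∧ π u ≤ c ∧
      0 < π u := fun u hu => by
    have := (h u ⟨orthInt_subset _ hu.1, hu.2⟩).2.le
    have h0 : 0 < π u := Finset.prod_pos fun j hj => hu.1 j (hJ hj)
    simp only [q, abs_of_pos h0] at this
    exact ⟨by linarith [norm_nonneg (fderiv ℝ π u)], by linarith [norm_nonneg (b u)],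
      by linarith [norm_nonneg (b u), norm_nonneg (fderiv ℝ π u)], h0⟩
  have hd : ∀ u ∈ orthInt C ∩ ball u₀ r, HasFDerivAt f (fderiv ℝ f u) u ∧
      π u ^ K • fderiv ℝ f u = b u := fun u hu => by
    obtain ⟨f', hf, h1⟩ := (h u ⟨orthInt_subset _ hu.1, hu.2⟩).1 hu.1
    rw [hf.fderiv]
    refine ⟨hf, ContinuousLinearMap.ext fun v => ?_⟩
    rw [clm_apply_eq_sum]
    simp [b, π, ← h1, mul_comm (v _)]
  have hder : ∀ N : ℕ, ∀ u ∈ orthInt C ∩ ball u₀ r, HasFDerivAt (fun u => π u ^ (N + K + 1) * f u)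
      (π u ^ (N + 1) • b u + ((N + K + 1) * π u ^ K * (π u ^ N * f u)) • fderiv ℝ π u) u :=
    fun N u hu => by
      refine (((hπ.differentiable (by simp) u).hasFDerivAt.pow (N + K + 1)).mul
        (hd u hu).1).congr_fderiv ?_
      rw [← (hd u hu).2]
      ext v
      simp
      ring
  have hbd : ∃ c', ∀ u ∈ orthInt C ∩ ball u₀ (r / 2), π u ^ K * |f u| ≤ c' := by
    set w : ℝ^ι := fun j => u₀ j + r / 2
    have hwb : w ∈ ball u₀ r := by
      rw [mem_ball_iff_norm, pi_norm_lt_iff hr]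
      intro j
      simp [w, abs_of_pos hr, hr]
    refine ⟨c ^ K * |f w| + c * (2 * r), fun u hu => ?_⟩
    have hur : u ∈ ball u₀ r := ball_subset_ball (by linarith) hu.2
    have hI : ∀ z ∈ Ici u ∩ ball u₀ r, z ∈ orthInt C ∩ ball u₀ r := fun z hz =>
      ⟨fun j hj => (hu.1 j hj).trans_le (hz.1 j), hz.2⟩
    obtain ⟨hc, -, hπc, hp⟩ := hlt u ⟨hu.1, hur⟩
    have hpK := pow_pos hp K
    have huw : w ∈ Ici u := fun j => by
      have := hu.2
      rw [mem_ball_iff_norm, pi_norm_lt_iff (by linarith)] at this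
      have := (abs_lt.1 (this j)).2
      simp only [Pi.sub_apply] at this
      simp only [w]
      linarith
    have := Convex.norm_image_sub_le_of_norm_hasFDerivWithin_le (f := f) (C := c / π u ^ K)
      (fun z hz => (hd z (hI z hz)).1.hasFDerivWithinAt) (fun z hz => by
        rw [le_div_iff₀ hpK, mul_comm]
        refine le_trans ?_ (hlt z (hI z hz)).1
        rw [← (hd z (hI z hz)).2, norm_smul, Real.norm_of_nonneg
          (pow_pos (hlt z (hI z hz)).2.2.2 K).le]
        gcongr
        exact Finset.prod_le_prod (fun j hj => (hu.1 j (hJ hj)).le) fun j _ => hz.1 j)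
      ((convex_Ici u).inter (convex_ball u₀ r)) ⟨self_mem_Ici, hur⟩ ⟨huw, hwb⟩
    have h2 : ‖w - u‖ ≤ 2 * r := by
      rw [← dist_eq_norm]
      linarith [dist_triangle_right w u u₀, mem_ball.1 hwb, mem_ball.1 hur]
    rw [div_mul_eq_mul_div, le_div_iff₀ hpK, Real.norm_eq_abs] at this
    have h3 : |f u| ≤ |f w| + |f w - f u| := by
      have := abs_sub_abs_le_abs_sub (f u) (f w)
      rw [abs_sub_comm] at this
      linarith
    have h4 : π u ^ K ≤ c ^ K := pow_le_pow_left₀ hp.le hπc K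
    nlinarith [abs_nonneg (f w), norm_nonneg (b u)]
  suffices ∃ (N : ℕ) (F : ℝ^ι → ℝ), Continuous F ∧
      ContDiffOn ℝ m F (orth C ∩ ball u₀ (r / 2)) ∧
      ∀ u ∈ orthInt C ∩ ball u₀ (r / 2), F u = π u ^ N * f u by
    obtain ⟨N, F, -, hF, hFe⟩ := this
    exact ⟨N, _, F, isOpen_ball, mem_ball_self (half_pos hr), hF, hFe⟩
  have hsub : ball u₀ (r / 2) ⊆ ball u₀ r := ball_subset_ball (by linarith)
  have hconv : Convex ℝ (orthInt C ∩ ball u₀ (r / 2)) :=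
    (convex_orthInt C).inter (convex_ball _ _)
  induction m with
  | zero =>
    obtain ⟨c', hc'⟩ := hbd
    obtain ⟨F, hF, hFe⟩ := (hconv.lipschitzOnWith_of_nnnorm_hasFDerivWithin_le
      (C := Real.toNNReal (c * c + (K + 1) * c' * c))
      (fun u hu => (hder 0 u ⟨hu.1, hsub hu.2⟩).hasFDerivWithinAt) fun u hu => by
        rw [← norm_toNNReal]
        refine Real.toNNReal_le_toNNReal ((norm_add_le _ _).trans ?_)
        obtain ⟨h1, h2, h3, h4⟩ := hlt u ⟨hu.1, hsub hu.2⟩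
        have h5 := hc' u hu
        have h6 : (0 : ℝ) ≤ π u ^ K := by positivity
        rw [norm_smul, norm_smul]
        simp [abs_of_pos h4]
        rw [abs_of_nonneg (by positivity : (0 : ℝ) ≤ K + 1), mul_assoc _ (π u ^ K)]
        gcongr ?_ * ?_ + _ * ?_ * ?_
        · have := (by positivity : 0 ≤ π u ^ K * |f u|).trans h5
          positivity).extend_real
    exact ⟨0 + K + 1, F, hF.continuous, contDiffOn_zero.2 hF.continuous.continuousOn,
      fun u hu => (hFe hu).symm⟩
  | succ m ih =>
    obtain ⟨N, F, hc, hF, hFe⟩ := ih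
    have hb' := (hb.mono (inter_subset_inter_right _ hsub)).of_le (m := m) (by exact_mod_cast le_top)
    have h1 := (hπ.of_le (m := m) (by exact_mod_cast le_top)).contDiffOn
      (s := orth C ∩ ball u₀ (r / 2))
    have h2 := (hπ'.of_le (m := m) (by exact_mod_cast le_top)).contDiffOn
      (s := orth C ∩ ball u₀ (r / 2))
    have hcG : ContDiffOn ℝ m (fun u => π u ^ (N + 1) • b u +
      ((N + K + 1) * π u ^ K * F u) • fderiv ℝ π u) (orth C ∩ ball u₀ (r / 2)) :=
      ((h1.pow _).smul hb').add (((contDiffOn_const.mul (h1.pow _)).mul hF).smul h2)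
    have hF' : ∀ u ∈ orthInt C ∩ ball u₀ (r / 2), HasFDerivAt (fun u => π u ^ (K + 1) * F u)
        (π u ^ (N + 1) • b u + ((N + K + 1) * π u ^ K * F u) • fderiv ℝ π u) u := fun u hu => by
      rw [hFe u hu]
      refine (hder N u ⟨hu.1, hsub hu.2⟩).congr_of_eventuallyEq (eventually_of_mem
        ((isOpen_orthInt_inter_ball C).mem_nhds hu) fun z hz => ?_)
      simp only [hFe z hz]
      ring
    have hFc : Continuous fun u => π u ^ (K + 1) * F u := (hπ.continuous.pow _).mul hc
    refine ⟨N + K + 1, _, hFc, ?_, fun u hu => ?_⟩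
    · push_cast
      refine (contDiffOn_succ_iff_hasFDerivWithinAt_of_uniqueDiffOn (uniqueDiffOn_orth_inter C
        isOpen_ball)).2 ⟨by simp, _, hcG, fun u hu =>
        (hasFDerivWithinAt_closure_of_tendsto_fderiv
          (fun z hz => (hF' z hz).differentiableAt.differentiableWithinAt) hconv
          (isOpen_orthInt_inter_ball C) (fun z _ => hFc.continuousWithinAt) ?_).mono
          fun z hz => mem_closure_orthInt_inter isOpen_ball hz⟩
      exact ((hcG.continuousOn u hu).mono (inter_subset_inter_left _ (orthInt_subset C))).congr'
        (eventually_nhdsWithin_of_forall fun z hz => (hF' z hz).fderiv.symm)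
    · rw [hFe u hu]
      ring

end Mono

namespace Patch

variable {ι : Type} [Fintype ι] [DecidableEq ι] {W : Type*} {X : W → ℝ} {U : Set W} {P : Patch ι W}
  {𝒜 : Set (Patch ι W)}

/-- In the patch `P`, near points of `U`, the function `X` is a positive multiple of a monomial. -/
def IsMono (X : W → ℝ) (U : Set W) (P : Patch ι W) : Prop :=
  ∀ v ∈ P.dom, P.toFun v ∈ U → MonoAt P.corners v fun u => X (P.toFun u)

lemma IsMono.monoAt {P' : Patch ι W} (h : P'.IsMono X U) {v : ℝ^ι} {O : Set ℝ^ι}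
    (hO : IsOpen O) (hv : v ∈ orth P.corners ∩ O) (hvU : P.toFun v ∈ U) {η : ℝ^ι → ℝ^ι}
    (hη : C∞ η (orth P.corners ∩ O)) (hm : MapsTo η (orth P.corners ∩ O) P'.dom)
    (hc : ∀ j ∈ P'.corners, MonoAt P.corners v fun u => η u j)
    (he : ∀ u ∈ orth P.corners ∩ O, P.toFun u = P'.toFun (η u)) :
    MonoAt P.corners v fun u => X (P.toFun u) := by
  refine (MonoAt.comp hO hv hη (fun u hu => (P'.dom_eq.le (hm hu)).1) hc
    (h _ (hm hv) (by rwa [← he v hv]))).congr (eventually_orth hO hv.2 fun u hu => by rw [he u hu])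

lemma isMono_of_mem_saturate (h𝒜 : ∀ P ∈ 𝒜, IsMono X U P) (hP : P ∈ saturate 𝒜) :
    P.IsMono X U := by
  intro v hv hvU
  obtain ⟨P', hP', h, h', O', hO', H, he⟩ := exists_of_mem_saturate hP
  rw [dom_eq] at hv he
  exact (h𝒜 P' hP').monoAt P.isOpen hv hvU H.smooth
    (fun u hu => P'.dom_eq.ge ⟨(H.maps hu).1, hO' (H.maps hu).2⟩) (fun j hj => H.monoAt hv hj) he

lemma isMono_of_blowUp {Zt Z : Patch ι W → Set ℝ^ι} {a : ℕ} {o : Option ι}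
    (h𝒜 : ∀ P ∈ 𝒜, IsMono X U P) (hP : BlowUp 𝒜 Zt Z a o P) : P.IsMono X U := by
  cases hP with
  | off P hP h => exact h𝒜 P hP
  | projX P hP R S h i hi =>
    intro v hv hvU
    rw [dom_eq] at hv
    refine (h𝒜 P hP).monoAt (P.pullX a R S i).isOpen hv hvU
      (contDiff_blowX a R S i).contDiffOn
      (fun u hu => mem_dom_pullX (h.1 hi) h.2.1 ((P.pullX a R S i).dom_eq.ge hu))
      (fun j hj => ?_) fun u hu => rfl
    have hjS := fun h' => Finset.disjoint_left.1 h.2.1 h' hj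
    have h1 : MonoAt _ v fun u => u j := MonoAt.coord hj
    change MonoAt P.corners v _
    by_cases hji : j = i
    · subst hji; simpa only [blowX_self] using h1
    · by_cases hjR : j ∈ R
      · simpa only [blowX_of_mem_R _ hjR hjS hji] using (MonoAt.coord (h.1 hi)).mul h1
      · simpa only [blowX_of_notMem _ hjR hjS hji] using h1
  | projY P hP R S h p hp ε hε =>
    intro v hv hvU
    rw [dom_eq] at hv
    refine (h𝒜 P hP).monoAt (P.pullY a R S p ε).isOpen hv hvU
      (contDiff_blowY a R S p ε).contDiffOn
      (fun u hu => mem_dom_pullY hp h.2.1 ((P.pullY a R S p ε).dom_eq.ge hu))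
      (fun j hj => ?_) fun u hu => rfl
    have hjS := fun h' => Finset.disjoint_left.1 h.2.1 h' hj
    have hjp : j ≠ p := fun h' => hjS (h' ▸ hp)
    have h1 : MonoAt (insert p _) v fun u => u j := MonoAt.coord (Finset.mem_insert_of_mem hj)
    change MonoAt (insert p _) v _
    by_cases hjR : j ∈ R
    · simpa only [blowY_of_mem_R _ hjR hjS hjp] using
        (MonoAt.coord (mem_insert_self p _)).mul h1
    · simpa only [blowY_of_notMem _ hjR hjS hjp] using h1

end Patch

namespace Tower

lemma isMono_of_isLocalParam (Γ : T.Charts) {P : 𝒫}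
    (hP : P.IsLocalParam ((𝓡∂ n).prod (𝓡∂ n))) :
    P.IsMono (fun q => T.x q.1) (Prod.fst ⁻¹' 𝕌) ∧
      P.IsMono (fun q => T.x q.2) (Prod.snd ⁻¹' 𝕌) := by
  have key : ∀ p ∈ 𝕌, ∀ w ∈ (Γ p).D, T.x _ = w 0 := fun p hp w hw => by
    rw [← Γ.c_zero p hp _ (Γ.subset p hp ((Γ p).inv_mem w hw)), (Γ p).right w hw]
  constructor <;> intro v hv hvU <;>
  obtain ⟨O, -, O', hO', h, h', H, hvO, -, -, -, he⟩ := (exists_samePoint_prodPatch hP hv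
    (Γ _) (Γ _) (HalfChart.mem _) (HalfChart.mem _)).exists_locDiffeo hv <;>
  rw [Patch.dom_eq] at hv
  · refine (H.monoAt ⟨hv.1, hvO⟩ (j := inl 0) (by simp [prodPatch])).congr
      (eventually_orth H.isOpen hvO fun u hu => ?_)
    rw [he u hu]
    exact key _ hvU _ (mem_dom_prodPatch.1 ((Patch.dom_eq _).ge
      ⟨(H.maps hu).1, hO' (H.maps hu).2⟩)).1
  · refine (H.monoAt ⟨hv.1, hvO⟩ (j := inr 0) (by simp [prodPatch])).congr
      (eventually_orth H.isOpen hvO fun u hu => ?_)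
    rw [he u hu]
    exact key _ hvU _ (mem_dom_prodPatch.1 ((Patch.dom_eq _).ge
      ⟨(H.maps hu).1, hO' (H.maps hu).2⟩)).2

lemma isMono_of_atlas {X : M × M → ℝ} {U : Set (M × M)} (h0 : ∀ P : 𝒫,
    P.IsLocalParam ((𝓡∂ n).prod (𝓡∂ n)) → P.IsMono X U) (m : Fin (k + 1)) :
    ∀ o P, T.atlas a m o P → P.IsMono X U := by
  induction m using Fin.induction with
  | zero =>
    intro o P hP
    rw [atlas_zero] at hP
    exact Patch.isMono_of_blowUp h0 hP
  | succ i ih =>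
    intro o P hP
    rw [atlas_succ] at hP
    exact Patch.isMono_of_blowUp (fun P hP => Patch.isMono_of_mem_saturate (fun P' h => ih _ P' h.choose_spec) hP) hP

lemma exists_contDiffOn_comp {ι E : Type} [Fintype ι] [NormedAddCommGroup E] [NormedSpace ℝ E]
    {C : Finset ι} {O : Set ℝ^ι} (hO : IsOpen O) {π : ℝ^ι → M}
    (hπ : ContMDiffOn 𝓘(ℝ, ℝ^ι) (𝓡∂ n) ∞ π (orth C ∩ O)) {v : ℝ^ι} (hv : v ∈ orth C ∩ O)
    {U : Set M} (hU : IsOpen U) (hvU : π v ∈ U) {f : M → E}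
    (hf : ContMDiffOn (𝓡∂ n) 𝓘(ℝ, E) ∞ f U) :
    ∃ O', IsOpen O' ∧ v ∈ O' ∧ O' ⊆ O ∧ MapsTo π (orth C ∩ O') U ∧
      C∞ (fun u => f (π u)) (orth C ∩ O') := by
  obtain ⟨O', hO', hvO', h⟩ := mem_nhdsWithin.1
    ((hπ.continuousOn v hv).eventually (hU.mem_nhds hvU))
  have hm : MapsTo π (orth C ∩ (O ∩ O')) U := fun u hu => h ⟨hu.2.2, hu.1, hu.2.1⟩
  exact ⟨_, hO.inter hO', ⟨hv.2, hvO'⟩, inter_subset_left, hm,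
    contMDiffOn_iff_contDiffOn.1 (hf.comp
      (hπ.mono (inter_subset_inter_right _ inter_subset_left)) hm)⟩

lemma gradAt_comp (H : T.Represents a 𝒱) (Γ : T.Charts) {g : M → ℝ} {θ : ACoField 𝒱}
    (hσ : IsSymbol T.x univ g 0 θ) {ι : Type} [Fintype ι] [DecidableEq ι]
    {C : Finset ι} {O : Set ℝ^ι} (hO : IsOpen O) {π : ℝ^ι → M}
    (hπ : ContMDiffOn 𝓘(ℝ, ℝ^ι) (𝓡∂ n) ∞ π (orth C ∩ O)) {v : ℝ^ι} (hv : v ∈ orth C ∩ O)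
    (hi : ∀ u ∈ orthInt C ∩ O, π u ∈ M°)
    (hm : π v ∈ 𝕌 → MonoAt C v fun u => T.x (π u)) :
    GradAt C C v fun u => g (π u) := by
  have hg := hσ.smooth
  rw [univ_inter] at hg
  by_cases hp : π v ∈ M°
  · obtain ⟨O', hO', hvO', -, -, h⟩ := exists_contDiffOn_comp hO hπ hv
      (ModelWithCorners.isOpen_interior (n := ∞) (by simp)) hp hg
    exact .of_smooth hO' hvO' h
  rw [← ModelWithCorners.compl_boundary, notMem_compl_iff] at hp
  have hps := T.boundary_subset hp
  obtain ⟨F⟩ := Γ.exists_frame H.fields hps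
  obtain ⟨ρ, hρ, hρr, hN⟩ := Γ.exists_radius F isOpen_univ (mem_univ _)
  set Q := Γ (π v)
  obtain ⟨O', hO', hvO', hOO, hmU, hc⟩ := exists_contDiffOn_comp hO hπ hv
    (Q.smooth.continuousOn.isOpen_inter_preimage Q.isOpen isOpen_ball)
    ⟨Q.mem, mem_ball_self hρ⟩ (Q.smooth.mono inter_subset_left)
  have hmc : ∀ u ∈ orth C ∩ O', Q.c (π u) ∈ orth {0} ∩ ball _ ρ := fun u hu =>
    ⟨(Q.c_mem (hmU hu).1).1, (hmU hu).2⟩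
  have hx : ∀ u ∈ orth C ∩ O', T.x (π u) = Q.c (π u) 0 := fun u hu =>
    (Γ.c_zero _ hps _ (Γ.subset _ hps (hmU hu).1)).symm
  refine .of_comp hO' hvO' hc (hm hps) (N := Γ.wt a) (G := fun w => g (Q.inv w))
    (fun j => (F.contDiffOn_symbol hσ hρr hN j).comp hc hmc) (fun u hu => ?_)
    fun u hu => by rw [Q.inv_c (hmU ⟨orthInt_subset _ hu.1, hu.2⟩).1]
  have hu' : u ∈ orth C ∩ O' := ⟨orthInt_subset _ hu.1, hu.2⟩
  have hD : Q.c (π u) ∈ Q.D := ⟨(hmc u hu').1, ball_subset_ball hρr (hmc u hu').2⟩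
  have h0 : 0 < Q.c (π u) 0 := by
    rw [← Q.inv_mem_interior_iff hD, Q.inv_c (hmU hu').1]
    exact hi u ⟨hu.1, hOO hu.2⟩
  obtain ⟨G', hG', h⟩ := F.hasFDerivAt_symbol hps isOpen_univ hσ hD h0 (hN _ (hmc u hu'))
  refine ⟨G', hG', fun j => ?_⟩
  rw [hx u hu', h j]
  simp

end Tower

lemma Tower.Represents.finiteOrder
    (H : T.Represents a 𝒱) (h : IsRefinement a 𝒱 ℛ) {g : M → ℝ} {θ : ACoField 𝒱}
    (hg : CM∞ g M°) (hθ : SmoothCoField θ)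
    (hgθ : ExtendsDifferential g θ) (hc : ∀ p ∈ ∂M, θ p ∈ conormal 𝒱 ℛ p) :
    T.FiniteOrderAtOtherFaces a g := by
  intro o P hP v hv m
  obtain ⟨Γ⟩ := T.exists_charts
  have hσ : IsSymbol T.x univ g 0 θ := ⟨by rwa [univ_inter], fun V => (hθ V).contMDiffOn,
    fun V q hq => by rw [pow_zero, one_mul, hgθ q hq.2 V]⟩
  have hF := Γ.atlasFacts (fun i => Nat.one_le_iff_ne_zero.1 (H.one_le i)) _ o P hP
  have hv' := P.dom_eq.le hv
  have hs :=
    P.dom_eq ▸ hF.smooth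
  have hi := fun u hu =>
    (hF.good.int_iff u (P.int_subset_dom (P.int_eq.ge hu))).2 (P.int_eq.ge hu)
  have hL :=
    (gradAt_comp H Γ hσ P.isOpen (contMDiff_fst.comp_contMDiffOn hs) hv' (fun u hu => (hi u hu).1)
      (isMono_of_atlas (fun P h => (isMono_of_isLocalParam Γ h).1) _ o P hP v hv)).sub
    (gradAt_comp H Γ hσ P.isOpen (contMDiff_snd.comp_contMDiffOn hs) hv' (fun u hu => (hi u hu).2)
      (isMono_of_atlas (fun P h => (isMono_of_isLocalParam Γ h).2) _ o P hP v hv))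
  suffices GradAt _ _ v
      fun u => g _ - g _ by
    obtain ⟨N, O, F, hO, hvO, hF, hFe⟩ := this.finiteOrder hv'.1 (Finset.filter_subset (fun j => o ≠ some j) _) m
    exact ⟨N, O, F, hO, hvO, hF.mono fun u hu => ⟨(P.dom_eq.le hu.1).1, hu.2⟩,
      fun u hu => hFe u ⟨(P.int_eq.le hu.1).1, hu.2⟩⟩
  cases o with
  | none => simpa using hL
  | some i =>
    have hi := hF.front_mem i rfl
    have he : P.corners.filter (fun j => some i ≠ some j) = P.corners.erase i := by
      ext j; simp [and_comm, eq_comm]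
    rw [he]
    rcases (hv'.1 i hi).eq_or_lt with h0 | h0
    · obtain ⟨G, hG, hGe, -⟩ := extendsToFront_frontEquiv H h hg hθ hgθ hc i P hP
      refine hL.erase hi h0.symm P.isOpen hv'.2 (hG.mono fun u hu => ⟨⟨hu.2.2, fun j hj => ?_⟩,
        fun j hj hji => hu.2.1 j (mem_erase.2 ⟨hji, hj⟩)⟩)
        fun u hu => (hGe u (P.int_eq.ge hu)).symm
      by_cases hji : j = i
      · exact hu.1 j (by simp [hji])
      · exact (hu.2.1 j (mem_erase.2 ⟨hji, hj⟩)).le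
    · refine hL.of_subset (Finset.erase_subset _ _) fun j hj => ?_
      have : j = i := by
        by_contra hji
        simp [hji] at hj
      rwa [this]

end MultiFibred

end

theorem mainTheorem11 {n : ℕ} [NeZero n] {M : Type u} [TopologicalSpace M]
    [ChartedSpace (EuclideanHalfSpace n) M] [IsManifold (𝓡∂ n) ∞ M] [T2Space M] [CompactSpace M]
    {k : ℕ} (a : Fin (k + 1) → ℕ) (ha₀ : a 0 = 1) (ha : ∀ i, 1 ≤ a i)
    (𝒱 : Submodule ℝ (MultiFibred.VField n M))
    (T : MultiFibred.Tower n M k) (hT : T.fields a = 𝒱)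
    (hconn : ∀ p ∈ (𝓡∂ n).boundary M,
      IsPreconnected {p' | p' ∈ (𝓡∂ n).boundary M ∧ T.SameFibre (Fin.last k) p p'}) :
    (∃ ℛ, MultiFibred.IsRefinement a 𝒱 ℛ) ∧
    ∃ e : {ℛ : Submodule ℝ (MultiFibred.VField n M) // MultiFibred.IsRefinement a 𝒱 ℛ} →
        (T.frontInterior a ≃ T.NormalProduct 𝒱),
      Function.Injective e ∧
      ∀ ℛ, MultiFibred.Tower.IsDiffeo (e ℛ) ∧ MultiFibred.Tower.CoversIdentity (e ℛ) ∧
        (∀ T' : MultiFibred.Tower n M k,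
          T'.fields (MultiFibred.refineOrder a) = ℛ.1 → T'.fields a = 𝒱 →
          MultiFibred.Tower.IsGivenByCoordinates (e ℛ) T') ∧
        ∀ (g : M → ℝ) (θ : MultiFibred.ACoField 𝒱),
          ContMDiffOn (𝓡∂ n) 𝓘(ℝ, ℝ) ∞ g ((𝓡∂ n).interior M) →
          MultiFibred.SmoothCoField θ → MultiFibred.ExtendsDifferential g θ →
          (∀ p ∈ (𝓡∂ n).boundary M, θ p ∈ MultiFibred.conormal 𝒱 ℛ.1 p) →
          MultiFibred.Tower.ExtendsToFront (e ℛ) g θ ∧ T.FiniteOrderAtOtherFaces a g := by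
  have H : T.Represents a 𝒱 := ⟨ha₀, ha, hT, hconn⟩
  exact ⟨⟨_, T, rfl, hT⟩, fun ℛ => MultiFibred.Tower.frontEquiv H ℛ.2, MultiFibred.Tower.frontEquiv_injective H,
    fun ℛ => ⟨MultiFibred.Tower.isDiffeo_frontEquiv H ℛ.2,
      fun ξ => (MultiFibred.Tower.isLimitAt_frontEquiv H ℛ.2 ξ).1,
      fun T' h1 h2 => MultiFibred.Tower.isGivenByCoordinates_frontEquiv H ℛ.2 h1 h2,
      fun g θ hg hθ hgθ hc => ⟨MultiFibred.Tower.extendsToFront_frontEquiv H ℛ.2 hg hθ hgθ hc,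
        H.finiteOrder ℛ.2 hg hθ hgθ hc⟩⟩⟩
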